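/- **Setting.** Let $(\mathcal M,\mu)$ be a $\sigma$-finite measure space and $\omega:\mathcal M\to[0,\infty)$ measurable with $\omega>0$ $\mu$-a.e. Scalar products are linear in the second argument. Let $\mathcal F=\mathbb C\oplus\bigoplus_{n\ge1}L^2_{\rm sym}(\mathcal M^n,\mu^{\otimes n})$ be the bosonic Fock space over $L^2(\mathcal M,\mu)$, with exponential vectors $\varepsilon(f)=1\oplus\bigoplus_{n\ge1}(n!)^{-1/2}f^{\otimes n}$, which are total in $\mathcal F$. For $f\in L^2(\mathcal M,\mu)$ let * $W(f)$ be the unitary (Weyl) operator with $W(f)\varepsilon(g)=e^{-\frac12\|f\|^2-\langle f,g\rangle}\varepsilon(f+g)$; * $d\Gamma(\omega)$ be the selfadjoint operator acting on the $n$-boson component as multiplication by $\omega(k_1)+\dots+\omega(k_n)$; * $a(f)$ be the closure of the linear operator with $a(f)\varepsilon(g)=\langle f,g\rangle\varepsilon(g)$ on the span of the exponential vectors, and $\varphi(f)=\overline{a(f)+a(f)^*}$; * $I_t(\omega,f)$, for $t\ge 0$, be the bounded operator with $I_t(\omega,f)\varepsilon(g)=e^{-\langle f,g\rangle}\varepsilon(e^{-t\omega}g)$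 (it exists if $f=0$ or if $t>0$ and $f/\sqrt\omega\in L^2$). Put $V_{\rm reg}=\{f\in L^2(\mathcal M,\mu): f/\sqrt\omega\in L^2(\mathcal M,\mu)\}$, $V_{\rm UV}=\{f:\mathcal M\to\mathbb C\text{ measurable}: f/\omega\in L^2(\mathcal M,\mu)\}$, and equip $V_{\rm reg}+V_{\rm UV}$ with the norm $\|v\|_\omega=\|v/(\sqrt\omega+\omega)\|_{L^2}$. **Hamiltonian.** Let $v\in V_{\rm reg}+V_{\rm UV}$ and let $v=v_{\rm reg}+v_{\rm UV}$ be any decomposition with $v_{\rm reg}\in V_{\rm reg}$, $v_{\rm UV}\in V_{\rm UV}$, $\langle v_{\rm reg},v_{\rm UV}/\omega\rangle=0$ (for example $v_{\rm reg}=v1_{\{\omega\le1\}}$). For $x=\pm1$ put $$h(v,x)=W(-xv_{\rm UV}/\omega)\big(d\Gamma(\omega)+x\varphi(v_{\rm reg})+\|\omega^{-1/2}v_{\rm reg}\|^2\big)W(xv_{\rm UV}/\omega),$$ and on $L^2(\{\pm1\};\mathcal F)$ (counting measure) let $(H_{\rm ren}(v)\psi)(x)=\psi(x)-\psi(-x)+h(v,x)\psi(x)$,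 with domain all $\psi$ such that $\psi(x)\in D(h(v,x))$ for $x=\pm1$. **Processes.** Let $\Omega$ be the set of right-continuous $\gamma:[0,\infty)\to\{\pm1\}$ with the $\sigma$-algebra generated by the evaluations $X_t(\gamma)=\gamma_t$, and let $\mathbb P^x$, with expectation $\mathbb E^x$, be the law on $\Omega$ of the continuous-time Markov chain started at $x=\pm1$ with transition function $p_t(x,y)=\frac12(1+e^{-2t}\delta_{x,y}-e^{-2t}\delta_{x,-y})$. For $t\ge0$ and $\gamma\in\Omega$ let $$U_t^+(v)(\gamma)(k)=\int_0^te^{-s\omega(k)}\gamma_sv(k)\,ds,\qquad U_t^-(v)(\gamma)(k)=\int_0^te^{-(t-s)\omega(k)}\gamma_sv(k)\,ds,$$ $$\nu(v)(t)=-\int_{\mathcal M}e^{-t\omega}\frac{|v|^2}{\omega}\,d\mu,\qquad u_t(v)(\gamma)=\int_0^t\Big(\gamma_0\,\nu(v)(s)+\int_0^s\nu(v)(s-r)\,d\gamma_r\Big)\gamma_s\,ds,$$ where the integral with respect to $d\gamma_r$ is a Riemann–Stieltjes integral (these expressions are well defined for $\mathbb P^x$-almost every $\gamma$). **Theorem.**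 For every $v\in V_{\rm reg}+V_{\rm UV}$, $t\ge0$, $x=\pm1$ and $\psi\in L^2(\{\pm1\};\mathcal F)$, the $\mathcal F$-valued random variable in $$(T_t(v)\psi)(x)=\mathbb E^x\Big[e^{u_t(v)}\,I_{t/2}(\omega,U_t^+(v))^*\,I_{t/2}(\omega,U_t^-(v))\,\psi(X_t)\Big]$$ is Bochner integrable, and this formula defines a strongly continuous semigroup $(T_t(v))_{t\ge0}$ of bounded operators on $L^2(\{\pm1\};\mathcal F)$. The operator $H_{\rm ren}(v)$ is selfadjoint and is the generator of this semigroup, i.e. $e^{-tH_{\rm ren}(v)}=T_t(v)$: one has $\psi\in D(H_{\rm ren}(v))$ and $H_{\rm ren}(v)\psi=\eta$ if and only if $\lim_{t\downarrow0}t^{-1}(\psi-T_t(v)\psi)=\eta$ in norm. Moreover, for every $t\ge0$, the map $v\mapsto T_t(v)$ from $(V_{\rm reg}+V_{\rm UV},\|\cdot\|_\omega)$ to the bounded operators on $L^2(\{\pm1\};\mathcal F)$ is continuous in operator norm. -/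

import Mathlib

open MeasureTheory Filter Topology Set
open scoped ENNReal NNReal InnerProductSpace Pointwise

noncomputable section

namespace SpinBoson

/-! ### Bosonic Fock space -/

section FockSpace

variable {M : Type*} [MeasurableSpace M] (μ : Measure M) [SigmaFinite μ]

/-- The one-boson Hilbert space `L²(M, μ)`. -/
abbrev OneBoson {M : Type*} [MeasurableSpace M] (μ : Measure M) : Type _ := Lp ℂ 2 μ

theorem measurePreserving_perm {n : ℕ} (σ : Equiv.Perm (Fin n)) :
    MeasurePreserving (fun (k : Fin n → M) i => k (σ i))
      (Measure.pi fun _ : Fin n => μ) (Measure.pi fun _ : Fin n => μ) := by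
  have h := measurePreserving_piCongrLeft (fun _ : Fin n => μ) σ.symm
  have e : ⇑(MeasurableEquiv.piCongrLeft (fun _ : Fin n => M) σ.symm)
      = fun (k : Fin n → M) i => k (σ i) := by
    funext k i
    have := Equiv.piCongrLeft_apply_apply (fun _ : Fin n => M) σ.symm k (σ i)
    rw [Equiv.symm_apply_apply] at this
    exact this
  rwa [e] at h

/-- The `n`-boson space `L²_sym(M^n, μ^{⊗ n})`: the square integrable functions that are invariant
under permutations of their `n` variables. For `n = 0` this is `ℂ`. -/
def nBoson (n : ℕ) : Submodule ℂ (Lp ℂ 2 (Measure.pi fun _ : Fin n => μ)) where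
  carrier := {F | ∀ σ : Equiv.Perm (Fin n),
    Lp.compMeasurePreserving (fun (k : Fin n → M) i => k (σ i)) (measurePreserving_perm μ σ) F = F}
  add_mem' := by
    intro F G hF hG σ
    rw [map_add, hF σ, hG σ]
  zero_mem' := by
    intro σ
    exact map_zero _
  smul_mem' := by
    intro c F hF σ
    have := (Lp.compMeasurePreservingₗ ℂ (fun (k : Fin n → M) i => k (σ i))
      (measurePreserving_perm μ σ) (E := ℂ) (p := 2)).map_smul c F
    have hF' := hF σ
    simp only [Lp.compMeasurePreservingₗ] at this
    change Lp.compMeasurePreserving _ _ (c • F) = c • F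
    calc _ = c • Lp.compMeasurePreserving _ (measurePreserving_perm μ σ) F := this
      _ = c • F := by rw [hF']

theorem isClosed_nBoson (n : ℕ) :
    IsClosed (nBoson μ n : Set (Lp ℂ 2 (Measure.pi fun _ : Fin n => μ))) := by
  have : (nBoson μ n : Set (Lp ℂ 2 (Measure.pi fun _ : Fin n => μ))) =
      ⋂ σ : Equiv.Perm (Fin n), {F | Lp.compMeasurePreserving
        (fun (k : Fin n → M) i => k (σ i)) (measurePreserving_perm μ σ) F = F} := by
    ext F
    simp [nBoson]
  rw [this]
  exact isClosed_iInter fun σ => isClosed_eq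
    (Lp.isometry_compMeasurePreserving (measurePreserving_perm μ σ)).continuous continuous_id

instance (n : ℕ) : CompleteSpace (nBoson μ n) :=
  (isClosed_nBoson μ n).completeSpace_coe

/-- The bosonic Fock space `ℂ ⊕ ⨁_{n ≥ 1} L²_sym(M^n, μ^{⊗ n})` (Hilbert space direct sum). -/
abbrev Fock : Type _ := lp (fun n : ℕ => nBoson μ n) 2

variable {μ}

theorem integrable_sq_prod (f : OneBoson μ) (n : ℕ) :
    Integrable (fun k : Fin n → M => ‖∏ i, f (k i)‖ ^ 2) (Measure.pi fun _ : Fin n => μ) := by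
  have h : Integrable (fun k : Fin n → M => ∏ i, ‖f (k i)‖ ^ 2)
      (Measure.pi fun _ : Fin n => μ) :=
    Integrable.fintype_prod (f := fun _ x => ‖f x‖ ^ 2)
      fun _ => (memLp_two_iff_integrable_sq_norm (Lp.memLp f).1).1 (Lp.memLp f)
  simpa only [norm_prod, Finset.prod_pow] using h

theorem memLp_prod (f : OneBoson μ) (n : ℕ) :
    MemLp (fun k : Fin n → M => ∏ i, f (k i)) 2 (Measure.pi fun _ : Fin n => μ) := by
  have hm : AEStronglyMeasurable (fun k : Fin n → M => ∏ i, f (k i))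
      (Measure.pi fun _ : Fin n => μ) := by
    have : ∀ i ∈ (Finset.univ : Finset (Fin n)), AEStronglyMeasurable
        (fun k : Fin n → M => f (k i)) (Measure.pi fun _ : Fin n => μ) := fun i _ =>
      (Lp.memLp f).1.comp_quasiMeasurePreserving (Measure.quasiMeasurePreserving_eval _ i)
    exact Finset.aestronglyMeasurable_fun_prod _ this
  exact (memLp_two_iff_integrable_sq_norm hm).2 (integrable_sq_prod f n)

/-- The tensor power `f^{⊗ n}`, `(k₁, …, kₙ) ↦ f(k₁) ⋯ f(kₙ)`. -/
def tensorPow (f : OneBoson μ) (n : ℕ) : nBoson μ n :=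
  ⟨(memLp_prod f n).toLp _, by
    intro σ
    rw [Lp.toLp_compMeasurePreserving]
    congr 1
    funext k
    exact Equiv.prod_comp σ fun i => f (k i)⟩

theorem norm_tensorPow_sq (f : OneBoson μ) (n : ℕ) : ‖tensorPow f n‖ ^ 2 = (‖f‖ ^ 2) ^ n := by
  have key : ∀ {α : Type _} [MeasurableSpace α] {ρ : Measure α} (g : Lp ℂ 2 ρ),
      ‖g‖ ^ 2 = ∫ x, ‖g x‖ ^ 2 ∂ρ := by
    intro α _ ρ g
    have h := inner_self_eq_norm_sq_to_K (𝕜 := ℂ) g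
    rw [L2.inner_def] at h
    simp only [inner_self_eq_norm_sq_to_K] at h
    have h2 : ((∫ x, ‖g x‖ ^ 2 ∂ρ : ℝ) : ℂ) = ((‖g‖ ^ 2 : ℝ) : ℂ) := by
      rw [← integral_complex_ofReal]
      push_cast
      exact h
    exact_mod_cast h2.symm
  change ‖(memLp_prod f n).toLp _‖ ^ 2 = _
  rw [key, key]
  have hae : (fun k : Fin n → M => ‖((memLp_prod f n).toLp _) k‖ ^ 2)
      =ᵐ[Measure.pi fun _ : Fin n => μ] fun k => ∏ i, ‖f (k i)‖ ^ 2 := by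
    filter_upwards [(memLp_prod f n).coeFn_toLp] with k hk
    rw [hk, norm_prod, Finset.prod_pow]
  rw [integral_congr_ae hae, integral_fintype_prod_eq_prod (fun _ x => ‖f x‖ ^ 2)]
  simp

/-- The exponential vector `ε(f) = 1 ⊕ ⨁_{n ≥ 1} (n!)^{-1/2} f^{⊗ n}`. -/
def expVec (f : OneBoson μ) : Fock μ :=
  ⟨fun n => ((Real.sqrt (n.factorial : ℝ))⁻¹ : ℂ) • tensorPow f n, by
    refine memℓp_gen ?_
    have : ∀ n : ℕ, ‖((Real.sqrt (n.factorial : ℝ))⁻¹ : ℂ) • tensorPow f n‖ ^ (2 : ℝ≥0∞).toReal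
        = (‖f‖ ^ 2) ^ n / n.factorial := by
      intro n
      have h2 : (2 : ℝ≥0∞).toReal = ((2 : ℕ) : ℝ) := by norm_num
      rw [h2, Real.rpow_natCast, norm_smul, mul_pow, norm_tensorPow_sq, norm_inv,
        Complex.norm_real, Real.norm_of_nonneg (Real.sqrt_nonneg _), inv_pow,
        Real.sq_sqrt (Nat.cast_nonneg _)]
      ring
    simp_rw [this]
    exact Real.summable_pow_div_factorial _⟩

/-! ### Operators on Fock space -/

/-- The element of `L²` given by a square integrable function (and `0` for any other function). -/
def toL2 {M : Type*} [MeasurableSpace M] (μ : Measure M) (f : M → ℂ) : OneBoson μ :=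
  open Classical in if h : MemLp f 2 μ then h.toLp f else 0

/-- The bounded operator `T` with `T ε(g) = Φ(g)` for all `g ∈ L²(M, μ)`. As the exponential
vectors are total, there is at most one such `T`; the value is `0` if there is none. -/
def extendExp (Φ : OneBoson μ → Fock μ) : Fock μ →L[ℂ] Fock μ :=
  open Classical in
  if h : ∃ T : Fock μ →L[ℂ] Fock μ, ∀ g, T (expVec g) = Φ g then h.choose else 0

/-- The Weyl operator, `W(f) ε(g) = exp(-‖f‖²/2 - ⟨f, g⟩) ε(f + g)`. -/
def weyl (f : OneBoson μ) : Fock μ →L[ℂ] Fock μ :=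
  extendExp fun g => Complex.exp (-(‖f‖ ^ 2 / 2 : ℝ) - ⟪f, g⟫_ℂ) • expVec (f + g)

/-- The bounded operator `I_t(m, f)`, the closure of `e^{-t dΓ(m)} e^{a(-f)}`, given by
`I_t(m, f) ε(g) = e^{-⟨f, g⟩} ε(e^{-tm} g)`. -/
def opI (t : ℝ) (m : M → ℝ) (f : OneBoson μ) : Fock μ →L[ℂ] Fock μ :=
  extendExp fun g =>
    Complex.exp (-⟪f, g⟫_ℂ) • expVec (toL2 μ fun k => (Real.exp (-t * m k) : ℂ) * g k)

/-- The graph of the differential second quantization of multiplication by `m`: the operator that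
multiplies the `n`-boson component with `(k₁, …, kₙ) ↦ m(k₁) + ⋯ + m(kₙ)`. -/
def dGammaGraph (m : M → ℝ) : Submodule ℂ (Fock μ × Fock μ) where
  carrier := {p | ∀ n : ℕ, ⇑((p.2 n : nBoson μ n) : Lp ℂ 2 (Measure.pi fun _ : Fin n => μ))
    =ᵐ[Measure.pi fun _ : Fin n => μ]
      fun k => ((∑ i, m (k i) : ℝ) : ℂ) *
        ((p.1 n : nBoson μ n) : Lp ℂ 2 (Measure.pi fun _ : Fin n => μ)) k}
  add_mem' := by
    intro p q hp hq n
    have e1 := Lp.coeFn_add (p.1 n : Lp ℂ 2 (Measure.pi fun _ : Fin n => μ)) (q.1 n).1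
    have e2 := Lp.coeFn_add (p.2 n : Lp ℂ 2 (Measure.pi fun _ : Fin n => μ)) (q.2 n).1
    filter_upwards [hp n, hq n, e1, e2] with k h1 h2 h3 h4
    change ((p.2 n : Lp ℂ 2 (Measure.pi fun _ : Fin n => μ)) + (q.2 n).1) k =
      _ * ((p.1 n : Lp ℂ 2 (Measure.pi fun _ : Fin n => μ)) + (q.1 n).1) k
    rw [h3, h4, Pi.add_apply, Pi.add_apply, h1, h2]
    ring
  zero_mem' := by
    intro n
    have e := Lp.coeFn_zero ℂ 2 (Measure.pi fun _ : Fin n => μ)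
    filter_upwards [e] with k h
    change (0 : Lp ℂ 2 (Measure.pi fun _ : Fin n => μ)) k =
      _ * (0 : Lp ℂ 2 (Measure.pi fun _ : Fin n => μ)) k
    rw [h]
    simp
  smul_mem' := by
    intro c p hp n
    have e1 := Lp.coeFn_smul c (p.1 n : Lp ℂ 2 (Measure.pi fun _ : Fin n => μ))
    have e2 := Lp.coeFn_smul c (p.2 n : Lp ℂ 2 (Measure.pi fun _ : Fin n => μ))
    filter_upwards [hp n, e1, e2] with k h1 h3 h4
    change (c • (p.2 n : Lp ℂ 2 (Measure.pi fun _ : Fin n => μ))) k =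
      _ * (c • (p.1 n : Lp ℂ 2 (Measure.pi fun _ : Fin n => μ))) k
    rw [h3, h4, Pi.smul_apply, Pi.smul_apply, h1, smul_eq_mul, smul_eq_mul]
    ring

/-- The differential second quantization `dΓ(m)` of multiplication by `m`, on its maximal
domain. -/
def dGamma (m : M → ℝ) : Fock μ →ₗ.[ℂ] Fock μ := (dGammaGraph m).toLinearPMap

/-- The annihilation operator `a(f)`: the closure of the linear operator on the span of the
exponential vectors with `a(f) ε(g) = ⟨f, g⟩ ε(g)`. -/
def ann (f : OneBoson μ) : Fock μ →ₗ.[ℂ] Fock μ :=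
  (Submodule.span ℂ (range fun g : OneBoson μ =>
    ((expVec g, ⟪f, g⟫_ℂ • expVec g) : Fock μ × Fock μ))).toLinearPMap.closure

/-- The creation operator `a†(f) = a(f)*`. -/
def cre (f : OneBoson μ) : Fock μ →ₗ.[ℂ] Fock μ := (ann f).adjoint

/-- The field operator `φ(f)`, the closure of `a(f) + a†(f)`. -/
def field (f : OneBoson μ) : Fock μ →ₗ.[ℂ] Fock μ := (ann f + cre f).closure

/-- The unbounded operator `A B C` for bounded `A`, `C`, on the domain of all `ψ` such that `C ψ`
lies in the domain of `B`. -/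
def sandwich {E : Type*} [NormedAddCommGroup E] [NormedSpace ℂ E] (A : E →L[ℂ] E) (B : E →ₗ.[ℂ] E)
    (C : E →L[ℂ] E) : E →ₗ.[ℂ] E where
  domain := B.domain.comap (C : E →ₗ[ℂ] E)
  toFun :=
    { toFun := fun ψ => A (B ⟨C ψ, ψ.2⟩)
      map_add' := fun ψ η => by
        rw [← map_add, ← LinearPMap.map_add]
        congr 2
        exact Subtype.ext (map_add C _ _)
      map_smul' := fun c ψ => by
        rw [RingHom.id_apply, ← map_smul, ← LinearPMap.map_smul]
        congr 2
        exact Subtype.ext (map_smul C _ _) }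

end FockSpace

/-! ### Form factors and the renormalized Hamiltonian

The two-point set `{±1}` is `ℤˣ`. -/

section Hamiltonian

variable {M : Type*} [MeasurableSpace M]

/-- The numerical value `±1`. -/
def spinVal (x : ℤˣ) : ℝ := ((x : ℤ) : ℝ)

/-- Regular form factors: `f ∈ L²` and `f/√ω ∈ L²`. -/
def VReg (μ : Measure M) (ω : M → ℝ) : Set (M → ℂ) :=
  {f | MemLp f 2 μ ∧ MemLp (fun k => f k / (Real.sqrt (ω k) : ℂ)) 2 μ}

/-- Ultraviolet singular form factors: `f` measurable and `f/ω ∈ L²`. -/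
def VUV (μ : Measure M) (ω : M → ℝ) : Set (M → ℂ) :=
  {f | AEStronglyMeasurable f μ ∧ MemLp (fun k => f k / (ω k : ℂ)) 2 μ}

/-- The norm `‖v/(√ω + ω)‖_{L²}` on form factors. -/
def formNorm (μ : Measure M) (ω : M → ℝ) (v : M → ℂ) : ℝ≥0∞ :=
  eLpNorm (fun k => v k / ((Real.sqrt (ω k) + ω k : ℝ) : ℂ)) 2 μ

variable (μ : Measure M) [SigmaFinite μ]

/-- The van Hove operator `dΓ(ω) + x φ(w) + ‖ω^{-1/2} w‖²` for regular `w`. -/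
def vanHove (ω : M → ℝ) (w : M → ℂ) (x : ℤˣ) : Fock μ →ₗ.[ℂ] Fock μ :=
  dGamma ω + (spinVal x : ℂ) • field (toL2 μ w) +
    LinearMap.toPMap
      (((‖toL2 μ fun k => w k / (Real.sqrt (ω k) : ℂ)‖ ^ 2 : ℝ) : ℂ) •
        (LinearMap.id : Fock μ →ₗ[ℂ] Fock μ)) ⊤

/-- The renormalized van Hove operator of `v = vreg + vuv`,
`h(v, x) = W(-x vuv/ω) (dΓ(ω) + x φ(vreg) + ‖ω^{-1/2} vreg‖²) W(x vuv/ω)`. -/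
def vanHoveRen (ω : M → ℝ) (vreg vuv : M → ℂ) (x : ℤˣ) : Fock μ →ₗ.[ℂ] Fock μ :=
  sandwich (weyl (toL2 μ fun k => -(spinVal x : ℂ) * (vuv k / (ω k : ℂ))))
    (vanHove μ ω vreg x)
    (weyl (toL2 μ fun k => (spinVal x : ℂ) * (vuv k / (ω k : ℂ))))

/-- The Hilbert space `L²({±1}; Fock)` (counting measure on `{±1}`). -/
abbrev SpinFock : Type _ := PiLp 2 fun _ : ℤˣ => Fock μ

/-- The self-energy renormalized spin boson Hamiltonian of `v = vreg + vuv`,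
`(H ψ)(x) = ψ(x) - ψ(-x) + h(v, x) ψ(x)`, on all `ψ` with `ψ(x)` in the domain of `h(v, x)`
for `x = ±1`. -/
def hRen (ω : M → ℝ) (vreg vuv : M → ℂ) : SpinFock μ →ₗ.[ℂ] SpinFock μ where
  domain :=
    { carrier := {ψ | ∀ x, ψ x ∈ (vanHoveRen μ ω vreg vuv x).domain}
      add_mem' := fun hψ hη x => Submodule.add_mem _ (hψ x) (hη x)
      zero_mem' := fun _ => Submodule.zero_mem _
      smul_mem' := fun c _ hψ x => Submodule.smul_mem _ c (hψ x) }
  toFun :=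
    { toFun := fun ψ => WithLp.toLp 2 fun x =>
        ψ.1 x - ψ.1 (-x) + vanHoveRen μ ω vreg vuv x ⟨ψ.1 x, ψ.2 x⟩
      map_add' := fun ψ η => by
        ext1 x
        have h := (vanHoveRen μ ω vreg vuv x).map_add ⟨ψ.1 x, ψ.2 x⟩ ⟨η.1 x, η.2 x⟩
        change (ψ.1 x + η.1 x) - (ψ.1 (-x) + η.1 (-x)) + vanHoveRen μ ω vreg vuv x
          (⟨ψ.1 x, ψ.2 x⟩ + ⟨η.1 x, η.2 x⟩) = (ψ.1 x - ψ.1 (-x) + _) + (η.1 x - η.1 (-x) + _)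
        rw [h]
        abel
      map_smul' := fun c ψ => by
        ext1 x
        have h := (vanHoveRen μ ω vreg vuv x).map_smul c ⟨ψ.1 x, ψ.2 x⟩
        change (c • ψ.1 x) - (c • ψ.1 (-x)) + vanHoveRen μ ω vreg vuv x
          (c • ⟨ψ.1 x, ψ.2 x⟩) = c • (ψ.1 x - ψ.1 (-x) + _)
        rw [h, smul_add, smul_sub] }

end Hamiltonian

/-! ### The spin process -/

/-- The path space: right-continuous functions `[0, ∞) → {±1}`. -/
def SpinPath : Type := {γ : ℝ≥0 → ℤˣ // ∀ t, ContinuousWithinAt γ (Ici t) t}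

/-- The `σ`-algebra on path space generated by the evaluations `γ ↦ γ(t)`, `t ≥ 0`. -/
instance : MeasurableSpace SpinPath :=
  ⨆ t : ℝ≥0, MeasurableSpace.comap (fun γ : SpinPath => γ.1 t) ⊤

/-- The value `γ_t = ±1` of a path at the time `t ≥ 0`, as a real number. -/
def SpinPath.val (γ : SpinPath) (t : ℝ) : ℝ := spinVal (γ.1 t.toNNReal)

/-- The transition function `p_t(x, y) = (1 + e^{-2t} δ_{x,y} - e^{-2t} δ_{x,-y})/2`. -/
def transition (t : ℝ) (x y : ℤˣ) : ℝ :=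
  1 / 2 * (1 + (if x = y then Real.exp (-2 * t) else 0) - (if x = -y then Real.exp (-2 * t) else 0))

/-- `P` is the law on path space of the `{±1}`-valued continuous-time Markov chain started at `x`
with transition function `p_t`: for all times `0 = t₀ ≤ t₁ ≤ ⋯ ≤ tₙ` and states
`x = x₀, x₁, …, xₙ`, one has `P[X_{t₁} = x₁, …, X_{tₙ} = xₙ] = ∏ p_{tᵢ₊₁ - tᵢ}(xᵢ, xᵢ₊₁)`. -/
def IsSpinLaw (x : ℤˣ) (P : Measure SpinPath) : Prop :=
  ∀ (n : ℕ) (t : ℕ → ℝ≥0) (y : ℕ → ℤˣ), Monotone t → t 0 = 0 → y 0 = x →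
    P {γ | ∀ i < n, γ.1 (t (i + 1)) = y (i + 1)} =
      ENNReal.ofReal (∏ i ∈ Finset.range n, transition (t (i + 1) - t i) (y i) (y (i + 1)))

/-! ### The processes entering the Feynman-Kac formula -/

/-- `I` is the Riemann-Stieltjes integral `∫_a^b f dg`: the limit of the sums
`∑ f(ξᵢ) (g(pᵢ₊₁) - g(pᵢ))` over tagged partitions of `[a, b]` as their mesh tends to zero. -/
def HasRSIntegral (f g : ℝ → ℝ) (a b I : ℝ) : Prop :=
  ∀ ε > 0, ∃ δ > 0, ∀ (n : ℕ) (p ξ : ℕ → ℝ), p 0 = a → p n = b →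
    (∀ i < n, p i ≤ ξ i ∧ ξ i ≤ p (i + 1) ∧ p (i + 1) - p i < δ) →
      |∑ i ∈ Finset.range n, f (ξ i) * (g (p (i + 1)) - g (p i)) - I| < ε

/-- The Riemann-Stieltjes integral `∫_a^b f dg` (and `0` if it does not exist). -/
def rsIntegral (f g : ℝ → ℝ) (a b : ℝ) : ℝ :=
  open Classical in if h : ∃ I, HasRSIntegral f g a b I then h.choose else 0

section FeynmanKac

variable {M : Type*} [MeasurableSpace M] (μ : Measure M)

/-- `U_t^+(v)(γ)(k) = ∫_0^t e^{-s ω(k)} γ_s v(k) ds`. -/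
def UPlus (ω : M → ℝ) (v : M → ℂ) (t : ℝ) (γ : SpinPath) (k : M) : ℂ :=
  ∫ s in (0 : ℝ)..t, ((Real.exp (-s * ω k) * γ.val s : ℝ) : ℂ) * v k

/-- `U_t^-(v)(γ)(k) = ∫_0^t e^{-(t - s) ω(k)} γ_s v(k) ds`. -/
def UMinus (ω : M → ℝ) (v : M → ℂ) (t : ℝ) (γ : SpinPath) (k : M) : ℂ :=
  ∫ s in (0 : ℝ)..t, ((Real.exp (-(t - s) * ω k) * γ.val s : ℝ) : ℂ) * v k

/-- The phase integrator `ν(v)(t) = -∫ e^{-tω} |v|²/ω dμ`. -/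
def phaseIntegrator (ω : M → ℝ) (v : M → ℂ) (t : ℝ) : ℝ :=
  -∫ k, Real.exp (-t * ω k) * ‖v k‖ ^ 2 / ω k ∂μ

/-- The phase process
`u_t(v)(γ) = ∫_0^t (γ_0 ν(v)(s) + ∫_0^s ν(v)(s - r) dγ_r) γ_s ds`. -/
def phase (ω : M → ℝ) (v : M → ℂ) (t : ℝ) (γ : SpinPath) : ℝ :=
  ∫ s in (0 : ℝ)..t, (γ.val 0 * phaseIntegrator μ ω v s +
    rsIntegral (fun r => phaseIntegrator μ ω v (s - r)) γ.val 0 s) * γ.val s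

variable [SigmaFinite μ]

/-- The integrand `e^{u_t(v)} I_{t/2}(ω, U_t^+(v))* I_{t/2}(ω, U_t^-(v)) ψ(X_t)` of the
Feynman-Kac formula, as a function of the path. -/
def fkIntegrand (ω : M → ℝ) (v : M → ℂ) (t : ℝ≥0) (ψ : SpinFock μ) (γ : SpinPath) : Fock μ :=
  (Real.exp (phase μ ω v t γ) : ℂ) •
    ContinuousLinearMap.adjoint (opI (t / 2) ω (toL2 μ (UPlus ω v t γ)))
      (opI (t / 2) ω (toL2 μ (UMinus ω v t γ)) (ψ (γ.1 t)))

end FeynmanKac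

/-! ### Operator semigroups -/

section Semigroup

variable {E : Type*} [NormedAddCommGroup E] [NormedSpace ℂ E]

/-- A strongly continuous one-parameter semigroup of bounded operators. -/
structure IsStronglyContinuousSemigroup (T : ℝ≥0 → E →L[ℂ] E) : Prop where
  zero : T 0 = 1
  add : ∀ s t, T (s + t) = T s * T t
  continuous : ∀ ψ, Continuous fun t => T t ψ

/-- `H` is the generator of `T` in the sense `T_t = e^{-tH}`: the domain of `H` consists of the
`ψ` for which `(ψ - T_t ψ)/t` converges in norm as `t ↓ 0`, and `H ψ` is the limit. -/
def IsGenerator (T : ℝ≥0 → E →L[ℂ] E) (H : E →ₗ.[ℂ] E) : Prop :=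
  ∀ ψ η : E, (ψ, η) ∈ H.graph ↔
    Tendsto (fun t : ℝ≥0 => ((t : ℝ)⁻¹ : ℂ) • (ψ - T t ψ)) (𝓝[>] 0) (𝓝 η)

end Semigroup

end SpinBoson

end

open MeasureTheory Filter Topology Set
open scoped ENNReal NNReal InnerProductSpace Pointwise

noncomputable section

namespace SpinBoson

/-! ### Inner products of exponential vectors and totality -/

section ExponentialVectors

variable {M : Type*} [MeasurableSpace M] {μ : Measure M} [SigmaFinite μ]

/-! Write ρ = √ω + ω and v = ρ v₀ with v₀ ∈ L². Then every object in the formula is a bounded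
multiplier applied to v₀, uniformly over regular and ultraviolet singular form factors: with β_t(λ)
= ∫₀ᵗ e^{-sλ} ds, the bounds β_t(ω) ≤ t and ω β_t(ω) ≤ 1 control both ρ β_t(ω) and (1 + √ω)² β_t(ω).
No cutoff has to be removed.

Van Hove operators. The semigroup e^{-t h(v,x)} is given explicitly by `sOp`: ε(g) ↦ exp(-⟨v₀, C_t
v₀⟩ - ⟨s_t v₀, g⟩) ε(e^{-tω} g - s_t v₀) with s_t = x ρ β_t(ω) and C_t = (1 + √ω)² β_t(ω). An
operator given on exponential vectors is bounded as soon as its Gram kernel divides the exponential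
kernel with a quotient that is again an exponential kernel (`exists_clm_expVec`, a consequence of
the Schur product theorem); this gives contractivity here and the norm bounds for I_t(ω, f) later.
For regular v, the generator of `sOp` is the van Hove operator: the vectors ε(g) with g in the
domain of ω span a core for both dΓ(ω) and that operator, and φ(f) is small relative to dΓ(ω)
(`IsRegularPair.mem_graph_iff`). For general v, W(x v_UV/ω) intertwines the semigroups of v and of
v_reg (`weyl_mul_sOp`). Hence H_ren(v) is the direct sum of the generators over x = ±1 plus the
bounded symmetric operator B = 1 - flip, and it is selfadjoint (`isSelfAdjoint_of_genRel`).

Feynman-Kac formula. Fix a path of finite variation on [0, t]. The ordered product of the van Hove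
semigroups along a partition, with the spin frozen on each interval, is again explicit on
exponential vectors. As the mesh tends to zero its multipliers converge to those of U⁺, U⁻ and of
the phase, so the products, which are contractions, converge strongly to e^{u} I* I
(`tendsto_prodS`). That the limiting exponent is the process u_t(v) is a Fubini argument on a finite
sum of jumps (`phase_eq`). The expectation of an ordered product is, by the Markov property, the
ordered product of (1 - (1 - e^{-2δ})/2 · B) S_δ, where S is the semigroup without spin flips
(`IsSpinLaw.integral_prodS`). By dominated convergence T_t(v) is the strong limit of these products;
partitions of [0, s + t] that pass through s give the semigroup law, and a first order expansion
gives (S_t ψ - T_t ψ)/t → Bψ. So the generator of T is the generator of S plus B, that is, H_ren(v).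

Continuity in v. For a fixed path the operator e^{u} I* I is locally Lipschitz in v₀, with a
constant affine in the variation of the path (`norm_fkOp_sub_le`). The expected variation on [0, t]
is at most 2t. -/

theorem coeFn_tensorPow (f : OneBoson μ) (n : ℕ) :
    ⇑((tensorPow f n : nBoson μ n) : Lp ℂ 2 (Measure.pi fun _ : Fin n => μ))
      =ᵐ[Measure.pi fun _ : Fin n => μ] fun k => ∏ i, f (k i) :=
  (memLp_prod f n).coeFn_toLp

theorem inner_tensorPow (f g : OneBoson μ) (n : ℕ) :
    ⟪tensorPow f n, tensorPow g n⟫_ℂ = ⟪f, g⟫_ℂ ^ n := by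
  rw [Submodule.coe_inner, L2.inner_def, L2.inner_def]
  have h : (fun k => ⟪((tensorPow f n : nBoson μ n) : Lp ℂ 2 (Measure.pi fun _ : Fin n => μ)) k,
      ((tensorPow g n : nBoson μ n) : Lp ℂ 2 (Measure.pi fun _ : Fin n => μ)) k⟫_ℂ)
      =ᵐ[Measure.pi fun _ : Fin n => μ] fun k => ∏ i, ⟪f (k i), g (k i)⟫_ℂ := by
    filter_upwards [coeFn_tensorPow f n, coeFn_tensorPow g n] with k h1 h2
    rw [h1, h2]
    simp [RCLike.inner_apply, Finset.prod_mul_distrib, map_prod]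
  rw [integral_congr_ae h, integral_fintype_prod_eq_prod (fun _ x => ⟪f x, g x⟫_ℂ)]
  simp

theorem expVec_apply (f : OneBoson μ) (n : ℕ) :
    expVec f n = ((Real.sqrt (n.factorial : ℝ))⁻¹ : ℂ) • tensorPow f n := rfl

theorem inner_smul_smul_nBoson {n : ℕ} (a b : ℂ) (F G : nBoson μ n) :
    ⟪a • F, b • G⟫_ℂ = starRingEnd ℂ a * b * ⟪F, G⟫_ℂ := by
  rw [inner_smul_left (𝕜 := ℂ) (E := nBoson μ n), inner_smul_right (𝕜 := ℂ) (E := nBoson μ n)]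
  ring

theorem inner_expVec (f g : OneBoson μ) : ⟪expVec f, expVec g⟫_ℂ = Complex.exp ⟪f, g⟫_ℂ := by
  rw [lp.inner_eq_tsum, Complex.exp_eq_exp_ℂ, NormedSpace.exp_eq_tsum_div]
  congr 1
  funext n
  rw [expVec_apply, expVec_apply]
  refine (inner_smul_smul_nBoson _ _ _ _).trans ?_
  rw [inner_tensorPow]
  have h : ((Real.sqrt (n.factorial : ℝ) : ℝ) : ℂ) * (Real.sqrt (n.factorial : ℝ) : ℝ)
      = (n.factorial : ℂ) := by
    rw [← Complex.ofReal_mul, Real.mul_self_sqrt (Nat.cast_nonneg _), Complex.ofReal_natCast]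
  have h0 : ((Real.sqrt (n.factorial : ℝ) : ℝ) : ℂ) ≠ 0 := by
    rw [Complex.ofReal_ne_zero]
    positivity
  rw [map_inv₀, Complex.conj_ofReal, ← h]
  field_simp

theorem norm_expVec_sq (f : OneBoson μ) : ‖expVec f‖ ^ 2 = Real.exp (‖f‖ ^ 2) := by
  have h := inner_self_eq_norm_sq_to_K (𝕜 := ℂ) (expVec f)
  rw [inner_expVec, inner_self_eq_norm_sq_to_K] at h
  have : ((Real.exp (‖f‖ ^ 2) : ℝ) : ℂ) = ((‖expVec f‖ ^ 2 : ℝ) : ℂ) := by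
    push_cast
    exact h
  exact_mod_cast this.symm

theorem norm_expVec (f : OneBoson μ) : ‖expVec f‖ = Real.exp (‖f‖ ^ 2 / 2) := by
  have h := norm_expVec_sq f
  have h2 : Real.exp (‖f‖ ^ 2) = Real.exp (‖f‖ ^ 2 / 2) ^ 2 := by
    rw [← Real.exp_nat_mul]
    congr 1
    push_cast
    ring
  rw [h2] at h
  exact (pow_left_inj₀ (norm_nonneg _) (Real.exp_pos _).le two_ne_zero).1 h

/-- A polarization formula for permanents. -/
theorem sum_sign_prod_sum {n : ℕ} (a : Fin n → Fin n → ℂ) :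
    ∑ e : Fin n → ℤˣ, (∏ l, ((e l : ℤ) : ℂ)) * ∏ l, ∑ i, ((e i : ℤ) : ℂ) * a l i =
      2 ^ n * ∑ σ : Equiv.Perm (Fin n), ∏ l, a l (σ l) := by
  have sq : ∀ u : ℤˣ, ((u : ℤ) : ℂ) * ((u : ℤ) : ℂ) = 1 := by
    intro u
    rcases Int.units_eq_one_or u with rfl | rfl <;> simp
  have key : ∀ φ : Fin n → Fin n,
      ∑ e : Fin n → ℤˣ, (∏ l, ((e l : ℤ) : ℂ)) * ∏ l, ((e (φ l) : ℤ) : ℂ) =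
        if Function.Bijective φ then 2 ^ n else 0 := by
    intro φ
    split_ifs with hφ
    · have : ∀ e : Fin n → ℤˣ,
          (∏ l, ((e l : ℤ) : ℂ)) * ∏ l, ((e (φ l) : ℤ) : ℂ) = 1 := by
        intro e
        have h1 : ∏ l, ((e (φ l) : ℤ) : ℂ) = ∏ l, ((e l : ℤ) : ℂ) :=
          (Equiv.ofBijective φ hφ).prod_comp fun l => ((e l : ℤ) : ℂ)
        rw [h1, ← Finset.prod_mul_distrib]
        exact Finset.prod_eq_one fun l _ => sq _
      simp [this]
    · have hs : ¬ Function.Surjective φ := fun h =>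
        hφ ⟨Finite.injective_iff_surjective.2 h, h⟩
      obtain ⟨j, hj⟩ := not_forall.1 hs
      push Not at hj
      -- Flipping the sign at an index j missed by φ changes the first product and not the second,
      -- so the sum equals its own negative.
      let m : Fin n → ℤˣ := Pi.mulSingle j (-1)
      have h1 : (∏ l, ((m l : ℤ) : ℂ)) = -1 := by
        rw [Finset.prod_eq_single j]
        · simp [m]
        · intro b _ hb
          simp [m, hb]
        · simp
      have h2 : ∀ l, m (φ l) = 1 := fun l => Pi.mulSingle_eq_of_ne (hj l) _
      have := Equiv.sum_comp (Equiv.mulLeft m) fun e : Fin n → ℤˣ =>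
        (∏ l, ((e l : ℤ) : ℂ)) * ∏ l, ((e (φ l) : ℤ) : ℂ)
      simp only [Equiv.coe_mulLeft, Pi.mul_apply, Units.val_mul, Int.cast_mul,
        Finset.prod_mul_distrib, h1, h2, one_mul, neg_mul, Finset.sum_neg_distrib] at this
      linear_combination (-1 / 2 : ℂ) * this
  have expand : ∀ e : Fin n → ℤˣ, ∏ l, ∑ i, ((e i : ℤ) : ℂ) * a l i =
      ∑ φ : Fin n → Fin n, (∏ l, ((e (φ l) : ℤ) : ℂ)) * ∏ l, a l (φ l) := by
    intro e
    rw [Finset.prod_univ_sum]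
    simp [Finset.prod_mul_distrib]
  simp_rw [expand, Finset.mul_sum]
  rw [Finset.sum_comm]
  simp_rw [← mul_assoc, ← Finset.sum_mul, key]
  simp_rw [ite_mul, zero_mul]
  rw [← Finset.sum_filter]
  symm
  refine Finset.sum_bij (fun σ _ => ⇑σ)
    (fun σ _ => Finset.mem_filter.2 ⟨Finset.mem_univ _, σ.bijective⟩)
    (fun σ _ τ _ h => Equiv.ext (congrFun h)) (fun φ hφ => ?_) (fun σ _ => rfl)
  exact ⟨Equiv.ofBijective φ (Finset.mem_filter.1 hφ).2, Finset.mem_univ _, rfl⟩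

/-- A symmetric square integrable function orthogonal to all tensor powers is orthogonal to the
indicators of all rectangles. -/
theorem setIntegral_pi_eq_zero {n : ℕ} (F : nBoson μ n) (hF : ∀ f, ⟪tensorPow f n, F⟫_ℂ = 0)
    (B : Fin n → Set M) (hB : ∀ i, MeasurableSet (B i)) (hB' : ∀ i, μ (B i) ≠ ∞) :
    ∫ k in univ.pi B, (F : Lp ℂ 2 (Measure.pi fun _ : Fin n => μ)) k
      ∂(Measure.pi fun _ : Fin n => μ) = 0 := by
  set π := Measure.pi fun _ : Fin n => μ with hπ
  set G : (Fin n → M) → ℂ := ⇑(F : Lp ℂ 2 π) with hG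
  have hG2 : MemLp G 2 π := Lp.memLp _
  let χ : Fin n → M → ℂ := fun i => (B i).indicator 1
  have hχ : ∀ i, MemLp (χ i) 2 μ := fun i => memLp_indicator_const 2 (hB i) 1 (Or.inr (hB' i))
  -- the integrals with permuted rectangles
  let I : Equiv.Perm (Fin n) → ℂ := fun σ => ∫ k, (∏ l, χ (σ l) (k l)) * G k ∂π
  have rect : ∀ σ : Equiv.Perm (Fin n), (fun k : Fin n → M => ∏ l, χ (σ l) (k l)) =
      (univ.pi fun l => B (σ l)).indicator 1 := by
    intro σ
    funext k
    by_cases hk : k ∈ univ.pi fun l => B (σ l)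
    · rw [indicator_of_mem hk]
      exact Finset.prod_eq_one fun l _ => indicator_of_mem (hk l trivial) _
    · rw [indicator_of_notMem hk]
      simp only [mem_univ_pi, not_forall] at hk
      obtain ⟨l, hl⟩ := hk
      exact Finset.prod_eq_zero (Finset.mem_univ l) (indicator_of_notMem hl _)
  have mrect : ∀ σ : Equiv.Perm (Fin n), MeasurableSet (univ.pi fun l => B (σ l)) :=
    fun σ => MeasurableSet.univ_pi fun l => hB _
  have frect : ∀ σ : Equiv.Perm (Fin n), π (univ.pi fun l => B (σ l)) ≠ ∞ := by
    intro σ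
    rw [hπ, Measure.pi_pi]
    exact ENNReal.prod_ne_top fun l _ => hB' _
  have I_set : ∀ σ, I σ = ∫ k in univ.pi fun l => B (σ l), G k ∂π := by
    intro σ
    rw [← integral_indicator (mrect σ)]
    refine integral_congr_ae (ae_of_all _ fun k => ?_)
    have := congrFun (rect σ) k
    simp only at this ⊢
    rw [this]
    by_cases hk : k ∈ univ.pi fun l => B (σ l)
    · simp only [indicator_of_mem hk, Pi.one_apply, one_mul]
    · simp only [indicator_of_notMem hk, zero_mul]
  have I_int : ∀ σ : Equiv.Perm (Fin n),
      Integrable (fun k => (∏ l, χ (σ l) (k l)) * G k) π := by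
    intro σ
    have : MemLp (fun k : Fin n → M => ∏ l, χ (σ l) (k l)) 2 π := by
      rw [rect σ]
      exact memLp_indicator_const 2 (mrect σ) 1 (Or.inr (frect σ))
    exact this.integrable_mul hG2
  -- symmetry
  have I_symm : ∀ σ, I σ = I 1 := by
    intro σ
    have hmp := measurePreserving_perm μ σ⁻¹
    have hsym : (fun k => G fun i => k (σ⁻¹ i)) =ᵐ[π] G := by
      have h1 := F.2 σ⁻¹
      have h2 := Lp.coeFn_compMeasurePreserving (F : Lp ℂ 2 π) hmp
      rw [h1] at h2
      exact h2.symm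
    have e : MeasurableEmbedding fun (k : Fin n → M) i => k (σ⁻¹ i) :=
by
      have h1 := (MeasurableEquiv.piCongrLeft (fun _ : Fin n => M) σ).measurableEmbedding
      convert h1 using 1
      funext k i
      have := Equiv.piCongrLeft_apply_apply (fun _ : Fin n => M) σ k (σ⁻¹ i)
      rw [show σ (σ⁻¹ i) = i from σ.apply_symm_apply i] at this
      exact this.symm
    calc I σ = ∫ k, (∏ l, χ (σ l) (k l)) * G (fun i => k (σ⁻¹ i)) ∂π := by
          refine integral_congr_ae ?_
          filter_upwards [hsym] with k hk
          rw [hk]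
      _ = ∫ k, (fun k' : Fin n → M => (∏ l, χ l (k' l)) * G k') (fun i => k (σ⁻¹ i)) ∂π := by
          refine integral_congr_ae (ae_of_all _ fun k => ?_)
          simp only
          congr 1
          rw [← Equiv.prod_comp σ fun l => χ l (k (σ⁻¹ l))]
          simp
      _ = I 1 := by
          rw [hmp.integral_comp e (fun k' : Fin n → M => (∏ l, χ l (k' l)) * G k')]
          rfl
  -- orthogonality
  have orth : ∀ e : Fin n → ℤˣ,
      ∫ k, (∏ l, ∑ i, ((e i : ℤ) : ℂ) * χ i (k l)) * G k ∂π = 0 := by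
    intro e
    have hm : MemLp (fun x => ∑ i, ((e i : ℤ) : ℂ) * χ i x) 2 μ :=
      memLp_finsetSum _ fun i _ => (hχ i).const_mul _
    have h := hF (hm.toLp _)
    rw [Submodule.coe_inner, L2.inner_def] at h
    rw [← h]
    refine integral_congr_ae ?_
    have h1 : ∀ᵐ k ∂π, ∀ l : Fin n, (hm.toLp _ : OneBoson μ) (k l) =
        ∑ i, ((e i : ℤ) : ℂ) * χ i (k l) := by
      rw [ae_all_iff]
      intro l
      exact (Measure.quasiMeasurePreserving_eval (fun _ : Fin n => μ) l).ae hm.coeFn_toLp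
    filter_upwards [h1, coeFn_tensorPow (hm.toLp _) n] with k h2 h3
    rw [h3, RCLike.inner_apply, mul_comm, map_prod]
    congr 1
    refine Finset.prod_congr rfl fun l _ => ?_
    rw [h2 l, map_sum]
    refine Finset.sum_congr rfl fun i _ => ?_
    rw [map_mul, map_intCast]
    congr 1
    by_cases hk : k l ∈ B i <;> simp [χ, hk]
  -- Polarization, applied pointwise under the integral, leaves the sum of the I σ; by symmetry all
  -- its terms equal I 1.
  have total : (2 : ℂ) ^ n * ∑ σ : Equiv.Perm (Fin n), I σ = 0 := by
    have h1 : ∫ k, (2 ^ n * ∑ σ : Equiv.Perm (Fin n), ∏ l, χ (σ l) (k l)) * G k ∂π =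
        2 ^ n * ∑ σ : Equiv.Perm (Fin n), I σ := by
      rw [← integral_finsetSum _ fun σ _ => I_int σ, ← integral_const_mul]
      refine integral_congr_ae (ae_of_all _ fun k => ?_)
      simp only [Finset.sum_mul, mul_assoc]
    rw [← h1]
    simp_rw [← fun k : Fin n → M => sum_sign_prod_sum fun l i => χ i (k l), Finset.sum_mul]
    have I_int' : ∀ e : Fin n → ℤˣ, Integrable (fun k => ((∏ l, ((e l : ℤ) : ℂ)) *
        ∏ l, ∑ i, ((e i : ℤ) : ℂ) * χ i (k l)) * G k) π := by
      intro e
      have hm : MemLp (fun x => ∑ i, ((e i : ℤ) : ℂ) * χ i x) 2 μ :=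
        memLp_finsetSum _ fun i _ => (hχ i).const_mul _
      have h2 : MemLp (fun k : Fin n → M => ∏ l, ∑ i, ((e i : ℤ) : ℂ) * χ i (k l)) 2 π := by
        refine (memLp_prod (hm.toLp _) n).ae_eq ?_
        have h1 : ∀ᵐ k ∂π, ∀ l : Fin n, (hm.toLp _ : OneBoson μ) (k l) =
            ∑ i, ((e i : ℤ) : ℂ) * χ i (k l) := by
          rw [ae_all_iff]
          intro l
          exact (Measure.quasiMeasurePreserving_eval (fun _ : Fin n => μ) l).ae hm.coeFn_toLp
        filter_upwards [h1] with k hk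
        simp_rw [hk]
      exact (h2.const_mul _).integrable_mul hG2
    rw [integral_finsetSum _ fun e _ => I_int' e]
    refine Finset.sum_eq_zero fun e _ => ?_
    simp_rw [mul_assoc]
    rw [integral_const_mul, orth e, mul_zero]
  simp_rw [I_symm] at total
  have h0 : I 1 = 0 := by
    simp only [Finset.sum_const, Finset.card_univ, nsmul_eq_mul, mul_eq_zero, pow_eq_zero_iff',
      Nat.cast_eq_zero] at total
    rcases total with h | h | h
    · exact absurd h.1 (by norm_num)
    · exact absurd h Fintype.card_ne_zero
    · exact h
  rw [I_set] at h0
  simpa using h0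

/-- Rectangles form a π-system generating the product σ-algebra, so vanishing integrals over
rectangles give vanishing integrals over all measurable subsets of a cube `S j` of finite measure,
on which F is integrable. The cubes exhaust the space. -/
theorem nBoson_eq_zero {n : ℕ} (F : nBoson μ n) (hF : ∀ f, ⟪tensorPow f n, F⟫_ℂ = 0) : F = 0 := by
  set π := Measure.pi fun _ : Fin n => μ with hπ
  have hrect := setIntegral_pi_eq_zero F hF
  let S : ℕ → Set (Fin n → M) := fun j => univ.pi fun _ => spanningSets μ j
  have hSm : ∀ j, MeasurableSet (S j) := fun j =>
    MeasurableSet.univ_pi fun _ => measurableSet_spanningSets μ j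
  have hSf : ∀ j, π (S j) ≠ ∞ := fun j => by
    rw [hπ, Measure.pi_pi]
    exact ENNReal.prod_ne_top fun l _ => (measure_spanningSets_lt_top μ j).ne
  have hint : ∀ j, IntegrableOn (F : Lp ℂ 2 π) (S j) π := by
    intro j
    have : IsFiniteMeasure (π.restrict (S j)) := ⟨by simpa using (hSf j).lt_top⟩
    exact ((Lp.memLp (F : Lp ℂ 2 π)).restrict (S j)).integrable one_le_two
  have hset : ∀ j A, MeasurableSet A → ∫ k in A ∩ S j, (F : Lp ℂ 2 π) k ∂π = 0 := by
    intro j A hA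
    induction A, hA using MeasurableSpace.induction_on_inter
      (generateFrom_pi (α := fun _ : Fin n => M)).symm isPiSystem_pi with
    | empty => simp
    | basic t ht =>
      obtain ⟨B, hB, rfl⟩ := ht
      rw [← pi_inter_distrib]
      exact hrect _ (fun i => (hB i trivial).inter (measurableSet_spanningSets μ j))
        (fun i => (measure_lt_top_of_subset inter_subset_right
          (measure_spanningSets_lt_top μ j).ne).ne)
    | compl t ht ih =>
      have h := hrect (fun _ => spanningSets μ j) (fun _ => measurableSet_spanningSets μ j)
        (fun _ => (measure_spanningSets_lt_top μ j).ne)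
      have h2 := integral_inter_add_sdiff (μ := π) (s := S j) ht (hint j)
      rw [inter_comm, ih, zero_add] at h2
      rw [inter_comm, ← sdiff_eq, h2]
      exact h
    | iUnion f hd hm ih =>
      rw [iUnion_inter, integral_iUnion (fun i => (hm i).inter (hSm j))
        (fun a b hab => (hd hab).mono inter_subset_left inter_subset_left)
        ((hint j).mono_set (iUnion_subset fun i => inter_subset_right))]
      simp [ih]
  have hae : ∀ j, ∀ᵐ k ∂π.restrict (S j), (F : Lp ℂ 2 π) k = 0 := by
    intro j
    refine Integrable.ae_eq_zero_of_forall_setIntegral_eq_zero (hint j) fun A hA _ => ?_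
    rw [Measure.restrict_restrict hA]
    exact hset j A hA
  have hU : ⋃ j, S j = univ := by
    refine eq_univ_of_forall fun k => mem_iUnion.2 ?_
    have hk : ∀ l, ∃ j, k l ∈ spanningSets μ j := fun l => by
      have : k l ∈ ⋃ j, spanningSets μ j := by
        rw [iUnion_spanningSets]
        trivial
      exact mem_iUnion.1 this
    choose j hj using hk
    refine ⟨Finset.univ.sup j, fun l _ => ?_⟩
    exact monotone_spanningSets μ (Finset.le_sup (Finset.mem_univ l)) (hj l)
  have hfin : ∀ᵐ k ∂π, (F : Lp ℂ 2 π) k = 0 := by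
    rw [← Measure.restrict_univ (μ := π), ← hU]
    exact (ae_restrict_iUnion_iff _ _).2 hae
  refine Subtype.ext ?_
  refine Lp.ext ?_
  filter_upwards [hfin, Lp.coeFn_zero ℂ 2 π] with k h1 h2
  rw [h1]
  exact h2.symm

theorem tensorPow_smul (z : ℂ) (f : OneBoson μ) (n : ℕ) :
    tensorPow (z • f) n = z ^ n • tensorPow f n := by
  refine Subtype.ext (Lp.ext ?_)
  have h1 : ∀ᵐ k ∂Measure.pi fun _ : Fin n => μ, ∀ l : Fin n, (z • f : OneBoson μ) (k l) =
      z * f (k l) := by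
    rw [ae_all_iff]
    intro l
    exact (Measure.quasiMeasurePreserving_eval (fun _ : Fin n => μ) l).ae (Lp.coeFn_smul z f)
  filter_upwards [h1, coeFn_tensorPow (z • f) n, coeFn_tensorPow f n,
    Lp.coeFn_smul (z ^ n) (tensorPow f n : Lp ℂ 2 (Measure.pi fun _ : Fin n => μ))] with k a b c d
  rw [b]
  refine Eq.trans ?_ d.symm
  rw [Pi.smul_apply, c]
  simp_rw [a, Finset.prod_mul_distrib]
  simp

/-- Scaling f by the conjugate of z turns the vanishing inner products into a power series in z that
is identically zero. Its coefficients are, up to the factor (n!)^{-1/2}, the inner products with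
tensor powers, which determine the n-boson components. -/
theorem eq_zero_of_inner_expVec (ψ : Fock μ) (h : ∀ f, ⟪expVec f, ψ⟫_ℂ = 0) : ψ = 0 := by
  have key : ∀ n (f : OneBoson μ), ⟪tensorPow f n, ψ n⟫_ℂ = 0 := by
    intro n f
    let c : ℕ → ℂ := fun n => ((Real.sqrt (n.factorial : ℝ))⁻¹ : ℂ) * ⟪tensorPow f n, ψ n⟫_ℂ
    have hs : ∀ z : ℂ, HasSum (fun n => z ^ n * c n) 0 := by
      intro z
      have h1 := lp.hasSum_inner (𝕜 := ℂ) (expVec ((starRingEnd ℂ z) • f)) ψ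
      rw [h] at h1
      have h2 : (fun n => z ^ n * c n) =
          fun n => ⟪expVec ((starRingEnd ℂ z) • f) n, ψ n⟫_ℂ := by
        funext n
        rw [expVec_apply, tensorPow_smul, smul_smul]
        refine Eq.trans ?_ (inner_smul_left (𝕜 := ℂ) (tensorPow f n) (ψ n) _).symm
        simp only [c, map_mul, map_inv₀, Complex.conj_ofReal, map_pow, Complex.conj_conj]
        ring
      rw [h2]
      exact h1
    have hp : HasFPowerSeriesAt (fun _ : ℂ => (0 : ℂ))
        (FormalMultilinearSeries.ofScalars ℂ c) 0 := by
      rw [hasFPowerSeriesAt_iff]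
      refine Eventually.of_forall fun z => ?_
      simpa [FormalMultilinearSeries.coeff_ofScalars] using hs z
    have h0 := hp.eq_zero
    have h1 : c n = 0 := by
      have := congrArg (fun p => FormalMultilinearSeries.coeff p n) h0
      rw [FormalMultilinearSeries.coeff_ofScalars] at this
      exact this
    refine (mul_eq_zero.1 h1).resolve_left ?_
    have : Real.sqrt (n.factorial : ℝ) ≠ 0 := by positivity
    simpa using this
  ext1
  funext n
  exact nBoson_eq_zero _ (key n)

/-- The exponential vectors are total. -/
theorem topologicalClosure_span_expVec :
    (Submodule.span ℂ (range (expVec : OneBoson μ → Fock μ))).topologicalClosure = ⊤ := by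
  rw [Submodule.topologicalClosure_eq_top_iff, Submodule.eq_bot_iff]
  intro ψ hψ
  refine eq_zero_of_inner_expVec ψ fun f => ?_
  exact (Submodule.mem_orthogonal _ _).1 hψ _ (Submodule.subset_span ⟨f, rfl⟩)

end ExponentialVectors

/-! ### Multiplication operators -/

section Multiplication

variable {M : Type*} [MeasurableSpace M] {μ : Measure M}

/-- Bounded measurable real functions. -/
def BddMul (m : M → ℝ) : Prop := Measurable m ∧ ∃ C, ∀ k, |m k| ≤ C

theorem BddMul.mul {m m' : M → ℝ} (h : BddMul m) (h' : BddMul m') :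
    BddMul fun k => m k * m' k := by
  obtain ⟨hm, C, hC⟩ := h
  obtain ⟨hm', C', hC'⟩ := h'
  refine ⟨hm.mul hm', C * C', fun k => ?_⟩
  rw [abs_mul]
  exact mul_le_mul (hC k) (hC' k) (abs_nonneg _) ((abs_nonneg _).trans (hC k))

theorem BddMul.add {m m' : M → ℝ} (h : BddMul m) (h' : BddMul m') :
    BddMul fun k => m k + m' k := by
  obtain ⟨hm, C, hC⟩ := h
  obtain ⟨hm', C', hC'⟩ := h'
  exact ⟨hm.add hm', C + C', fun k => (abs_add_le _ _).trans (add_le_add (hC k) (hC' k))⟩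

theorem BddMul.sub {m m' : M → ℝ} (h : BddMul m) (h' : BddMul m') :
    BddMul fun k => m k - m' k := by
  obtain ⟨hm, C, hC⟩ := h
  obtain ⟨hm', C', hC'⟩ := h'
  exact ⟨hm.sub hm', C + C', fun k => (abs_sub _ _).trans (add_le_add (hC k) (hC' k))⟩

theorem BddMul.const (c : ℝ) : BddMul fun _ : M => c :=
  ⟨measurable_const, |c|, fun _ => le_rfl⟩

theorem BddMul.memLp {m : M → ℝ} (h : BddMul m) (f : Lp ℂ 2 μ) :
    MemLp (fun k => (m k : ℂ) * f k) 2 μ := by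
  obtain ⟨hm, C, hC⟩ := h
  refine (Lp.memLp f).of_le_mul (c := C)
    ((Complex.measurable_ofReal.comp hm).aestronglyMeasurable.mul (Lp.memLp f).1)
    (ae_of_all _ fun k => ?_)
  rw [norm_mul, Complex.norm_real]
  exact mul_le_mul_of_nonneg_right (hC k) (norm_nonneg _)

theorem norm_toLp_mul_le {m : M → ℝ} (h : BddMul m) {C : ℝ} (hC : ∀ k, |m k| ≤ C)
    (f : Lp ℂ 2 μ) : ‖(h.memLp f).toLp _‖ ≤ C * ‖f‖ := by
  refine Lp.norm_le_mul_norm_of_ae_le_mul ?_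
  filter_upwards [(h.memLp f).coeFn_toLp] with k hk
  rw [hk, norm_mul, Complex.norm_real]
  exact mul_le_mul_of_nonneg_right (hC k) (norm_nonneg _)

variable (μ) in
open Classical in
/-- The operator of multiplication by a bounded real function (and `0` for other functions). -/
def mulOp (m : M → ℝ) : Lp ℂ 2 μ →L[ℂ] Lp ℂ 2 μ :=
  if h : BddMul m then
    LinearMap.mkContinuous
      { toFun := fun f => (h.memLp f).toLp _
        map_add' := fun f g => by
          refine Lp.ext ?_
          filter_upwards [(h.memLp f).coeFn_toLp, (h.memLp g).coeFn_toLp,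
            (h.memLp (f + g)).coeFn_toLp, Lp.coeFn_add f g,
            Lp.coeFn_add ((h.memLp f).toLp _) ((h.memLp g).toLp _)] with k h1 h2 h3 h4 h5
          rw [h3, h5, Pi.add_apply, h1, h2, h4, Pi.add_apply, mul_add]
        map_smul' := fun c f => by
          refine Lp.ext ?_
          filter_upwards [(h.memLp f).coeFn_toLp, (h.memLp (c • f)).coeFn_toLp,
            Lp.coeFn_smul c f, Lp.coeFn_smul c ((h.memLp f).toLp _)] with k h1 h2 h3 h4
          rw [h2, RingHom.id_apply, h4, Pi.smul_apply, h1, h3, Pi.smul_apply]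
          simp only [smul_eq_mul]
          ring } h.2.choose (fun f => norm_toLp_mul_le h h.2.choose_spec f)
  else 0

theorem coeFn_mulOp {m : M → ℝ} (h : BddMul m) (f : Lp ℂ 2 μ) :
    ⇑(mulOp μ m f) =ᵐ[μ] fun k => (m k : ℂ) * f k := by
  rw [mulOp, dif_pos h]
  exact (h.memLp f).coeFn_toLp

theorem norm_mulOp_le {m : M → ℝ} (h : Measurable m) {C : ℝ} (hC : ∀ k, |m k| ≤ C)
    (f : Lp ℂ 2 μ) : ‖mulOp μ m f‖ ≤ C * ‖f‖ := by
  have h' : BddMul m := ⟨h, C, hC⟩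
  rw [mulOp, dif_pos h']
  exact norm_toLp_mul_le h' hC f

theorem eq_mulOp {m : M → ℝ} (h : BddMul m) {f g : Lp ℂ 2 μ}
    (hg : ⇑g =ᵐ[μ] fun k => (m k : ℂ) * f k) : g = mulOp μ m f :=
  Lp.ext (hg.trans (coeFn_mulOp h f).symm)

theorem toL2_coe {f : M → ℂ} (h : MemLp f 2 μ) : ⇑(toL2 μ f) =ᵐ[μ] f := by
  rw [toL2, dif_pos h]
  exact h.coeFn_toLp

theorem toL2_eq_of_ae {f : M → ℂ} {g : Lp ℂ 2 μ} (h : f =ᵐ[μ] g) : toL2 μ f = g := by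
  have hf : MemLp f 2 μ := (Lp.memLp g).ae_eq h.symm
  exact Lp.ext ((toL2_coe hf).trans h)

theorem toL2_eq_mulOp {m : M → ℝ} (h : BddMul m) {f : M → ℂ} {g : Lp ℂ 2 μ}
    (hf : f =ᵐ[μ] fun k => (m k : ℂ) * g k) : toL2 μ f = mulOp μ m g :=
  toL2_eq_of_ae (hf.trans (coeFn_mulOp h g).symm)

theorem mulOp_mul {m m' : M → ℝ} (h : BddMul m) (h' : BddMul m') (f : Lp ℂ 2 μ) :
    mulOp μ m (mulOp μ m' f) = mulOp μ (fun k => m k * m' k) f := by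
  refine eq_mulOp (h.mul h') ?_
  filter_upwards [coeFn_mulOp h (mulOp μ m' f), coeFn_mulOp h' f] with k h1 h2
  rw [h1, h2]
  push_cast
  ring

theorem mulOp_add {m m' : M → ℝ} (h : BddMul m) (h' : BddMul m') (f : Lp ℂ 2 μ) :
    mulOp μ m f + mulOp μ m' f = mulOp μ (fun k => m k + m' k) f := by
  refine eq_mulOp (h.add h') ?_
  filter_upwards [Lp.coeFn_add (mulOp μ m f) (mulOp μ m' f), coeFn_mulOp h f,
    coeFn_mulOp h' f] with k h1 h2 h3
  rw [h1, Pi.add_apply, h2, h3]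
  push_cast
  ring

theorem mulOp_sub {m m' : M → ℝ} (h : BddMul m) (h' : BddMul m') (f : Lp ℂ 2 μ) :
    mulOp μ m f - mulOp μ m' f = mulOp μ (fun k => m k - m' k) f := by
  refine eq_mulOp (h.sub h') ?_
  filter_upwards [Lp.coeFn_sub (mulOp μ m f) (mulOp μ m' f), coeFn_mulOp h f,
    coeFn_mulOp h' f] with k h1 h2 h3
  rw [h1, Pi.sub_apply, h2, h3]
  push_cast
  ring

theorem mulOp_smul {m : M → ℝ} (h : BddMul m) (c : ℝ) (f : Lp ℂ 2 μ) :
    (c : ℂ) • mulOp μ m f = mulOp μ (fun k => c * m k) f := by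
  refine eq_mulOp ((BddMul.const c).mul h) ?_
  filter_upwards [Lp.coeFn_smul (c : ℂ) (mulOp μ m f), coeFn_mulOp h f] with k h1 h2
  rw [h1, Pi.smul_apply, h2, smul_eq_mul]
  push_cast
  ring

theorem mulOp_const (c : ℝ) (f : Lp ℂ 2 μ) : mulOp μ (fun _ => c) f = (c : ℂ) • f :=
  (eq_mulOp (BddMul.const c) (Lp.coeFn_smul (c : ℂ) f)).symm

theorem inner_mulOp_right {m : M → ℝ} (h : BddMul m) (f g : Lp ℂ 2 μ) :
    ⟪f, mulOp μ m g⟫_ℂ = ∫ k, (m k : ℂ) * ⟪f k, g k⟫_ℂ ∂μ := by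
  rw [L2.inner_def]
  refine integral_congr_ae ?_
  filter_upwards [coeFn_mulOp h g] with k h1
  rw [h1, ← smul_eq_mul, inner_smul_right]

theorem inner_mulOp_left {m : M → ℝ} (h : BddMul m) (f g : Lp ℂ 2 μ) :
    ⟪mulOp μ m f, g⟫_ℂ = ⟪f, mulOp μ m g⟫_ℂ := by
  rw [L2.inner_def, inner_mulOp_right h]
  refine integral_congr_ae ?_
  filter_upwards [coeFn_mulOp h f] with k h1
  rw [h1, ← smul_eq_mul, inner_smul_left, Complex.conj_ofReal]

theorem norm_sq_Lp (g : Lp ℂ 2 μ) : ‖g‖ ^ 2 = ∫ x, ‖g x‖ ^ 2 ∂μ := by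
  have h := inner_self_eq_norm_sq_to_K (𝕜 := ℂ) g
  rw [L2.inner_def] at h
  simp only [inner_self_eq_norm_sq_to_K] at h
  have h2 : ((∫ x, ‖g x‖ ^ 2 ∂μ : ℝ) : ℂ) = ((‖g‖ ^ 2 : ℝ) : ℂ) := by
    rw [← integral_complex_ofReal]
    push_cast
    exact h
  exact_mod_cast h2.symm

theorem inner_mulOp_self {m : M → ℝ} (h : BddMul m) (f : Lp ℂ 2 μ) :
    ⟪f, mulOp μ m f⟫_ℂ = ((∫ k, m k * ‖f k‖ ^ 2 ∂μ : ℝ) : ℂ) := by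
  rw [inner_mulOp_right h, ← integral_complex_ofReal]
  refine integral_congr_ae (ae_of_all _ fun k => ?_)
  simp only [inner_self_eq_norm_sq_to_K]
  push_cast
  rfl

/-- Dominated convergence for |mᵢ - m₀|² |f|²: bounded pointwise convergence of multipliers gives
strong convergence of the operators. All limits t ↓ 0 and all limits of discretizations of
multipliers go through this. -/
theorem tendsto_mulOp {ι : Type*} {l : Filter ι} [l.IsCountablyGenerated] {m : ι → M → ℝ}
    {m₀ : M → ℝ} {C : ℝ} (hb : ∀ i, BddMul (m i)) (hm₀ : Measurable m₀)
    (hC : ∀ᶠ i in l, ∀ k, |m i k| ≤ C) (hC₀ : ∀ k, |m₀ k| ≤ C)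
    (hlim : ∀ᵐ k ∂μ, Tendsto (fun i => m i k) l (𝓝 (m₀ k))) (f : Lp ℂ 2 μ) :
    Tendsto (fun i => mulOp μ (m i) f) l (𝓝 (mulOp μ m₀ f)) := by
  rw [tendsto_iff_norm_sub_tendsto_zero]
  have hb₀ : BddMul m₀ := ⟨hm₀, C, hC₀⟩
  have hsq : Tendsto (fun i => ‖mulOp μ (m i) f - mulOp μ m₀ f‖ ^ 2) l (𝓝 0) := by
    have h1 : ∀ i, ‖mulOp μ (m i) f - mulOp μ m₀ f‖ ^ 2 =
        ∫ k, (m i k - m₀ k) ^ 2 * ‖f k‖ ^ 2 ∂μ := by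
      intro i
      rw [mulOp_sub (hb i) hb₀, norm_sq_Lp]
      refine integral_congr_ae ?_
      filter_upwards [coeFn_mulOp ((hb i).sub hb₀) f] with k hk
      rw [hk, norm_mul, Complex.norm_real, mul_pow, Real.norm_eq_abs, sq_abs]
    simp_rw [h1]
    have hf2 : Integrable (fun k => ‖f k‖ ^ 2) μ :=
      (memLp_two_iff_integrable_sq_norm (Lp.memLp f).1).1 (Lp.memLp f)
    have := tendsto_integral_filter_of_dominated_convergence (μ := μ) (l := l)
      (F := fun i k => (m i k - m₀ k) ^ 2 * ‖f k‖ ^ 2) (f := fun _ => (0 : ℝ))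
      (fun k => (C + C) ^ 2 * ‖f k‖ ^ 2) (Eventually.of_forall fun i =>
        (((hb i).1.sub hm₀).pow_const 2).aestronglyMeasurable.mul hf2.1)
      (hC.mono fun i hCi => ae_of_all _ fun k => ?_) (hf2.const_mul _) ?_
    · simpa using this
    · rw [norm_mul, Real.norm_of_nonneg (sq_nonneg _), norm_pow, norm_norm]
      refine mul_le_mul_of_nonneg_right ?_ (sq_nonneg _)
      rw [← sq_abs]
      exact pow_le_pow_left₀ (abs_nonneg _)
        ((abs_sub _ _).trans (add_le_add (hCi k) (hC₀ k))) 2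
    · filter_upwards [hlim] with k hk
      have h2 := ((hk.sub_const (m₀ k)).pow 2).mul_const (‖f k‖ ^ 2)
      simpa using h2
  have h3 := (Real.continuous_sqrt.tendsto 0).comp hsq
  simpa [Function.comp_def, Real.sqrt_sq (norm_nonneg _)] using h3

end Multiplication

/-! ### Gram kernels -/

section Gram

variable {E E' : Type*} [NormedAddCommGroup E] [InnerProductSpace ℂ E] [NormedAddCommGroup E']
  [InnerProductSpace ℂ E'] {ι : Type*}

/-- The Schur product theorem in explicit form: inserting an orthonormal basis between `y i` and `y
j` turns the entrywise product of two Gram matrices into a sum of squared norms. -/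
theorem sum_gram_mul_gram_finiteDimensional [FiniteDimensional ℂ E'] (s : Finset ι) (c : ι → ℂ)
    (x : ι → E) (y : ι → E') :
    ∑ i ∈ s, ∑ j ∈ s, starRingEnd ℂ (c i) * c j * (⟪x i, x j⟫_ℂ * ⟪y i, y j⟫_ℂ) =
      ∑ b, ((‖∑ j ∈ s, (c j * ⟪stdOrthonormalBasis ℂ E' b, y j⟫_ℂ) • x j‖ ^ 2 : ℝ) : ℂ) := by
  have h : ∀ b, ((‖∑ j ∈ s, (c j * ⟪stdOrthonormalBasis ℂ E' b, y j⟫_ℂ) • x j‖ ^ 2 : ℝ) : ℂ) =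
      ∑ i ∈ s, ∑ j ∈ s, starRingEnd ℂ (c i) * c j * ⟪x i, x j⟫_ℂ *
        (⟪y i, stdOrthonormalBasis ℂ E' b⟫_ℂ * ⟪stdOrthonormalBasis ℂ E' b, y j⟫_ℂ) := by
    intro b
    have h1 := inner_self_eq_norm_sq_to_K (𝕜 := ℂ)
      (∑ j ∈ s, (c j * ⟪stdOrthonormalBasis ℂ E' b, y j⟫_ℂ) • x j)
    push_cast
    refine h1.symm.trans ?_
    rw [sum_inner]
    refine Finset.sum_congr rfl fun i _ => ?_
    rw [inner_sum]
    refine Finset.sum_congr rfl fun j _ => ?_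
    rw [inner_smul_left, inner_smul_right, map_mul, inner_conj_symm]
    ring
  simp_rw [h]
  refine Eq.trans ?_ Finset.sum_comm
  refine Finset.sum_congr rfl fun i _ => ?_
  refine Eq.trans ?_ Finset.sum_comm
  refine Finset.sum_congr rfl fun j _ => ?_
  rw [← Finset.mul_sum, (stdOrthonormalBasis ℂ E').sum_inner_mul_inner]
  ring

theorem re_sum_gram_mul_gram_nonneg (s : Finset ι) (c : ι → ℂ) (x : ι → E) (y : ι → E') :
    0 ≤ (∑ i ∈ s, ∑ j ∈ s, starRingEnd ℂ (c i) * c j * (⟪x i, x j⟫_ℂ * ⟪y i, y j⟫_ℂ)).re := by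
  classical
  let W := Submodule.span ℂ ((s.image y : Finset E') : Set E')
  have : FiniteDimensional ℂ W := FiniteDimensional.span_finset ℂ _
  let y' : ι → W := fun i => if h : y i ∈ W then ⟨y i, h⟩ else 0
  have hy : ∀ i ∈ s, (y' i : E') = y i := by
    intro i hi
    have : y i ∈ W := Submodule.subset_span (Finset.mem_coe.2 (Finset.mem_image_of_mem y hi))
    simp [y', this]
  have h := sum_gram_mul_gram_finiteDimensional s c x y'
  have h2 : ∑ i ∈ s, ∑ j ∈ s, starRingEnd ℂ (c i) * c j * (⟪x i, x j⟫_ℂ * ⟪y i, y j⟫_ℂ) =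
      ∑ i ∈ s, ∑ j ∈ s, starRingEnd ℂ (c i) * c j * (⟪x i, x j⟫_ℂ * ⟪y' i, y' j⟫_ℂ) := by
    refine Finset.sum_congr rfl fun i hi => Finset.sum_congr rfl fun j hj => ?_
    rw [Submodule.coe_inner, hy i hi, hy j hj]
  rw [h2, h, ← Complex.ofReal_sum, Complex.ofReal_re]
  exact Finset.sum_nonneg fun b _ => sq_nonneg _

/-- In an orthonormal basis of the span of the `y i`, each coordinate of the left side is an inner
product with e, and Cauchy-Schwarz leaves one square of the Schur product expansion. With `y`
exponential vectors this is the estimate ‖a(f)ψ‖² ≤ ‖f/√ω‖² ⟨ψ, dΓ(ω)ψ⟩. -/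
theorem norm_sum_inner_smul_sq_le (s : Finset ι) (c : ι → ℂ) (x : ι → E) (y : ι → E') (e : E) :
    ‖∑ i ∈ s, (c i * ⟪e, x i⟫_ℂ) • y i‖ ^ 2 ≤ ‖e‖ ^ 2 *
      (∑ i ∈ s, ∑ j ∈ s, starRingEnd ℂ (c i) * c j * (⟪x i, x j⟫_ℂ * ⟪y i, y j⟫_ℂ)).re := by
  classical
  let W := Submodule.span ℂ ((s.image y : Finset E') : Set E')
  have : FiniteDimensional ℂ W := FiniteDimensional.span_finset ℂ _
  let y' : ι → W := fun i => if h : y i ∈ W then ⟨y i, h⟩ else 0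
  have hy : ∀ i ∈ s, (y' i : E') = y i := by
    intro i hi
    have : y i ∈ W := Submodule.subset_span (Finset.mem_coe.2 (Finset.mem_image_of_mem y hi))
    simp [y', this]
  have h := sum_gram_mul_gram_finiteDimensional s c x y'
  have h2 : ∑ i ∈ s, ∑ j ∈ s, starRingEnd ℂ (c i) * c j * (⟪x i, x j⟫_ℂ * ⟪y i, y j⟫_ℂ) =
      ∑ i ∈ s, ∑ j ∈ s, starRingEnd ℂ (c i) * c j * (⟪x i, x j⟫_ℂ * ⟪y' i, y' j⟫_ℂ) := by
    refine Finset.sum_congr rfl fun i hi => Finset.sum_congr rfl fun j hj => ?_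
    rw [Submodule.coe_inner, hy i hi, hy j hj]
  rw [h2, h, ← Complex.ofReal_sum, Complex.ofReal_re, Finset.mul_sum]
  have h3 : ∑ i ∈ s, (c i * ⟪e, x i⟫_ℂ) • y i =
      ((∑ i ∈ s, (c i * ⟪e, x i⟫_ℂ) • y' i : W) : E') := by
    rw [Submodule.coe_sum]
    refine Finset.sum_congr rfl fun i hi => ?_
    rw [Submodule.coe_smul, hy i hi]
  rw [h3, Submodule.norm_coe, ← (stdOrthonormalBasis ℂ W).sum_sq_norm_inner_right]
  refine Finset.sum_le_sum fun b _ => ?_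
  have h4 : ⟪stdOrthonormalBasis ℂ W b, ∑ i ∈ s, (c i * ⟪e, x i⟫_ℂ) • y' i⟫_ℂ =
      ⟪e, ∑ j ∈ s, (c j * ⟪stdOrthonormalBasis ℂ W b, y' j⟫_ℂ) • x j⟫_ℂ := by
    rw [inner_sum, inner_sum]
    refine Finset.sum_congr rfl fun i _ => ?_
    rw [inner_smul_right (𝕜 := ℂ) (E := W), inner_smul_right]
    ring
  rw [h4, ← mul_pow]
  exact pow_le_pow_left₀ (norm_nonneg _) (norm_inner_le_norm _ _) 2

end Gram

/-! ### Bounded operators defined on exponential vectors -/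

section Extension

variable {M : Type*} [MeasurableSpace M] {μ : Measure M} [SigmaFinite μ]

theorem dense_span_expVec :
    Dense (Submodule.span ℂ (range (expVec : OneBoson μ → Fock μ)) : Set (Fock μ)) := by
  rw [Submodule.dense_iff_topologicalClosure_eq_top]
  exact topologicalClosure_span_expVec

theorem clm_ext_expVec {E : Type*} [NormedAddCommGroup E] [NormedSpace ℂ E]
    {T T' : Fock μ →L[ℂ] E} (h : ∀ g, T (expVec g) = T' (expVec g)) : T = T' := by
  refine ContinuousLinearMap.ext_on dense_span_expVec ?_
  rintro _ ⟨g, rfl⟩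
  exact h g

theorem ext_inner_expVec {ψ φ : Fock μ} (h : ∀ f, ⟪expVec f, ψ⟫_ℂ = ⟪expVec f, φ⟫_ℂ) : ψ = φ := by
  rw [← sub_eq_zero]
  refine eq_zero_of_inner_expVec _ fun f => ?_
  rw [inner_sub_right, h, sub_self]

theorem extendExp_eq {Φ : OneBoson μ → Fock μ} {T : Fock μ →L[ℂ] Fock μ}
    (h : ∀ g, T (expVec g) = Φ g) : extendExp Φ = T := by
  have h' : ∃ T : Fock μ →L[ℂ] Fock μ, ∀ g, T (expVec g) = Φ g := ⟨T, h⟩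
  refine clm_ext_expVec fun g => ?_
  rw [extendExp, dif_pos h', h'.choose_spec g, h]

theorem norm_sum_smul_sq {E : Type*} [NormedAddCommGroup E] [InnerProductSpace ℂ E] {ι : Type*}
    (s : Finset ι) (c : ι → ℂ) (x : ι → E) : ((‖∑ i ∈ s, c i • x i‖ ^ 2 : ℝ) : ℂ) =
      ∑ i ∈ s, ∑ j ∈ s, starRingEnd ℂ (c i) * c j * ⟪x i, x j⟫_ℂ := by
  have h1 := inner_self_eq_norm_sq_to_K (𝕜 := ℂ) (∑ j ∈ s, c j • x j)
  push_cast
  refine h1.symm.trans ?_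
  rw [sum_inner]
  refine Finset.sum_congr rfl fun i _ => ?_
  rw [inner_sum]
  refine Finset.sum_congr rfl fun j _ => ?_
  rw [inner_smul_left, inner_smul_right]
  ring

/-- An operator on exponential vectors is bounded if its Gram kernel is dominated by
the exponential kernel with a quotient that is again an exponential kernel. -/
theorem exists_clm_expVec (Φ : OneBoson μ → Fock μ) (η : OneBoson μ → OneBoson μ) {C : ℝ}
    (hC : 0 ≤ C) (h : ∀ g g', (C : ℂ) ^ 2 * Complex.exp ⟪g, g'⟫_ℂ =
      ⟪Φ g, Φ g'⟫_ℂ * Complex.exp ⟪η g, η g'⟫_ℂ) :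
    ∃ T : Fock μ →L[ℂ] Fock μ, (∀ g, T (expVec g) = Φ g) ∧ ‖T‖ ≤ C := by
  let e : (OneBoson μ →₀ ℂ) →ₗ[ℂ] Fock μ := Finsupp.linearCombination ℂ expVec
  let f : (OneBoson μ →₀ ℂ) →ₗ[ℂ] Fock μ := Finsupp.linearCombination ℂ Φ
  have hd : DenseRange e := by
    rw [DenseRange, ← LinearMap.coe_range, Finsupp.range_linearCombination]
    exact dense_span_expVec
  have hn : ∀ x, ‖f x‖ ≤ C * ‖e x‖ := by
    intro x
    refine (sq_le_sq₀ (norm_nonneg _) (by positivity)).1 ?_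
    have h1 : ((‖f x‖ ^ 2 : ℝ) : ℂ) = _ := norm_sum_smul_sq x.support x Φ
    have h2 : ((‖e x‖ ^ 2 : ℝ) : ℂ) = _ := norm_sum_smul_sq x.support x expVec
    -- Subtracting the vacuum ε(0) makes the second Gram kernel exp⟨η g, η g'⟩ - 1, so the product
    -- with the kernel of Φ is exactly the difference C² exp⟨g, g'⟩ - ⟨Φ g, Φ g'⟩.
    have h3 := re_sum_gram_mul_gram_nonneg x.support x Φ
      (fun g => expVec (η g) - expVec (0 : OneBoson μ))
    have h4 : ∑ i ∈ x.support, ∑ j ∈ x.support, starRingEnd ℂ (x i) * x j *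
        (⟪Φ i, Φ j⟫_ℂ * ⟪expVec (η i) - expVec (0 : OneBoson μ),
          expVec (η j) - expVec (0 : OneBoson μ)⟫_ℂ) =
        (((C * ‖e x‖) ^ 2 - ‖f x‖ ^ 2 : ℝ) : ℂ) := by
      rw [mul_pow, Complex.ofReal_sub, Complex.ofReal_mul, h1, h2, Finset.mul_sum,
        ← Finset.sum_sub_distrib]
      refine Finset.sum_congr rfl fun i _ => ?_
      rw [Finset.mul_sum, ← Finset.sum_sub_distrib]
      refine Finset.sum_congr rfl fun j _ => ?_
      rw [inner_sub_left, inner_sub_right, inner_sub_right, inner_expVec, inner_expVec,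
        inner_expVec, inner_expVec, inner_expVec, inner_zero_left, inner_zero_right,
        inner_zero_right, Complex.exp_zero]
      push_cast
      linear_combination -(starRingEnd ℂ (x i) * x j) * h i j
    rw [h4, Complex.ofReal_re] at h3
    linarith
  refine ⟨f.extendOfNorm e, fun g => ?_, ?_⟩
  · have := LinearMap.extendOfNorm_eq hd ⟨C, hn⟩ (Finsupp.single g 1)
    simpa [e, f] using this
  · exact ContinuousLinearMap.opNorm_le_bound _ hC
      (LinearMap.norm_extendOfNorm_apply_le hd C hn)

/-- Boundedness of the operators `ε(g) ↦ exp(c - ⟨a, g⟩) ε(E g - b)`. -/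
theorem exists_clm_affine {E R : OneBoson μ →L[ℂ] OneBoson μ}
    (hE : ∀ f g, ⟪E f, g⟫_ℂ = ⟪f, E g⟫_ℂ) (hR : ∀ f g, ⟪R f, g⟫_ℂ = ⟪f, R g⟫_ℂ)
    (hER : ∀ f, E (E f) + R (R f) = f) (c : ℂ) {a b h : OneBoson μ} (hab : a + E b = R h) :
    ∃ T : Fock μ →L[ℂ] Fock μ,
      (∀ g, T (expVec g) = Complex.exp (c - ⟪a, g⟫_ℂ) • expVec (E g - b)) ∧
      ‖T‖ ≤ Real.exp (c.re + ‖b‖ ^ 2 / 2 + ‖h‖ ^ 2 / 2) := by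
  -- Completing the square: E² + R² = 1 restores ⟨g, g'⟩, the relation a + E b = R h cancels the
  -- terms linear in g and g', and the constants 2 Re c + ‖b‖² + ‖h‖² form the square of the norm
  -- bound.
  refine exists_clm_expVec _ (fun g => R g + h) (Real.exp_pos _).le fun g g' => ?_
  rw [inner_smul_left, inner_smul_right, inner_expVec, ← Complex.exp_conj, ← Complex.exp_add,
    ← Complex.exp_add, ← Complex.exp_add, Complex.ofReal_exp, ← Complex.exp_nat_mul,
    ← Complex.exp_add]
  congr 1
  have h1 : ⟪a, g'⟫_ℂ + ⟪b, E g'⟫_ℂ = ⟪h, R g'⟫_ℂ := by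
    rw [← hE, ← hR, ← inner_add_left, hab]
  have h2 : ⟪g, a⟫_ℂ + ⟪E g, b⟫_ℂ = ⟪R g, h⟫_ℂ := by
    rw [hE, hR, ← inner_add_right, hab]
  have h3 : ⟪E g, E g'⟫_ℂ + ⟪R g, R g'⟫_ℂ = ⟪g, g'⟫_ℂ := by
    rw [hE, hR, ← inner_add_right, hER]
  have h4 := inner_self_eq_norm_sq_to_K (𝕜 := ℂ) b
  have h5 := inner_self_eq_norm_sq_to_K (𝕜 := ℂ) h
  have h6 : c + starRingEnd ℂ c = 2 * c.re := by
    rw [Complex.add_conj]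
    push_cast
    ring
  simp only [inner_sub_left, inner_sub_right, inner_add_left, inner_add_right, map_sub,
    inner_conj_symm, h4, h5]
  push_cast
  simp only [Complex.coe_algebraMap] at *
  linear_combination -h3 + h1 + h2 - h6

/-- The affine case E = 1, R = 0, b = -f, h = 0: the normalization -‖f‖²/2 cancels ‖b‖²/2 in the
norm bound. -/
theorem weyl_expVec_and_norm (f : OneBoson μ) :
    (∀ g, weyl f (expVec g) =
      Complex.exp (-(‖f‖ ^ 2 / 2 : ℝ) - ⟪f, g⟫_ℂ) • expVec (f + g)) ∧ ‖weyl f‖ ≤ 1 := by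
  obtain ⟨T, hT, hn⟩ := exists_clm_affine (μ := μ) (E := 1) (R := 0) (fun _ _ => rfl)
    (by simp) (by simp) (-(‖f‖ ^ 2 / 2 : ℝ)) (a := f) (b := -f) (h := 0) (by simp)
  have hT' : ∀ g, T (expVec g) =
      Complex.exp (-(‖f‖ ^ 2 / 2 : ℝ) - ⟪f, g⟫_ℂ) • expVec (f + g) := by
    intro g
    rw [hT]
    congr 2
    simp [add_comm]
  have h := extendExp_eq hT'
  rw [weyl, h]
  refine ⟨hT', hn.trans ?_⟩
  rw [← Complex.ofReal_neg, Complex.ofReal_re, norm_neg, norm_zero]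
  simp

end Extension

/-! ### Holomorphic families of exponential vectors -/

section Holomorphic

/-- Cauchy's estimate on circles of radius r⁻¹ around points of the unit disc bounds the derivative
by Φ r. With r the distance of two parameters, a growth bound on the complex line joining them
becomes a Lipschitz bound. -/
theorem norm_sub_le_of_entire {E : Type*} [NormedAddCommGroup E] [NormedSpace ℂ E] {F : ℂ → E}
    (hF : Differentiable ℂ F) {r Φ : ℝ} (hr : 0 < r) (hb : ∀ z, ‖z‖ ≤ 1 + r⁻¹ → ‖F z‖ ≤ Φ) :
    ‖F 1 - F 0‖ ≤ Φ * r := by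
  have h := (convex_closedBall (0 : ℂ) 1).norm_image_sub_le_of_norm_deriv_le (𝕜 := ℂ) (f := F)
    (C := Φ * r) (x := 0) (y := 1) (fun z _ => hF z) (fun z hz => ?_) (by simp) (by simp)
  · simpa using h
  · have := Complex.norm_deriv_le_of_forall_mem_sphere_norm_le (f := F) (c := z) (R := r⁻¹) (C := Φ)
      (inv_pos.2 hr) hF.diffContOnCl (fun w hw => hb w ?_)
    · simpa using this
    · rw [mem_sphere_iff_norm] at hw
      rw [mem_closedBall_zero_iff] at hz
      calc ‖w‖ = ‖z + (w - z)‖ := by congr 1; ring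
        _ ≤ ‖z‖ + ‖w - z‖ := norm_add_le _ _
        _ ≤ 1 + r⁻¹ := by rw [hw]; linarith

variable {M : Type*} [MeasurableSpace M] {μ : Measure M} [SigmaFinite μ]

/-- A continuous map into Fock space is entire if its inner products with exponential vectors
are. -/
theorem differentiable_of_inner_expVec {F : ℂ → Fock μ} (hF : Continuous F)
    (h : ∀ f, Differentiable ℂ fun z => ⟪expVec f, F z⟫_ℂ) : Differentiable ℂ F := by
  intro z₀
  have hci : CircleIntegrable F z₀ ((1 : ℝ≥0) : ℝ) := hF.continuousOn.circleIntegrable (by simp)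
  have hps := hasFPowerSeriesOn_cauchy_integral hci one_pos
  -- The Cauchy integral of a continuous function is analytic; tested against exponential vectors it
  -- coincides with F, hence it is F.
  have heq : ∀ w ∈ Metric.ball z₀ (1 : ℝ),
      F w = (2 * Real.pi * Complex.I : ℂ)⁻¹ • ∮ z in C(z₀, 1), (z - w)⁻¹ • F z := by
    intro w hw
    refine ext_inner_expVec fun f => ?_
    have hint : CircleIntegrable (fun z => (z - w)⁻¹ • F z) z₀ 1 := by
      refine ContinuousOn.circleIntegrable zero_le_one ?_
      refine ContinuousOn.smul (ContinuousOn.inv₀ (continuous_id.sub continuous_const).continuousOn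
        fun z hz => ?_) hF.continuousOn
      rw [Pi.sub_apply, sub_ne_zero]
      rintro rfl
      rw [mem_sphere_iff_norm] at hz
      rw [mem_ball_iff_norm] at hw
      exact hw.ne hz
    have hd : DiffContOnCl ℂ (fun z => ⟪expVec f, F z⟫_ℂ) (Metric.ball z₀ 1) :=
      (h f).diffContOnCl
    rw [← hd.two_pi_i_inv_smul_circleIntegral_sub_inv_smul hw, inner_smul_right, smul_eq_mul]
    congr 1
    have := (innerSL ℂ (expVec f)).intervalIntegral_comp_comm hint.out
    rw [circleIntegral, circleIntegral]
    refine Eq.trans ?_ this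
    refine intervalIntegral.integral_congr fun θ _ => ?_
    simp only [innerSL_apply_apply, inner_smul_right, smul_eq_mul]
  have hd : DifferentiableAt ℂ
      (fun w => (2 * Real.pi * Complex.I : ℂ)⁻¹ • ∮ z in C(z₀, 1), (z - w)⁻¹ • F z) z₀ :=
    hps.hasFPowerSeriesAt.differentiableAt
  refine hd.congr_of_eventuallyEq ?_
  filter_upwards [Metric.ball_mem_nhds z₀ one_pos] with w hw
  exact heq w hw

theorem continuous_expVec : Continuous (expVec : OneBoson μ → Fock μ) := by
  rw [continuous_iff_continuousAt]
  intro g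
  rw [ContinuousAt, tendsto_iff_norm_sub_tendsto_zero]
  have h1 : ∀ f : OneBoson μ, ‖expVec f - expVec g‖ ^ 2 =
      Real.exp (‖f‖ ^ 2) + Real.exp (‖g‖ ^ 2) - 2 * (Complex.exp ⟪f, g⟫_ℂ).re := by
    intro f
    rw [@norm_sub_sq ℂ, norm_expVec_sq, norm_expVec_sq, inner_expVec]
    simp only [RCLike.re_to_complex]
    ring
  have h2 : Tendsto (fun f : OneBoson μ => ‖expVec f - expVec g‖ ^ 2) (𝓝 g) (𝓝 0) := by
    simp_rw [h1]
    have hc : Continuous fun f : OneBoson μ =>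
        Real.exp (‖f‖ ^ 2) + Real.exp (‖g‖ ^ 2) - 2 * (Complex.exp ⟪f, g⟫_ℂ).re := by
      fun_prop
    have := hc.tendsto g
    rw [← h1 g] at this
    simpa using this
  have h3 := (Real.continuous_sqrt.tendsto 0).comp h2
  simpa [Function.comp_def, Real.sqrt_sq (norm_nonneg _)] using h3

theorem differentiable_expVec_line (g h : OneBoson μ) :
    Differentiable ℂ fun z : ℂ => expVec (g + z • h) := by
  refine differentiable_of_inner_expVec (continuous_expVec.comp (by fun_prop)) fun f => ?_
  simp_rw [inner_expVec, inner_add_right, inner_smul_right]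
  fun_prop

/-- On the line g + z(f - g) with |z| ≤ 1 + ‖f - g‖⁻¹ the argument has norm at most r + (2r + 1),
which is the source of 3r + 1. -/
theorem norm_expVec_sub_le {f g : OneBoson μ} {r : ℝ} (hf : ‖f‖ ≤ r) (hg : ‖g‖ ≤ r) :
    ‖expVec f - expVec g‖ ≤ Real.exp ((3 * r + 1) ^ 2 / 2) * ‖f - g‖ := by
  by_cases hfg : f = g
  · simp [hfg]
  have hpos : 0 < ‖f - g‖ := norm_pos_iff.2 (sub_ne_zero.2 hfg)
  have := norm_sub_le_of_entire (differentiable_expVec_line g (f - g)) hpos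
    (Φ := Real.exp ((3 * r + 1) ^ 2 / 2)) (fun z hz => ?_)
  · simpa using this
  · rw [norm_expVec, Real.exp_le_exp]
    refine div_le_div_of_nonneg_right (pow_le_pow_left₀ (norm_nonneg _) ?_ 2) zero_le_two
    have h1 : ‖z • (f - g)‖ ≤ ‖f - g‖ + 1 := by
      rw [norm_smul]
      refine (mul_le_mul_of_nonneg_right hz hpos.le).trans_eq ?_
      field_simp
    have h2 := norm_sub_le f g
    have h3 := norm_add_le g (z • (f - g))
    linarith

/-- The derivative of `z ↦ ε(g + z h)` at `0`. -/
def dExp (g h : OneBoson μ) : Fock μ := deriv (fun z : ℂ => expVec (g + z • h)) 0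

theorem hasDerivAt_expVec_line (g h : OneBoson μ) :
    HasDerivAt (fun z : ℂ => expVec (g + z • h)) (dExp g h) 0 :=
  (differentiable_expVec_line g h 0).hasDerivAt

theorem inner_expVec_dExp (f g h : OneBoson μ) :
    ⟪expVec f, dExp g h⟫_ℂ = ⟪f, h⟫_ℂ * Complex.exp ⟪f, g⟫_ℂ := by
  have h1 : HasDerivAt (fun z : ℂ => ⟪expVec f, expVec (g + z • h)⟫_ℂ) ⟪expVec f, dExp g h⟫_ℂ 0 :=
    (innerSL ℂ (expVec f)).hasFDerivAt.comp_hasDerivAt (0 : ℂ) (hasDerivAt_expVec_line g h)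
  simp_rw [inner_expVec, inner_add_right, inner_smul_right] at h1
  have h2 : HasDerivAt (fun z : ℂ => Complex.exp (⟪f, g⟫_ℂ + z * ⟪f, h⟫_ℂ))
      (Complex.exp (⟪f, g⟫_ℂ + 0 * ⟪f, h⟫_ℂ) * (1 * ⟪f, h⟫_ℂ)) 0 :=
    (((hasDerivAt_id (0 : ℂ)).mul_const _).const_add _).cexp
  rw [h1.unique h2]
  simp [mul_comm]

theorem inner_dExp_expVec (f g h : OneBoson μ) :
    ⟪dExp g h, expVec f⟫_ℂ = ⟪h, f⟫_ℂ * Complex.exp ⟪g, f⟫_ℂ := by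
  rw [← inner_conj_symm, inner_expVec_dExp, map_mul, ← Complex.exp_conj, inner_conj_symm,
    inner_conj_symm]

theorem inner_dExp_dExp (g h g' h' : OneBoson μ) :
    ⟪dExp g h, dExp g' h'⟫_ℂ =
      (⟪h, h'⟫_ℂ + ⟪h, g'⟫_ℂ * ⟪g, h'⟫_ℂ) * Complex.exp ⟪g, g'⟫_ℂ := by
  have h1 : HasDerivAt (fun z : ℂ => ⟪dExp g h, expVec (g' + z • h')⟫_ℂ)
      ⟪dExp g h, dExp g' h'⟫_ℂ 0 :=
    (innerSL ℂ (dExp g h)).hasFDerivAt.comp_hasDerivAt (0 : ℂ) (hasDerivAt_expVec_line g' h')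
  simp_rw [inner_dExp_expVec, inner_add_right, inner_smul_right] at h1
  have h2 : HasDerivAt (fun z : ℂ => (⟪h, g'⟫_ℂ + z * ⟪h, h'⟫_ℂ) *
      Complex.exp (⟪g, g'⟫_ℂ + z * ⟪g, h'⟫_ℂ))
      ((1 * ⟪h, h'⟫_ℂ) * Complex.exp (⟪g, g'⟫_ℂ + 0 * ⟪g, h'⟫_ℂ) +
        (⟪h, g'⟫_ℂ + 0 * ⟪h, h'⟫_ℂ) *
          (Complex.exp (⟪g, g'⟫_ℂ + 0 * ⟪g, h'⟫_ℂ) * (1 * ⟪g, h'⟫_ℂ))) 0 :=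
    (((hasDerivAt_id (0 : ℂ)).mul_const _).const_add _).mul
      (((hasDerivAt_id (0 : ℂ)).mul_const _).const_add _).cexp
  rw [h1.unique h2]
  simp only [zero_mul, add_zero, one_mul]
  ring

theorem dExp_add (g h h' : OneBoson μ) : dExp g (h + h') = dExp g h + dExp g h' := by
  refine ext_inner_expVec fun f => ?_
  rw [inner_add_right, inner_expVec_dExp, inner_expVec_dExp, inner_expVec_dExp, inner_add_right]
  ring

theorem dExp_smul (g : OneBoson μ) (c : ℂ) (h : OneBoson μ) : dExp g (c • h) = c • dExp g h := by
  refine ext_inner_expVec fun f => ?_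
  rw [inner_smul_right, inner_expVec_dExp, inner_expVec_dExp, inner_smul_right]
  ring

/-- A chain rule for curves in L² that are differentiable at one point only. Replacing u by its
linearization g - s η costs o(s) by the local Lipschitz bound, and the linearization is handled by
holomorphy on the line. This is how generators are computed on exponential vectors. -/
theorem tendsto_expVec_sub {ι : Type*} {l : Filter ι} {s : ι → ℝ} {u : ι → OneBoson μ}
    {g η : OneBoson μ} (hs : Tendsto s l (𝓝[≠] 0))
    (hu : Tendsto (fun i => ((s i : ℂ))⁻¹ • (g - u i)) l (𝓝 η)) :
    Tendsto (fun i => ((s i : ℂ))⁻¹ • (expVec g - expVec (u i))) l (𝓝 (dExp g η)) := by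
  have hs0 : Tendsto s l (𝓝 0) := hs.mono_right nhdsWithin_le_nhds
  have hsne : ∀ᶠ i in l, s i ≠ 0 := hs.eventually eventually_mem_nhdsWithin
  have hsc : Tendsto (fun i => (s i : ℂ)) l (𝓝 0) := by
    have := (Complex.continuous_ofReal.tendsto 0).comp hs0
    simpa [Function.comp_def] using this
  -- the linear part
  have h1 : Tendsto (fun i => ((s i : ℂ))⁻¹ • (expVec g - expVec (g + (-(s i : ℂ)) • η))) l
      (𝓝 (dExp g η)) := by
    have hd := (hasDerivAt_iff_tendsto_slope_zero.1 (hasDerivAt_expVec_line g η))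
    have hn : Tendsto (fun i => -(s i : ℂ)) l (𝓝[≠] 0) := by
      refine tendsto_nhdsWithin_iff.2 ⟨by simpa using hsc.neg, ?_⟩
      filter_upwards [hsne] with i hi
      simpa using hi
    refine (hd.comp hn).congr fun i => ?_
    simp only [Function.comp_apply, zero_add, zero_smul, add_zero, inv_neg, neg_smul]
    rw [← smul_neg, neg_sub]
  -- the remainder
  have hlin : Tendsto (fun i => g + (-(s i : ℂ)) • η) l (𝓝 g) := by
    have := (hsc.neg.smul_const η).const_add g
    simpa using this
  have hu' : Tendsto u l (𝓝 g) := by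
    have h2 := (hsc.smul hu).const_sub g
    rw [zero_smul, sub_zero] at h2
    refine h2.congr' ?_
    filter_upwards [hsne] with i hi
    rw [smul_smul, mul_inv_cancel₀ (by simpa using hi), one_smul, sub_sub_cancel]
  have h2 : Tendsto (fun i => ((s i : ℂ))⁻¹ • (expVec (g + (-(s i : ℂ)) • η) - expVec (u i))) l
      (𝓝 0) := by
    have hb : ∀ᶠ i in l, ‖((s i : ℂ))⁻¹ • (expVec (g + (-(s i : ℂ)) • η) - expVec (u i))‖ ≤
        Real.exp ((3 * (‖g‖ + 1) + 1) ^ 2 / 2) * ‖((s i : ℂ))⁻¹ • (g - u i) - η‖ := by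
      filter_upwards [hsne, hlin.norm.eventually (gt_mem_nhds (lt_add_one ‖g‖)),
        hu'.norm.eventually (gt_mem_nhds (lt_add_one ‖g‖))] with i hi h3 h4
      have h5 := norm_expVec_sub_le h3.le h4.le
      rw [norm_smul]
      refine (mul_le_mul_of_nonneg_left h5 (norm_nonneg _)).trans_eq ?_
      rw [mul_left_comm, ← norm_smul]
      congr 2
      have hi' : (s i : ℂ) ≠ 0 := by simpa using hi
      rw [smul_sub, smul_add, smul_smul, smul_sub, mul_neg, inv_mul_cancel₀ hi', neg_one_smul]
      abel
    refine squeeze_zero_norm' hb ?_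
    have := ((hu.sub_const η).norm).const_mul (Real.exp ((3 * (‖g‖ + 1) + 1) ^ 2 / 2))
    simpa using this
  have h3 := h1.add h2
  rw [add_zero] at h3
  refine h3.congr fun i => ?_
  rw [← smul_add]
  congr 1
  abel

end Holomorphic

/-! ### The operators `I_t(ω, f)` -/

section OpI

variable {M : Type*} [MeasurableSpace M] {μ : Measure M} {ω : M → ℝ}

variable (μ ω) in
/-- Multiplication by `exp(-tω)`. -/
def eOp (t : ℝ) : OneBoson μ →L[ℂ] OneBoson μ := mulOp μ fun k => Real.exp (-t * ω k)

variable (μ ω) in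
/-- Multiplication by `√(1 - exp(-2tω))`. -/
def rOp (t : ℝ) : OneBoson μ →L[ℂ] OneBoson μ :=
  mulOp μ fun k => Real.sqrt (1 - Real.exp (-t * ω k) ^ 2)

theorem exp_neg_mul_le_one {t : ℝ} (ht : 0 ≤ t) {a : ℝ} (ha : 0 ≤ a) : Real.exp (-t * a) ≤ 1 := by
  rw [Real.exp_le_one_iff]
  nlinarith [mul_nonneg ht ha]

theorem bddMul_exp (hω : Measurable ω) (hω_nonneg : ∀ k, 0 ≤ ω k) {t : ℝ} (ht : 0 ≤ t) :
    BddMul fun k => Real.exp (-t * ω k) :=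
  ⟨by fun_prop, 1, fun k => by
    rw [abs_of_pos (Real.exp_pos _)]
    exact exp_neg_mul_le_one ht (hω_nonneg k)⟩

theorem bddMul_sqrt (hω : Measurable ω) (t : ℝ) :
    BddMul fun k => Real.sqrt (1 - Real.exp (-t * ω k) ^ 2) :=
  ⟨by fun_prop, 1, fun k => by
    rw [abs_of_nonneg (Real.sqrt_nonneg _)]
    refine Real.sqrt_le_one.2 ?_
    nlinarith [sq_nonneg (Real.exp (-t * ω k))]⟩

theorem eOp_sq_add_rOp_sq (hω : Measurable ω) (hω_nonneg : ∀ k, 0 ≤ ω k) {t : ℝ} (ht : 0 ≤ t)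
    (f : OneBoson μ) : eOp μ ω t (eOp μ ω t f) + rOp μ ω t (rOp μ ω t f) = f := by
  have he := bddMul_exp hω hω_nonneg ht
  have hr := bddMul_sqrt hω t
  rw [eOp, rOp, mulOp_mul he he, mulOp_mul hr hr, mulOp_add (he.mul he) (hr.mul hr)]
  symm
  refine eq_mulOp ((he.mul he).add (hr.mul hr)) (ae_of_all _ fun k => ?_)
  have h1 : Real.exp (-t * ω k) * Real.exp (-t * ω k) +
      Real.sqrt (1 - Real.exp (-t * ω k) ^ 2) * Real.sqrt (1 - Real.exp (-t * ω k) ^ 2) = 1 := by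
    rw [Real.mul_self_sqrt]
    · ring
    · have := exp_neg_mul_le_one ht (hω_nonneg k)
      nlinarith [Real.exp_pos (-t * ω k)]
  simp only [h1, Complex.ofReal_one, one_mul]

theorem eOp_add (hω : Measurable ω) (hω_nonneg : ∀ k, 0 ≤ ω k) {s t : ℝ} (hs : 0 ≤ s)
    (ht : 0 ≤ t) (f : OneBoson μ) : eOp μ ω s (eOp μ ω t f) = eOp μ ω (s + t) f := by
  rw [eOp, eOp, eOp, mulOp_mul (bddMul_exp hω hω_nonneg hs) (bddMul_exp hω hω_nonneg ht)]
  congr 1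
  congr 1
  funext k
  rw [← Real.exp_add]
  congr 1
  ring

theorem eOp_zero (f : OneBoson μ) : eOp μ ω 0 f = f := by
  simp [eOp, mulOp_const]

theorem toL2_exp_mul (hω : Measurable ω) (hω_nonneg : ∀ k, 0 ≤ ω k) {t : ℝ} (ht : 0 ≤ t)
    (g : OneBoson μ) : (toL2 μ fun k => (Real.exp (-t * ω k) : ℂ) * g k) = eOp μ ω t g :=
  toL2_eq_mulOp (bddMul_exp hω hω_nonneg ht) (EventuallyEq.refl _ _)

variable [SigmaFinite μ]

theorem exists_clm_exp (hω : Measurable ω) (hω_nonneg : ∀ k, 0 ≤ ω k) {t : ℝ} (ht : 0 ≤ t) (c : ℂ)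
    {a b h : OneBoson μ} (hab : a + eOp μ ω t b = rOp μ ω t h) :
    ∃ T : Fock μ →L[ℂ] Fock μ,
      (∀ g, T (expVec g) = Complex.exp (c - ⟪a, g⟫_ℂ) • expVec (eOp μ ω t g - b)) ∧
      ‖T‖ ≤ Real.exp (c.re + ‖b‖ ^ 2 / 2 + ‖h‖ ^ 2 / 2) :=
  exists_clm_affine (fun f g => inner_mulOp_left (bddMul_exp hω hω_nonneg ht) f g)
    (fun f g => inner_mulOp_left (bddMul_sqrt hω t) f g)
    (eOp_sq_add_rOp_sq hω hω_nonneg ht) c hab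

/-- Writing the form factor as √(1 - e^{-2tω}) h is what makes I_t bounded: this is the affine
criterion with b = 0, and ‖h‖ controls the norm. -/
theorem opI_expVec_and_norm (hω : Measurable ω) (hω_nonneg : ∀ k, 0 ≤ ω k) {t : ℝ} (ht : 0 ≤ t)
    (h : OneBoson μ) :
    (∀ g, opI t ω (rOp μ ω t h) (expVec g) =
      Complex.exp (-⟪rOp μ ω t h, g⟫_ℂ) • expVec (eOp μ ω t g)) ∧
    ‖opI t ω (rOp μ ω t h)‖ ≤ Real.exp (‖h‖ ^ 2 / 2) := by
  obtain ⟨T, hT, hn⟩ := exists_clm_exp hω hω_nonneg ht 0 (a := rOp μ ω t h) (b := 0) (h := h)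
    (by simp)
  simp only [zero_sub, sub_zero] at hT
  have hT' : ∀ g, T (expVec g) = Complex.exp (-⟪rOp μ ω t h, g⟫_ℂ) •
      expVec (toL2 μ fun k => (Real.exp (-t * ω k) : ℂ) * g k) := by
    intro g
    rw [hT, toL2_exp_mul hω hω_nonneg ht]
  have h1 : opI t ω (rOp μ ω t h) = T := extendExp_eq hT'
  rw [h1]
  refine ⟨hT, hn.trans_eq ?_⟩
  simp

theorem adjoint_opI_expVec (hω : Measurable ω) (hω_nonneg : ∀ k, 0 ≤ ω k) {t : ℝ} (ht : 0 ≤ t)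
    (h g : OneBoson μ) :
    ContinuousLinearMap.adjoint (opI t ω (rOp μ ω t h)) (expVec g) =
      expVec (eOp μ ω t g - rOp μ ω t h) := by
  refine ext_inner_expVec fun f => ?_
  rw [ContinuousLinearMap.adjoint_inner_right, (opI_expVec_and_norm hω hω_nonneg ht h).1,
    inner_smul_left, inner_expVec, inner_expVec, ← Complex.exp_conj, ← Complex.exp_add,
    inner_sub_right, map_neg, inner_conj_symm, eOp,
    inner_mulOp_left (bddMul_exp hω hω_nonneg ht)]
  congr 1
  ring

/-- On the span of the exponential vectors, h' + z̄ k enters only through scalars exp(-⟨·, g⟩), so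
the operator applied to a fixed vector is entire in z; the conjugate compensates the antilinear
slot. The growth bound in ‖h‖ then yields the Lipschitz bound through `norm_sub_le_of_entire`. -/
theorem norm_opI_sub_le (hω : Measurable ω) (hω_nonneg : ∀ k, 0 ≤ ω k) {t : ℝ} (ht : 0 ≤ t)
    (h h' : OneBoson μ) :
    ‖opI t ω (rOp μ ω t h) - opI t ω (rOp μ ω t h')‖ ≤
      Real.exp ((‖h'‖ + ‖h - h'‖ + 1) ^ 2 / 2) * ‖h - h'‖ := by
  by_cases hh : h = h'
  · refine (ContinuousLinearMap.opNorm_le_bound _ le_rfl fun ψ => ?_).trans (by positivity)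
    rw [hh, sub_self]
    simp
  set k := h - h' with hk
  have hpos : 0 < ‖k‖ := norm_pos_iff.2 (sub_ne_zero.2 hh)
  refine ContinuousLinearMap.opNorm_le_bound _ (by positivity) fun ψ => ?_
  revert ψ
  refine fun ψ => dense_span_expVec.induction (P := fun ψ =>
    ‖(opI t ω (rOp μ ω t h) - opI t ω (rOp μ ω t h')) ψ‖ ≤
      Real.exp ((‖h'‖ + ‖k‖ + 1) ^ 2 / 2) * ‖k‖ * ‖ψ‖) (fun ψ hψ => ?_)
    (isClosed_le (by fun_prop) (by fun_prop)) ψ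
  have hd : Differentiable ℂ fun z : ℂ => opI t ω (rOp μ ω t (h' + starRingEnd ℂ z • k)) ψ := by
    refine Submodule.span_induction (p := fun ψ _ => Differentiable ℂ fun z : ℂ =>
      opI t ω (rOp μ ω t (h' + starRingEnd ℂ z • k)) ψ) ?_ ?_ ?_ ?_ hψ
    · rintro _ ⟨g, rfl⟩
      simp_rw [(opI_expVec_and_norm hω hω_nonneg ht _).1, map_add, map_smul, inner_add_left,
        inner_smul_left, Complex.conj_conj]
      fun_prop
    · simp
    · intro x y _ _ hx hy
      have e : (fun z : ℂ => opI t ω (rOp μ ω t (h' + starRingEnd ℂ z • k)) (x + y)) = fun z =>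
          opI t ω (rOp μ ω t (h' + starRingEnd ℂ z • k)) x +
            opI t ω (rOp μ ω t (h' + starRingEnd ℂ z • k)) y :=
        funext fun z => ContinuousLinearMap.map_add _ _ _
      rw [e]
      exact hx.fun_add hy
    · intro c x _ hx
      have e : (fun z : ℂ => opI t ω (rOp μ ω t (h' + starRingEnd ℂ z • k)) (c • x)) = fun z =>
          c • opI t ω (rOp μ ω t (h' + starRingEnd ℂ z • k)) x :=
        funext fun z => ContinuousLinearMap.map_smul _ _ _
      rw [e]
      exact hx.fun_const_smul c
  have h1 := norm_sub_le_of_entire hd hpos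
    (Φ := Real.exp ((‖h'‖ + ‖k‖ + 1) ^ 2 / 2) * ‖ψ‖) (fun z hz => ?_)
  · simp only [map_one, one_smul, map_zero, zero_smul, add_zero] at h1
    rw [show h' + k = h by rw [hk]; abel] at h1
    rw [_root_.sub_apply]
    refine h1.trans_eq ?_
    ring
  · refine (ContinuousLinearMap.le_opNorm _ _).trans
      (mul_le_mul_of_nonneg_right ?_ (norm_nonneg _))
    refine (opI_expVec_and_norm hω hω_nonneg ht _).2.trans (Real.exp_le_exp.2 ?_)
    refine div_le_div_of_nonneg_right (pow_le_pow_left₀ (norm_nonneg _) ?_ 2) zero_le_two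
    refine (norm_add_le _ _).trans ?_
    rw [norm_smul, RCLike.norm_conj, add_assoc]
    refine add_le_add le_rfl ((mul_le_mul_of_nonneg_right hz hpos.le).trans_eq ?_)
    field_simp

end OpI

/-! ### Contraction semigroups and their generators -/

section SemigroupTheory

variable {E : Type*} [NormedAddCommGroup E]

/-- Contraction semigroups. -/
structure IsContractionSemigroup [NormedSpace ℂ E] (T : ℝ≥0 → E →L[ℂ] E) : Prop
    extends IsStronglyContinuousSemigroup T where
  norm_le : ∀ t, ‖T t‖ ≤ 1

/-- `ψ` lies in the domain of the generator of `T` and is mapped to `η`. -/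
def GenRel [NormedSpace ℂ E] (T : ℝ≥0 → E →L[ℂ] E) (ψ η : E) : Prop :=
  Tendsto (fun t : ℝ≥0 => ((t : ℝ)⁻¹ : ℂ) • (ψ - T t ψ)) (𝓝[>] 0) (𝓝 η)

/-- The integrals `∫₀ᵗ Tₛ ψ ds`. -/
def semigroupIntegral [NormedSpace ℂ E] (T : ℝ≥0 → E →L[ℂ] E) (t : ℝ) (ψ : E) : E :=
  ∫ s in (0 : ℝ)..t, T s.toNNReal ψ

section NormedSpace

variable [NormedSpace ℂ E] {T : ℝ≥0 → E →L[ℂ] E}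

theorem IsContractionSemigroup.norm_apply_le (hT : IsContractionSemigroup T) (t : ℝ≥0) (ψ : E) :
    ‖T t ψ‖ ≤ ‖ψ‖ :=
  ((T t).le_of_opNorm_le (hT.norm_le t) ψ).trans_eq (one_mul _)

theorem isContractionSemigroup_of_tendsto (h0 : T 0 = 1) (hadd : ∀ s t, T (s + t) = T s * T t)
    (hn : ∀ t, ‖T t‖ ≤ 1) {D : Set E} (hD : Dense (Submodule.span ℂ D : Set E))
    (hc : ∀ ψ ∈ D, Tendsto (fun t => T t ψ) (𝓝 0) (𝓝 ψ)) : IsContractionSemigroup T := by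
  have hn' : ∀ t ψ, ‖T t ψ‖ ≤ ‖ψ‖ := fun t ψ =>
    ((T t).le_of_opNorm_le (hn t) ψ).trans_eq (one_mul _)
  have hspan : ∀ ψ ∈ Submodule.span ℂ D, Tendsto (fun t => T t ψ) (𝓝 0) (𝓝 ψ) := by
    intro ψ hψ
    induction hψ using Submodule.span_induction with
    | mem x hx => exact hc x hx
    | zero => simp
    | add x y _ _ hx hy => simpa using hx.add hy
    | smul c x _ hx => simpa using hx.const_smul c
  have hall : ∀ ψ, Tendsto (fun t => T t ψ) (𝓝 0) (𝓝 ψ) := by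
    intro ψ
    rw [Metric.tendsto_nhds]
    intro ε hε
    obtain ⟨φ, hφ, hd⟩ := Metric.dense_iff.1 hD ψ (ε / 3) (by positivity)
    rw [Metric.mem_ball, dist_eq_norm] at hφ
    filter_upwards [Metric.tendsto_nhds.1 (hspan φ hd) (ε / 3) (by positivity)] with t ht
    rw [dist_eq_norm] at ht ⊢
    have h1 : T t ψ - ψ = (T t φ - φ) - T t (φ - ψ) + (φ - ψ) := by
      rw [map_sub]
      abel
    have h2 := hn' t (φ - ψ)
    calc ‖T t ψ - ψ‖ ≤ ‖T t φ - φ‖ + ‖T t (φ - ψ)‖ + ‖φ - ψ‖ := by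
          rw [h1]
          exact (norm_add_le _ _).trans (add_le_add (norm_sub_le _ _) le_rfl)
      _ < ε := by linarith
  refine ⟨⟨h0, hadd, fun ψ => ?_⟩, hn⟩
  have hle : ∀ s t : ℝ≥0, s ≤ t → ‖T t ψ - T s ψ‖ ≤ ‖T (t - s) ψ - ψ‖ := by
    intro s t hst
    have : T t = T s * T (t - s) := by rw [← hadd, add_tsub_cancel_of_le hst]
    rw [this, mul_apply_eq_comp, ← map_sub]
    exact hn' _ _
  rw [continuous_iff_continuousAt]
  intro s
  rw [ContinuousAt, tendsto_iff_norm_sub_tendsto_zero]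
  have hlim : Tendsto (fun t => (t - s) + (s - t)) (𝓝 s) (𝓝 (0 : ℝ≥0)) := by
    have : Continuous fun t : ℝ≥0 => (t - s) + (s - t) := by fun_prop
    simpa using this.tendsto s
  have h3 := (tendsto_iff_norm_sub_tendsto_zero.1 (hall ψ)).comp hlim
  refine squeeze_zero (fun _ => norm_nonneg _) (fun t => ?_) h3
  rcases le_total s t with h | h
  · simpa [tsub_eq_zero_of_le h] using hle s t h
  · rw [norm_sub_rev]
    simpa [tsub_eq_zero_of_le h] using hle t s h

theorem GenRel.add {ψ η ψ' η' : E} (h : GenRel T ψ η) (h' : GenRel T ψ' η') :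
    GenRel T (ψ + ψ') (η + η') := by
  refine (Tendsto.add h h').congr fun t => ?_
  rw [map_add, ← smul_add]
  congr 1
  abel

theorem GenRel.smul {ψ η : E} (c : ℂ) (h : GenRel T ψ η) : GenRel T (c • ψ) (c • η) := by
  refine (Tendsto.const_smul h c).congr fun t => ?_
  rw [map_smul, ← smul_sub, smul_comm]

theorem GenRel.unique {ψ η η' : E} (h : GenRel T ψ η) (h' : GenRel T ψ η') : η = η' :=
  tendsto_nhds_unique h h'

theorem tendsto_coe_nhdsGT_zero : Tendsto (fun t : ℝ≥0 => (t : ℝ)) (𝓝[>] 0) (𝓝[≠] 0) := by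
  refine tendsto_nhdsWithin_iff.2 ⟨?_, ?_⟩
  · exact (NNReal.continuous_coe.tendsto 0).mono_left nhdsWithin_le_nhds
  · filter_upwards [self_mem_nhdsWithin] with t ht
    simpa using (ne_of_gt ht : t ≠ 0)

theorem IsContractionSemigroup.continuous_real (hT : IsContractionSemigroup T) (ψ : E) :
    Continuous fun s : ℝ => T s.toNNReal ψ :=
  (hT.continuous ψ).comp continuous_real_toNNReal

/-- `GenRel` provides only a right derivative of s ↦ -T_s ψ, namely T_s η; continuity makes the
one-sided fundamental theorem of calculus sufficient. -/
theorem GenRel.sub_eq_integral [CompleteSpace E] (hT : IsContractionSemigroup T) {ψ η : E}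
    (h : GenRel T ψ η) (t : ℝ≥0) : ψ - T t ψ = semigroupIntegral T t η := by
  have h1 := intervalIntegral.integral_eq_sub_of_hasDeriv_right (a := 0) (b := (t : ℝ))
    (f := fun s : ℝ => -T s.toNNReal ψ) (f' := fun s : ℝ => T s.toNNReal η)
    (hT.continuous_real ψ).neg.continuousOn (fun s hs => ?_)
    ((hT.continuous_real η).intervalIntegrable _ _)
  · rw [semigroupIntegral, h1]
    simp [hT.zero]
    abel
  · rw [min_eq_left t.coe_nonneg] at hs
    rw [hasDerivWithinAt_iff_tendsto_slope' self_notMem_Ioi]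
    have h2 := ((T s.toNNReal).continuous.tendsto _).comp h
    have h3 : Tendsto (fun r : ℝ => (r - s).toNNReal) (𝓝[>] s) (𝓝[>] 0) := by
      refine tendsto_nhdsWithin_iff.2 ⟨?_, ?_⟩
      · have : Continuous fun r : ℝ => (r - s).toNNReal := by fun_prop
        have := this.tendsto s
        simp only [sub_self, Real.toNNReal_zero] at this
        exact this.mono_left nhdsWithin_le_nhds
      · filter_upwards [self_mem_nhdsWithin] with r hr
        exact Real.toNNReal_pos.2 (sub_pos.2 hr)
    refine (h2.comp h3).congr' ?_
    filter_upwards [self_mem_nhdsWithin] with r hr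
    have hr' : s < r := hr
    have h4 : r.toNNReal = s.toNNReal + (r - s).toNNReal := by
      rw [← Real.toNNReal_add hs.1.le (sub_nonneg.2 hr'.le)]
      congr 1
      ring
    rw [Function.comp_apply, Function.comp_apply, map_smul, map_sub, slope_def_module,
      Real.coe_toNNReal _ (sub_nonneg.2 hr'.le), h4, hT.add, mul_apply_eq_comp,
      ← Complex.ofReal_inv, Complex.coe_smul]
    congr 1
    abel

theorem tendsto_semigroupIntegral [CompleteSpace E] (hT : IsContractionSemigroup T) (η : E) :
    Tendsto (fun t : ℝ≥0 => ((t : ℝ)⁻¹ : ℂ) • semigroupIntegral T t η) (𝓝[>] 0) (𝓝 η) := by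
  have hc := hT.continuous_real η
  have h1 := intervalIntegral.integral_hasDerivAt_right (a := 0) (b := 0)
    (hc.intervalIntegrable _ _) (hc.stronglyMeasurableAtFilter _ _) hc.continuousAt
  have h2 := (hasDerivAt_iff_tendsto_slope_zero.1 h1).comp tendsto_coe_nhdsGT_zero
  simp only [Real.toNNReal_zero, hT.zero, one_apply_eq_self] at h2
  refine h2.congr fun t => ?_
  simp only [Function.comp_apply, zero_add, intervalIntegral.integral_same, sub_zero]
  rw [← Complex.ofReal_inv, Complex.coe_smul]
  rfl

theorem genRel_of_sub_eq_integral [CompleteSpace E] (hT : IsContractionSemigroup T) {ψ η : E}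
    (h : ∀ t : ℝ≥0, ψ - T t ψ = semigroupIntegral T t η) : GenRel T ψ η :=
  (tendsto_semigroupIntegral hT η).congr fun t => by rw [h]

theorem continuous_semigroupIntegral (hT : IsContractionSemigroup T) (t : ℝ≥0) :
    Continuous (semigroupIntegral T t) := by
  refine LipschitzWith.continuous (K := t) (LipschitzWith.of_dist_le_mul fun ψ φ => ?_)
  rw [dist_eq_norm, dist_eq_norm, semigroupIntegral, semigroupIntegral,
    ← intervalIntegral.integral_sub ((hT.continuous_real ψ).intervalIntegrable _ _)
      ((hT.continuous_real φ).intervalIntegrable _ _)]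
  refine (intervalIntegral.norm_integral_le_of_norm_le_const (C := ‖ψ - φ‖) fun s _ => ?_).trans_eq
    ?_
  · rw [← map_sub]
    exact hT.norm_apply_le _ _
  · rw [sub_zero, abs_of_nonneg t.coe_nonneg, mul_comm]

/-- The difference quotients are replaced by the integrated identities ψ - T_t ψ = ∫₀ᵗ T_s η ds,
each of which is a closed condition on (ψ, η). -/
theorem isClosed_genRel [CompleteSpace E] (hT : IsContractionSemigroup T) :
    IsClosed {p : E × E | GenRel T p.1 p.2} := by
  have : {p : E × E | GenRel T p.1 p.2} =
      ⋂ t : ℝ≥0, {p : E × E | p.1 - T t p.1 = semigroupIntegral T t p.2} := by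
    ext p
    simp only [mem_ofPred_eq, mem_iInter]
    exact ⟨fun h => h.sub_eq_integral hT, genRel_of_sub_eq_integral hT⟩
  rw [this]
  refine isClosed_iInter fun t => isClosed_eq (by fun_prop) ?_
  exact (continuous_semigroupIntegral hT t).comp continuous_snd

theorem genRel_semigroupIntegral [CompleteSpace E] (hT : IsContractionSemigroup T) (ψ : E)
    (t : ℝ≥0) : GenRel T (semigroupIntegral T t ψ) (ψ - T t ψ) := by
  refine genRel_of_sub_eq_integral hT fun h => ?_
  have hi : ∀ a b, IntervalIntegrable (fun s : ℝ => T s.toNNReal ψ) volume a b := fun a b =>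
    (hT.continuous_real ψ).intervalIntegrable a b
  have shift : ∀ r u : ℝ≥0, T u (semigroupIntegral T r ψ) =
      ∫ s in (u : ℝ)..(r + u : ℝ≥0), T s.toNNReal ψ := by
    intro r u
    rw [semigroupIntegral, ← ContinuousLinearMap.intervalIntegral_comp_comm _ (hi _ _)]
    have := intervalIntegral.integral_comp_add_right (a := 0) (b := (r : ℝ))
      (fun s : ℝ => T s.toNNReal ψ) (u : ℝ)
    rw [zero_add] at this
    rw [NNReal.coe_add, ← this]
    refine intervalIntegral.integral_congr fun s hs => ?_
    rw [uIcc_of_le r.coe_nonneg] at hs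
    rw [Real.toNNReal_add hs.1 u.coe_nonneg, Real.toNNReal_coe, add_comm, hT.add,
      mul_apply_eq_comp]
  have h2 : semigroupIntegral T h (ψ - T t ψ) =
      semigroupIntegral T h ψ - T t (semigroupIntegral T h ψ) := by
    have hi' : IntervalIntegrable (fun s : ℝ => T t (T s.toNNReal ψ)) volume 0 h :=
      ((T t).continuous.comp (hT.continuous_real ψ)).intervalIntegrable _ _
    rw [semigroupIntegral, semigroupIntegral,
      ← ContinuousLinearMap.intervalIntegral_comp_comm _ (hi _ _),
      ← intervalIntegral.integral_sub (hi _ _) hi']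
    refine intervalIntegral.integral_congr fun s _ => ?_
    rw [map_sub, ← mul_apply_eq_comp, ← mul_apply_eq_comp, ← hT.add,
      ← hT.add, add_comm]
  rw [h2, shift, shift, add_comm t h, semigroupIntegral, semigroupIntegral]
  have e1 := intervalIntegral.integral_add_adjacent_intervals (hi 0 t) (hi t (h + t : ℝ≥0))
  have e2 := intervalIntegral.integral_add_adjacent_intervals (hi 0 h) (hi h (h + t : ℝ≥0))
  rw [sub_eq_sub_iff_add_eq_add, e1, e2]

/-- An invariant subspace of the graph of the generator whose domain is dense is dense in
the graph. -/
theorem genRel_mem_closure [CompleteSpace E] (hT : IsContractionSemigroup T)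
    {D : Submodule ℂ (E × E)} (hD : ∀ p ∈ D, GenRel T p.1 p.2)
    (hinv : ∀ p ∈ D, ∀ t, (T t p.1, T t p.2) ∈ D) (hdense : Dense (Prod.fst '' (D : Set (E × E))))
    {ψ η : E} (h : GenRel T ψ η) : (ψ, η) ∈ closure (D : Set (E × E)) := by
  rw [← Submodule.topologicalClosure_coe]
  set C := D.topologicalClosure with hC
  have hCc : IsClosed (C : Set (E × E)) := D.isClosed_topologicalClosure
  -- The integral of the orbit of p stays in C, because after rescaling to the unit interval it is t
  -- times an average over a closed convex set containing the orbit.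
  have step1 : ∀ p ∈ D, ∀ t : ℝ≥0, (semigroupIntegral T t p.1, p.1 - T t p.1) ∈ C := by
    intro p hp t
    rw [(hD p hp).sub_eq_integral hT]
    let F : ℝ → E × E := fun s => (T s.toNNReal p.1, T s.toNNReal p.2)
    have hF : Continuous F := (hT.continuous_real p.1).prodMk (hT.continuous_real p.2)
    have e1 : (semigroupIntegral T t p.1, semigroupIntegral T t p.2) = ∫ s in (0 : ℝ)..t, F s := by
      refine Prod.ext ?_ ?_
      · exact (ContinuousLinearMap.fst ℂ E E).intervalIntegral_comp_comm
          (hF.intervalIntegrable _ _)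
      · exact (ContinuousLinearMap.snd ℂ E E).intervalIntegral_comp_comm
          (hF.intervalIntegrable _ _)
    have e2 := intervalIntegral.smul_integral_comp_mul_left (a := 0) (b := 1) F (t : ℝ)
    rw [mul_zero, mul_one] at e2
    rw [e1, ← e2, intervalIntegral.integral_of_le zero_le_one, ← Complex.coe_smul]
    refine C.smul_mem _ ?_
    have : IsProbabilityMeasure ((volume : Measure ℝ).restrict (Ioc 0 1)) := ⟨by simp⟩
    have hconv : Convex ℝ (C : Set (E × E)) := (C.restrictScalars ℝ).convex
    refine hconv.integral_mem hCc (ae_of_all _ fun s => ?_)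
      (((hF.comp (continuous_const_mul (t : ℝ))).integrableOn_Ioc))
    exact D.le_topologicalClosure (hinv p hp _)
  have step2 : ∀ φ, ∀ t : ℝ≥0, (semigroupIntegral T t φ, φ - T t φ) ∈ C := by
    intro φ t
    have hcl : IsClosed {φ | (semigroupIntegral T t φ, φ - T t φ) ∈ C} :=
      hCc.preimage ((continuous_semigroupIntegral hT t).prodMk
        (continuous_id.sub (T t).continuous))
    have : closure (Prod.fst '' (D : Set (E × E))) ⊆
        {φ | (semigroupIntegral T t φ, φ - T t φ) ∈ C} := by
      refine closure_minimal ?_ hcl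
      rintro _ ⟨p, hp, rfl⟩
      exact step1 p hp t
    exact this (hdense φ)
  -- The pairs t⁻¹ (∫₀ᵗ T_s ψ ds, ψ - T_t ψ) lie in C and converge to (ψ, η).
  refine hCc.mem_of_tendsto ((tendsto_semigroupIntegral hT ψ).prodMk_nhds h)
    (Eventually.of_forall fun t => ?_)
  exact C.smul_mem ((t : ℝ)⁻¹ : ℂ) (step2 ψ t)

end NormedSpace

/-! ### Symmetric contraction semigroups and selfadjointness -/

section Hilbert

variable [InnerProductSpace ℂ E] [CompleteSpace E] {T : ℝ≥0 → E →L[ℂ] E}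

theorem inner_semigroupIntegral (hT : IsContractionSemigroup T)
    (hs : ∀ t φ ψ, ⟪T t φ, ψ⟫_ℂ = ⟪φ, T t ψ⟫_ℂ) (t : ℝ) (φ ψ : E) :
    ⟪semigroupIntegral T t φ, ψ⟫_ℂ = ⟪φ, semigroupIntegral T t ψ⟫_ℂ := by
  have h : ∀ φ ψ : E, ⟪φ, semigroupIntegral T t ψ⟫_ℂ =
      ∫ s in (0 : ℝ)..t, ⟪φ, T s.toNNReal ψ⟫_ℂ := fun φ ψ =>
    ((innerSL ℂ φ).intervalIntegral_comp_comm
      ((hT.continuous_real ψ).intervalIntegrable _ _)).symm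
  have hc : IntervalIntegrable (fun s : ℝ => ⟪ψ, T s.toNNReal φ⟫_ℂ) volume 0 t :=
    ((innerSL ℂ ψ).continuous.comp (hT.continuous_real φ)).intervalIntegrable _ _
  rw [← inner_conj_symm, h, h]
  refine (Complex.conjCLE.toContinuousLinearMap.intervalIntegral_comp_comm hc).symm.trans ?_
  refine intervalIntegral.integral_congr fun s _ => ?_
  exact (inner_conj_symm _ _).trans (hs _ _ _)

/-- A bounded symmetric perturbation of the generator of a symmetric contraction semigroup is
selfadjoint. -/
theorem isSelfAdjoint_of_genRel (hT : IsContractionSemigroup T)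
    (hs : ∀ t φ ψ, ⟪T t φ, ψ⟫_ℂ = ⟪φ, T t ψ⟫_ℂ) {B : E →L[ℂ] E}
    (hB : ∀ φ ψ, ⟪B φ, ψ⟫_ℂ = ⟪φ, B ψ⟫_ℂ) {H : E →ₗ.[ℂ] E}
    (hH : ∀ ψ η, (ψ, η) ∈ H.graph ↔ GenRel T ψ (η - B ψ)) : IsSelfAdjoint H := by
  have hgen : ∀ {ψ η}, GenRel T ψ η → (ψ, η + B ψ) ∈ H.graph := by
    intro ψ η h
    rwa [hH, add_sub_cancel_right]
  have hdense : Dense (H.domain : Set E) := by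
    intro ψ
    refine mem_closure_of_tendsto (tendsto_semigroupIntegral hT ψ)
      (Eventually.of_forall fun t => ?_)
    exact H.domain.smul_mem _ (LinearPMap.mem_domain_of_mem_graph
      (hgen (genRel_semigroupIntegral hT ψ t)))
  rw [LinearPMap.isSelfAdjoint_def]
  refine LinearPMap.eq_of_eq_graph ?_
  rw [LinearPMap.adjoint_graph_eq_graph_adjoint hdense]
  ext ⟨φ, ξ⟩
  rw [Submodule.mem_adjoint_iff]
  constructor
  -- An element of the adjoint domain is tested against the vectors ∫₀ᵗ T_s ψ ds, which lie in the
  -- domain for every ψ; symmetry moves T and the integral to the other side and yields the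
  -- integrated identity for φ.
  · intro h
    rw [hH]
    refine genRel_of_sub_eq_integral hT fun t => ext_inner_left ℂ fun ψ => ?_
    have h1 := h _ _ (hgen (genRel_semigroupIntegral hT ψ t))
    simp only at h1
    rw [inner_add_left, hB, inner_sub_left, hs] at h1
    rw [inner_sub_right, ← inner_semigroupIntegral hT hs, inner_sub_right]
    linear_combination h1
  · intro h a b hab
    rw [hH] at h hab
    have h1 : Tendsto (fun t : ℝ≥0 => ⟪((t : ℝ)⁻¹ : ℂ) • (a - T t a), φ⟫_ℂ) (𝓝[>] 0)
        (𝓝 ⟪b - B a, φ⟫_ℂ) := Tendsto.inner hab tendsto_const_nhds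
    have h2 : Tendsto (fun t : ℝ≥0 => ⟪a, ((t : ℝ)⁻¹ : ℂ) • (φ - T t φ)⟫_ℂ) (𝓝[>] 0)
        (𝓝 ⟪a, ξ - B φ⟫_ℂ) := Tendsto.inner tendsto_const_nhds h
    have h3 := tendsto_nhds_unique h1 (h2.congr fun t => ?_)
    · rw [inner_sub_left, inner_sub_right, hB] at h3
      simp only
      linear_combination h3
    · rw [inner_smul_left, inner_smul_right, inner_sub_left, inner_sub_right, hs, map_inv₀,
        Complex.conj_ofReal]

end Hilbert

end SemigroupTheory

/-! ### The semigroups of van Hove operators -/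

section VanHoveSemigroup

/-- `β_t(λ) = ∫₀ᵗ e^{-sλ} ds`. -/
def beta (t l : ℝ) : ℝ := ∫ s in (0 : ℝ)..t, Real.exp (-s * l)

theorem mul_beta (t l : ℝ) : l * beta t l = 1 - Real.exp (-t * l) := by
  rw [beta, ← intervalIntegral.integral_const_mul]
  have h := intervalIntegral.integral_eq_sub_of_hasDerivAt (a := 0) (b := t)
    (f := fun s => -Real.exp (-s * l)) (f' := fun s => l * Real.exp (-s * l)) (fun s _ => ?_)
    (Continuous.intervalIntegrable (by fun_prop) _ _)
  · rw [h]
    simp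
    ring
  · have h1 : HasDerivAt (fun s : ℝ => -s * l) (-1 * l) s := (hasDerivAt_neg s).mul_const l
    exact (h1.exp.fun_neg).congr_deriv (by ring)

theorem beta_zero_left (l : ℝ) : beta 0 l = 0 := by simp [beta]

theorem beta_zero_right (t : ℝ) : beta t 0 = t := by simp [beta]

theorem beta_nonneg {t : ℝ} (ht : 0 ≤ t) (l : ℝ) : 0 ≤ beta t l :=
  intervalIntegral.integral_nonneg ht fun _ _ => (Real.exp_pos _).le

theorem beta_le {t l : ℝ} (ht : 0 ≤ t) (hl : 0 ≤ l) : beta t l ≤ t := by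
  have h := intervalIntegral.integral_mono_on (μ := volume) (a := 0) (b := t)
    (f := fun s => Real.exp (-s * l)) (g := fun _ => 1) ht
    (Continuous.intervalIntegrable (by fun_prop) _ _)
    (Continuous.intervalIntegrable (by fun_prop) _ _) (fun s hs => exp_neg_mul_le_one hs.1 hl)
  simpa [beta] using h

theorem beta_mul_le_one (t l : ℝ) : l * beta t l ≤ 1 := by
  rw [mul_beta]
  linarith [Real.exp_pos (-t * l)]

theorem beta_add (s t l : ℝ) : beta (s + t) l = beta s l + Real.exp (-s * l) * beta t l := by
  by_cases hl : l = 0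
  · subst hl
    simp [beta_zero_right]
  · refine mul_left_cancel₀ hl ?_
    rw [mul_add, mul_left_comm, mul_beta, mul_beta, mul_beta,
      show -(s + t) * l = -s * l + -t * l by ring, Real.exp_add]
    ring

theorem measurable_beta (t : ℝ) : Measurable (beta t) := by
  have h : beta t = fun l => if l = 0 then t else (1 - Real.exp (-t * l)) / l := by
    funext l
    split_ifs with hl
    · rw [hl, beta_zero_right]
    · rw [← mul_beta, mul_div_cancel_left₀ _ hl]
  rw [h]
  exact Measurable.ite (measurableSet_singleton 0) measurable_const (by fun_prop)

theorem tendsto_beta_div {l : ℝ} :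
    Tendsto (fun t : ℝ≥0 => (t : ℝ)⁻¹ * beta t l) (𝓝[>] 0) (𝓝 1) := by
  have hc : Continuous fun s : ℝ => Real.exp (-s * l) := by fun_prop
  have h1 := intervalIntegral.integral_hasDerivAt_right (a := 0) (b := 0)
    (hc.intervalIntegrable _ _) (hc.stronglyMeasurableAtFilter _ _) hc.continuousAt
  have h2 := (hasDerivAt_iff_tendsto_slope_zero.1 h1).comp tendsto_coe_nhdsGT_zero
  simp only [neg_zero, zero_mul, Real.exp_zero] at h2
  refine h2.congr fun t => ?_
  simp [beta]

variable {M : Type*} [MeasurableSpace M] {μ : Measure M} {ω : M → ℝ}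

/-- The weight `√ω + ω`. -/
def rho (ω : M → ℝ) (k : M) : ℝ := Real.sqrt (ω k) + ω k

theorem rho_nonneg (hω_nonneg : ∀ k, 0 ≤ ω k) (k : M) : 0 ≤ rho ω k :=
  add_nonneg (Real.sqrt_nonneg _) (hω_nonneg k)

theorem measurable_rho (hω : Measurable ω) : Measurable (rho ω) := by
  unfold rho
  fun_prop

theorem rho_sq (hω_nonneg : ∀ k, 0 ≤ ω k) (k : M) :
    rho ω k ^ 2 = (1 + Real.sqrt (ω k)) ^ 2 * ω k := by
  have := Real.sq_sqrt (hω_nonneg k)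
  simp only [rho]
  linear_combination (1 - ω k) * this

/-- If `|m| ≤ min(t, 1/ω)` then `(√ω + ω) m` is bounded. -/
theorem rho_mul_abs_le (hω_nonneg : ∀ k, 0 ≤ ω k) {t : ℝ} {k : M} {m : ℝ}
    (h1 : |m| ≤ t) (h2 : ω k * |m| ≤ 1) : rho ω k * |m| ≤ Real.sqrt t + 1 := by
  have h3 : Real.sqrt (ω k) * |m| ≤ Real.sqrt t := by
    refine Real.le_sqrt_of_sq_le ?_
    rw [mul_pow, Real.sq_sqrt (hω_nonneg k)]
    nlinarith [abs_nonneg m]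
  rw [rho, add_mul]
  exact add_le_add h3 h2

/-- If `0 ≤ m ≤ min(t, 1/ω)` then `(1 + √ω)² m` is bounded. -/
theorem one_add_sqrt_sq_mul_le (hω_nonneg : ∀ k, 0 ≤ ω k) {k : M} {m t r : ℝ}
    (h0 : 0 ≤ m) (h1 : m ≤ t) (h2 : ω k * m ≤ r) :
    (1 + Real.sqrt (ω k)) ^ 2 * m ≤ 2 * (t + r) := by
  have h3 := Real.sq_sqrt (hω_nonneg k)
  nlinarith [sq_nonneg (1 - Real.sqrt (ω k)), mul_nonneg h0 (sq_nonneg (1 - Real.sqrt (ω k)))]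

/-- The vectors `exp(-⟨v, A v⟩ - ⟨a v, g⟩) ε(e^{-tω} g - b v)` for multiplication operators
`A`, `a`, `b`. -/
def affineExp [SigmaFinite μ] (ω : M → ℝ) (v : OneBoson μ) (t : ℝ) (A a b : M → ℝ)
    (g : OneBoson μ) : Fock μ :=
  Complex.exp (-⟪v, mulOp μ A v⟫_ℂ - ⟪mulOp μ a v, g⟫_ℂ) • expVec (eOp μ ω t g - mulOp μ b v)

variable [SigmaFinite μ]

/-- Composition of operators of the form `ε(g) ↦ affineExp ω v t A a b g`. -/
theorem affineExp_comp (hω : Measurable ω) (hω_nonneg : ∀ k, 0 ≤ ω k) {v : OneBoson μ} {s t : ℝ}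
    (hs : 0 ≤ s) (ht : 0 ≤ t) {A₁ a₁ b₁ A₂ a₂ b₂ A a b : M → ℝ} (hA₁ : BddMul A₁) (ha₁ : BddMul a₁)
    (hb₁ : BddMul b₁) (hA₂ : BddMul A₂) (ha₂ : BddMul a₂) (hb₂ : BddMul b₂)
    (hA : ∀ k, A k = A₁ k + A₂ k - a₁ k * b₂ k)
    (ha : ∀ k, a k = a₂ k + Real.exp (-t * ω k) * a₁ k)
    (hb : ∀ k, b k = b₁ k + Real.exp (-s * ω k) * b₂ k) {T : Fock μ →L[ℂ] Fock μ}
    (hT : ∀ g, T (expVec g) = affineExp ω v s A₁ a₁ b₁ g) (g : OneBoson μ) :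
    T (affineExp ω v t A₂ a₂ b₂ g) = affineExp ω v (s + t) A a b g := by
  have hes := bddMul_exp hω hω_nonneg hs
  have het := bddMul_exp hω hω_nonneg ht
  have eA : mulOp μ A v = mulOp μ A₁ v + mulOp μ A₂ v - mulOp μ a₁ (mulOp μ b₂ v) := by
    rw [mulOp_add hA₁ hA₂, mulOp_mul ha₁ hb₂, mulOp_sub (hA₁.add hA₂) (ha₁.mul hb₂)]
    congr 2
    exact funext hA
  have ea : mulOp μ a v = mulOp μ a₂ v + eOp μ ω t (mulOp μ a₁ v) := by
    rw [eOp, mulOp_mul het ha₁, mulOp_add ha₂ (het.mul ha₁)]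
    congr 2
    exact funext ha
  have eb : mulOp μ b v = mulOp μ b₁ v + eOp μ ω s (mulOp μ b₂ v) := by
    rw [eOp, mulOp_mul hes hb₂, mulOp_add hb₁ (hes.mul hb₂)]
    congr 2
    exact funext hb
  rw [affineExp, map_smul, hT, affineExp, affineExp, smul_smul, ← Complex.exp_add]
  congr 1
  · congr 1
    have h1 : ⟪eOp μ ω t (mulOp μ a₁ v), g⟫_ℂ = ⟪mulOp μ a₁ v, eOp μ ω t g⟫_ℂ :=
      inner_mulOp_left het _ _
    have h2 : ⟪mulOp μ a₁ v, mulOp μ b₂ v⟫_ℂ = ⟪v, mulOp μ a₁ (mulOp μ b₂ v)⟫_ℂ :=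
      inner_mulOp_left ha₁ _ _
    rw [eA, ea, inner_add_left, inner_sub_right, inner_sub_right, inner_add_right, h1, h2]
    ring
  · congr 1
    rw [map_sub, eOp_add hω hω_nonneg hs ht, eb]
    abel

/-- The multipliers of the van Hove semigroup. -/
def sMul (ω : M → ℝ) (x t : ℝ) (k : M) : ℝ := x * (rho ω k * beta t (ω k))

/-- The multipliers of the exponents of the van Hove semigroup. -/
def cMul (ω : M → ℝ) (t : ℝ) (k : M) : ℝ := (1 + Real.sqrt (ω k)) ^ 2 * beta t (ω k)

theorem abs_sMul_le (hω_nonneg : ∀ k, 0 ≤ ω k) {x : ℝ} (hx : x ^ 2 = 1) {t : ℝ} (ht : 0 ≤ t)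
    (k : M) : |sMul ω x t k| ≤ Real.sqrt t + 1 := by
  have hx' : |x| = 1 := by
    rw [← sq_eq_sq₀ (abs_nonneg x) zero_le_one, sq_abs, hx, one_pow]
  have hb := beta_nonneg ht (ω k)
  rw [sMul, abs_mul, hx', one_mul, abs_mul, abs_of_nonneg (rho_nonneg hω_nonneg k)]
  refine rho_mul_abs_le hω_nonneg ?_ ?_
  · rw [abs_of_nonneg hb]
    exact beta_le ht (hω_nonneg k)
  · rw [abs_of_nonneg hb]
    exact beta_mul_le_one t _

theorem bddMul_sMul (hω : Measurable ω) (hω_nonneg : ∀ k, 0 ≤ ω k) {x : ℝ} (hx : x ^ 2 = 1)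
    {t : ℝ} (ht : 0 ≤ t) : BddMul (sMul ω x t) :=
  ⟨((measurable_rho hω).mul ((measurable_beta t).comp hω)).const_mul x, _,
    abs_sMul_le hω_nonneg hx ht⟩

theorem cMul_nonneg {t : ℝ} (ht : 0 ≤ t) (k : M) : 0 ≤ cMul ω t k :=
  mul_nonneg (sq_nonneg _) (beta_nonneg ht _)

theorem abs_cMul_le (hω_nonneg : ∀ k, 0 ≤ ω k) {t : ℝ} (ht : 0 ≤ t) (k : M) :
    |cMul ω t k| ≤ 2 * (t + 1) := by
  rw [abs_of_nonneg (cMul_nonneg ht k)]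
  exact one_add_sqrt_sq_mul_le hω_nonneg (beta_nonneg ht _) (beta_le ht (hω_nonneg k))
    (beta_mul_le_one t _)

theorem bddMul_cMul (hω : Measurable ω) (hω_nonneg : ∀ k, 0 ≤ ω k) {t : ℝ} (ht : 0 ≤ t) :
    BddMul (cMul ω t) := by
  refine ⟨?_, _, abs_cMul_le hω_nonneg ht⟩
  have h1 := (measurable_beta t).comp hω
  have h2 : Measurable fun k => (1 + Real.sqrt (ω k)) ^ 2 := by fun_prop
  exact h2.mul h1

/-- The vector `h` with `(1 + e^{-tω}) a = √(1 - e^{-2tω}) h` for the multiplier `a = sMul ω x t`. -/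
def hMul (ω : M → ℝ) (x t : ℝ) (k : M) : ℝ :=
  x * (Real.sqrt (1 - Real.exp (-t * ω k) ^ 2) * (rho ω k / ω k))

theorem one_sub_exp_sq_nonneg {t l : ℝ} (ht : 0 ≤ t) (hl : 0 ≤ l) :
    0 ≤ 1 - Real.exp (-t * l) ^ 2 := by
  have := exp_neg_mul_le_one ht hl
  nlinarith [Real.exp_pos (-t * l)]

/-- Since ρ/ω = ω^{-1/2} + 1, the first summand is handled by 1 - e^{-2tω} ≤ 2tω and the second by 1
- e^{-2tω} ≤ 1. Where ω = 0 the quotient is 0 by convention. -/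
theorem sqrt_mul_rho_div_le (hω_nonneg : ∀ k, 0 ≤ ω k) (t : ℝ) (k : M) :
    Real.sqrt (1 - Real.exp (-t * ω k) ^ 2) * (rho ω k / ω k) ≤ Real.sqrt (2 * t) + 1 := by
  rcases (hω_nonneg k).eq_or_lt with h0 | hpos
  · rw [← h0, div_zero, mul_zero]
    positivity
  · have h1 : 1 - Real.exp (-t * ω k) ^ 2 ≤ 2 * t * ω k := by
      have := Real.add_one_le_exp (-t * ω k + -t * ω k)
      rw [Real.exp_add] at this
      nlinarith
    have hs : 0 < Real.sqrt (ω k) := Real.sqrt_pos.2 hpos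
    have h2 : rho ω k / ω k = 1 / Real.sqrt (ω k) + 1 := by
      have := Real.mul_self_sqrt hpos.le
      rw [rho, add_div, div_self hpos.ne']
      congr 1
      rw [div_eq_div_iff hpos.ne' hs.ne', this, one_mul]
    rw [h2, mul_add, mul_one]
    refine add_le_add ?_ ?_
    · rw [mul_one_div, div_le_iff₀ hs, ← Real.sqrt_mul' _ hpos.le]
      exact Real.sqrt_le_sqrt h1
    · refine Real.sqrt_le_one.2 ?_
      nlinarith [Real.exp_pos (-t * ω k)]

theorem abs_hMul_le (hω_nonneg : ∀ k, 0 ≤ ω k) {x : ℝ} (hx : |x| ≤ 1) (t : ℝ)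
    (k : M) : |hMul ω x t k| ≤ Real.sqrt (2 * t) + 1 := by
  have h0 : 0 ≤ Real.sqrt (1 - Real.exp (-t * ω k) ^ 2) * (rho ω k / ω k) :=
    mul_nonneg (Real.sqrt_nonneg _) (div_nonneg (rho_nonneg hω_nonneg k) (hω_nonneg k))
  rw [hMul, abs_mul, abs_of_nonneg h0]
  exact (mul_le_of_le_one_left h0 hx).trans (sqrt_mul_rho_div_le hω_nonneg t k)

theorem bddMul_hMul (hω : Measurable ω) (hω_nonneg : ∀ k, 0 ≤ ω k) {x : ℝ} (hx : |x| ≤ 1) {t : ℝ}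
    (ht : 0 ≤ t) : BddMul (hMul ω x t) := by
  refine ⟨?_, _, abs_hMul_le hω_nonneg hx t⟩
  have h1 := measurable_rho hω
  unfold hMul
  fun_prop

theorem one_add_exp_mul_sMul (hω_nonneg : ∀ k, 0 ≤ ω k) {t : ℝ} (ht : 0 ≤ t) (x : ℝ) (k : M) :
    sMul ω x t k + Real.exp (-t * ω k) * sMul ω x t k =
      Real.sqrt (1 - Real.exp (-t * ω k) ^ 2) * hMul ω x t k := by
  have h1 := Real.mul_self_sqrt (one_sub_exp_sq_nonneg ht (hω_nonneg k))
  rcases (hω_nonneg k).eq_or_lt with h0 | hpos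
  · simp [sMul, hMul, rho, ← h0]
  · have h2 : beta t (ω k) = (1 - Real.exp (-t * ω k)) / ω k := by
      rw [← mul_beta, mul_div_cancel_left₀ _ hpos.ne']
    rw [sMul, hMul, h2]
    linear_combination (-x * rho ω k / ω k) * h1

variable (ω) in
/-- The semigroup `e^{-t h(v, x)}` on Fock space, where `v = (√ω + ω) v₀`. -/
def sOp (v₀ : OneBoson μ) (x : ℝ) (t : ℝ) : Fock μ →L[ℂ] Fock μ :=
  extendExp (affineExp ω v₀ t (cMul ω t) (sMul ω x t) (sMul ω x t))

theorem norm_mulOp_sq {m : M → ℝ} (h : BddMul m) (v : OneBoson μ) :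
    ‖mulOp μ m v‖ ^ 2 = (⟪v, mulOp μ (fun k => m k * m k) v⟫_ℂ).re := by
  rw [← mulOp_mul h h, ← inner_mulOp_left h]
  exact (inner_self_eq_norm_sq (𝕜 := ℂ) _).symm

theorem re_inner_mulOp_nonneg {m : M → ℝ} (h : BddMul m) (h0 : ∀ k, 0 ≤ m k) (v : OneBoson μ) :
    0 ≤ (⟪v, mulOp μ m v⟫_ℂ).re := by
  rw [inner_mulOp_self h, Complex.ofReal_re]
  exact integral_nonneg fun k => mul_nonneg (h0 k) (sq_nonneg _)

/-- The affine criterion bounds the norm by exp(-⟨v₀, C v₀⟩ + ‖s v₀‖²/2 + ‖h v₀‖²/2) with the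
multipliers C = `cMul`, s = `sMul`, h = `hMul`. Pointwise C = (s² + h²)/2 where ω > 0, so the
exponent vanishes there; where ω = 0 both s and h vanish and C = t ≥ 0. -/
theorem sOp_expVec_and_norm (hω : Measurable ω) (hω_nonneg : ∀ k, 0 ≤ ω k) (v₀ : OneBoson μ)
    {x : ℝ} (hx : x ^ 2 = 1) {t : ℝ} (ht : 0 ≤ t) :
    (∀ g, sOp ω v₀ x t (expVec g) =
      affineExp ω v₀ t (cMul ω t) (sMul ω x t) (sMul ω x t) g) ∧ ‖sOp ω v₀ x t‖ ≤ 1 := by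
  have hx' : |x| ≤ 1 := by
    rw [← sq_le_one_iff_abs_le_one, hx]
  have hc := bddMul_cMul hω hω_nonneg ht
  have hs := bddMul_sMul hω hω_nonneg hx ht
  have hh := bddMul_hMul hω hω_nonneg hx' ht
  have he := bddMul_exp hω hω_nonneg ht
  have hr := bddMul_sqrt hω t
  obtain ⟨T, hT, hn⟩ := exists_clm_exp hω hω_nonneg ht (-⟪v₀, mulOp μ (cMul ω t) v₀⟫_ℂ)
    (a := mulOp μ (sMul ω x t) v₀) (b := mulOp μ (sMul ω x t) v₀) (h := mulOp μ (hMul ω x t) v₀)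
    (by
      rw [eOp, rOp, mulOp_mul he hs, mulOp_mul hr hh, mulOp_add hs (he.mul hs)]
      congr 2
      exact funext (one_add_exp_mul_sMul hω_nonneg ht x))
  have h1 : sOp ω v₀ x t = T := extendExp_eq hT
  rw [h1]
  refine ⟨hT, hn.trans (Real.exp_le_one_iff.2 ?_)⟩
  have hhalf : BddMul fun k => 1 / 2 * (sMul ω x t k * sMul ω x t k + hMul ω x t k * hMul ω x t k) :=
    (BddMul.const _).mul ((hs.mul hs).add (hh.mul hh))
  have h2 := re_inner_mulOp_nonneg (hc.sub hhalf) (fun k => ?_) v₀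
  · rw [← mulOp_sub hc hhalf, ← mulOp_smul ((hs.mul hs).add (hh.mul hh)),
      ← mulOp_add (hs.mul hs) (hh.mul hh), inner_sub_right, inner_smul_right, inner_add_right,
      Complex.sub_re, Complex.re_ofReal_mul, Complex.add_re, ← norm_mulOp_sq hs,
      ← norm_mulOp_sq hh] at h2
    rw [Complex.neg_re]
    linarith
  · rcases (hω_nonneg k).eq_or_lt with h0 | hpos
    · simp [sMul, hMul, cMul, rho, ← h0, beta_zero_right, ht]
    · refine le_of_eq ?_
      have h3 : beta t (ω k) = (1 - Real.exp (-t * ω k)) / ω k := by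
        rw [← mul_beta, mul_div_cancel_left₀ _ hpos.ne']
      have h4 := Real.mul_self_sqrt (one_sub_exp_sq_nonneg ht (hω_nonneg k))
      have h5 := rho_sq hω_nonneg k
      have h6 : (1 + Real.sqrt (ω k)) ^ 2 = rho ω k ^ 2 / ω k := by
        rw [h5, mul_div_cancel_right₀ _ hpos.ne']
      rw [sMul, hMul, cMul, h6, h3]
      have h7 : x * (Real.sqrt (1 - Real.exp (-t * ω k) ^ 2) * (rho ω k / ω k)) *
          (x * (Real.sqrt (1 - Real.exp (-t * ω k) ^ 2) * (rho ω k / ω k))) =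
          x ^ 2 * ((1 - Real.exp (-t * ω k) ^ 2) * (rho ω k / ω k) ^ 2) := by
        linear_combination (x ^ 2 * (rho ω k / ω k) ^ 2) * h4
      have h8 : x * (rho ω k * ((1 - Real.exp (-t * ω k)) / ω k)) *
          (x * (rho ω k * ((1 - Real.exp (-t * ω k)) / ω k))) =
          x ^ 2 * (rho ω k * ((1 - Real.exp (-t * ω k)) / ω k)) ^ 2 := by ring
      rw [h7, h8, hx]
      field_simp
      ring

theorem sOp_zero (hω : Measurable ω) (hω_nonneg : ∀ k, 0 ≤ ω k) (v₀ : OneBoson μ) {x : ℝ}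
    (hx : x ^ 2 = 1) : sOp ω v₀ x 0 = 1 := by
  refine clm_ext_expVec fun g => ?_
  have h1 : mulOp μ (cMul ω 0) v₀ = 0 := by
    have : cMul ω 0 = fun _ => 0 := by
      funext k
      simp [cMul, beta_zero_left]
    simp [this, mulOp_const]
  have h2 : mulOp μ (sMul ω x 0) v₀ = 0 := by
    have : sMul ω x 0 = fun _ => 0 := by
      funext k
      simp [sMul, beta_zero_left]
    simp [this, mulOp_const]
  rw [(sOp_expVec_and_norm hω hω_nonneg v₀ hx le_rfl).1, affineExp, h1, h2, eOp_zero]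
  simp

/-- The exponents match because ω β_s = 1 - e^{-sω} and ρ² = (1 + √ω)² ω: the cross term of the
composition is exactly the part of C_t lost in β_{s+t} = β_s + e^{-sω} β_t. -/
theorem sOp_add (hω : Measurable ω) (hω_nonneg : ∀ k, 0 ≤ ω k) (v₀ : OneBoson μ) {x : ℝ}
    (hx : x ^ 2 = 1) {s t : ℝ} (hs : 0 ≤ s) (ht : 0 ≤ t) :
    sOp ω v₀ x (s + t) = sOp ω v₀ x s * sOp ω v₀ x t := by
  refine clm_ext_expVec fun g => ?_
  have hs' := bddMul_sMul hω hω_nonneg hx hs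
  have ht' := bddMul_sMul hω hω_nonneg hx ht
  rw [mul_apply_eq_comp, (sOp_expVec_and_norm hω hω_nonneg v₀ hx ht).1,
    (sOp_expVec_and_norm hω hω_nonneg v₀ hx (add_nonneg hs ht)).1]
  refine (affineExp_comp hω hω_nonneg hs ht (bddMul_cMul hω hω_nonneg hs) hs' hs'
    (bddMul_cMul hω hω_nonneg ht) ht' ht' (fun k => ?_) (fun k => ?_) (fun k => ?_)
    (sOp_expVec_and_norm hω hω_nonneg v₀ hx hs).1 g).symm
  · have h1 := rho_sq hω_nonneg k
    have h2 := mul_beta s (ω k)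
    simp only [cMul, sMul]
    rw [beta_add]
    linear_combination ((1 + Real.sqrt (ω k)) ^ 2 * beta t (ω k)) * h2 +
      (x ^ 2 * beta s (ω k) * beta t (ω k)) * h1 +
      (beta s (ω k) * beta t (ω k) * (1 + Real.sqrt (ω k)) ^ 2 * ω k) * hx
  · simp only [sMul]
    rw [add_comm s t, beta_add]
    ring
  · simp only [sMul]
    rw [beta_add]
    ring

theorem inner_sOp_left (hω : Measurable ω) (hω_nonneg : ∀ k, 0 ≤ ω k) (v₀ : OneBoson μ) {x : ℝ}
    (hx : x ^ 2 = 1) {t : ℝ} (ht : 0 ≤ t) (φ ψ : Fock μ) :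
    ⟪sOp ω v₀ x t φ, ψ⟫_ℂ = ⟪φ, sOp ω v₀ x t ψ⟫_ℂ := by
  have h : ContinuousLinearMap.adjoint (sOp ω v₀ x t) = sOp ω v₀ x t := by
    refine clm_ext_expVec fun g => ext_inner_expVec fun f => ?_
    rw [ContinuousLinearMap.adjoint_inner_right, (sOp_expVec_and_norm hω hω_nonneg v₀ hx ht).1,
      (sOp_expVec_and_norm hω hω_nonneg v₀ hx ht).1, affineExp, affineExp, inner_smul_left,
      inner_smul_right, inner_expVec, inner_expVec, ← Complex.exp_conj, ← Complex.exp_add,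
      ← Complex.exp_add, inner_mulOp_self (bddMul_cMul hω hω_nonneg ht), inner_sub_left,
      inner_sub_right, map_sub, map_neg, Complex.conj_ofReal, inner_conj_symm]
    congr 1
    have := inner_mulOp_left (bddMul_exp hω hω_nonneg ht) f g
    rw [eOp, this]
    ring
  rw [← ContinuousLinearMap.adjoint_inner_right, h]

theorem isContractionSemigroup_sOp (hω : Measurable ω) (hω_nonneg : ∀ k, 0 ≤ ω k)
    (v₀ : OneBoson μ) {x : ℝ} (hx : x ^ 2 = 1) :
    IsContractionSemigroup fun t : ℝ≥0 => sOp ω v₀ x t := by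
  refine isContractionSemigroup_of_tendsto (sOp_zero hω hω_nonneg v₀ hx)
    (fun s t => sOp_add hω hω_nonneg v₀ hx s.coe_nonneg t.coe_nonneg)
    (fun t => (sOp_expVec_and_norm hω hω_nonneg v₀ hx t.coe_nonneg).2) dense_span_expVec ?_
  rintro _ ⟨g, rfl⟩
  have h1 : (fun t : ℝ≥0 => sOp ω v₀ x t (expVec g)) = fun t : ℝ≥0 =>
      affineExp ω v₀ t (cMul ω t) (sMul ω x t) (sMul ω x t) g :=
    funext fun t => (sOp_expVec_and_norm hω hω_nonneg v₀ hx t.coe_nonneg).1 g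
  have hlt : ∀ᶠ t : ℝ≥0 in 𝓝 0, (t : ℝ) ≤ 1 := by
    filter_upwards [gt_mem_nhds zero_lt_one] with t ht
    exact_mod_cast ht.le
  have hcoe : Tendsto (fun t : ℝ≥0 => (t : ℝ)) (𝓝 0) (𝓝 0) := NNReal.continuous_coe.tendsto 0
  have hbeta : ∀ l, 0 ≤ l → Tendsto (fun t : ℝ≥0 => beta t l) (𝓝 0) (𝓝 0) := fun l hl =>
    squeeze_zero (fun t => beta_nonneg t.coe_nonneg l) (fun t => beta_le t.coe_nonneg hl) hcoe
  have hC : Tendsto (fun t : ℝ≥0 => mulOp μ (cMul ω t) v₀) (𝓝 0) (𝓝 0) := by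
    have := tendsto_mulOp (μ := μ) (l := 𝓝 (0 : ℝ≥0)) (m := fun t => cMul ω t) (m₀ := fun _ => 0)
      (C := 2 * (1 + 1)) (fun t => bddMul_cMul hω hω_nonneg t.coe_nonneg) measurable_const
      (hlt.mono fun t ht k => (abs_cMul_le hω_nonneg t.coe_nonneg k).trans (by linarith))
      (fun k => by simp) (ae_of_all _ fun k => ?_) v₀
    · simpa [mulOp_const] using this
    · simpa [cMul] using (hbeta _ (hω_nonneg k)).const_mul _
  have hS : Tendsto (fun t : ℝ≥0 => mulOp μ (sMul ω x t) v₀) (𝓝 0) (𝓝 0) := by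
    have := tendsto_mulOp (μ := μ) (l := 𝓝 (0 : ℝ≥0)) (m := fun t => sMul ω x t) (m₀ := fun _ => 0)
      (C := 1 + 1) (fun t => bddMul_sMul hω hω_nonneg hx t.coe_nonneg) measurable_const
      (hlt.mono fun t ht k => (abs_sMul_le hω_nonneg hx t.coe_nonneg k).trans
        (by linarith [Real.sqrt_le_one.2 ht]))
      (fun k => by simp) (ae_of_all _ fun k => ?_) v₀
    · simpa [mulOp_const] using this
    · simpa [sMul] using ((hbeta _ (hω_nonneg k)).const_mul (rho ω k)).const_mul x
  have hE : Tendsto (fun t : ℝ≥0 => eOp μ ω t g) (𝓝 0) (𝓝 g) := by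
    have := tendsto_mulOp (μ := μ) (l := 𝓝 (0 : ℝ≥0)) (m := fun t k => Real.exp (-t * ω k))
      (m₀ := fun _ => 1) (C := 1) (fun t => bddMul_exp hω hω_nonneg t.coe_nonneg) measurable_const
      (Eventually.of_forall fun t k => by
        rw [abs_of_pos (Real.exp_pos _)]
        exact exp_neg_mul_le_one t.coe_nonneg (hω_nonneg k))
      (fun k => by simp) (ae_of_all _ fun k => ?_) g
    · simp only [mulOp_const, Complex.ofReal_one, one_smul] at this
      exact this
    · have hc : Continuous fun s : ℝ => Real.exp (-s * ω k) := by fun_prop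
      have := (hc.tendsto 0).comp hcoe
      simpa [Function.comp_def] using this
  rw [h1]
  simp only [affineExp]
  have h2 : Tendsto (fun t : ℝ≥0 => Complex.exp (-⟪v₀, mulOp μ (cMul ω t) v₀⟫_ℂ -
      ⟪mulOp μ (sMul ω x t) v₀, g⟫_ℂ)) (𝓝 0) (𝓝 1) := by
    have h3 := ((tendsto_const_nhds (x := v₀)).inner (𝕜 := ℂ) hC).neg.sub
      (hS.inner (𝕜 := ℂ) (tendsto_const_nhds (x := g)))
    have := (Complex.continuous_exp.tendsto _).comp h3
    simpa [Function.comp_def] using this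
  have h4 := (continuous_expVec.tendsto _).comp (hE.sub hS)
  have := h2.smul h4
  simpa [Function.comp_def] using this

end VanHoveSemigroup

/-! ### Weyl operators and the differential second quantization -/

section Weyl

variable {M : Type*} [MeasurableSpace M] {μ : Measure M} {ω : M → ℝ} [SigmaFinite μ]

/-- The bounded multiplier `ω/(√ω + ω)`. -/
def qMul (ω : M → ℝ) (k : M) : ℝ := ω k / rho ω k

theorem abs_qMul_le (hω_nonneg : ∀ k, 0 ≤ ω k) (k : M) : |qMul ω k| ≤ 1 := by
  rw [qMul, abs_of_nonneg (div_nonneg (hω_nonneg k) (rho_nonneg hω_nonneg k))]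
  exact div_le_one_of_le₀ (le_add_of_nonneg_left (Real.sqrt_nonneg _)) (rho_nonneg hω_nonneg k)

theorem bddMul_qMul (hω : Measurable ω) (hω_nonneg : ∀ k, 0 ≤ ω k) : BddMul (qMul ω) :=
  ⟨hω.div (measurable_rho hω), 1, abs_qMul_le hω_nonneg⟩

theorem rho_mul_qMul (hω_nonneg : ∀ k, 0 ≤ ω k) (k : M) : rho ω k * qMul ω k = ω k := by
  rcases (hω_nonneg k).eq_or_lt with h0 | hpos
  · simp [qMul, ← h0]
  · have : 0 < rho ω k := add_pos_of_nonneg_of_pos (Real.sqrt_nonneg _) hpos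
    rw [qMul, mul_div_cancel₀ _ this.ne']

theorem sMul_mul_qMul (hω_nonneg : ∀ k, 0 ≤ ω k) (x t : ℝ) (k : M) :
    sMul ω x t k * qMul ω k = x * (1 - Real.exp (-t * ω k)) := by
  rw [← mul_beta, ← rho_mul_qMul hω_nonneg k, sMul]
  rw [rho_mul_qMul hω_nonneg k]
  linear_combination (x * beta t (ω k)) * rho_mul_qMul hω_nonneg k

theorem cMul_mul_qMul (hω_nonneg : ∀ k, 0 ≤ ω k) {x : ℝ} (hx : x ^ 2 = 1) (t : ℝ) (k : M) :
    cMul ω t k * qMul ω k = x * sMul ω x t k := by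
  rcases (hω_nonneg k).eq_or_lt with h0 | hpos
  · simp [qMul, ← h0, sMul, rho]
  · have h1 : 0 < rho ω k := add_pos_of_nonneg_of_pos (Real.sqrt_nonneg _) hpos
    have h2 : (1 + Real.sqrt (ω k)) ^ 2 * qMul ω k = rho ω k := by
      rw [qMul, ← mul_div_assoc, ← rho_sq hω_nonneg, sq, mul_div_cancel_right₀ _ h1.ne']
    rw [cMul, sMul]
    linear_combination beta t (ω k) * h2 - (rho ω k * beta t (ω k)) * hx

/-- The hypothesis says that the form factors ρ v₀ and ρ w₀ differ by ω y, as v and v_reg do with y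
= v_UV/ω. The translation by x y passes through the semigroup since s_t ω/ρ = x (1 - e^{-tω}) and
C_t ω/ρ = x s_t. -/
theorem weyl_mul_sOp (hω : Measurable ω) (hω_nonneg : ∀ k, 0 ≤ ω k) {v₀ w₀ y : OneBoson μ}
    (hv : v₀ = w₀ + mulOp μ (qMul ω) y) {x : ℝ} (hx : x ^ 2 = 1) {t : ℝ} (ht : 0 ≤ t) :
    weyl ((x : ℂ) • y) * sOp ω v₀ x t = sOp ω w₀ x t * weyl ((x : ℂ) • y) := by
  refine clm_ext_expVec fun g => ?_
  have hs := bddMul_sMul hω hω_nonneg hx ht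
  have hc := bddMul_cMul hω hω_nonneg ht
  have hq := bddMul_qMul hω hω_nonneg
  have he := bddMul_exp hω hω_nonneg ht
  set f := (x : ℂ) • y with hf
  have hyf : (x : ℂ) • f = y := by
    rw [hf, smul_smul, ← sq, ← Complex.ofReal_pow, hx, Complex.ofReal_one, one_smul]
  have h1e := (BddMul.const (M := M) 1).sub he
  have h1 : mulOp μ (sMul ω x t) (mulOp μ (qMul ω) y) = f - eOp μ ω t f := by
    have h2 : mulOp μ (fun k => 1 - Real.exp (-t * ω k)) f = f - eOp μ ω t f := by
      rw [← mulOp_sub (BddMul.const 1) he, mulOp_const, Complex.ofReal_one, one_smul, eOp]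
    rw [← h2, hf, map_smul, mulOp_smul h1e, mulOp_mul hs hq]
    congr 2
    exact funext (sMul_mul_qMul hω_nonneg x t)
  have h3 : mulOp μ (cMul ω t) (mulOp μ (qMul ω) y) = mulOp μ (sMul ω x t) f := by
    rw [hf, map_smul, mulOp_smul hs, mulOp_mul hc hq]
    congr 2
    exact funext (cMul_mul_qMul hω_nonneg hx t)
  rw [mul_apply_eq_comp, mul_apply_eq_comp, (sOp_expVec_and_norm hω hω_nonneg v₀ hx ht).1,
    (weyl_expVec_and_norm f).1, map_smul, (sOp_expVec_and_norm hω hω_nonneg w₀ hx ht).1,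
    affineExp, affineExp, map_smul, (weyl_expVec_and_norm f).1, smul_smul, smul_smul,
    ← Complex.exp_add, ← Complex.exp_add]
  have hqy : ⟪mulOp μ (qMul ω) y, mulOp μ (cMul ω t) (mulOp μ (qMul ω) y)⟫_ℂ =
      ⟪f, f⟫_ℂ - ⟪f, eOp μ ω t f⟫_ℂ := by
    rw [h3, ← inner_mulOp_left hs, h1, inner_sub_left, eOp, inner_mulOp_left he]
  have hqw : ⟪mulOp μ (qMul ω) y, mulOp μ (cMul ω t) w₀⟫_ℂ = ⟪f, mulOp μ (sMul ω x t) w₀⟫_ℂ := by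
    rw [← inner_mulOp_left hc, h3, inner_mulOp_left hs]
  have hef : ⟪eOp μ ω t f, g⟫_ℂ = ⟪f, eOp μ ω t g⟫_ℂ := inner_mulOp_left he _ _
  have hwf : ⟪mulOp μ (sMul ω x t) w₀, f⟫_ℂ = ⟪w₀, mulOp μ (sMul ω x t) f⟫_ℂ :=
    inner_mulOp_left hs _ _
  congr 1
  · congr 1
    rw [hv]
    simp only [map_add, inner_add_left, inner_add_right, inner_sub_left, inner_sub_right, h1, h3,
      hqw, hef, hwf]
    rw [← h3, hqy]
    ring
  · congr 1
    rw [hv, map_add, h1, map_add]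
    abel

theorem weyl_mul_weyl_neg (f : OneBoson μ) : weyl f * weyl (-f) = 1 := by
  refine clm_ext_expVec fun g => ?_
  rw [mul_apply_eq_comp, (weyl_expVec_and_norm (-f)).1, map_smul, (weyl_expVec_and_norm f).1,
    smul_smul, ← Complex.exp_add, add_neg_cancel_left, inner_neg_left, inner_add_right,
    inner_neg_right, norm_neg, inner_self_eq_norm_sq_to_K]
  have h : ∀ c : ℂ, c = 0 → Complex.exp c • expVec g = (1 : Fock μ →L[ℂ] Fock μ) (expVec g) := by
    rintro _ rfl
    simp
  refine h _ ?_
  simp only [Complex.coe_algebraMap]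
  push_cast
  ring

end Weyl

/-! ### The differential second quantization as a generator -/

section SecondQuantization

variable {M : Type*} [MeasurableSpace M] {μ : Measure M} {ω : M → ℝ} [SigmaFinite μ]

theorem measurable_sum_apply (hω : Measurable ω) (n : ℕ) :
    Measurable fun k : Fin n → M => ∑ i, ω (k i) :=
  Finset.measurable_sum _ fun i _ => hω.comp (measurable_pi_apply i)

theorem sum_apply_nonneg (hω_nonneg : ∀ k, 0 ≤ ω k) (n : ℕ) (k : Fin n → M) :
    0 ≤ ∑ i, ω (k i) := Finset.sum_nonneg fun i _ => hω_nonneg (k i)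

variable (ω) in
/-- The semigroup `e^{-t dΓ(ω)}`. -/
def gammaOp (t : ℝ) : Fock μ →L[ℂ] Fock μ := sOp ω 0 1 t

theorem gammaOp_expVec (hω : Measurable ω) (hω_nonneg : ∀ k, 0 ≤ ω k) {t : ℝ} (ht : 0 ≤ t)
    (g : OneBoson μ) : gammaOp ω t (expVec g) = expVec (eOp μ ω t g) := by
  rw [gammaOp, (sOp_expVec_and_norm hω hω_nonneg 0 (one_pow 2) ht).1, affineExp]
  simp

theorem isContractionSemigroup_gammaOp (hω : Measurable ω) (hω_nonneg : ∀ k, 0 ≤ ω k) :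
    IsContractionSemigroup fun t : ℝ≥0 => gammaOp (μ := μ) ω t :=
  isContractionSemigroup_sOp hω hω_nonneg 0 (one_pow 2)

variable (μ) in
/-- The `n`-boson component, as an element of `L²(Mⁿ)`. -/
def component (n : ℕ) : Fock μ →L[ℂ] Lp ℂ 2 (Measure.pi fun _ : Fin n => μ) :=
  (nBoson μ n).subtypeL ∘L lp.evalCLM ℂ (fun n => nBoson μ n) 2 n

theorem component_apply (n : ℕ) (ψ : Fock μ) :
    component μ n ψ = (ψ n : Lp ℂ 2 (Measure.pi fun _ : Fin n => μ)) := rfl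

theorem component_gammaOp (hω : Measurable ω) (hω_nonneg : ∀ k, 0 ≤ ω k) {t : ℝ} (ht : 0 ≤ t)
    (n : ℕ) (ψ : Fock μ) : component μ n (gammaOp ω t ψ) =
      eOp (Measure.pi fun _ : Fin n => μ) (fun k => ∑ i, ω (k i)) t (component μ n ψ) := by
  have h : component μ n ∘L gammaOp ω t =
      eOp (Measure.pi fun _ : Fin n => μ) (fun k => ∑ i, ω (k i)) t ∘L component μ n := by
    refine clm_ext_expVec fun g => ?_
    have he := bddMul_exp (measurable_sum_apply hω n) (sum_apply_nonneg hω_nonneg n) ht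
    change component μ n (gammaOp ω t (expVec g)) = eOp _ _ t (component μ n (expVec g))
    rw [gammaOp_expVec hω hω_nonneg ht, component_apply, component_apply, expVec_apply,
      expVec_apply, Submodule.coe_smul, Submodule.coe_smul, map_smul]
    congr 1
    refine eq_mulOp he ?_
    have h1 := coeFn_mulOp (bddMul_exp hω hω_nonneg ht) g
    have h2 : ∀ᵐ k ∂(Measure.pi fun _ : Fin n => μ), ∀ i,
        eOp μ ω t g (k i) = (Real.exp (-t * ω (k i)) : ℂ) * g (k i) :=
      ae_all_iff.2 fun i =>
        (Measure.quasiMeasurePreserving_eval (fun _ : Fin n => μ) i).ae h1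
    filter_upwards [h2, coeFn_tensorPow (eOp μ ω t g) n, coeFn_tensorPow g n] with k h3 h4 h5
    rw [h4, h5, Finset.prod_congr rfl fun i _ => h3 i, Finset.prod_mul_distrib,
      ← Complex.ofReal_prod, ← Real.exp_sum, Finset.mul_sum]
  exact DFunLike.congr_fun h ψ

theorem exp_sub_eq_beta (t : ℝ) {ν : Type*} [MeasurableSpace ν] {π : Measure ν} {l : ν → ℝ}
    (hl : Measurable l) (hl0 : ∀ k, 0 ≤ l k) (ht : 0 ≤ t) {r : ν → ℝ} (hr : BddMul r) (F : Lp ℂ 2 π) :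
    mulOp π r (F - eOp π l t F) = mulOp π (fun k => beta t (l k) * (l k * r k)) F := by
  have he := bddMul_exp hl hl0 ht
  have hb : BddMul fun k => beta t (l k) := ⟨(measurable_beta t).comp hl, t, fun k => by
    rw [abs_of_nonneg (beta_nonneg ht _)]
    exact beta_le ht (hl0 k)⟩
  rw [map_sub, eOp, mulOp_mul hr he, mulOp_sub hr (hr.mul he)]
  congr 2
  funext k
  linear_combination (-r k) * mul_beta t (l k)

theorem norm_sq_fock (ψ : Fock μ) : ‖ψ‖ ^ 2 = ∑' n, ‖component μ n ψ‖ ^ 2 := by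
  have := lp.norm_rpow_eq_tsum (p := 2) (by norm_num) ψ
  simp only [ENNReal.toReal_ofNat, Real.rpow_ofNat] at this
  exact this

theorem summable_norm_sq_fock (ψ : Fock μ) : Summable fun n => ‖component μ n ψ‖ ^ 2 := by
  have := (lp.memℓp ψ).summable (by norm_num)
  simp only [ENNReal.toReal_ofNat, Real.rpow_ofNat] at this
  exact this

theorem inv_mul_beta_mem {l : ℝ} (hl : 0 ≤ l) {t : ℝ} (ht : 0 ≤ t) :
    0 ≤ t⁻¹ * beta t l ∧ t⁻¹ * beta t l ≤ 1 := by
  refine ⟨mul_nonneg (inv_nonneg.2 ht) (beta_nonneg ht l), ?_⟩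
  rw [inv_mul_eq_div]
  exact div_le_one_of_le₀ (beta_le ht hl) ht

/-- `dΓ(ω)` is the generator of the semigroup `e^{-t dΓ(ω)}`. -/
theorem mem_dGammaGraph_iff (hω : Measurable ω) (hω_nonneg : ∀ k, 0 ≤ ω k) (ψ η : Fock μ) :
    (ψ, η) ∈ dGammaGraph (μ := μ) ω ↔ GenRel (fun t : ℝ≥0 => gammaOp ω t) ψ η := by
  constructor
  · intro h
    have hm : ∀ (t : ℝ≥0) (n : ℕ),
        BddMul fun k : Fin n → M => (t : ℝ)⁻¹ * beta t (∑ i, ω (k i)) := fun t n =>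
      ⟨((measurable_beta t).comp (measurable_sum_apply hω n)).const_mul _, 1, fun k => by
        have := inv_mul_beta_mem (sum_apply_nonneg hω_nonneg n k) t.coe_nonneg
        exact abs_le.2 ⟨by linarith [this.1], this.2⟩⟩
    -- Since η = l ψ on the n-boson component, ψ - e^{-tl} ψ equals β_t(l) η, and t⁻¹ β_t(l) lies in
    -- [0, 1] and tends to 1. This makes the limit dominated in k and in n.
    have hcomp : ∀ (t : ℝ≥0) (n : ℕ), component μ n (ψ - gammaOp ω t ψ) =
        mulOp (Measure.pi fun _ : Fin n => μ) (fun k => beta t (∑ i, ω (k i)))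
          (component μ n η) := by
      intro t n
      have hl := measurable_sum_apply hω n
      have hl0 := sum_apply_nonneg hω_nonneg n
      have hb : BddMul fun k : Fin n → M => beta t (∑ i, ω (k i)) :=
        ⟨(measurable_beta t).comp hl, t, fun k => by
          rw [abs_of_nonneg (beta_nonneg t.coe_nonneg _)]
          exact beta_le t.coe_nonneg (hl0 k)⟩
      rw [map_sub, component_gammaOp hω hω_nonneg t.coe_nonneg]
      refine eq_mulOp hb ?_
      have he := coeFn_mulOp (bddMul_exp hl hl0 t.coe_nonneg) (component μ n ψ)
      filter_upwards [h n, he, Lp.coeFn_sub (component μ n ψ)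
        (eOp (Measure.pi fun _ : Fin n => μ) (fun k => ∑ i, ω (k i)) t (component μ n ψ))]
        with k h1 h2 h3
      rw [h3, Pi.sub_apply]
      erw [h2, h1]
      have := mul_beta t (∑ i, ω (k i))
      have h4 : ((∑ i, ω (k i) : ℝ) : ℂ) * (beta t (∑ i, ω (k i)) : ℂ) =
          1 - (Real.exp (-t * ∑ i, ω (k i)) : ℂ) := by
        exact_mod_cast this
      change component μ n ψ k - _ * component μ n ψ k = _ * (_ * component μ n ψ k)
      linear_combination (-component μ n ψ k) * h4
    rw [GenRel, tendsto_iff_norm_sub_tendsto_zero]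
    have hsq : Tendsto (fun t : ℝ≥0 =>
        ‖((t : ℝ)⁻¹ : ℂ) • (ψ - gammaOp ω t ψ) - η‖ ^ 2) (𝓝[>] 0) (𝓝 0) := by
      have hc : ∀ (t : ℝ≥0) (n : ℕ),
          component μ n (((t : ℝ)⁻¹ : ℂ) • (ψ - gammaOp ω t ψ) - η) =
          mulOp (Measure.pi fun _ : Fin n => μ) (fun k => (t : ℝ)⁻¹ * beta t (∑ i, ω (k i)))
            (component μ n η) - component μ n η := by
        intro t n
        have hb : BddMul fun k : Fin n → M => beta t (∑ i, ω (k i)) :=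
          ⟨(measurable_beta t).comp (measurable_sum_apply hω n), t, fun k => by
            rw [abs_of_nonneg (beta_nonneg t.coe_nonneg _)]
            exact beta_le t.coe_nonneg (sum_apply_nonneg hω_nonneg n k)⟩
        rw [map_sub, map_smul, hcomp, ← Complex.ofReal_inv, mulOp_smul hb]
      simp only [norm_sq_fock, hc]
      rw [show (0 : ℝ) = ∑' _ : ℕ, (0 : ℝ) by simp]
      refine tendsto_tsum_of_dominated_convergence (summable_norm_sq_fock η) (fun n => ?_) ?_
      · have h1 := tendsto_mulOp (μ := Measure.pi fun _ : Fin n => μ) (l := 𝓝[>] (0 : ℝ≥0))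
          (m₀ := fun _ => 1) (C := 1) (fun t => hm t n) measurable_const
          (Eventually.of_forall fun t k => abs_le.2
            ⟨by linarith [(inv_mul_beta_mem (sum_apply_nonneg hω_nonneg n k) t.coe_nonneg).1],
              (inv_mul_beta_mem (sum_apply_nonneg hω_nonneg n k) t.coe_nonneg).2⟩)
          (fun k => by simp) (ae_of_all _ fun k => tendsto_beta_div) (component μ n η)
        rw [mulOp_const, Complex.ofReal_one, one_smul] at h1
        have h2 := (h1.sub_const (component μ n η)).norm.pow 2
        simpa using h2
      · refine Eventually.of_forall fun t n => ?_
        have hd := (hm t n).sub (BddMul.const 1)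
        have h1 : mulOp (Measure.pi fun _ : Fin n => μ)
            (fun k => (t : ℝ)⁻¹ * beta t (∑ i, ω (k i))) (component μ n η) - component μ n η =
            mulOp (Measure.pi fun _ : Fin n => μ)
              (fun k => (t : ℝ)⁻¹ * beta t (∑ i, ω (k i)) - 1) (component μ n η) := by
          rw [← mulOp_sub (hm t n) (BddMul.const 1), mulOp_const, Complex.ofReal_one, one_smul]
        have h2 := norm_mulOp_le (μ := Measure.pi fun _ : Fin n => μ) hd.1 (C := 1) (fun k => by
          have := inv_mul_beta_mem (sum_apply_nonneg hω_nonneg n k) t.coe_nonneg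
          exact abs_le.2 ⟨by linarith [this.1], by linarith [this.2]⟩) (component μ n η)
        rw [one_mul] at h2
        rw [h1, Real.norm_of_nonneg (sq_nonneg _)]
        exact pow_le_pow_left₀ (norm_nonneg _) h2 2
    have := (Real.continuous_sqrt.tendsto 0).comp hsq
    simpa [Function.comp_def, Real.sqrt_sq] using this
  · intro h n
    have hl := measurable_sum_apply hω n
    have hl0 := sum_apply_nonneg hω_nonneg n
    set l : (Fin n → M) → ℝ := fun k => ∑ i, ω (k i) with hl_def
    -- The bounded factor 1/(1 + l) regularizes the difference quotient, so that its limit can be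
    -- identified before it is known that l ψ is square integrable.
    have hr : BddMul fun k => (1 + l k)⁻¹ := ⟨by fun_prop, 1, fun k => by
      have : 0 < 1 + l k := by linarith [hl0 k]
      rw [abs_of_pos (inv_pos.2 this)]
      exact inv_le_one_of_one_le₀ (by linarith [hl0 k])⟩
    have hlr : ∀ k, 0 ≤ l k * (1 + l k)⁻¹ ∧ l k * (1 + l k)⁻¹ ≤ 1 := fun k => by
      have h0 := hl0 k
      have : 0 < 1 + l k := by linarith
      refine ⟨mul_nonneg h0 (inv_pos.2 this).le, ?_⟩
      rw [← div_eq_mul_inv, div_le_one this]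
      linarith
    have hrb : BddMul fun k => l k * (1 + l k)⁻¹ := ⟨by fun_prop, 1, fun k =>
      abs_le.2 ⟨by linarith [(hlr k).1], (hlr k).2⟩⟩
    have h1 := ((mulOp (Measure.pi fun _ : Fin n => μ) (fun k => (1 + l k)⁻¹) ∘L
      component μ n).continuous.tendsto _).comp h
    have hbd : ∀ (t : ℝ≥0) k, 0 ≤ (t : ℝ)⁻¹ * (beta t (l k) * (l k * (1 + l k)⁻¹)) ∧
        (t : ℝ)⁻¹ * (beta t (l k) * (l k * (1 + l k)⁻¹)) ≤ 1 := fun t k => by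
      have h2 := inv_mul_beta_mem (hl0 k) t.coe_nonneg
      rw [← mul_assoc]
      exact ⟨mul_nonneg h2.1 (hlr k).1, mul_le_one₀ h2.2 (hlr k).1 (hlr k).2⟩
    have h2 := tendsto_mulOp (μ := Measure.pi fun _ : Fin n => μ) (l := 𝓝[>] (0 : ℝ≥0))
      (m := fun t k => (t : ℝ)⁻¹ * (beta t (l k) * (l k * (1 + l k)⁻¹)))
      (m₀ := fun k => l k * (1 + l k)⁻¹) (C := 1)
      (fun t => ⟨(((measurable_beta t).comp hl).mul hrb.1).const_mul _, 1, fun k =>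
        abs_le.2 ⟨by linarith [(hbd t k).1], (hbd t k).2⟩⟩) hrb.1
      (Eventually.of_forall fun t k => abs_le.2 ⟨by linarith [(hbd t k).1], (hbd t k).2⟩)
      (fun k => abs_le.2 ⟨by linarith [(hlr k).1], (hlr k).2⟩)
      (ae_of_all _ fun k => by
        simpa [mul_assoc] using tendsto_beta_div.mul_const (l k * (1 + l k)⁻¹))
      (component μ n ψ)
    have h3 := tendsto_nhds_unique (h1.congr fun t => ?_) h2
    · have h4 := coeFn_mulOp hr (component μ n η)
      have h5 := coeFn_mulOp hrb (component μ n ψ)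
      change mulOp _ _ (component μ n η) = _ at h3
      rw [h3] at h4
      filter_upwards [h4, h5] with k h6 h7
      have h8 : ((1 + l k : ℝ) : ℂ) ≠ 0 := by
        exact_mod_cast (by linarith [hl0 k] : 0 < 1 + l k).ne'
      rw [h7] at h6
      push_cast at h6 h8
      change component μ n η k = ((l k : ℝ) : ℂ) * component μ n ψ k
      field_simp at h6
      exact h6.symm
    · have hbe : BddMul fun k => beta t (l k) * (l k * (1 + l k)⁻¹) :=
        ⟨((measurable_beta t).comp hl).mul hrb.1, t * 1, fun k => by
          rw [abs_mul, abs_of_nonneg (beta_nonneg t.coe_nonneg _), abs_of_nonneg (hlr k).1]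
          exact mul_le_mul (beta_le t.coe_nonneg (hl0 k)) (hlr k).2 (hlr k).1 t.coe_nonneg⟩
      change mulOp _ _ (component μ n _) = _
      rw [map_smul, map_smul, map_sub, component_gammaOp hω hω_nonneg t.coe_nonneg,
        exp_sub_eq_beta t hl hl0 t.coe_nonneg hr, ← Complex.ofReal_inv, mulOp_smul hbe]

end SecondQuantization
/-! ### Annihilation, creation and field operators -/

section FieldOperator

variable {M : Type*} [MeasurableSpace M] {μ : Measure M} [SigmaFinite μ]

/-- The closed linear relation dual to `ε(h) ↦ Φ(h)`. -/
def expDual (Φ : OneBoson μ → Fock μ) : Submodule ℂ (Fock μ × Fock μ) where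
  carrier := {p | ∀ h, ⟪Φ h, p.1⟫_ℂ = ⟪expVec h, p.2⟫_ℂ}
  add_mem' := fun {p q} hp hq h => by
    rw [Prod.fst_add, Prod.snd_add, inner_add_right, inner_add_right, hp, hq]
  zero_mem' := fun h => by simp
  smul_mem' := fun c p hp h => by
    rw [Prod.smul_fst, Prod.smul_snd, inner_smul_right, inner_smul_right, hp]

theorem isClosed_expDual (Φ : OneBoson μ → Fock μ) :
    IsClosed (expDual Φ : Set (Fock μ × Fock μ)) := by
  have : (expDual Φ : Set (Fock μ × Fock μ)) =
      ⋂ h, {p | ⟪Φ h, p.1⟫_ℂ = ⟪expVec h, p.2⟫_ℂ} := by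
    ext p
    simp [expDual]
  rw [this]
  exact isClosed_iInter fun h => isClosed_eq (by fun_prop) (by fun_prop)

/-- Totality of the exponential vectors makes every relation inside `expDual Φ` single valued. As
`expDual Φ` is closed, any operator whose graph lies in it is closable. -/
theorem expDual_snd_eq_zero (Φ : OneBoson μ → Fock μ) (p : Fock μ × Fock μ) (hp : p ∈ expDual Φ)
    (h0 : p.1 = 0) : p.2 = 0 :=
  ext_inner_expVec fun h => by rw [← hp h, h0, inner_zero_right, inner_zero_right]

theorem graph_toLinearPMap_of_le_expDual {Φ : OneBoson μ → Fock μ}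
    {S : Submodule ℂ (Fock μ × Fock μ)} (hS : S ≤ expDual Φ) : S.toLinearPMap.graph = S :=
  Submodule.toLinearPMap_graph_eq _ fun p hp => expDual_snd_eq_zero Φ p (hS hp)

theorem isClosable_of_le_expDual {Φ : OneBoson μ → Fock μ} {L : Fock μ →ₗ.[ℂ] Fock μ}
    (hL : L.graph ≤ expDual Φ) : L.IsClosable :=
  ⟨L.graph.topologicalClosure.toLinearPMap, (graph_toLinearPMap_of_le_expDual
    (Submodule.topologicalClosure_minimal _ hL (isClosed_expDual Φ))).symm⟩

theorem graph_closure_le_expDual {Φ : OneBoson μ → Fock μ} {L : Fock μ →ₗ.[ℂ] Fock μ}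
    (hL : L.graph ≤ expDual Φ) : L.closure.graph ≤ expDual Φ := by
  rw [← (isClosable_of_le_expDual hL).graph_closure_eq_closure_graph]
  exact Submodule.topologicalClosure_minimal _ hL (isClosed_expDual Φ)

theorem span_ann_le_expDual (f : OneBoson μ) :
    Submodule.span ℂ (range fun g : OneBoson μ =>
      ((expVec g, ⟪f, g⟫_ℂ • expVec g) : Fock μ × Fock μ)) ≤ expDual fun h => dExp h f := by
  rw [Submodule.span_le]
  rintro _ ⟨g, rfl⟩ h
  rw [inner_dExp_expVec, inner_smul_right, inner_expVec]

theorem graph_ann_le_expDual (f : OneBoson μ) : (ann f).graph ≤ expDual fun h => dExp h f :=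
  graph_closure_le_expDual <| by
    rw [graph_toLinearPMap_of_le_expDual (span_ann_le_expDual f)]
    exact span_ann_le_expDual f

theorem expVec_mem_graph_ann (f g : OneBoson μ) :
    (expVec g, ⟪f, g⟫_ℂ • expVec g) ∈ (ann f).graph := by
  refine LinearPMap.le_graph_of_le (LinearPMap.le_closure _) ?_
  rw [graph_toLinearPMap_of_le_expDual (span_ann_le_expDual f)]
  exact Submodule.subset_span ⟨g, rfl⟩

theorem dense_domain_ann (f : OneBoson μ) : Dense ((ann f).domain : Set (Fock μ)) := by
  refine dense_span_expVec.mono ?_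
  refine (Submodule.span_le (p := (ann f).domain)).2 ?_
  rintro _ ⟨g, rfl⟩
  exact LinearPMap.mem_domain_of_mem_graph (expVec_mem_graph_ann f g)

theorem expVec_mem_graph_cre (f h : OneBoson μ) : (expVec h, dExp h f) ∈ (cre f).graph := by
  have h1 : ∀ ψ : (ann f).domain, ⟪dExp h f, (ψ : Fock μ)⟫_ℂ = ⟪expVec h, ann f ψ⟫_ℂ := fun ψ =>
    graph_ann_le_expDual f ((ann f).mem_graph ψ) h
  have h2 : expVec h ∈ (cre f).domain := LinearPMap.mem_adjoint_domain_of_exists _ ⟨_, h1⟩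
  have h3 : cre f ⟨expVec h, h2⟩ = dExp h f :=
    LinearPMap.adjoint_apply_eq (dense_domain_ann f) ⟨expVec h, h2⟩ h1
  rw [← h3]
  exact (cre f).mem_graph ⟨expVec h, h2⟩

/-- The value `φ(f) ε(g)`. -/
def fieldExp (f g : OneBoson μ) : Fock μ := ⟪f, g⟫_ℂ • expVec g + dExp g f

theorem mem_graph_add_iff {E : Type*} [NormedAddCommGroup E] [NormedSpace ℂ E]
    {A B : E →ₗ.[ℂ] E} {ψ η : E} : (ψ, η) ∈ (A + B).graph ↔
      ∃ α φ, (ψ, α) ∈ A.graph ∧ (ψ, φ) ∈ B.graph ∧ η = α + φ := by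
  constructor
  · intro h
    obtain ⟨y, hy, hη⟩ := (LinearPMap.mem_graph_iff _).1 h
    dsimp only at hy hη
    have hA : ψ ∈ A.domain := hy ▸ y.2.1
    have hB : ψ ∈ B.domain := hy ▸ y.2.2
    refine ⟨A ⟨ψ, hA⟩, B ⟨ψ, hB⟩, A.mem_graph ⟨ψ, hA⟩, B.mem_graph ⟨ψ, hB⟩, ?_⟩
    subst hy
    rw [← hη, LinearPMap.add_apply]
  · rintro ⟨α, φ, hA, hB, rfl⟩
    obtain ⟨y, hy, hα⟩ := (LinearPMap.mem_graph_iff _).1 hA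
    obtain ⟨z, hz, hφ⟩ := (LinearPMap.mem_graph_iff _).1 hB
    dsimp only at hy hα hz hφ
    subst hy
    refine (LinearPMap.mem_graph_iff _).2 ⟨⟨y, y.2, hz ▸ z.2⟩, rfl, ?_⟩
    rw [LinearPMap.add_apply, ← hα, ← hφ]
    congr 2
    exact Subtype.ext hz.symm

/-- This is the symmetry of a(f) + a(f)* against exponential vectors, and what makes the closure in
the definition of `field` a genuine operator. -/
theorem graph_ann_add_cre_le_expDual (f : OneBoson μ) :
    (ann f + cre f).graph ≤ expDual (fieldExp f) := by
  rintro ⟨ψ, η⟩ hp h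
  obtain ⟨α, φ, hA, hB, rfl⟩ := mem_graph_add_iff.1 hp
  have h1 := graph_ann_le_expDual f hA h
  obtain ⟨y, hy, hφ⟩ := (LinearPMap.mem_graph_iff _).1 hB
  obtain ⟨z, hz, hz'⟩ := (LinearPMap.mem_graph_iff _).1 (expVec_mem_graph_ann f h)
  dsimp only at hy hφ hz hz' h1 ⊢
  have h2 := (LinearPMap.adjoint_isFormalAdjoint (dense_domain_ann f)).symm z y
  rw [hz', hz, hy] at h2
  rw [fieldExp, inner_add_left, h1, h2, inner_add_right, add_comm, ← hφ]
  rfl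

theorem isClosed_graph_field (f : OneBoson μ) :
    IsClosed ((field f).graph : Set (Fock μ × Fock μ)) :=
  (isClosable_of_le_expDual (graph_ann_add_cre_le_expDual f)).closure_isClosed

theorem expVec_mem_graph_field (f g : OneBoson μ) : (expVec g, fieldExp f g) ∈ (field f).graph :=
  LinearPMap.le_graph_of_le (LinearPMap.le_closure _) <|
    mem_graph_add_iff.2 ⟨_, _, expVec_mem_graph_ann f g, expVec_mem_graph_cre f g, rfl⟩

end FieldOperator

/-! ### Closures of relatively bounded perturbations -/

section Lift

variable {E : Type*} [NormedAddCommGroup E] [NormedSpace ℂ E]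

/-- A relation that is small with respect to `G` can be added without changing closures. -/
theorem exists_mem_closure_of_relBound [CompleteSpace E] (G : Submodule ℂ (E × E × E)) {C : ℝ}
    (hC : 0 ≤ C) (hG : ∀ p ∈ G, ‖p.2.2‖ ≤ 1 / 2 * ‖p.2.1‖ + C * ‖p.1‖) {x c : ℂ} (hx : ‖x‖ ≤ 1)
    {ψ η : E}
    (h : (ψ, η) ∈ closure ((fun p : E × E × E => (p.1, p.2.1 + x • p.2.2 + c • p.1)) '' G)) :
    ∃ α φ, (ψ, α, φ) ∈ closure (G : Set (E × E × E)) ∧ η = α + x • φ + c • ψ := by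
  set L : (E × E × E) →L[ℂ] (E × E) := (ContinuousLinearMap.fst ℂ E (E × E)).prod
    (ContinuousLinearMap.fst ℂ E E ∘L ContinuousLinearMap.snd ℂ E (E × E) +
      x • (ContinuousLinearMap.snd ℂ E E ∘L ContinuousLinearMap.snd ℂ E (E × E)) +
      c • ContinuousLinearMap.fst ℂ E (E × E)) with hL
  have hLp : ∀ p, L p = (p.1, p.2.1 + x • p.2.2 + c • p.1) := fun p => rfl
  have hG' : ∀ p ∈ G.topologicalClosure, ‖p.2.2‖ ≤ 1 / 2 * ‖p.2.1‖ + C * ‖p.1‖ := by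
    intro p hp
    have hcl : IsClosed {p : E × E × E | ‖p.2.2‖ ≤ 1 / 2 * ‖p.2.1‖ + C * ‖p.1‖} :=
      isClosed_le (by fun_prop) (by fun_prop)
    exact closure_minimal hG hcl hp
  -- With relative bound 1/2 the second component can be absorbed: its norm is at most twice that of
  -- the perturbed sum, up to multiples of ‖p.1‖. So L is bounded below on the closure of G, and its
  -- range there is closed.
  have hbound : ∀ p : G.topologicalClosure,
      ‖p‖ ≤ ((5 + 3 * C + 2 * ‖c‖).toNNReal : ℝ) * ‖(L ∘L G.topologicalClosure.subtypeL) p‖ := by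
    rintro ⟨p, hp⟩
    have h1 := hG' p hp
    have h2 : ‖p.1‖ ≤ ‖L p‖ := norm_fst_le (L p)
    have h3 : ‖p.2.1 + x • p.2.2 + c • p.1‖ ≤ ‖L p‖ := norm_snd_le (L p)
    have h4 : ‖p.2.1‖ ≤ ‖p.2.1 + x • p.2.2 + c • p.1‖ + ‖p.2.2‖ + ‖c‖ * ‖p.1‖ := by
      have h5 : p.2.1 = (p.2.1 + x • p.2.2 + c • p.1) - x • p.2.2 - c • p.1 := by abel
      have h6 : ‖x • p.2.2‖ ≤ ‖p.2.2‖ := by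
        rw [norm_smul]
        exact mul_le_of_le_one_left (norm_nonneg _) hx
      calc ‖p.2.1‖ = ‖(p.2.1 + x • p.2.2 + c • p.1) - x • p.2.2 - c • p.1‖ := by rw [← h5]
        _ ≤ ‖p.2.1 + x • p.2.2 + c • p.1‖ + ‖x • p.2.2‖ + ‖c • p.1‖ :=
          (norm_sub_le _ _).trans (add_le_add_left (norm_sub_le _ _) _)
        _ ≤ _ := by
          rw [norm_smul c]
          linarith
    change ‖p‖ ≤ _ * ‖L p‖
    rw [Real.coe_toNNReal _ (by positivity)]
    have hc := norm_nonneg c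
    have hLn := norm_nonneg (L p)
    have h7 := mul_le_mul_of_nonneg_left h2 hC
    have h8 := mul_le_mul_of_nonneg_left h2 hc
    have h9 := mul_nonneg hC hLn
    have h10 := mul_nonneg hc hLn
    refine max_le ?_ (max_le ?_ ?_) <;> nlinarith
  have hanti := ContinuousLinearMap.antilipschitz_of_bound _ hbound
  have hcomp : CompleteSpace G.topologicalClosure :=
    G.isClosed_topologicalClosure.completeSpace_coe
  have hclosed := hanti.isClosed_range (ContinuousLinearMap.uniformContinuous _)
  have hsub : (fun p : E × E × E => (p.1, p.2.1 + x • p.2.2 + c • p.1)) '' G ⊆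
      range (L ∘L G.topologicalClosure.subtypeL) := by
    rintro _ ⟨p, hp, rfl⟩
    exact ⟨⟨p, G.le_topologicalClosure hp⟩, rfl⟩
  obtain ⟨⟨⟨ψ', α, φ⟩, hp⟩, hq⟩ := closure_minimal hsub hclosed h
  have h1 : ψ' = ψ := congrArg Prod.fst hq
  have h2 : α + x • φ + c • ψ' = η := congrArg Prod.snd hq
  subst h1
  exact ⟨α, φ, hp, h2.symm⟩

end Lift
/-! ### Van Hove operators as generators -/

section VanHove

variable {M : Type*} [MeasurableSpace M] {μ : Measure M} {ω : M → ℝ}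

/-- The multiplier `1/(1 + ω)`. -/
def resMul (ω : M → ℝ) (k : M) : ℝ := (1 + ω k)⁻¹

/-- The multiplier `√ω/(1 + ω)`. -/
def sqrtResMul (ω : M → ℝ) (k : M) : ℝ := Real.sqrt (ω k) * (1 + ω k)⁻¹

/-- The multiplier `ω/(1 + ω)`. -/
def mulResMul (ω : M → ℝ) (k : M) : ℝ := ω k * (1 + ω k)⁻¹

theorem bddMul_resMul (hω : Measurable ω) (hω_nonneg : ∀ k, 0 ≤ ω k) : BddMul (resMul ω) := by
  refine ⟨by unfold resMul; fun_prop, 1, fun k => ?_⟩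
  have := hω_nonneg k
  rw [resMul, abs_of_pos (inv_pos.2 (by linarith))]
  exact inv_le_one_of_one_le₀ (by linarith)

theorem bddMul_mulResMul (hω : Measurable ω) (hω_nonneg : ∀ k, 0 ≤ ω k) :
    BddMul (mulResMul ω) := by
  refine ⟨by unfold mulResMul; fun_prop, 1, fun k => ?_⟩
  have := hω_nonneg k
  rw [mulResMul, ← div_eq_mul_inv, abs_of_nonneg (by positivity), div_le_one (by linarith)]
  linarith

theorem bddMul_sqrtResMul (hω : Measurable ω) (hω_nonneg : ∀ k, 0 ≤ ω k) :
    BddMul (sqrtResMul ω) := by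
  refine ⟨by unfold sqrtResMul; fun_prop, 1, fun k => ?_⟩
  have := hω_nonneg k
  rw [sqrtResMul, ← div_eq_mul_inv, abs_of_nonneg (by positivity), div_le_one (by linarith),
    Real.sqrt_le_left (by linarith)]
  nlinarith

theorem bddMul_beta (hω : Measurable ω) (hω_nonneg : ∀ k, 0 ≤ ω k) {t : ℝ} (ht : 0 ≤ t) :
    BddMul fun k => beta t (ω k) :=
  ⟨(measurable_beta t).comp hω, t, fun k => by
    rw [abs_of_nonneg (beta_nonneg ht _)]
    exact beta_le ht (hω_nonneg k)⟩

theorem bddMul_one_add_mul_beta (hω : Measurable ω) (hω_nonneg : ∀ k, 0 ≤ ω k) {t : ℝ}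
    (ht : 0 ≤ t) : BddMul fun k => (1 + ω k) * beta t (ω k) := by
  refine ⟨(hω.const_add 1).mul ((measurable_beta t).comp hω), t + 1, fun k => ?_⟩
  have h0 := hω_nonneg k
  have h1 := beta_nonneg ht (ω k)
  rw [abs_of_nonneg (mul_nonneg (by linarith) h1), add_mul, one_mul]
  exact add_le_add (beta_le ht h0) (beta_mul_le_one t _)

theorem sub_eOp_eq (hω : Measurable ω) (hω_nonneg : ∀ k, 0 ≤ ω k) {t : ℝ} (ht : 0 ≤ t)
    (u : OneBoson μ) : mulOp μ (resMul ω) u - eOp μ ω t (mulOp μ (resMul ω) u) =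
      mulOp μ (fun k => beta t (ω k)) (mulOp μ (mulResMul ω) u) := by
  have hr := bddMul_resMul hω hω_nonneg
  have he := bddMul_exp hω hω_nonneg ht
  rw [eOp, mulOp_mul he hr, mulOp_sub hr (he.mul hr),
    mulOp_mul (bddMul_beta hω hω_nonneg ht) (bddMul_mulResMul hω hω_nonneg)]
  congr 2
  funext k
  simp only [resMul, mulResMul]
  linear_combination (-(1 + ω k)⁻¹) * mul_beta t (ω k)

theorem tendsto_inv_smul_beta (hω : Measurable ω) (hω_nonneg : ∀ k, 0 ≤ ω k) (f : OneBoson μ) :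
    Tendsto (fun t : ℝ≥0 => ((t : ℝ)⁻¹ : ℂ) • mulOp μ (fun k => beta t (ω k)) f)
      (𝓝[>] 0) (𝓝 f) := by
  have hm : ∀ (t : ℝ≥0) k, |(t : ℝ)⁻¹ * beta t (ω k)| ≤ 1 := fun t k => by
    have := inv_mul_beta_mem (hω_nonneg k) t.coe_nonneg
    exact abs_le.2 ⟨by linarith [this.1], this.2⟩
  have h := tendsto_mulOp (μ := μ) (l := 𝓝[>] (0 : ℝ≥0))
    (m := fun t k => (t : ℝ)⁻¹ * beta t (ω k)) (m₀ := fun _ => 1) (C := 1)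
    (fun t => ⟨((measurable_beta t).comp hω).const_mul _, 1, hm t⟩) measurable_const
    (Eventually.of_forall hm) (fun k => by simp) (ae_of_all _ fun k => tendsto_beta_div) f
  rw [mulOp_const, Complex.ofReal_one, one_smul] at h
  refine h.congr fun t => ?_
  rw [← Complex.ofReal_inv, mulOp_smul (bddMul_beta hω hω_nonneg t.coe_nonneg)]

/-- The range is the domain of multiplication by ω. The approximants (1 + ω/(n+1))⁻¹ g lie in it,
being (1 + ω)⁻¹ times the bounded multiplier (1 + ω)/(1 + ω/(n+1)) applied to g, and converge to g.
-/
theorem dense_range_resMul (hω : Measurable ω) (hω_nonneg : ∀ k, 0 ≤ ω k) :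
    DenseRange (mulOp μ (resMul ω)) := by
  intro g
  have hpos : ∀ (n : ℕ) k, 0 < 1 + ω k / (n + 1) := fun n k => by
    have := hω_nonneg k
    positivity
  have hb : ∀ n : ℕ, BddMul fun k => (1 + ω k) / (1 + ω k / (n + 1)) := fun n => by
    refine ⟨by fun_prop, n + 1, fun k => ?_⟩
    have h0 := hω_nonneg k
    rw [abs_of_nonneg (div_nonneg (by linarith) (hpos n k).le), div_le_iff₀ (hpos n k)]
    field_simp
    have : (0 : ℝ) ≤ n := n.cast_nonneg
    linarith
  have hb' : ∀ (n : ℕ) k, |resMul ω k * ((1 + ω k) / (1 + ω k / (n + 1)))| ≤ 1 := fun n k => by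
    have h0 := hω_nonneg k
    have h1 : 1 + ω k ≠ 0 := by linarith
    have h2 : resMul ω k * ((1 + ω k) / (1 + ω k / (n + 1))) = (1 + ω k / (n + 1))⁻¹ := by
      rw [resMul, ← mul_div_assoc, inv_mul_cancel₀ h1, one_div]
    rw [h2, abs_of_pos (inv_pos.2 (hpos n k))]
    refine inv_le_one_of_one_le₀ ?_
    have : 0 ≤ ω k / (n + 1) := by positivity
    linarith
  have h := tendsto_mulOp (μ := μ) (l := atTop)
    (m := fun (n : ℕ) k => resMul ω k * ((1 + ω k) / (1 + ω k / (n + 1)))) (m₀ := fun _ => 1) (C := 1)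
    (fun n => (bddMul_resMul hω hω_nonneg).mul (hb n)) measurable_const
    (Eventually.of_forall hb') (fun k => by simp) (ae_of_all _ fun k => ?_) g
  · rw [mulOp_const, Complex.ofReal_one, one_smul] at h
    refine mem_closure_of_tendsto h (Eventually.of_forall fun n => ?_)
    rw [← mulOp_mul (bddMul_resMul hω hω_nonneg) (hb n)]
    exact mem_range_self _
  · have h0 := hω_nonneg k
    have h1 : 1 + ω k ≠ 0 := by linarith
    have h2 : Tendsto (fun n : ℕ => (1 + ω k * (1 / ((n : ℝ) + 1)))⁻¹) atTop (𝓝 (1 + ω k * 0)⁻¹) :=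
      ((tendsto_one_div_add_atTop_nhds_zero_nat.const_mul _).const_add 1).inv₀ (by simp)
    simp only [mul_zero, add_zero, inv_one] at h2
    refine h2.congr fun n => ?_
    simp only [resMul]
    rw [div_eq_mul_inv (1 + ω k), inv_mul_cancel_left₀ h1, mul_one_div]

variable [SigmaFinite μ]

theorem genRel_gammaOp_dExp (hω : Measurable ω) (hω_nonneg : ∀ k, 0 ≤ ω k) (u : OneBoson μ) :
    GenRel (fun t : ℝ≥0 => gammaOp ω t) (expVec (mulOp μ (resMul ω) u))
      (dExp (mulOp μ (resMul ω) u) (mulOp μ (mulResMul ω) u)) := by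
  have h := tendsto_expVec_sub (g := mulOp μ (resMul ω) u) (l := 𝓝[>] (0 : ℝ≥0))
    (s := fun t => (t : ℝ)) (u := fun t => eOp μ ω t (mulOp μ (resMul ω) u))
    (η := mulOp μ (mulResMul ω) u) tendsto_coe_nhdsGT_zero
    ((tendsto_inv_smul_beta hω hω_nonneg (mulOp μ (mulResMul ω) u)).congr fun t => by
      rw [sub_eOp_eq hω hω_nonneg t.coe_nonneg])
  rw [GenRel]
  refine h.congr fun t => ?_
  rw [gammaOp_expVec hω hω_nonneg t.coe_nonneg]

theorem dense_span_expVec_resMul (hω : Measurable ω) (hω_nonneg : ∀ k, 0 ≤ ω k) :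
    Dense (Submodule.span ℂ (range fun u : OneBoson μ => expVec (mulOp μ (resMul ω) u)) :
      Set (Fock μ)) := by
  have h1 : (Submodule.span ℂ (range (expVec : OneBoson μ → Fock μ)) : Set (Fock μ)) ⊆
      closure (Submodule.span ℂ (range fun u : OneBoson μ => expVec (mulOp μ (resMul ω) u))) := by
    rw [← Submodule.topologicalClosure_coe]
    refine SetLike.coe_subset_coe.2 (Submodule.span_le.2 ?_)
    rintro _ ⟨g, rfl⟩
    rw [Submodule.topologicalClosure_coe]
    have h2 := (dense_range_resMul (μ := μ) hω hω_nonneg).closure_eq ▸ mem_univ g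
    have h3 := image_closure_subset_closure_image continuous_expVec (mem_image_of_mem expVec h2)
    refine closure_mono ?_ h3
    rintro _ ⟨_, ⟨u, rfl⟩, rfl⟩
    exact Submodule.subset_span ⟨u, rfl⟩
  rw [← dense_closure]
  exact dense_span_expVec.mono h1

/-- The data of a regular form factor: `f = √ω e` and `w₀ = f/(√ω + ω)`. -/
structure IsRegularPair (ω : M → ℝ) (f e w₀ : OneBoson μ) : Prop where
  res : mulOp μ (resMul ω) f = mulOp μ (sqrtResMul ω) e
  eq_weight : w₀ = mulOp μ (fun k => (1 + Real.sqrt (ω k))⁻¹) e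

theorem bddMul_inv_one_add_sqrt (hω : Measurable ω) :
    BddMul fun k => (1 + Real.sqrt (ω k))⁻¹ := by
  refine ⟨by fun_prop, 1, fun k => ?_⟩
  have := Real.sqrt_nonneg (ω k)
  rw [abs_of_pos (inv_pos.2 (by linarith))]
  exact inv_le_one_of_one_le₀ (by linarith)

variable {f e w₀ : OneBoson μ}

theorem IsRegularPair.mulOp_sMul (h : IsRegularPair ω f e w₀) (hω : Measurable ω)
    (hω_nonneg : ∀ k, 0 ≤ ω k) {x : ℝ} (hx : x ^ 2 = 1) {t : ℝ} (ht : 0 ≤ t) :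
    mulOp μ (sMul ω x t) w₀ = (x : ℂ) • mulOp μ (fun k => beta t (ω k)) f := by
  have hs := bddMul_sMul hω hω_nonneg hx ht
  have hb := bddMul_one_add_mul_beta hω hω_nonneg ht
  have hr := bddMul_resMul hω hω_nonneg
  have hq := bddMul_sqrtResMul hω hω_nonneg
  have h1 : mulOp μ (fun k => beta t (ω k)) f =
      mulOp μ (fun k => (1 + ω k) * beta t (ω k)) (mulOp μ (resMul ω) f) := by
    rw [mulOp_mul hb hr]
    congr 2
    funext k
    have : 1 + ω k ≠ 0 := by linarith [hω_nonneg k]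
    rw [resMul]
    field_simp
  rw [h1, h.res, h.eq_weight, mulOp_mul hs (bddMul_inv_one_add_sqrt hω), mulOp_mul hb hq,
    mulOp_smul (hb.mul hq)]
  congr 2
  funext k
  have h2 : 1 + ω k ≠ 0 := by linarith [hω_nonneg k]
  have h3 : 1 + Real.sqrt (ω k) ≠ 0 := by linarith [Real.sqrt_nonneg (ω k)]
  have h4 : rho ω k = Real.sqrt (ω k) * (1 + Real.sqrt (ω k)) := by
    rw [rho, mul_add, mul_one, Real.mul_self_sqrt (hω_nonneg k)]
  rw [sMul, sqrtResMul, h4]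
  field_simp

theorem IsRegularPair.inner_cMul (h : IsRegularPair ω f e w₀) (hω : Measurable ω)
    (hω_nonneg : ∀ k, 0 ≤ ω k) {t : ℝ} (ht : 0 ≤ t) :
    ⟪w₀, mulOp μ (cMul ω t) w₀⟫_ℂ = ⟪e, mulOp μ (fun k => beta t (ω k)) e⟫_ℂ := by
  have hp := bddMul_inv_one_add_sqrt hω
  have hc := bddMul_cMul hω hω_nonneg ht
  rw [h.eq_weight, inner_mulOp_left hp, mulOp_mul hc hp, mulOp_mul hp (hc.mul hp)]
  congr 3
  funext k
  have h3 : 1 + Real.sqrt (ω k) ≠ 0 := by linarith [Real.sqrt_nonneg (ω k)]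
  rw [cMul]
  field_simp

theorem IsRegularPair.inner_resMul (h : IsRegularPair ω f e w₀) (hω : Measurable ω)
    (hω_nonneg : ∀ k, 0 ≤ ω k) (u : OneBoson μ) :
    ⟪f, mulOp μ (resMul ω) u⟫_ℂ = ⟪e, mulOp μ (sqrtResMul ω) u⟫_ℂ := by
  rw [← inner_mulOp_left (bddMul_resMul hω hω_nonneg), h.res,
    inner_mulOp_left (bddMul_sqrtResMul hω hω_nonneg)]

/-- The core triples `(ε(g), dΓ(ω) ε(g), φ(f) ε(g))` for `g` in the domain of `ω`. -/
def coreTriple (ω : M → ℝ) (f u : OneBoson μ) : Fock μ × Fock μ × Fock μ :=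
  (expVec (mulOp μ (resMul ω) u), dExp (mulOp μ (resMul ω) u) (mulOp μ (mulResMul ω) u),
    fieldExp f (mulOp μ (resMul ω) u))

/-- Here a and b stand for the norms of a(f)ψ and a(f)*ψ, and p, q for those of ψ and dΓ(ω)ψ. The
arithmetic-geometric mean inequality is weighted to give a ≤ q/4 + e² p, since a enters twice and
the total coefficient of q has to be 1/2. -/
theorem add_le_of_sq_le {a b e f p q : ℝ} (ha : 0 ≤ a) (hb : 0 ≤ b) (hf : 0 ≤ f) (hp : 0 ≤ p)
    (hq : 0 ≤ q) (h1 : a ^ 2 ≤ e ^ 2 * (p * q)) (h2 : b ^ 2 = f ^ 2 * p ^ 2 + a ^ 2) :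
    a + b ≤ 1 / 2 * q + (2 * e ^ 2 + f) * p := by
  have h3 : a ≤ 1 / 4 * q + e ^ 2 * p := by
    refine (sq_le_sq₀ (by positivity) (by positivity)).1 ?_
    nlinarith [sq_nonneg (1 / 4 * q - e ^ 2 * p)]
  have h4 : b ≤ f * p + a := by
    refine (sq_le_sq₀ (by positivity) (by positivity)).1 ?_
    rw [h2]
    nlinarith [mul_nonneg (mul_nonneg hf hp) ha]
  linarith

/-- φ(f) is small relative to dΓ(ω) on the core. The annihilation part A satisfies ‖A‖² ≤ ‖f/√ω‖²
‖ψ‖ ‖dΓ(ω)ψ‖, and the creation part B is controlled by A through the commutation relations. -/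
theorem IsRegularPair.norm_le (h : IsRegularPair ω f e w₀) (hω : Measurable ω)
    (hω_nonneg : ∀ k, 0 ≤ ω k) {p : Fock μ × Fock μ × Fock μ}
    (hp : p ∈ Submodule.span ℂ (range (coreTriple ω f))) :
    ‖p.2.2‖ ≤ 1 / 2 * ‖p.2.1‖ + (2 * ‖e‖ ^ 2 + ‖f‖) * ‖p.1‖ := by
  obtain ⟨c, rfl⟩ := Finsupp.mem_span_range_iff_exists_finsupp.1 hp
  have hr := bddMul_resMul hω hω_nonneg
  have hq := bddMul_sqrtResMul hω hω_nonneg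
  have hm := bddMul_mulResMul hω hω_nonneg
  set s := c.support
  set g : OneBoson μ → OneBoson μ := fun u => mulOp μ (resMul ω) u with hg
  set g₁ : OneBoson μ → OneBoson μ := fun u => mulOp μ (sqrtResMul ω) u with hg₁
  set g₂ : OneBoson μ → OneBoson μ := fun u => mulOp μ (mulResMul ω) u with hg₂
  have hfg : ∀ u, ⟪f, g u⟫_ℂ = ⟪e, g₁ u⟫_ℂ := h.inner_resMul hω hω_nonneg
  have hgg : ∀ u u', ⟪g₁ u, g₁ u'⟫_ℂ = ⟪g u, g₂ u'⟫_ℂ := fun u u' => by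
    rw [hg, hg₁, hg₂]
    dsimp only
    rw [inner_mulOp_left hq, inner_mulOp_left hr, mulOp_mul hq hq, mulOp_mul hr hm]
    congr 3
    funext k
    have := Real.mul_self_sqrt (hω_nonneg k)
    rw [sqrtResMul, resMul, mulResMul]
    linear_combination (1 + ω k)⁻¹ ^ 2 * this
  set ψ : Fock μ := ∑ u ∈ s, c u • expVec (g u) with hψ
  set α : Fock μ := ∑ u ∈ s, c u • dExp (g u) (g₂ u) with hα
  set A : Fock μ := ∑ u ∈ s, (c u * ⟪e, g₁ u⟫_ℂ) • expVec (g u) with hA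
  set B : Fock μ := ∑ u ∈ s, c u • dExp (g u) f with hB
  have e1 : (c.sum fun i a => a • coreTriple ω f i) = (ψ, α, A + B) := by
    rw [Finsupp.sum]
    refine Prod.ext ?_ (Prod.ext ?_ ?_)
    · rw [Prod.fst_sum]
      rfl
    · rw [Prod.snd_sum, Prod.fst_sum]
      rfl
    · rw [Prod.snd_sum, Prod.snd_sum, hA, hB, ← Finset.sum_add_distrib]
      refine Finset.sum_congr rfl fun u _ => ?_
      change c u • (⟪f, g u⟫_ℂ • expVec (g u) + dExp (g u) f) = _
      rw [smul_add, smul_smul, hfg]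
  rw [e1]
  have hAψ : ‖A‖ ^ 2 ≤ ‖e‖ ^ 2 * (‖ψ‖ * ‖α‖) := by
    have h1 := norm_sum_inner_smul_sq_le s c g₁ (fun u => expVec (g u)) e
    refine h1.trans (mul_le_mul_of_nonneg_left ?_ (sq_nonneg _))
    have h2 : ⟪ψ, α⟫_ℂ = ∑ i ∈ s, ∑ j ∈ s,
        starRingEnd ℂ (c i) * c j * (⟪g₁ i, g₁ j⟫_ℂ * ⟪expVec (g i), expVec (g j)⟫_ℂ) := by
      rw [hψ, hα, sum_inner]
      refine Finset.sum_congr rfl fun i _ => ?_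
      rw [inner_sum]
      refine Finset.sum_congr rfl fun j _ => ?_
      rw [inner_smul_left, inner_smul_right, inner_expVec_dExp, hgg, inner_expVec]
      ring
    rw [← h2]
    exact (Complex.re_le_norm _).trans (norm_inner_le_norm _ _)
  -- The canonical commutation relation ‖a(f)*ψ‖² = ‖a(f)ψ‖² + ‖f‖² ‖ψ‖², read off from the Gram
  -- kernel of the derivatives `dExp`.
  have hBA : ‖B‖ ^ 2 = ‖f‖ ^ 2 * ‖ψ‖ ^ 2 + ‖A‖ ^ 2 := by
    have h1 : ((‖B‖ ^ 2 : ℝ) : ℂ) = ((‖f‖ ^ 2 * ‖ψ‖ ^ 2 + ‖A‖ ^ 2 : ℝ) : ℂ) := by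
      rw [Complex.ofReal_add, Complex.ofReal_mul, hB, hψ, hA, norm_sum_smul_sq, norm_sum_smul_sq,
        norm_sum_smul_sq, Finset.mul_sum, ← Finset.sum_add_distrib]
      refine Finset.sum_congr rfl fun i _ => ?_
      rw [Finset.mul_sum, ← Finset.sum_add_distrib]
      refine Finset.sum_congr rfl fun j _ => ?_
      have h2 : ⟪f, f⟫_ℂ = ((‖f‖ ^ 2 : ℝ) : ℂ) := by
        rw [inner_self_eq_norm_sq_to_K]
        simp
      rw [inner_dExp_dExp, inner_expVec, map_mul, ← hfg, ← hfg, inner_conj_symm, h2]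
      ring
    exact_mod_cast h1
  exact (norm_add_le _ _).trans (add_le_of_sq_le (norm_nonneg _) (norm_nonneg _) (norm_nonneg _)
    (norm_nonneg _) (norm_nonneg _) hAψ hBA)

/-- A product rule for exp(κ_t) ε(w_t): the scalar contributes ‖e‖² + x⟨f, g⟩ and the vector
contributes `dExp g (ω g + x f)`. Regularity of f makes κ and w differentiable at t = 0. -/
theorem IsRegularPair.genRel_sOp (h : IsRegularPair ω f e w₀) (hω : Measurable ω)
    (hω_nonneg : ∀ k, 0 ≤ ω k) {x : ℝ} (hx : x ^ 2 = 1) (u : OneBoson μ) :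
    GenRel (fun t : ℝ≥0 => sOp ω w₀ x t) (coreTriple ω f u).1
      ((coreTriple ω f u).2.1 + (x : ℂ) • (coreTriple ω f u).2.2 +
        ((‖e‖ ^ 2 : ℝ) : ℂ) • (coreTriple ω f u).1) := by
  set g := mulOp μ (resMul ω) u with hg
  have hb := tendsto_inv_smul_beta (μ := μ) hω hω_nonneg
  set κ : ℝ≥0 → ℂ := fun t => -⟪e, mulOp μ (fun k => beta t (ω k)) e⟫_ℂ -
    x * ⟪mulOp μ (fun k => beta t (ω k)) f, g⟫_ℂ with hκ
  set w : ℝ≥0 → OneBoson μ := fun t =>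
    eOp μ ω t g - (x : ℂ) • mulOp μ (fun k => beta t (ω k)) f with hw
  have hS : ∀ t : ℝ≥0, sOp ω w₀ x t (expVec g) = Complex.exp (κ t) • expVec (w t) := fun t => by
    rw [(sOp_expVec_and_norm hω hω_nonneg w₀ hx t.coe_nonneg).1, affineExp,
      h.mulOp_sMul hω hω_nonneg hx t.coe_nonneg, h.inner_cMul hω hω_nonneg t.coe_nonneg,
      inner_smul_left, Complex.conj_ofReal]
  have ht0 : Tendsto (fun t : ℝ≥0 => ((t : ℝ) : ℂ)) (𝓝[>] 0) (𝓝 0) := by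
    have := (Complex.continuous_ofReal.tendsto 0).comp
      (tendsto_coe_nhdsGT_zero.mono_right nhdsWithin_le_nhds)
    simpa [Function.comp_def] using this
  have htne : ∀ᶠ t : ℝ≥0 in 𝓝[>] 0, ((t : ℝ) : ℂ) ≠ 0 := by
    filter_upwards [self_mem_nhdsWithin] with t ht
    exact_mod_cast (show (0 : ℝ≥0) < t from ht).ne'
  have hκ1 : Tendsto (fun t : ℝ≥0 => ((t : ℝ) : ℂ)⁻¹ * κ t) (𝓝[>] 0)
      (𝓝 (-⟪e, e⟫_ℂ - x * ⟪f, g⟫_ℂ)) := by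
    have h1 := ((tendsto_const_nhds (x := e)).inner (𝕜 := ℂ) (hb e)).neg.sub
      (((hb f).inner (𝕜 := ℂ) (tendsto_const_nhds (x := g))).const_mul (x : ℂ))
    refine h1.congr fun t => ?_
    rw [inner_smul_right, inner_smul_left, ← Complex.ofReal_inv, Complex.conj_ofReal, hκ]
    ring
  have hκ0 : Tendsto κ (𝓝[>] 0) (𝓝 0) := by
    have h1 := ht0.mul hκ1
    rw [zero_mul] at h1
    refine h1.congr' ?_
    filter_upwards [htne] with t ht
    rw [mul_inv_cancel_left₀ ht]
  have hexp : Tendsto (fun t => Complex.exp (κ t)) (𝓝[>] 0) (𝓝 1) := by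
    have := (Complex.continuous_exp.tendsto 0).comp hκ0
    simpa [Function.comp_def] using this
  -- The divided slope of exp at 0 gives e^κ - 1 = κ · slope(κ) also where κ vanishes, so no
  -- division by κ_t is needed.
  have hexp1 : Tendsto (fun t : ℝ≥0 => ((t : ℝ) : ℂ)⁻¹ * (1 - Complex.exp (κ t))) (𝓝[>] 0)
      (𝓝 (⟪e, e⟫_ℂ + x * ⟪f, g⟫_ℂ)) := by
    have h1 : ContinuousAt (dslope Complex.exp 0) 0 :=
      continuousAt_dslope_same.2 Complex.differentiable_exp.differentiableAt
    have h2 := (hκ1.mul (h1.tendsto.comp hκ0)).neg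
    rw [dslope_same, Complex.deriv_exp, Complex.exp_zero, mul_one, neg_sub, sub_neg_eq_add,
      add_comm] at h2
    refine h2.congr fun t => ?_
    have h3 := sub_smul_dslope Complex.exp 0 (κ t)
    rw [smul_eq_mul, sub_zero, Complex.exp_zero] at h3
    simp only [Function.comp_apply]
    linear_combination (-((t : ℝ) : ℂ)⁻¹) * h3
  have hu : Tendsto (fun t : ℝ≥0 => ((t : ℝ) : ℂ)⁻¹ • (g - w t)) (𝓝[>] 0)
      (𝓝 (mulOp μ (mulResMul ω) u + (x : ℂ) • f)) := by
    refine ((hb (mulOp μ (mulResMul ω) u)).add ((hb f).const_smul (x : ℂ))).congr fun t => ?_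
    rw [← sub_eOp_eq hω hω_nonneg t.coe_nonneg, smul_comm, ← smul_add]
    congr 1
    simp only [hw]
    rw [sub_sub_eq_add_sub, sub_add_eq_add_sub]
  have hmain := (hexp1.smul (tendsto_const_nhds (x := expVec g))).add
    (hexp.smul (tendsto_expVec_sub tendsto_coe_nhdsGT_zero hu))
  have he : ⟪e, e⟫_ℂ = ((‖e‖ ^ 2 : ℝ) : ℂ) := by
    rw [inner_self_eq_norm_sq_to_K]
    simp
  have hlim : (⟪e, e⟫_ℂ + x * ⟪f, g⟫_ℂ) • expVec g +
      (1 : ℂ) • dExp g (mulOp μ (mulResMul ω) u + (x : ℂ) • f) =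
      (coreTriple ω f u).2.1 + (x : ℂ) • (coreTriple ω f u).2.2 +
        ((‖e‖ ^ 2 : ℝ) : ℂ) • (coreTriple ω f u).1 := by
    simp only [coreTriple, fieldExp, ← hg]
    rw [dExp_add, dExp_smul, he, one_smul, add_smul, smul_add, mul_smul]
    abel
  rw [hlim] at hmain
  refine hmain.congr fun t => ?_
  change _ = ((t : ℝ)⁻¹ : ℂ) • (expVec g - sOp ω w₀ x t (expVec g))
  rw [hS, mul_smul, smul_comm (Complex.exp (κ t)), ← smul_add]
  congr 1
  rw [sub_smul, one_smul, smul_sub]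
  abel

theorem GenRel.apply {E : Type*} [NormedAddCommGroup E] [NormedSpace ℂ E] {T : ℝ≥0 → E →L[ℂ] E}
    (hT : IsContractionSemigroup T) {ψ η : E} (h : GenRel T ψ η) (s : ℝ≥0) :
    GenRel T (T s ψ) (T s η) := by
  refine (((T s).continuous.tendsto _).comp h).congr fun t => ?_
  have h1 : T t (T s ψ) = T s (T t ψ) := by
    rw [← mul_apply_eq_comp, ← mul_apply_eq_comp, ← hT.add, ← hT.add, add_comm]
  simp only [Function.comp_apply, map_smul, map_sub, h1]

theorem GenRel.span {E : Type*} [NormedAddCommGroup E] [NormedSpace ℂ E] {T : ℝ≥0 → E →L[ℂ] E}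
    {S : Set (E × E)} (hS : ∀ p ∈ S, GenRel T p.1 p.2) {p : E × E}
    (hp : p ∈ Submodule.span ℂ S) : GenRel T p.1 p.2 := by
  induction hp using Submodule.span_induction with
  | mem p hp => exact hS p hp
  | zero => simp [GenRel]
  | add p q _ _ hp hq => exact hp.add hq
  | smul c p _ hp => exact hp.smul c

/-- A core criterion: vectors of a total set that are permuted by the semigroup up to scalars. -/
theorem genRel_mem_closure_span {E ι : Type*} [NormedAddCommGroup E] [NormedSpace ℂ E]
    [CompleteSpace E] {T : ℝ≥0 → E →L[ℂ] E} (hT : IsContractionSemigroup T) (L : ι → E × E)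
    (hL : ∀ u, GenRel T (L u).1 (L u).2)
    (hinv : ∀ u t, ∃ (c : ℂ) (u' : ι), T t (L u).1 = c • (L u').1)
    (hdense : Dense (Submodule.span ℂ (range fun u => (L u).1) : Set E)) {ψ η : E}
    (h : GenRel T ψ η) : (ψ, η) ∈ closure (Submodule.span ℂ (range L) : Set (E × E)) := by
  refine genRel_mem_closure hT (fun p hp => GenRel.span ?_ hp) (fun p hp t => ?_) ?_ h
  · rintro _ ⟨u, rfl⟩
    exact hL u
  · induction hp using Submodule.span_induction with
    | mem p hp =>
      obtain ⟨u, rfl⟩ := hp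
      obtain ⟨c, u', hu'⟩ := hinv u t
      have h1 : T t (L u).2 = c • (L u').2 := by
        have h2 := (hL u).apply hT t
        rw [hu'] at h2
        exact h2.unique ((hL u').smul c)
      rw [hu', h1]
      exact Submodule.smul_mem _ c (Submodule.subset_span ⟨u', rfl⟩)
    | zero =>
      simp only [Prod.fst_zero, Prod.snd_zero, map_zero]
      exact Submodule.zero_mem _
    | add p q _ _ hp hq =>
      simp only [Prod.fst_add, Prod.snd_add, map_add]
      exact Submodule.add_mem _ hp hq
    | smul c p _ hp =>
      simp only [Prod.smul_fst, Prod.smul_snd, map_smul]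
      exact Submodule.smul_mem _ c hp
  · have h1 : Prod.fst '' (Submodule.span ℂ (range L) : Set (E × E)) =
        Submodule.span ℂ (range fun u => (L u).1) := by
      have h2 := Submodule.map_span (LinearMap.fst ℂ E E) (range L)
      rw [← range_comp] at h2
      have h3 := congrArg (fun S : Submodule ℂ E => (S : Set E)) h2
      simpa [Submodule.map_coe, Function.comp_def] using h3
    rw [h1]
    exact hdense

variable (ω f) in
/-- The span of the core triples. -/
def coreSpan : Submodule ℂ (Fock μ × Fock μ × Fock μ) :=
  Submodule.span ℂ (range (coreTriple ω f))

variable (ω f) in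
/-- The core of the combination `dΓ(ω) + x φ(f) + c`. -/
def corePair (x c : ℂ) (u : OneBoson μ) : Fock μ × Fock μ :=
  ((coreTriple ω f u).1,
    (coreTriple ω f u).2.1 + x • (coreTriple ω f u).2.2 + c • (coreTriple ω f u).1)

theorem span_corePair (x c : ℂ) :
    (Submodule.span ℂ (range (corePair ω f x c)) : Set (Fock μ × Fock μ)) =
      (fun p : Fock μ × Fock μ × Fock μ => (p.1, p.2.1 + x • p.2.2 + c • p.1)) '' coreSpan ω f := by
  set L : (Fock μ × Fock μ × Fock μ) →ₗ[ℂ] (Fock μ × Fock μ) :=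
    (LinearMap.fst ℂ (Fock μ) (Fock μ × Fock μ)).prod
    (LinearMap.fst ℂ (Fock μ) (Fock μ) ∘ₗ LinearMap.snd ℂ (Fock μ) (Fock μ × Fock μ) +
      x • (LinearMap.snd ℂ (Fock μ) (Fock μ) ∘ₗ LinearMap.snd ℂ (Fock μ) (Fock μ × Fock μ)) +
      c • LinearMap.fst ℂ (Fock μ) (Fock μ × Fock μ))
  have h1 := Submodule.map_span L (range (coreTriple ω f))
  rw [← range_comp] at h1
  exact (congrArg (fun S : Submodule ℂ (Fock μ × Fock μ) => (S : Set (Fock μ × Fock μ)))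
    h1).symm

theorem mem_graph_field_of_mem_closure {p : Fock μ × Fock μ × Fock μ}
    (hp : p ∈ closure (coreSpan ω f : Set (Fock μ × Fock μ × Fock μ))) :
    (p.1, p.2.2) ∈ (field f).graph := by
  have hle : coreSpan ω f ≤ (field f).graph.comap
      ((LinearMap.fst ℂ (Fock μ) (Fock μ × Fock μ)).prod
      (LinearMap.snd ℂ (Fock μ) (Fock μ) ∘ₗ LinearMap.snd ℂ (Fock μ) (Fock μ × Fock μ))) := by
    rw [coreSpan, Submodule.span_le]
    rintro _ ⟨u, rfl⟩
    exact expVec_mem_graph_field f _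
  have hcl : IsClosed {p : Fock μ × Fock μ × Fock μ | (p.1, p.2.2) ∈ (field f).graph} :=
    (isClosed_graph_field f).preimage (by fun_prop)
  exact closure_minimal (fun q hq => hle hq) hcl hp

theorem genRel_of_mem_closure {T : ℝ≥0 → Fock μ →L[ℂ] Fock μ} (hT : IsContractionSemigroup T)
    {x c : ℂ} (hg : ∀ u, GenRel T (corePair ω f x c u).1 (corePair ω f x c u).2)
    {p : Fock μ × Fock μ × Fock μ}
    (hp : p ∈ closure (coreSpan ω f : Set (Fock μ × Fock μ × Fock μ))) :
    GenRel T p.1 (p.2.1 + x • p.2.2 + c • p.1) := by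
  have hcl : IsClosed {p : Fock μ × Fock μ × Fock μ |
      GenRel T p.1 (p.2.1 + x • p.2.2 + c • p.1)} :=
    (isClosed_genRel hT).preimage
      (f := fun p : Fock μ × Fock μ × Fock μ => (p.1, p.2.1 + x • p.2.2 + c • p.1))
      (by fun_prop)
  refine closure_minimal (fun q hq => ?_) hcl hp
  have h1 : (q.1, q.2.1 + x • q.2.2 + c • q.1) ∈
      (Submodule.span ℂ (range (corePair ω f x c)) : Set (Fock μ × Fock μ)) := by
    rw [span_corePair]
    exact ⟨q, hq, rfl⟩
  refine GenRel.span (S := range (corePair ω f x c)) ?_ h1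
  rintro _ ⟨u, rfl⟩
  exact hg u

theorem eOp_resMul (hω : Measurable ω) (hω_nonneg : ∀ k, 0 ≤ ω k) {t : ℝ} (ht : 0 ≤ t)
    (u : OneBoson μ) :
    eOp μ ω t (mulOp μ (resMul ω) u) = mulOp μ (resMul ω) (eOp μ ω t u) := by
  have he := bddMul_exp hω hω_nonneg ht
  have hr := bddMul_resMul hω hω_nonneg
  rw [eOp, mulOp_mul he hr, mulOp_mul hr he]
  simp only [mul_comm]

theorem mulOp_beta_eq_resMul (hω : Measurable ω) (hω_nonneg : ∀ k, 0 ≤ ω k) {t : ℝ} (ht : 0 ≤ t)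
    (f : OneBoson μ) : mulOp μ (fun k => beta t (ω k)) f =
      mulOp μ (resMul ω) (mulOp μ (fun k => (1 + ω k) * beta t (ω k)) f) := by
  rw [mulOp_mul (bddMul_resMul hω hω_nonneg) (bddMul_one_add_mul_beta hω hω_nonneg ht)]
  congr 2
  funext k
  have : 1 + ω k ≠ 0 := by linarith [hω_nonneg k]
  rw [resMul, inv_mul_cancel_left₀ this]

theorem exists_gammaOp_corePair (hω : Measurable ω) (hω_nonneg : ∀ k, 0 ≤ ω k) {t : ℝ}
    (ht : 0 ≤ t) (x c : ℂ) (u : OneBoson μ) : ∃ (z : ℂ) (u' : OneBoson μ),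
      gammaOp ω t (corePair ω f x c u).1 = z • (corePair ω f x c u').1 := by
  refine ⟨1, eOp μ ω t u, (gammaOp_expVec hω hω_nonneg ht _).trans ?_⟩
  rw [eOp_resMul hω hω_nonneg ht, one_smul]
  rfl

theorem IsRegularPair.exists_sOp_corePair (h : IsRegularPair ω f e w₀) (hω : Measurable ω)
    (hω_nonneg : ∀ k, 0 ≤ ω k) {x : ℝ} (hx : x ^ 2 = 1) {t : ℝ} (ht : 0 ≤ t) (y c : ℂ)
    (u : OneBoson μ) : ∃ (z : ℂ) (u' : OneBoson μ),
      sOp ω w₀ x t (corePair ω f y c u).1 = z • (corePair ω f y c u').1 := by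
  refine ⟨Complex.exp (-⟪w₀, mulOp μ (cMul ω t) w₀⟫_ℂ -
      ⟪mulOp μ (sMul ω x t) w₀, mulOp μ (resMul ω) u⟫_ℂ), eOp μ ω t u - (x : ℂ) • mulOp μ (fun k => (1 + ω k) * beta t (ω k)) f,
    ((sOp_expVec_and_norm hω hω_nonneg w₀ hx ht).1 _).trans ?_⟩
  have h1 : eOp μ ω t (mulOp μ (resMul ω) u) - mulOp μ (sMul ω x t) w₀ = mulOp μ (resMul ω)
      (eOp μ ω t u - (x : ℂ) • mulOp μ (fun k => (1 + ω k) * beta t (ω k)) f) := by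
    rw [h.mulOp_sMul hω hω_nonneg hx ht, eOp_resMul hω hω_nonneg ht,
      mulOp_beta_eq_resMul hω hω_nonneg ht, map_sub, map_smul]
  rw [affineExp, h1]
  rfl

/-- The van Hove operator of a regular form factor is the generator of its semigroup. -/
theorem IsRegularPair.mem_graph_iff (h : IsRegularPair ω f e w₀) (hω : Measurable ω)
    (hω_nonneg : ∀ k, 0 ≤ ω k) {x : ℝ} (hx : x ^ 2 = 1) (ψ η : Fock μ) :
    (∃ α φ, GenRel (fun t : ℝ≥0 => gammaOp ω t) ψ α ∧ (ψ, φ) ∈ (field f).graph ∧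
      η = α + (x : ℂ) • φ + ((‖e‖ ^ 2 : ℝ) : ℂ) • ψ) ↔
      GenRel (fun t : ℝ≥0 => sOp ω w₀ x t) ψ η := by
  have hSc := isContractionSemigroup_sOp hω hω_nonneg w₀ hx
  have hΓc := isContractionSemigroup_gammaOp (μ := μ) hω hω_nonneg
  have hbound : ∀ p ∈ coreSpan ω f,
      ‖p.2.2‖ ≤ 1 / 2 * ‖p.2.1‖ + (2 * ‖e‖ ^ 2 + ‖f‖) * ‖p.1‖ :=
    fun p hp => h.norm_le hω hω_nonneg hp
  have hC : 0 ≤ 2 * ‖e‖ ^ 2 + ‖f‖ := by positivity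
  have hxn : ‖(x : ℂ)‖ ≤ 1 := by
    rw [Complex.norm_real, Real.norm_eq_abs, ← sq_le_one_iff_abs_le_one, hx]
  have h0n : ‖(0 : ℂ)‖ ≤ 1 := by simp
  set c : ℂ := ((‖e‖ ^ 2 : ℝ) : ℂ) with hc
  have hS : ∀ u, GenRel (fun t : ℝ≥0 => sOp ω w₀ x t) (corePair ω f x c u).1
      (corePair ω f x c u).2 := h.genRel_sOp hω hω_nonneg hx
  have hΓ : ∀ u, GenRel (fun t : ℝ≥0 => gammaOp ω t) (corePair ω f 0 0 u).1
      (corePair ω f 0 0 u).2 := fun u => by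
    rw [corePair, zero_smul, zero_smul, add_zero, add_zero]
    exact genRel_gammaOp_dExp hω hω_nonneg u
  have hdense := dense_span_expVec_resMul (μ := μ) hω hω_nonneg
  constructor
  · rintro ⟨α, φ, h1, h2, rfl⟩
    -- The graph of dΓ(ω) is the closure of its restriction to the core. The relative bound lifts
    -- this to convergence of whole core triples, so the field component converges too and must be φ
    -- because the graph of φ(f) is closed.
    have h3 := genRel_mem_closure_span hΓc (corePair ω f 0 0) hΓ
      (fun u t => exists_gammaOp_corePair hω hω_nonneg t.coe_nonneg 0 0 u) hdense h1
    rw [span_corePair] at h3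
    obtain ⟨α', φ', h4, h5⟩ := exists_mem_closure_of_relBound _ hC hbound h0n h3
    rw [zero_smul, zero_smul, add_zero, add_zero] at h5
    subst h5
    have h6 : φ = φ' :=
      LinearPMap.mem_graph_snd_inj _ h2 (mem_graph_field_of_mem_closure h4) rfl
    subst h6
    have h7 := genRel_of_mem_closure (x := x) (c := c) hSc hS h4
    exact h7
  · intro h1
    -- The same core is invariant, up to scalars, under the van Hove semigroup. Lifting convergence
    -- of the sum to the triples separates the limits of dΓ(ω) and φ(f).
    have h3 := genRel_mem_closure_span hSc (corePair ω f x c) hS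
      (fun u t => h.exists_sOp_corePair hω hω_nonneg hx t.coe_nonneg _ _ u) hdense h1
    rw [span_corePair] at h3
    obtain ⟨α, φ, h4, h5⟩ := exists_mem_closure_of_relBound _ hC hbound hxn h3
    refine ⟨α, φ, ?_, mem_graph_field_of_mem_closure h4, h5⟩
    have h6 := genRel_of_mem_closure hΓc hΓ h4
    rwa [zero_smul, zero_smul, add_zero, add_zero] at h6

end VanHove
/-! ### Operators on the spin space -/

section Spin

variable {E : Type*} [NormedAddCommGroup E] [InnerProductSpace ℂ E]

/-- The diagonal operator `(A ψ)(x) = A_x ψ(x)`. -/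
def spinDiag (A : ℤˣ → E →L[ℂ] E) : PiLp 2 (fun _ : ℤˣ => E) →L[ℂ] PiLp 2 (fun _ : ℤˣ => E) :=
  (PiLp.continuousLinearEquiv 2 ℂ (fun _ : ℤˣ => E)).symm.toContinuousLinearMap ∘L
    ContinuousLinearMap.pi fun x => A x ∘L PiLp.proj 2 (fun _ : ℤˣ => E) x

theorem spinDiag_apply (A : ℤˣ → E →L[ℂ] E) (ψ : PiLp 2 (fun _ : ℤˣ => E)) (x : ℤˣ) :
    spinDiag A ψ x = A x (ψ x) := rfl

theorem norm_spinDiag_le {A : ℤˣ → E →L[ℂ] E} (hA : ∀ x, ‖A x‖ ≤ 1) : ‖spinDiag A‖ ≤ 1 := by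
  refine ContinuousLinearMap.opNorm_le_bound _ zero_le_one fun ψ => ?_
  rw [one_mul, ← sq_le_sq₀ (norm_nonneg _) (norm_nonneg _), PiLp.norm_sq_eq_of_L2,
    PiLp.norm_sq_eq_of_L2]
  refine Finset.sum_le_sum fun x _ => pow_le_pow_left₀ (norm_nonneg _) ?_ 2
  rw [spinDiag_apply]
  exact ((A x).le_of_opNorm_le (hA x) _).trans (one_mul _).le

variable (E) in
/-- The flip `(σ ψ)(x) = ψ(-x)`. -/
def spinFlip : PiLp 2 (fun _ : ℤˣ => E) →L[ℂ] PiLp 2 (fun _ : ℤˣ => E) :=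
  (LinearIsometryEquiv.piLpCongrLeft 2 ℂ E (Equiv.neg ℤˣ)).toContinuousLinearEquiv

theorem spinFlip_apply (ψ : PiLp 2 (fun _ : ℤˣ => E)) (x : ℤˣ) : spinFlip E ψ x = ψ (-x) := rfl

theorem norm_spinFlip_apply (ψ : PiLp 2 (fun _ : ℤˣ => E)) : ‖spinFlip E ψ‖ = ‖ψ‖ :=
  (LinearIsometryEquiv.piLpCongrLeft 2 ℂ E (Equiv.neg ℤˣ)).norm_map ψ

theorem inner_spinFlip_left (φ ψ : PiLp 2 (fun _ : ℤˣ => E)) :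
    ⟪spinFlip E φ, ψ⟫_ℂ = ⟪φ, spinFlip E ψ⟫_ℂ := by
  rw [PiLp.inner_apply, PiLp.inner_apply]
  refine Fintype.sum_equiv (Equiv.neg ℤˣ) _ _ fun x => ?_
  simp [spinFlip_apply]

variable (E) in
/-- The spin part `(B ψ)(x) = ψ(x) - ψ(-x)` of the Hamiltonian. -/
def spinB : PiLp 2 (fun _ : ℤˣ => E) →L[ℂ] PiLp 2 (fun _ : ℤˣ => E) := 1 - spinFlip E

theorem inner_spinB_left (φ ψ : PiLp 2 (fun _ : ℤˣ => E)) :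
    ⟪spinB E φ, ψ⟫_ℂ = ⟪φ, spinB E ψ⟫_ℂ := by
  change ⟪φ - spinFlip E φ, ψ⟫_ℂ = ⟪φ, ψ - spinFlip E ψ⟫_ℂ
  rw [inner_sub_left, inner_sub_right, inner_spinFlip_left]

theorem tendsto_spin_iff {ι : Type*} {l : Filter ι} {u : ι → PiLp 2 (fun _ : ℤˣ => E)}
    {ψ : PiLp 2 (fun _ : ℤˣ => E)} :
    Tendsto u l (𝓝 ψ) ↔ ∀ x, Tendsto (fun i => u i x) l (𝓝 (ψ x)) := by
  rw [(PiLp.continuousLinearEquiv 2 ℂ (fun _ : ℤˣ => E)).toHomeomorph.isInducing.tendsto_nhds_iff]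
  exact tendsto_pi_nhds

theorem isContractionSemigroup_spinDiag {S : ℤˣ → ℝ≥0 → E →L[ℂ] E}
    (hS : ∀ x, IsContractionSemigroup (S x)) :
    IsContractionSemigroup fun t => spinDiag fun x => S x t where
  zero := by
    ext ψ x
    rw [spinDiag_apply, (hS x).zero]
    rfl
  add s t := by
    ext ψ x
    rw [spinDiag_apply, (hS x).add]
    rfl
  continuous ψ := by
    refine (PiLp.continuous_toLp 2 _).comp (continuous_pi fun x => ?_)
    exact (hS x).continuous (ψ x)
  norm_le t := norm_spinDiag_le fun x => (hS x).norm_le t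

theorem genRel_spinDiag_iff {S : ℤˣ → ℝ≥0 → E →L[ℂ] E} {ψ η : PiLp 2 (fun _ : ℤˣ => E)} :
    GenRel (fun t => spinDiag fun x => S x t) ψ η ↔ ∀ x, GenRel (S x) (ψ x) (η x) :=
  tendsto_spin_iff

end Spin

/-! ### Graphs of the Hamiltonians -/

section Graphs

variable {E : Type*} [NormedAddCommGroup E] [NormedSpace ℂ E]

theorem mem_graph_smul_iff {A : E →ₗ.[ℂ] E} {z : ℂ} {ψ η : E} :
    (ψ, η) ∈ (z • A).graph ↔ ∃ φ, (ψ, φ) ∈ A.graph ∧ η = z • φ := by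
  constructor
  · intro h
    obtain ⟨y, hy, hη⟩ := (LinearPMap.mem_graph_iff _).1 h
    exact ⟨A y, (LinearPMap.mem_graph_iff _).2 ⟨y, hy, rfl⟩, hη.symm⟩
  · rintro ⟨φ, h, rfl⟩
    obtain ⟨y, hy, hη⟩ := (LinearPMap.mem_graph_iff _).1 h
    refine (LinearPMap.mem_graph_iff _).2 ⟨y, hy, ?_⟩
    rw [LinearPMap.smul_apply, hη]

theorem mem_graph_toPMap_top_iff {L : E →ₗ[ℂ] E} {ψ η : E} :
    (ψ, η) ∈ (L.toPMap ⊤).graph ↔ η = L ψ := by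
  constructor
  · intro h
    obtain ⟨y, hy, hη⟩ := (LinearPMap.mem_graph_iff _).1 h
    dsimp only at hy hη
    rw [← hη, ← hy]
    rfl
  · rintro rfl
    exact (LinearPMap.mem_graph_iff _).2 ⟨⟨ψ, Submodule.mem_top⟩, rfl, rfl⟩

theorem mem_graph_sandwich_iff {A C : E →L[ℂ] E} {B : E →ₗ.[ℂ] E} {ψ η : E} :
    (ψ, η) ∈ (sandwich A B C).graph ↔ ∃ ξ, (C ψ, ξ) ∈ B.graph ∧ η = A ξ := by
  constructor
  · intro h
    obtain ⟨⟨y, hyd⟩, hy, hη⟩ := (LinearPMap.mem_graph_iff _).1 h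
    dsimp only at hy hη
    subst hy
    exact ⟨B ⟨C y, hyd⟩, B.mem_graph ⟨C y, hyd⟩, hη.symm⟩
  · rintro ⟨ξ, h, rfl⟩
    obtain ⟨⟨z, hzd⟩, hz, hξ⟩ := (LinearPMap.mem_graph_iff _).1 h
    dsimp only at hz hξ
    subst hz
    refine (LinearPMap.mem_graph_iff _).2 ⟨⟨ψ, hzd⟩, rfl, ?_⟩
    rw [← hξ]
    rfl

variable {M : Type*} [MeasurableSpace M] {μ : Measure M} [SigmaFinite μ] {ω : M → ℝ}

theorem mem_graph_hRen_iff {vreg vuv : M → ℂ} {ψ η : SpinFock μ} :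
    (ψ, η) ∈ (hRen μ ω vreg vuv).graph ↔
      ∀ x, (ψ x, (η - spinB (Fock μ) ψ) x) ∈ (vanHoveRen μ ω vreg vuv x).graph := by
  constructor
  · intro h x
    obtain ⟨⟨y, hyd⟩, hy, hη⟩ := (LinearPMap.mem_graph_iff _).1 h
    dsimp only at hy hη
    subst hy
    refine (LinearPMap.mem_graph_iff _).2 ⟨⟨y x, hyd x⟩, rfl, ?_⟩
    rw [← hη]
    change _ = (y x - y (-x) + vanHoveRen μ ω vreg vuv x ⟨y x, hyd x⟩) - (y x - y (-x))
    rw [add_sub_cancel_left]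
  · intro h
    have hd : ∀ x, ψ x ∈ (vanHoveRen μ ω vreg vuv x).domain := fun x =>
      LinearPMap.mem_domain_of_mem_graph (h x)
    refine (LinearPMap.mem_graph_iff _).2 ⟨⟨ψ, hd⟩, rfl, ?_⟩
    ext1 x
    change ψ x - ψ (-x) + vanHoveRen μ ω vreg vuv x ⟨ψ x, hd x⟩ = η x
    have h1 := LinearPMap.mem_graph_snd_inj _ (h x)
      ((vanHoveRen μ ω vreg vuv x).mem_graph ⟨ψ x, hd x⟩) rfl
    rw [← h1]
    change ψ x - ψ (-x) + (η x - (ψ x - ψ (-x))) = η x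
    rw [add_sub_cancel]

theorem spinVal_sq (x : ℤˣ) : spinVal x ^ 2 = 1 := by
  rw [spinVal, ← Int.cast_pow, ← Units.val_pow_eq_pow_val, Int.units_sq, Units.val_one,
    Int.cast_one]

theorem graph_dGamma (hω : Measurable ω) (hω_nonneg : ∀ k, 0 ≤ ω k) :
    (dGamma (μ := μ) ω).graph = dGammaGraph ω := by
  refine Submodule.toLinearPMap_graph_eq _ fun p hp h0 => ?_
  obtain ⟨ψ, η⟩ := p
  dsimp only at h0 ⊢
  subst h0
  have h1 := (mem_dGammaGraph_iff hω hω_nonneg _ _).1 hp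
  have h2 : GenRel (fun t : ℝ≥0 => gammaOp (μ := μ) ω t) 0 0 := by simp [GenRel]
  exact h1.unique h2

theorem memLp_div_rho_of_reg (hω : Measurable ω) (hω_pos : ∀ᵐ k ∂μ, 0 < ω k) {w : M → ℂ}
    (hw : w ∈ VReg μ ω) : MemLp (fun k => w k / (rho ω k : ℂ)) 2 μ := by
  have h1 : MemLp (fun k => w k / (Real.sqrt (ω k) : ℂ)) 2 μ := hw.2
  refine h1.mono ?_ ?_
  · refine hw.1.1.mul ?_
    have : Measurable fun k => ((rho ω k : ℝ) : ℂ)⁻¹ :=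
      (Complex.measurable_ofReal.comp (measurable_rho hω)).inv
    exact this.aestronglyMeasurable
  · filter_upwards [hω_pos] with k hk
    rw [norm_div, norm_div, Complex.norm_real, Complex.norm_real,
      Real.norm_of_nonneg (Real.sqrt_nonneg _)]
    have h2 : 0 < Real.sqrt (ω k) := Real.sqrt_pos.2 hk
    rw [rho, Real.norm_of_nonneg (add_nonneg h2.le hk.le)]
    refine div_le_div_of_nonneg_left (norm_nonneg _) h2 ?_
    linarith

theorem memLp_div_rho_of_uv (hω : Measurable ω) (hω_pos : ∀ᵐ k ∂μ, 0 < ω k) {w : M → ℂ}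
    (hw : w ∈ VUV μ ω) : MemLp (fun k => w k / (rho ω k : ℂ)) 2 μ := by
  have h1 : MemLp (fun k => w k / (ω k : ℂ)) 2 μ := hw.2
  refine h1.mono ?_ ?_
  · refine hw.1.mul ?_
    have : Measurable fun k => ((rho ω k : ℝ) : ℂ)⁻¹ :=
      (Complex.measurable_ofReal.comp (measurable_rho hω)).inv
    exact this.aestronglyMeasurable
  · filter_upwards [hω_pos] with k hk
    rw [norm_div, norm_div, Complex.norm_real, Complex.norm_real, Real.norm_of_nonneg hk.le]
    have h2 : 0 < Real.sqrt (ω k) := Real.sqrt_pos.2 hk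
    rw [rho, Real.norm_of_nonneg (add_nonneg h2.le hk.le)]
    refine div_le_div_of_nonneg_left (norm_nonneg _) hk ?_
    linarith

theorem isRegularPair_toL2 (hω : Measurable ω) (hω_nonneg : ∀ k, 0 ≤ ω k)
    (hω_pos : ∀ᵐ k ∂μ, 0 < ω k) {w : M → ℂ} (hw : w ∈ VReg μ ω) :
    IsRegularPair ω (toL2 μ w) (toL2 μ fun k => w k / (Real.sqrt (ω k) : ℂ))
      (toL2 μ fun k => w k / (rho ω k : ℂ)) where
  res := by
    refine eq_mulOp (bddMul_sqrtResMul hω hω_nonneg) ?_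
    filter_upwards [coeFn_mulOp (bddMul_resMul hω hω_nonneg) (toL2 μ w), toL2_coe hw.1,
      toL2_coe hw.2, hω_pos] with k h1 h2 h3 h4
    have h5 : ((Real.sqrt (ω k) : ℝ) : ℂ) ≠ 0 := by
      exact_mod_cast (Real.sqrt_pos.2 h4).ne'
    rw [h1, h2, h3, resMul, sqrtResMul]
    push_cast
    field_simp
  eq_weight := by
    refine eq_mulOp (bddMul_inv_one_add_sqrt hω) ?_
    filter_upwards [toL2_coe (memLp_div_rho_of_reg hω hω_pos hw), toL2_coe hw.2, hω_pos]
      with k h1 h2 h3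
    have h4 : rho ω k = (1 + Real.sqrt (ω k)) * Real.sqrt (ω k) := by
      rw [rho, add_mul, one_mul, Real.mul_self_sqrt h3.le]
    rw [h1, h2, h4]
    push_cast
    rw [div_mul_eq_div_div_swap, div_eq_inv_mul _ (1 + _ : ℂ)]

theorem mem_graph_vanHove_iff (hω : Measurable ω) (hω_nonneg : ∀ k, 0 ≤ ω k)
    (hω_pos : ∀ᵐ k ∂μ, 0 < ω k) {w : M → ℂ} (hw : w ∈ VReg μ ω) (x : ℤˣ) {ψ η : Fock μ} :
    (ψ, η) ∈ (vanHove μ ω w x).graph ↔ GenRel (fun t : ℝ≥0 =>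
      sOp ω (toL2 μ fun k => w k / (rho ω k : ℂ)) (spinVal x) t) ψ η := by
  rw [← (isRegularPair_toL2 hω hω_nonneg hω_pos hw).mem_graph_iff hω hω_nonneg (spinVal_sq x),
    vanHove, mem_graph_add_iff]
  constructor
  · rintro ⟨α, c, h1, h2, rfl⟩
    obtain ⟨α, φ, h3, h4, rfl⟩ := mem_graph_add_iff.1 h1
    obtain ⟨φ, h5, rfl⟩ := mem_graph_smul_iff.1 h4
    rw [mem_graph_toPMap_top_iff] at h2
    subst h2
    rw [graph_dGamma hω hω_nonneg, mem_dGammaGraph_iff hω hω_nonneg] at h3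
    exact ⟨α, φ, h3, h5, rfl⟩
  · rintro ⟨α, φ, h1, h2, rfl⟩
    refine ⟨_, _, mem_graph_add_iff.2 ⟨α, _, ?_, mem_graph_smul_iff.2 ⟨φ, h2, rfl⟩, rfl⟩,
      mem_graph_toPMap_top_iff.2 rfl, rfl⟩
    rw [graph_dGamma hω hω_nonneg, mem_dGammaGraph_iff hω hω_nonneg]
    exact h1

/-- The Weyl operator of x v_UV/ω maps difference quotients of the semigroup of v to those of the
semigroup of v_reg, and the latter is generated by the regular van Hove operator. The graph
therefore depends on v alone and not on its decomposition. -/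
theorem mem_graph_vanHoveRen_iff (hω : Measurable ω) (hω_nonneg : ∀ k, 0 ≤ ω k)
    (hω_pos : ∀ᵐ k ∂μ, 0 < ω k) {v vreg vuv : M → ℂ} (hreg : vreg ∈ VReg μ ω)
    (huv : vuv ∈ VUV μ ω) (hv : v =ᵐ[μ] vreg + vuv) (x : ℤˣ) {ψ η : Fock μ} :
    (ψ, η) ∈ (vanHoveRen μ ω vreg vuv x).graph ↔ GenRel (fun t : ℝ≥0 =>
      sOp ω (toL2 μ fun k => v k / (rho ω k : ℂ)) (spinVal x) t) ψ η := by
  set y := toL2 μ fun k => vuv k / (ω k : ℂ) with hy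
  set v₀ := toL2 μ fun k => v k / (rho ω k : ℂ) with hv₀
  set w₀ := toL2 μ fun k => vreg k / (rho ω k : ℂ) with hw₀
  set f := (spinVal x : ℂ) • y with hf
  have h1 : (toL2 μ fun k => (spinVal x : ℂ) * (vuv k / (ω k : ℂ))) = f := by
    refine toL2_eq_of_ae ?_
    filter_upwards [Lp.coeFn_smul (spinVal x : ℂ) y, toL2_coe huv.2] with k h1 h2
    rw [h1, Pi.smul_apply, h2, smul_eq_mul]
  have h2 : (toL2 μ fun k => -(spinVal x : ℂ) * (vuv k / (ω k : ℂ))) = -f := by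
    refine toL2_eq_of_ae ?_
    filter_upwards [Lp.coeFn_smul (spinVal x : ℂ) y, toL2_coe huv.2, Lp.coeFn_neg f]
      with k h1 h2 h3
    rw [h3, Pi.neg_apply, h1, Pi.smul_apply, h2, smul_eq_mul, neg_mul]
  have h3 : v₀ = w₀ + mulOp μ (qMul ω) y := by
    refine toL2_eq_of_ae ?_
    filter_upwards [Lp.coeFn_add w₀ (mulOp μ (qMul ω) y),
      coeFn_mulOp (bddMul_qMul hω hω_nonneg) y, toL2_coe huv.2,
      toL2_coe (memLp_div_rho_of_reg hω hω_pos hreg), hv, hω_pos] with k h1 h2 h3 h4 h5 h6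
    have h7 : ((ω k : ℝ) : ℂ) ≠ 0 := by exact_mod_cast h6.ne'
    rw [h1, Pi.add_apply, h2, h3, h4, h5, Pi.add_apply, qMul, add_div]
    push_cast
    field_simp
  have hW := weyl_mul_weyl_neg f
  have hW' := weyl_mul_weyl_neg (-f)
  rw [neg_neg] at hW'
  have hcomm : ∀ (t : ℝ≥0) φ, weyl f (sOp ω v₀ (spinVal x) t φ) =
      sOp ω w₀ (spinVal x) t (weyl f φ) := fun t φ =>
    DFunLike.congr_fun (weyl_mul_sOp hω hω_nonneg h3 (spinVal_sq x) t.coe_nonneg) φ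
  have hinv : ∀ φ, weyl (-f) (weyl f φ) = φ := fun φ => DFunLike.congr_fun hW' φ
  have hinv' : ∀ φ, weyl f (weyl (-f) φ) = φ := fun φ => DFunLike.congr_fun hW φ
  rw [vanHoveRen, h1, h2, mem_graph_sandwich_iff]
  have hquot : ∀ t : ℝ≥0, weyl f (((t : ℝ)⁻¹ : ℂ) • (ψ - sOp ω v₀ (spinVal x) t ψ)) =
      ((t : ℝ)⁻¹ : ℂ) • (weyl f ψ - sOp ω w₀ (spinVal x) t (weyl f ψ)) := fun t => by
    rw [map_smul, map_sub, hcomm]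
  constructor
  · rintro ⟨ξ, h4, rfl⟩
    rw [mem_graph_vanHove_iff hω hω_nonneg hω_pos hreg] at h4
    refine (((weyl (-f)).continuous.tendsto _).comp h4).congr fun t => ?_
    simp only [Function.comp_apply]
    rw [← hquot, hinv]
  · intro h4
    refine ⟨weyl f η, ?_, (hinv η).symm⟩
    rw [mem_graph_vanHove_iff hω hω_nonneg hω_pos hreg]
    exact (((weyl f).continuous.tendsto _).comp h4).congr hquot

variable (ω) in
/-- The semigroup of the Hamiltonian without spin flips. -/
def spinS (v₀ : OneBoson μ) (t : ℝ) : SpinFock μ →L[ℂ] SpinFock μ :=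
  spinDiag fun x => sOp ω v₀ (spinVal x) t

theorem isContractionSemigroup_spinS (hω : Measurable ω) (hω_nonneg : ∀ k, 0 ≤ ω k)
    (v₀ : OneBoson μ) : IsContractionSemigroup fun t : ℝ≥0 => spinS ω v₀ t :=
  isContractionSemigroup_spinDiag (S := fun x (t : ℝ≥0) => sOp ω v₀ (spinVal x) t)
    fun x => isContractionSemigroup_sOp hω hω_nonneg v₀ (spinVal_sq x)

theorem inner_spinS_left (hω : Measurable ω) (hω_nonneg : ∀ k, 0 ≤ ω k) (v₀ : OneBoson μ)
    {t : ℝ} (ht : 0 ≤ t) (φ ψ : SpinFock μ) :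
    ⟪spinS ω v₀ t φ, ψ⟫_ℂ = ⟪φ, spinS ω v₀ t ψ⟫_ℂ := by
  rw [PiLp.inner_apply, PiLp.inner_apply]
  exact Finset.sum_congr rfl fun x _ =>
    inner_sOp_left hω hω_nonneg v₀ (spinVal_sq x) ht (φ x) (ψ x)

theorem mem_graph_hRen_iff_genRel (hω : Measurable ω) (hω_nonneg : ∀ k, 0 ≤ ω k)
    (hω_pos : ∀ᵐ k ∂μ, 0 < ω k) {v vreg vuv : M → ℂ} (hreg : vreg ∈ VReg μ ω)
    (huv : vuv ∈ VUV μ ω) (hv : v =ᵐ[μ] vreg + vuv) (ψ η : SpinFock μ) :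
    (ψ, η) ∈ (hRen μ ω vreg vuv).graph ↔ GenRel (fun t : ℝ≥0 =>
      spinS ω (toL2 μ fun k => v k / (rho ω k : ℂ)) t) ψ (η - spinB (Fock μ) ψ) := by
  rw [mem_graph_hRen_iff]
  refine (forall_congr' fun x => ?_).trans genRel_spinDiag_iff.symm
  exact mem_graph_vanHoveRen_iff hω hω_nonneg hω_pos hreg huv hv x

theorem isSelfAdjoint_hRen (hω : Measurable ω) (hω_nonneg : ∀ k, 0 ≤ ω k)
    (hω_pos : ∀ᵐ k ∂μ, 0 < ω k) {v vreg vuv : M → ℂ} (hreg : vreg ∈ VReg μ ω)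
    (huv : vuv ∈ VUV μ ω) (hv : v =ᵐ[μ] vreg + vuv) :
    IsSelfAdjoint (hRen μ ω vreg vuv) :=
  isSelfAdjoint_of_genRel (isContractionSemigroup_spinS hω hω_nonneg _)
    (fun t => inner_spinS_left hω hω_nonneg _ t.coe_nonneg) inner_spinB_left
    (mem_graph_hRen_iff_genRel hω hω_nonneg hω_pos hreg huv hv)

/-- If S and T differ to first order by t B on every vector, then their difference quotients
converge on the same vectors, and the limits differ by B. -/
theorem genRel_of_tendsto_sub {T S : ℝ≥0 → E →L[ℂ] E} {B : E →L[ℂ] E}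
    (h : ∀ ψ, Tendsto (fun t : ℝ≥0 => ((t : ℝ)⁻¹ : ℂ) • (S t ψ - T t ψ)) (𝓝[>] 0) (𝓝 (B ψ)))
    (ψ η : E) : GenRel S ψ (η - B ψ) ↔ GenRel T ψ η := by
  constructor
  · intro h1
    have h2 := Tendsto.add h1 (h ψ)
    rw [sub_add_cancel] at h2
    refine h2.congr fun t => ?_
    rw [← smul_add, sub_add_sub_cancel]
  · intro h1
    refine (Tendsto.sub h1 (h ψ)).congr fun t => ?_
    rw [← smul_sub]
    congr 1
    abel

end Graphs
/-! ### Products of van Hove semigroups along a discretized path -/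

section Discretization

/-- `∫₀^{pₙ} e^{-(pₙ - s)λ} g(s) ds` for the step function `g` with value `yᵢ` on `[pᵢ, pᵢ₊₁)`. -/
def stepMinus (p y : ℕ → ℝ) (l : ℝ) : ℕ → ℝ
  | 0 => 0
  | n + 1 => Real.exp (-(p (n + 1) - p n) * l) * stepMinus p y l n +
      y n * beta (p (n + 1) - p n) l

/-- `∫₀^{pₙ} e^{-sλ} g(s) ds` for the step function `g` with value `yᵢ` on `[pᵢ, pᵢ₊₁)`. -/
def stepPlus (p y : ℕ → ℝ) (l : ℝ) : ℕ → ℝ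
  | 0 => 0
  | n + 1 => stepPlus p y l n + Real.exp (-p n * l) * (y n * beta (p (n + 1) - p n) l)

/-- `∫₀^{pₙ} g(s) (g(s) - λ ∫₀ˢ e^{-(s - r)λ} g(r) dr) ds` for the step function `g` with value
`yᵢ = ±1` on `[pᵢ, pᵢ₊₁)`. -/
def stepPhase (p y : ℕ → ℝ) (l : ℝ) : ℕ → ℝ
  | 0 => 0
  | n + 1 => stepPhase p y l n + beta (p (n + 1) - p n) l -
      l * stepMinus p y l n * (y n * beta (p (n + 1) - p n) l)

variable {p y : ℕ → ℝ}

theorem measurable_stepMinus (p y : ℕ → ℝ) (n : ℕ) : Measurable fun l => stepMinus p y l n := by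
  induction n with
  | zero => exact measurable_const
  | succ n ih =>
    have := measurable_beta (p (n + 1) - p n)
    simp only [stepMinus]
    fun_prop

theorem measurable_stepPlus (p y : ℕ → ℝ) (n : ℕ) : Measurable fun l => stepPlus p y l n := by
  induction n with
  | zero => exact measurable_const
  | succ n ih =>
    have := measurable_beta (p (n + 1) - p n)
    simp only [stepPlus]
    fun_prop

theorem measurable_stepPhase (p y : ℕ → ℝ) (n : ℕ) : Measurable fun l => stepPhase p y l n := by
  induction n with
  | zero => exact measurable_const
  | succ n ih =>
    have h1 := measurable_beta (p (n + 1) - p n)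
    have h2 := measurable_stepMinus p y n
    simp only [stepPhase]
    fun_prop

theorem abs_stepMinus_le (hp : Monotone p) (hp0 : p 0 = 0) (hy : ∀ n, |y n| ≤ 1) (l : ℝ) (n : ℕ) :
    |stepMinus p y l n| ≤ beta (p n) l := by
  induction n with
  | zero => simp [stepMinus, hp0, beta_zero_left]
  | succ n ih =>
    have h0 : 0 ≤ p (n + 1) - p n := sub_nonneg.2 (hp n.le_succ)
    have h1 : beta (p (n + 1)) l = beta (p (n + 1) - p n) l +
        Real.exp (-(p (n + 1) - p n) * l) * beta (p n) l := by
      rw [← beta_add, sub_add_cancel]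
    rw [stepMinus, h1, add_comm]
    refine (abs_add_le _ _).trans (add_le_add ?_ ?_)
    · rw [abs_mul, abs_of_nonneg (beta_nonneg h0 l)]
      exact mul_le_of_le_one_left (beta_nonneg h0 l) (hy n)
    · rw [abs_mul, abs_of_pos (Real.exp_pos _)]
      exact mul_le_mul_of_nonneg_left ih (Real.exp_pos _).le

theorem abs_stepPlus_le (hp : Monotone p) (hp0 : p 0 = 0) (hy : ∀ n, |y n| ≤ 1) (l : ℝ) (n : ℕ) :
    |stepPlus p y l n| ≤ beta (p n) l := by
  induction n with
  | zero => simp [stepPlus, hp0, beta_zero_left]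
  | succ n ih =>
    have h0 : 0 ≤ p (n + 1) - p n := sub_nonneg.2 (hp n.le_succ)
    have h1 : beta (p (n + 1)) l = beta (p n) l +
        Real.exp (-p n * l) * beta (p (n + 1) - p n) l := by
      rw [← beta_add, add_sub_cancel]
    rw [stepPlus, h1]
    refine (abs_add_le _ _).trans (add_le_add ih ?_)
    rw [abs_mul, abs_of_pos (Real.exp_pos _), abs_mul, abs_of_nonneg (beta_nonneg h0 l)]
    exact mul_le_mul_of_nonneg_left (mul_le_of_le_one_left (beta_nonneg h0 l) (hy n))
      (Real.exp_pos _).le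

/-- With u = ∫₀ˢ e^{-(s-r)l} g(r) dr, the difference between the phase A and l u²/2 has derivative
(g - l u)² because g² = 1. The integrated gain over one interval is b (1 + e)/2 · (l u - y)². This
yields positivity of the phase without any bound on l. -/
theorem le_stepPhase (hp : Monotone p) (hy : ∀ n, y n ^ 2 = 1) (l : ℝ) (n : ℕ) :
    l * stepMinus p y l n ^ 2 / 2 ≤ stepPhase p y l n := by
  induction n with
  | zero => simp [stepMinus, stepPhase]
  | succ n ih =>
    have h0 : 0 ≤ beta (p (n + 1) - p n) l := beta_nonneg (sub_nonneg.2 (hp n.le_succ)) l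
    have h1 := mul_beta (p (n + 1) - p n) l
    rw [stepMinus, stepPhase]
    set b := beta (p (n + 1) - p n) l
    set e := Real.exp (-(p (n + 1) - p n) * l)
    set u := stepMinus p y l n
    have h2 : e = 1 - l * b := by linarith
    have h3 : 0 ≤ b * (1 + e) / 2 * (l * u - y n) ^ 2 := by
      have : 0 < e := Real.exp_pos _
      positivity
    have h4 := hy n
    rw [h2] at h3 ⊢
    have h5 : b * (1 + (1 - l * b)) / 2 * (l * u - y n) ^ 2 =
        l * u ^ 2 / 2 + b - l * u * (y n * b) - l * ((1 - l * b) * u + y n * b) ^ 2 / 2 := by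
      linear_combination b * h4
    linarith

theorem stepPhase_nonneg (hp : Monotone p) (hy : ∀ n, y n ^ 2 = 1) {l : ℝ} (hl : 0 ≤ l) (n : ℕ) :
    0 ≤ stepPhase p y l n :=
  le_trans (by positivity) (le_stepPhase hp hy l n)

theorem abs_le_one_of_sq {a : ℝ} (h : a ^ 2 = 1) : |a| ≤ 1 := by
  rw [← sq_le_one_iff_abs_le_one, h]

/-- Between jumps the residual y - l u decays by the factor e, while l A grows by (1 - e) y (y - l
u), at most (1 - e)|y - l u|. Hence l A + |y - l u| does not increase between jumps, and a jump
raises it by at most the jump size. This is where the variation of the path enters. -/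
theorem stepPhase_aux (hp : Monotone p) (hy : ∀ n, y n ^ 2 = 1) {l : ℝ} (hl : 0 ≤ l)
    (n : ℕ) : l * stepPhase p y l n + |y n - l * stepMinus p y l n| ≤
      1 + ∑ i ∈ Finset.range n, |y (i + 1) - y i| := by
  induction n with
  | zero => simpa [stepMinus, stepPhase] using abs_le_one_of_sq (hy 0)
  | succ n ih =>
    have h0 : 0 ≤ beta (p (n + 1) - p n) l := beta_nonneg (sub_nonneg.2 (hp n.le_succ)) l
    have h1 := mul_beta (p (n + 1) - p n) l
    rw [stepMinus, stepPhase, Finset.sum_range_succ]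
    set b := beta (p (n + 1) - p n) l
    set e := Real.exp (-(p (n + 1) - p n) * l)
    set u := stepMinus p y l n
    have he : 0 < e := Real.exp_pos _
    have h2 : y (n + 1) - l * (e * u + y n * b) = e * (y n - l * u) + (y (n + 1) - y n) := by
      linear_combination (-y n) * h1
    have h3 : l * (stepPhase p y l n + b - l * u * (y n * b)) =
        l * stepPhase p y l n + (1 - e) * (y n * (y n - l * u)) := by
      linear_combination (1 - l * u * y n) * h1 - (1 - e) * hy n
    have h4 : |y (n + 1) - l * (e * u + y n * b)| ≤ e * |y n - l * u| + |y (n + 1) - y n| := by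
      rw [h2]
      refine (abs_add_le _ _).trans ?_
      rw [abs_mul, abs_of_pos he]
    have h5 : y n * (y n - l * u) ≤ |y n - l * u| := by
      refine (le_abs_self _).trans ?_
      rw [abs_mul]
      exact mul_le_of_le_one_left (abs_nonneg _) (abs_le_one_of_sq (hy n))
    have h6 : 0 ≤ 1 - e := by
      rw [← h1]
      positivity
    rw [h3]
    nlinarith [mul_le_mul_of_nonneg_left h5 h6]

/-- If the total jump of the path is at most `K - 1`, then `λ A ≤ K`. -/
theorem mul_stepPhase_le (hp : Monotone p) (hy : ∀ n, y n ^ 2 = 1) {l : ℝ}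
    (hl : 0 ≤ l) {K : ℝ} (hK0 : 0 ≤ K) {n : ℕ}
    (hK : ∀ m < n, 1 + ∑ i ∈ Finset.range m, |y (i + 1) - y i| ≤ K) :
    l * stepPhase p y l n ≤ K := by
  cases n with
  | zero => simpa [stepPhase] using hK0
  | succ n =>
    -- `stepPhase_aux` is used one step earlier: at `n + 1` it would charge the jump to `y (n + 1)`,
    -- which the phase does not see and which may lie beyond the time interval.
    refine le_trans ?_ ((stepPhase_aux hp hy hl n).trans (hK n n.lt_succ_self))
    have h0 : 0 ≤ beta (p (n + 1) - p n) l := beta_nonneg (sub_nonneg.2 (hp n.le_succ)) l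
    have h1 := mul_beta (p (n + 1) - p n) l
    rw [stepPhase]
    set b := beta (p (n + 1) - p n) l
    set e := Real.exp (-(p (n + 1) - p n) * l)
    set u := stepMinus p y l n
    have he : 0 < e := Real.exp_pos _
    have h3 : l * (stepPhase p y l n + b - l * u * (y n * b)) =
        l * stepPhase p y l n + (1 - e) * (y n * (y n - l * u)) := by
      linear_combination (1 - l * u * y n) * h1 - (1 - e) * hy n
    have h5 : y n * (y n - l * u) ≤ |y n - l * u| := by
      refine (le_abs_self _).trans ?_
      rw [abs_mul]
      exact mul_le_of_le_one_left (abs_nonneg _) (abs_le_one_of_sq (hy n))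
    have h6 : 0 ≤ 1 - e := by
      rw [← h1]
      positivity
    rw [h3]
    nlinarith [mul_le_mul_of_nonneg_left h5 h6, abs_nonneg (y n - l * u)]

/-- If the total jump of the path is at most `K - 1`, then `A ≤ K t`. -/
theorem stepPhase_le (hp : Monotone p) (hp0 : p 0 = 0) (hy : ∀ n, y n ^ 2 = 1) {l : ℝ}
    (hl : 0 ≤ l) {K : ℝ} {n : ℕ}
    (hK : ∀ m < n, 1 + ∑ i ∈ Finset.range m, |y (i + 1) - y i| ≤ K) :
    stepPhase p y l n ≤ K * p n := by
  induction n with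
  | zero => simp [stepPhase, hp0]
  | succ n ih =>
    have hd : 0 ≤ p (n + 1) - p n := sub_nonneg.2 (hp n.le_succ)
    have h0 : 0 ≤ beta (p (n + 1) - p n) l := beta_nonneg hd l
    have h1 := ih fun m hm => hK m (hm.trans n.lt_succ_self)
    have h2 := (stepPhase_aux hp hy hl n).trans (hK n n.lt_succ_self)
    have h3 := stepPhase_nonneg hp hy hl n
    have h4 : |y n - l * stepMinus p y l n| ≤ K := by nlinarith [mul_nonneg hl h3]
    have h5 := beta_le hd hl
    rw [stepPhase]
    set b := beta (p (n + 1) - p n) l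
    set u := stepMinus p y l n
    have h6 : y n * (y n - l * u) ≤ K := by
      refine ((le_abs_self _).trans ?_).trans h4
      rw [abs_mul]
      exact mul_le_of_le_one_left (abs_nonneg _) (abs_le_one_of_sq (hy n))
    have h7 : stepPhase p y l n + b - l * u * (y n * b) =
        stepPhase p y l n + y n * (y n - l * u) * b := by
      linear_combination (-b) * hy n
    rw [h7]
    have hK0 : 0 ≤ K := (abs_nonneg _).trans h4
    nlinarith [mul_le_mul_of_nonneg_right h6 h0, mul_le_mul_of_nonneg_left h5 hK0]

variable {M : Type*} [MeasurableSpace M] {μ : Measure M} {ω : M → ℝ}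

/-- The bound of a multiplier `(√ω + ω) m` with `|m| ≤ β_t(ω)`. -/
theorem rho_mul_abs_le_of_beta (hω_nonneg : ∀ k, 0 ≤ ω k) {t : ℝ} (ht : 0 ≤ t) {k : M} {m : ℝ}
    (h : |m| ≤ beta t (ω k)) : |rho ω k * m| ≤ Real.sqrt t + 1 := by
  rw [abs_mul, abs_of_nonneg (rho_nonneg hω_nonneg k)]
  exact rho_mul_abs_le hω_nonneg (h.trans (beta_le ht (hω_nonneg k)))
    ((mul_le_mul_of_nonneg_left h (hω_nonneg k)).trans (beta_mul_le_one t _))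

variable [SigmaFinite μ]

variable (ω) in
/-- The ordered product of the operators `e^{-(pᵢ₊₁ - pᵢ) h(v, yᵢ)}`. -/
def prodS (v₀ : OneBoson μ) (p : ℕ → ℝ) (y : ℕ → ℤˣ) : ℕ → Fock μ →L[ℂ] Fock μ
  | 0 => 1
  | n + 1 => prodS v₀ p y n * sOp ω v₀ (spinVal (y n)) (p (n + 1) - p n)

theorem norm_prodS_le (hω : Measurable ω) (hω_nonneg : ∀ k, 0 ≤ ω k) (v₀ : OneBoson μ)
    (hp : Monotone p) (y : ℕ → ℤˣ) (n : ℕ) : ‖prodS ω v₀ p y n‖ ≤ 1 := by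
  induction n with
  | zero => exact ContinuousLinearMap.norm_id_le
  | succ n ih =>
    have h := (sOp_expVec_and_norm hω hω_nonneg v₀ (spinVal_sq (y n))
      (sub_nonneg.2 (hp n.le_succ))).2
    exact (ContinuousLinearMap.opNorm_comp_le _ _).trans (mul_le_one₀ ih (norm_nonneg _) h)

theorem bddMul_rho_mul (hω : Measurable ω) (hω_nonneg : ∀ k, 0 ≤ ω k) {t : ℝ} (ht : 0 ≤ t)
    {m : ℝ → ℝ} (hm : Measurable m) (hb : ∀ l, 0 ≤ l → |m l| ≤ beta t l) :
    BddMul fun k => rho ω k * m (ω k) :=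
  ⟨(measurable_rho hω).mul (hm.comp hω), _,
    fun k => rho_mul_abs_le_of_beta hω_nonneg ht (hb _ (hω_nonneg k))⟩

theorem bddMul_one_add_sqrt_sq_mul (hω : Measurable ω) (hω_nonneg : ∀ k, 0 ≤ ω k) {m : ℝ → ℝ}
    (hm : Measurable m) {a b : ℝ} (h0 : ∀ l, 0 ≤ l → 0 ≤ m l) (h1 : ∀ l, 0 ≤ l → m l ≤ a)
    (h2 : ∀ l, 0 ≤ l → l * m l ≤ b) : BddMul fun k => (1 + Real.sqrt (ω k)) ^ 2 * m (ω k) := by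
  have h3 : Measurable fun k => (1 + Real.sqrt (ω k)) ^ 2 := by fun_prop
  refine ⟨h3.mul (hm.comp hω), 2 * (a + b), fun k => ?_⟩
  have hk := hω_nonneg k
  rw [abs_of_nonneg (mul_nonneg (sq_nonneg _) (h0 _ hk))]
  exact one_add_sqrt_sq_mul_le hω_nonneg (h0 _ hk) (h1 _ hk) (h2 _ hk)

theorem le_sum_range (y : ℕ → ℝ) (n : ℕ) : ∀ m < n,
    1 + ∑ i ∈ Finset.range m, |y (i + 1) - y i| ≤ 1 + ∑ i ∈ Finset.range n, |y (i + 1) - y i| :=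
  fun _ hm => add_le_add_right (Finset.sum_le_sum_of_subset_of_nonneg
    (Finset.range_subset_range.2 hm.le) fun _ _ _ => abs_nonneg _) 1

theorem bddMul_stepPhase (hω : Measurable ω) (hω_nonneg : ∀ k, 0 ≤ ω k) (hp : Monotone p)
    (hp0 : p 0 = 0) (hy : ∀ n, y n ^ 2 = 1) (n : ℕ) :
    BddMul fun k => (1 + Real.sqrt (ω k)) ^ 2 * stepPhase p y (ω k) n :=
  bddMul_one_add_sqrt_sq_mul hω hω_nonneg (measurable_stepPhase p y n)
    (fun _ hl => stepPhase_nonneg hp hy hl n)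
    (fun _ hl => stepPhase_le hp hp0 hy hl (le_sum_range y n))
    (fun _ hl => mul_stepPhase_le hp hy hl (by positivity) (le_sum_range y n))

/-- The three recursions are the composition rule `affineExp_comp` with the rightmost factor split
off; ρ² = (1 + √ω)² ω converts the cross term into the last summand of `stepPhase`. -/
theorem prodS_expVec (hω : Measurable ω) (hω_nonneg : ∀ k, 0 ≤ ω k) (v₀ : OneBoson μ)
    (hp : Monotone p) (hp0 : p 0 = 0) (y : ℕ → ℤˣ) (n : ℕ) (g : OneBoson μ) :
    prodS ω v₀ p y n (expVec g) = affineExp ω v₀ (p n)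
      (fun k => (1 + Real.sqrt (ω k)) ^ 2 * stepPhase p (fun i => spinVal (y i)) (ω k) n)
      (fun k => rho ω k * stepMinus p (fun i => spinVal (y i)) (ω k) n)
      (fun k => rho ω k * stepPlus p (fun i => spinVal (y i)) (ω k) n) g := by
  set z : ℕ → ℝ := fun i => spinVal (y i) with hz
  have hz2 : ∀ n, z n ^ 2 = 1 := fun n => spinVal_sq _
  have hz1 : ∀ n, |z n| ≤ 1 := fun n => abs_le_one_of_sq (hz2 n)
  have hpn : ∀ n, 0 ≤ p n := fun n => hp0 ▸ hp n.zero_le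
  induction n generalizing g with
  | zero =>
    have h0 : mulOp μ (fun _ => (0 : ℝ)) v₀ = 0 := by simp [mulOp_const]
    simp only [prodS, affineExp, stepPhase, stepMinus, stepPlus, mul_zero, h0, hp0, eOp_zero]
    simp
  | succ n ih =>
    have hd : 0 ≤ p (n + 1) - p n := sub_nonneg.2 (hp n.le_succ)
    have hs := bddMul_sMul hω hω_nonneg (hz2 n) hd
    rw [prodS, mul_apply_eq_comp, (sOp_expVec_and_norm hω hω_nonneg v₀ (hz2 n) hd).1]
    have h := affineExp_comp hω hω_nonneg (hpn n) hd
      (bddMul_stepPhase hω hω_nonneg hp hp0 hz2 n)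
      (bddMul_rho_mul hω hω_nonneg (hpn n) (measurable_stepMinus p z n)
        fun l _ => abs_stepMinus_le hp hp0 hz1 l n)
      (bddMul_rho_mul hω hω_nonneg (hpn n) (measurable_stepPlus p z n)
        fun l _ => abs_stepPlus_le hp hp0 hz1 l n)
      (bddMul_cMul hω hω_nonneg hd) hs hs
      (A := fun k => (1 + Real.sqrt (ω k)) ^ 2 * stepPhase p z (ω k) (n + 1))
      (a := fun k => rho ω k * stepMinus p z (ω k) (n + 1))
      (b := fun k => rho ω k * stepPlus p z (ω k) (n + 1)) (v := v₀)
      (fun k => by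
        have := rho_sq hω_nonneg k
        simp only [stepPhase, cMul, sMul]
        linear_combination (stepMinus p z (ω k) n * z n * beta (p (n + 1) - p n) (ω k)) * this)
      (fun k => by
        simp only [stepMinus, sMul]
        ring)
      (fun k => by
        simp only [stepPlus, sMul]
        ring) ih g
    rw [add_sub_cancel] at h
    exact h

end Discretization
/-! ### The processes of a path as limits of discretizations -/

section PathLimits

/-- `∫₀ᵗ e^{-(t - s)λ} g(s) ds`. -/
def pathMinus (g : ℝ → ℝ) (t l : ℝ) : ℝ := ∫ r in (0 : ℝ)..t, Real.exp (-(t - r) * l) * g r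

/-- `∫₀ᵗ e^{-sλ} g(s) ds`. -/
def pathPlus (g : ℝ → ℝ) (t l : ℝ) : ℝ := ∫ r in (0 : ℝ)..t, Real.exp (-r * l) * g r

/-- `∫₀ᵗ g(s) (g(s) - λ ∫₀ˢ e^{-(s - r)λ} g(r) dr) ds`. -/
def pathPhase (g : ℝ → ℝ) (t l : ℝ) : ℝ := ∫ s in (0 : ℝ)..t, g s * (g s - l * pathMinus g s l)

variable {g : ℝ → ℝ}

theorem intervalIntegrable_mul_of_bounded {f : ℝ → ℝ} (hf : Continuous f) (hg : Measurable g)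
    (hg1 : ∀ s, |g s| ≤ 1) (a b : ℝ) : IntervalIntegrable (fun s => f s * g s) volume a b := by
  refine (hf.intervalIntegrable a b).mono_fun ?_ (ae_of_all _ fun s => ?_)
  · exact (hf.measurable.mul hg).aestronglyMeasurable
  · dsimp only
    rw [norm_mul]
    exact mul_le_of_le_one_right (norm_nonneg _) (hg1 s)

theorem pathMinus_eq (g : ℝ → ℝ) (t l : ℝ) :
    pathMinus g t l = Real.exp (-t * l) * ∫ r in (0 : ℝ)..t, Real.exp (r * l) * g r := by
  rw [pathMinus, ← intervalIntegral.integral_const_mul]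
  refine intervalIntegral.integral_congr fun r _ => ?_
  rw [← mul_assoc, ← Real.exp_add]
  ring_nf

theorem continuous_pathMinus (hg : Measurable g) (hg1 : ∀ s, |g s| ≤ 1) (l : ℝ) :
    Continuous fun t => pathMinus g t l := by
  simp only [pathMinus_eq]
  refine Continuous.mul (by fun_prop) (intervalIntegral.continuous_primitive (fun a b => ?_) 0)
  exact intervalIntegrable_mul_of_bounded (by fun_prop) hg hg1 a b

theorem pathMinus_add_const (hg : Measurable g) (hg1 : ∀ s, |g s| ≤ 1) {a s y : ℝ}
    (has : a ≤ s) (hy : ∀ r ∈ Ico a s, g r = y) (l : ℝ) :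
    pathMinus g s l = Real.exp (-(s - a) * l) * pathMinus g a l + y * beta (s - a) l := by
  have h1 : ∫ r in a..s, Real.exp (-(s - r) * l) * g r = y * beta (s - a) l := by
    have h2 : ∫ r in a..s, Real.exp (-(s - r) * l) * g r =
        ∫ r in a..s, y * Real.exp (-(s - r) * l) := by
      refine intervalIntegral.integral_congr_ae ?_
      have : ∀ᵐ r : ℝ, r ≠ s := by simp [ae_iff]
      filter_upwards [this] with r hr hr'
      rw [uIoc_of_le has] at hr'
      rw [hy r ⟨hr'.1.le, lt_of_le_of_ne hr'.2 hr⟩, mul_comm]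
    rw [h2, intervalIntegral.integral_const_mul,
      intervalIntegral.integral_comp_sub_left (fun r => Real.exp (-r * l)) s, sub_self, beta]
  rw [pathMinus, ← intervalIntegral.integral_add_adjacent_intervals
    (intervalIntegrable_mul_of_bounded (by fun_prop) hg hg1 0 a)
    (intervalIntegrable_mul_of_bounded (by fun_prop) hg hg1 a s), h1, pathMinus,
    ← intervalIntegral.integral_const_mul]
  congr 1
  refine intervalIntegral.integral_congr fun r _ => ?_
  rw [← mul_assoc, ← Real.exp_add]
  ring_nf

theorem pathPlus_add_const (hg : Measurable g) (hg1 : ∀ s, |g s| ≤ 1) {a s y : ℝ}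
    (has : a ≤ s) (hy : ∀ r ∈ Ico a s, g r = y) (l : ℝ) :
    pathPlus g s l = pathPlus g a l + Real.exp (-a * l) * (y * beta (s - a) l) := by
  have h1 : ∫ r in a..s, Real.exp (-r * l) * g r = Real.exp (-a * l) * (y * beta (s - a) l) := by
    have h2 : ∫ r in a..s, Real.exp (-r * l) * g r =
        ∫ r in a..s, (Real.exp (-a * l) * y) * Real.exp (-(r - a) * l) := by
      refine intervalIntegral.integral_congr_ae ?_
      have : ∀ᵐ r : ℝ, r ≠ s := by simp [ae_iff]
      filter_upwards [this] with r hr hr'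
      rw [uIoc_of_le has] at hr'
      rw [hy r ⟨hr'.1.le, lt_of_le_of_ne hr'.2 hr⟩, mul_right_comm, ← Real.exp_add]
      ring_nf
    rw [h2, intervalIntegral.integral_const_mul,
      intervalIntegral.integral_comp_sub_right (fun r => Real.exp (-r * l)) a, sub_self, beta,
      mul_assoc]
  rw [pathPlus, ← intervalIntegral.integral_add_adjacent_intervals
    (intervalIntegrable_mul_of_bounded (by fun_prop) hg hg1 0 a)
    (intervalIntegrable_mul_of_bounded (by fun_prop) hg hg1 a s), h1, pathPlus]

theorem intervalIntegrable_pathPhase (hg : Measurable g) (hg1 : ∀ s, |g s| ≤ 1) (l a b : ℝ) :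
    IntervalIntegrable (fun s => g s * (g s - l * pathMinus g s l)) volume a b := by
  have h1 : IntervalIntegrable (fun s => 1 + |l * pathMinus g s l|) volume a b :=
    Continuous.intervalIntegrable
      (((continuous_pathMinus hg hg1 l).const_mul l).abs.const_add 1) a b
  refine h1.mono_fun ?_ (ae_of_all _ fun s => ?_)
  · exact (hg.mul (hg.sub ((continuous_pathMinus hg hg1 l).measurable.const_mul
      l))).aestronglyMeasurable
  · dsimp only
    rw [norm_mul, Real.norm_eq_abs, Real.norm_eq_abs, Real.norm_eq_abs, abs_of_nonneg
      (add_nonneg zero_le_one (abs_nonneg (l * pathMinus g s l)))]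
    exact (mul_le_of_le_one_left (abs_nonneg _) (hg1 s)).trans
      ((abs_sub _ _).trans (add_le_add_left (hg1 s) _))

theorem pathPhase_add_const (hg : Measurable g) (hg1 : ∀ s, |g s| ≤ 1) {a s y : ℝ}
    (has : a ≤ s) (hy : ∀ r ∈ Ico a s, g r = y) (hy2 : y ^ 2 = 1) (l : ℝ) :
    pathPhase g s l = pathPhase g a l + beta (s - a) l -
      l * pathMinus g a l * (y * beta (s - a) l) := by
  -- On a stretch where g is the constant y with y² = 1, the integrand is y (y - l U(r)), and this
  -- residual decays exponentially from its value at a.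
  have h1 : ∫ r in a..s, g r * (g r - l * pathMinus g r l) =
      ∫ r in a..s, (1 - l * pathMinus g a l * y) * Real.exp (-(r - a) * l) := by
    refine intervalIntegral.integral_congr_ae ?_
    have : ∀ᵐ r : ℝ, r ≠ s := by simp [ae_iff]
    filter_upwards [this] with r hr hr'
    rw [uIoc_of_le has] at hr'
    rw [hy r ⟨hr'.1.le, lt_of_le_of_ne hr'.2 hr⟩, pathMinus_add_const hg hg1 hr'.1.le
      (fun u hu => hy u ⟨hu.1, hu.2.trans_le hr'.2⟩)]
    have := mul_beta (r - a) l
    linear_combination (1 - l * beta (r - a) l) * hy2 - this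
  rw [pathPhase, ← intervalIntegral.integral_add_adjacent_intervals
    (intervalIntegrable_pathPhase hg hg1 l 0 a) (intervalIntegrable_pathPhase hg hg1 l a s), h1,
    intervalIntegral.integral_const_mul,
    intervalIntegral.integral_comp_sub_right (fun r => Real.exp (-r * l)) a, sub_self, ← beta,
    pathPhase]
  ring

variable {p y : ℕ → ℝ}

theorem path_eq_step (hp : Monotone p) (hp0 : p 0 = 0) (hy : ∀ n, y n ^ 2 = 1)
    (hg : Measurable g) (hg1 : ∀ s, |g s| ≤ 1) {N : ℕ}
    (hgy : ∀ i < N, ∀ s ∈ Ico (p i) (p (i + 1)), g s = y i) (l : ℝ) :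
    ∀ n ≤ N, pathMinus g (p n) l = stepMinus p y l n ∧ pathPlus g (p n) l = stepPlus p y l n ∧
      pathPhase g (p n) l = stepPhase p y l n := by
  intro n
  induction n with
  | zero =>
    intro _
    simp [pathMinus, pathPlus, pathPhase, stepMinus, stepPlus, stepPhase, hp0]
  | succ n ih =>
    intro hn
    obtain ⟨h1, h2, h3⟩ := ih (Nat.le_of_succ_le hn)
    have hle := hp n.le_succ
    have hc := hgy n hn
    rw [pathMinus_add_const hg hg1 hle hc, pathPlus_add_const hg hg1 hle hc,
      pathPhase_add_const hg hg1 hle hc (hy n), h1, h2, h3, stepMinus, stepPlus, stepPhase]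
    exact ⟨rfl, rfl, rfl⟩

/-- The step function with value `yᵢ` on `[pᵢ, pᵢ₊₁)` for `i < N`. -/
def stepFun (p y : ℕ → ℝ) : ℕ → ℝ → ℝ
  | 0, _ => 0
  | n + 1, s => if s < p n then stepFun p y n s else y n

theorem measurable_stepFun (p y : ℕ → ℝ) (n : ℕ) : Measurable (stepFun p y n) := by
  induction n with
  | zero => exact measurable_const
  | succ n ih => exact Measurable.ite measurableSet_Iio ih measurable_const

theorem abs_stepFun_le (hy : ∀ n, |y n| ≤ 1) (n : ℕ) (s : ℝ) : |stepFun p y n s| ≤ 1 := by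
  induction n with
  | zero => simp [stepFun]
  | succ n ih =>
    rw [stepFun]
    split_ifs
    exacts [ih, hy n]

theorem stepFun_eq (hp : Monotone p) {N i : ℕ} (hi : i < N) {s : ℝ}
    (hs : s ∈ Ico (p i) (p (i + 1))) : stepFun p y N s = y i := by
  induction N with
  | zero => exact absurd hi i.not_lt_zero
  | succ N ih =>
    rw [stepFun]
    rcases (Nat.lt_succ_iff_lt_or_eq.1 hi) with h | rfl
    · rw [if_pos (hs.2.trans_le (hp h)), ih h]
    · rw [if_neg hs.1.not_gt]

theorem exists_mem_Ico_of_monotone (hp0 : p 0 = 0) {N : ℕ} {s : ℝ} (h0 : 0 ≤ s) (hs : s < p N) :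
    ∃ i < N, s ∈ Ico (p i) (p (i + 1)) := by
  induction N with
  | zero => exact absurd (hp0 ▸ hs) h0.not_gt
  | succ N ih =>
    by_cases h : s < p N
    · obtain ⟨i, hi, h'⟩ := ih h
      exact ⟨i, hi.trans N.lt_succ_self, h'⟩
    · exact ⟨N, N.lt_succ_self, not_lt.1 h, hs⟩

/-- Dominated convergence for the functionals of a path. -/
theorem tendsto_path {u : ℕ → ℝ → ℝ} (hu : ∀ n, Measurable (u n)) (hu1 : ∀ n s, |u n s| ≤ 1)
    {t : ℝ} (ht : 0 ≤ t)
    (hlim : ∀ s ∈ Ico 0 t, Tendsto (fun n => u n s) atTop (𝓝 (g s))) {l : ℝ} (hl : 0 ≤ l) :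
    Tendsto (fun n => pathMinus (u n) t l) atTop (𝓝 (pathMinus g t l)) ∧
    Tendsto (fun n => pathPlus (u n) t l) atTop (𝓝 (pathPlus g t l)) ∧
    Tendsto (fun n => pathPhase (u n) t l) atTop (𝓝 (pathPhase g t l)) := by
  have hne : ∀ᵐ s : ℝ, s ≠ t := by simp [ae_iff]
  have hgen : ∀ (f : ℝ → ℝ), Continuous f → ∀ s ∈ Icc 0 t,
      Tendsto (fun n => ∫ r in (0 : ℝ)..s, f r * u n r) atTop
        (𝓝 (∫ r in (0 : ℝ)..s, f r * g r)) := by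
    intro f hf s hs
    refine intervalIntegral.tendsto_integral_filter_of_dominated_convergence (fun r => |f r|)
      (Eventually.of_forall fun n => (hf.measurable.mul (hu n)).aestronglyMeasurable)
      (Eventually.of_forall fun n => ae_of_all _ fun r _ => ?_)
      (hf.abs.intervalIntegrable _ _) ?_
    · rw [norm_mul]
      exact mul_le_of_le_one_right (norm_nonneg _) (hu1 n r)
    · filter_upwards [hne] with r hr hr'
      rw [uIoc_of_le hs.1] at hr'
      exact (hlim r ⟨hr'.1.le, lt_of_le_of_ne (hr'.2.trans hs.2) hr⟩).const_mul _
  have hminus : ∀ s ∈ Icc 0 t, Tendsto (fun n => pathMinus (u n) s l) atTop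
      (𝓝 (pathMinus g s l)) := fun s hs => hgen _ (by fun_prop) s hs
  refine ⟨hminus t ⟨ht, le_rfl⟩, hgen _ (by fun_prop) t ⟨ht, le_rfl⟩, ?_⟩
  refine intervalIntegral.tendsto_integral_filter_of_dominated_convergence (fun _ => 1 + l * t)
    (Eventually.of_forall fun n => ?_) (Eventually.of_forall fun n => ae_of_all _ fun s hs => ?_)
    intervalIntegrable_const ?_
  · exact ((hu n).mul ((hu n).sub ((continuous_pathMinus (hu n) (hu1 n) l).measurable.const_mul
      l))).aestronglyMeasurable
  · rw [uIoc_of_le ht] at hs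
    have h1 : |pathMinus (u n) s l| ≤ t := by
      have h2 := intervalIntegral.norm_integral_le_of_norm_le_const (a := (0 : ℝ)) (b := s)
        (f := fun r => Real.exp (-(s - r) * l) * u n r) (C := 1) fun r hr => by
          rw [uIoc_of_le hs.1.le] at hr
          rw [norm_mul, Real.norm_of_nonneg (Real.exp_pos _).le]
          exact mul_le_one₀ (exp_neg_mul_le_one (sub_nonneg.2 hr.2) hl) (norm_nonneg _) (hu1 n r)
      rw [one_mul, sub_zero, abs_of_pos hs.1] at h2
      exact h2.trans hs.2
    rw [norm_mul]
    refine (mul_le_of_le_one_left (norm_nonneg _) (hu1 n s)).trans ?_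
    refine (abs_sub _ _).trans (add_le_add (hu1 n s) ?_)
    rw [abs_mul, abs_of_nonneg hl]
    exact mul_le_mul_of_nonneg_left h1 hl
  · filter_upwards [hne] with s hs hs'
    rw [uIoc_of_le ht] at hs'
    have h1 := hlim s ⟨hs'.1.le, lt_of_le_of_ne hs'.2 hs⟩
    exact h1.mul (h1.sub ((hminus s ⟨hs'.1.le, hs'.2⟩).const_mul l))

/-- Sequences of partitions of `[0, t]` whose mesh tends to zero. -/
structure IsPartitionSeq (t : ℝ) (p : ℕ → ℕ → ℝ) (N : ℕ → ℕ) : Prop where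
  mono : ∀ n, Monotone (p n)
  zero : ∀ n, p n 0 = 0
  last : ∀ n, p n (N n) = t
  mesh : ∀ ε > 0, ∀ᶠ n in atTop, ∀ i < N n, p n (i + 1) - p n i < ε

/-- Each interval carries the value of g at its right endpoint. These endpoints approach a given s
strictly from the right, so right-continuity suffices for pointwise convergence, and it is this
sampling that fits the Markov property. -/
theorem tendsto_step {t : ℝ} (ht : 0 ≤ t) {p : ℕ → ℕ → ℝ} {N : ℕ → ℕ}
    (hp : IsPartitionSeq t p N) (hg2 : ∀ s, g s ^ 2 = 1)
    (hgc : ∀ s, 0 ≤ s → ContinuousWithinAt g (Ici s) s) {l : ℝ} (hl : 0 ≤ l) :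
    Tendsto (fun n => stepMinus (p n) (fun i => g (p n (i + 1))) l (N n)) atTop
      (𝓝 (pathMinus g t l)) ∧
    Tendsto (fun n => stepPlus (p n) (fun i => g (p n (i + 1))) l (N n)) atTop
      (𝓝 (pathPlus g t l)) ∧
    Tendsto (fun n => stepPhase (p n) (fun i => g (p n (i + 1))) l (N n)) atTop
      (𝓝 (pathPhase g t l)) := by
  set u : ℕ → ℝ → ℝ := fun n => stepFun (p n) (fun i => g (p n (i + 1))) (N n) with hu
  have hg1 : ∀ s, |g s| ≤ 1 := fun s => abs_le_one_of_sq (hg2 s)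
  have hlim : ∀ s ∈ Ico 0 t, Tendsto (fun n => u n s) atTop (𝓝 (g s)) := by
    intro s hs
    rw [Metric.tendsto_atTop']
    intro ε hε
    obtain ⟨δ, hδ, h1⟩ := Metric.continuousWithinAt_iff.1 (hgc s hs.1) ε hε
    obtain ⟨n₀, hn₀⟩ := eventually_atTop.1 (hp.mesh δ hδ)
    refine ⟨n₀, fun n hn => ?_⟩
    obtain ⟨i, hi, hsi⟩ := exists_mem_Ico_of_monotone (hp.zero n) hs.1 ((hp.last n).symm ▸ hs.2)
    have h2 : u n s = g (p n (i + 1)) := stepFun_eq (hp.mono n) hi hsi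
    rw [h2]
    refine h1 hsi.2.le ?_
    rw [Real.dist_eq, abs_of_nonneg (by linarith [hsi.2])]
    linarith [hn₀ n hn.le i hi, hsi.1]
  have hmeas : ∀ n, Measurable (u n) := fun n => measurable_stepFun _ _ _
  have hbd : ∀ n s, |u n s| ≤ 1 := fun n s => abs_stepFun_le (fun _ => hg1 _) _ _
  have h := tendsto_path hmeas hbd ht hlim hl
  have heq : ∀ n, _ := fun n => path_eq_step (hp.mono n) (hp.zero n)
    (fun i => hg2 (p n (i + 1))) (hmeas n) (hbd n)
    (fun i hi s hs => stepFun_eq (hp.mono n) hi hs) l (N n) le_rfl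
  refine ⟨h.1.congr fun n => ?_, h.2.1.congr fun n => ?_, h.2.2.congr fun n => ?_⟩
  · rw [← hp.last n]
    exact (heq n).1
  · rw [← hp.last n]
    exact (heq n).2.1
  · rw [← hp.last n]
    exact (heq n).2.2

theorem SpinPath.val_sq (γ : SpinPath) (s : ℝ) : γ.val s ^ 2 = 1 := spinVal_sq _

theorem SpinPath.continuousWithinAt_val (γ : SpinPath) (s : ℝ) :
    ContinuousWithinAt γ.val (Ici s) s := by
  have h1 : ContinuousWithinAt (fun r : ℝ => γ.1 r.toNNReal) (Ici s) s :=
    (γ.2 s.toNNReal).comp continuous_real_toNNReal.continuousWithinAt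
      fun r hr => Real.toNNReal_le_toNNReal hr
  have h2 : Continuous spinVal := continuous_of_discreteTopology
  exact h2.continuousAt.comp_continuousWithinAt h1

/-- A right-continuous path is the pointwise limit of its values at the grid points (⌊s(n+1)⌋ +
1)/(n+1), which lie strictly to the right of s and within 1/(n+1) of it. -/
theorem SpinPath.measurable_val (γ : SpinPath) : Measurable γ.val := by
  have h1 : ∀ n : ℕ, Measurable fun s : ℝ => γ.val ((⌊s * (n + 1)⌋ + 1 : ℤ) / (n + 1)) := fun n =>
    (measurable_from_top (f := fun z : ℤ => γ.val ((z + 1 : ℤ) / (n + 1)))).comp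
      (Int.measurable_floor.comp (measurable_id.mul_const _))
  refine measurable_of_tendsto_metrizable h1 (tendsto_pi_nhds.2 fun s => ?_)
  have hc := γ.continuousWithinAt_val s
  refine hc.tendsto.comp (tendsto_nhdsWithin_iff.2 ⟨?_, Eventually.of_forall fun n => ?_⟩)
  · refine tendsto_of_tendsto_of_tendsto_of_le_of_le (tendsto_const_nhds (x := s))
      (h := fun n : ℕ => s + 1 / ((n : ℝ) + 1)) ?_ (fun n => ?_) (fun n => ?_)
    · simpa using (tendsto_one_div_add_atTop_nhds_zero_nat (𝕜 := ℝ)).const_add s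
    · have h2 := Int.lt_floor_add_one (s * (n + 1))
      have h3 : (0 : ℝ) < n + 1 := by positivity
      push_cast
      rw [le_div_iff₀ h3]
      exact h2.le
    · have h2 := Int.floor_le (s * (n + 1))
      have h3 : (0 : ℝ) < n + 1 := by positivity
      push_cast
      rw [add_div]
      refine add_le_add_left ?_ _
      rw [div_le_iff₀ h3]
      exact h2
  · have h2 := Int.lt_floor_add_one (s * (n + 1))
    have h3 : (0 : ℝ) < n + 1 := by positivity
    rw [mem_Ici]
    push_cast
    rw [le_div_iff₀ h3]
    exact h2.le

end PathLimits
/-! ### Jumps of paths and Riemann-Stieltjes integrals -/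

section Jumps

/-- A right-continuous `±1`-valued function of bounded variation is a finite sum of jumps. -/
theorem exists_jumps {g : ℝ → ℝ} (hg2 : ∀ s, g s ^ 2 = 1)
    (hgc : ∀ s, 0 ≤ s → ContinuousWithinAt g (Ici s) s) {t : ℝ} (K : ℕ) :
    ∀ a, 0 ≤ a → a ≤ t → eVariationOn g (Icc a t) ≤ 2 * K →
      ∃ (m : ℕ) (q D : ℕ → ℝ), (∀ j < m, a < q j) ∧
        ∀ r ∈ Icc a t, g r = g a + ∑ j ∈ Finset.range m, D j * if q j ≤ r then 1 else 0 := by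
  have hdisc : ∀ r s, |g r - g s| < 1 → g r = g s := by
    intro r s h
    rcases sq_eq_one_iff.1 (hg2 r) with h1 | h1 <;>
    rcases sq_eq_one_iff.1 (hg2 s) with h2 | h2 <;> rw [h1, h2] at h ⊢ <;> norm_num at h
  induction K with
  | zero =>
    intro a ha hat hv
    refine ⟨0, fun _ => 0, fun _ => 0, by simp, fun r hr => ?_⟩
    have h1 := (eVariationOn.edist_le g hr (left_mem_Icc.2 hat)).trans hv
    rw [Nat.cast_zero, mul_zero, nonpos_iff_eq_zero, edist_eq_zero] at h1
    simpa using h1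
  | succ K ih =>
    intro a ha hat hv
    set S := {r | r ∈ Icc a t ∧ g r ≠ g a} with hS
    rcases S.eq_empty_or_nonempty with h0 | hne
    · refine ⟨0, fun _ => 0, fun _ => 0, by simp, fun r hr => ?_⟩
      by_contra h
      have : r ∈ S := ⟨hr, by simpa using h⟩
      simp [h0] at this
    · set b := sInf S with hb
      have hbdd : BddBelow S := ⟨a, fun r hr => hr.1.1⟩
      have hab : a ≤ b := le_csInf hne fun r hr => hr.1.1
      have hbt : b ≤ t := by
        obtain ⟨r, hr⟩ := hne
        exact (csInf_le hbdd hr).trans hr.1.2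
      have hlt : ∀ r ∈ Icc a t, r < b → g r = g a := fun r hr hrb => by
        by_contra h
        exact (csInf_le hbdd ⟨hr, h⟩).not_gt hrb
      -- By right-continuity and discreteness of the values the infimum of the times with a changed
      -- value is attained, so b is a genuine jump time.
      have hgb : g b ≠ g a := by
        intro h
        obtain ⟨δ, hδ, h1⟩ := Metric.continuousWithinAt_iff.1 (hgc b (ha.trans hab)) 1 one_pos
        obtain ⟨r, hr, hrb⟩ := exists_lt_of_csInf_lt hne (lt_add_of_pos_right b hδ)
        have hbr : b ≤ r := csInf_le hbdd hr
        have h2 := h1 (x := r) hbr (by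
          rw [Real.dist_eq, abs_of_nonneg (sub_nonneg.2 hbr)]
          linarith)
        rw [Real.dist_eq] at h2
        exact hr.2 ((hdisc r b h2).trans h)
      have hab' : a < b := lt_of_le_of_ne hab fun h => hgb (by rw [← h])
      -- A jump between 1 and -1 consumes exactly 2 units of variation, so the induction on K is on
      -- the number of jumps still allowed.
      have hv2 : eVariationOn g (Icc b t) ≤ 2 * K := by
        have h1 := eVariationOn.Icc_add_Icc g (s := univ) hab hbt (mem_univ b)
        simp only [univ_inter] at h1
        have h2 : (2 : ℝ≥0∞) ≤ eVariationOn g (Icc a b) := by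
          refine le_trans ?_ (eVariationOn.edist_le g (right_mem_Icc.2 hab) (left_mem_Icc.2 hab))
          have h3 : |g b - g a| = 2 := by
            have h4 : 1 ≤ |g b - g a| := not_lt.1 fun h => hgb (hdisc b a h)
            have h5 : |g b - g a| ^ 2 = 2 - 2 * (g b * g a) := by
              rw [sq_abs]
              linear_combination hg2 b + hg2 a
            have h6 : (g b * g a) ^ 2 = 1 := by rw [mul_pow, hg2, hg2, one_mul]
            rcases sq_eq_one_iff.1 h6 with h7 | h7 <;> nlinarith
          rw [edist_dist, Real.dist_eq, h3]
          norm_num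
        rw [← h1] at hv
        have h3 : 2 + eVariationOn g (Icc b t) ≤ 2 + 2 * K := by
          refine (add_le_add_left h2 _).trans (hv.trans (le_of_eq ?_))
          push_cast
          ring
        exact (ENNReal.add_le_add_iff_left (by norm_num)).1 h3
      obtain ⟨m, q, D, hq, hrep⟩ := ih b (ha.trans hab) hbt hv2
      refine ⟨m + 1, fun j => Nat.casesOn j b q, fun j => Nat.casesOn j (g b - g a) D, ?_, ?_⟩
      · rintro (_ | j) hj
        · exact hab'
        · exact hab'.trans (hq j (Nat.succ_lt_succ_iff.1 hj))
      · intro r hr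
        rw [Finset.sum_range_succ']
        rcases lt_or_ge r b with h | h
        · rw [hlt r hr h, Finset.sum_eq_zero fun j hj => ?_]
          · simp [h.not_ge]
          · have := h.trans (hq j (Finset.mem_range.1 hj))
            simp [this.not_ge]
        · rw [hrep r ⟨h, hr.2⟩]
          change _ = g a + ((∑ j ∈ Finset.range m, D j * if q j ≤ r then 1 else 0) +
            (g b - g a) * if b ≤ r then 1 else 0)
          rw [if_pos h]
          ring

theorem HasRSIntegral.unique {f g : ℝ → ℝ} {a b I J : ℝ} (hab : a ≤ b)
    (hI : HasRSIntegral f g a b I) (hJ : HasRSIntegral f g a b J) : I = J := by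
  by_contra hne
  have hε : 0 < |I - J| / 2 := half_pos (abs_pos.2 (sub_ne_zero.2 hne))
  obtain ⟨δ₁, hδ₁, h1⟩ := hI _ hε
  obtain ⟨δ₂, hδ₂, h2⟩ := hJ _ hε
  obtain ⟨n, hn⟩ := exists_nat_gt ((b - a) / min δ₁ δ₂)
  have hδ : 0 < min δ₁ δ₂ := lt_min hδ₁ hδ₂
  have hn0 : (0 : ℝ) < n + 1 := by positivity
  set p : ℕ → ℝ := fun i => a + (b - a) * i / (n + 1) with hp
  have hstep : ∀ i, p (i + 1) - p i = (b - a) / (n + 1) := fun i => by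
    simp only [hp]
    push_cast
    ring
  have hstep0 : 0 ≤ (b - a) / (n + 1) := div_nonneg (sub_nonneg.2 hab) hn0.le
  have hmesh : (b - a) / (n + 1) < min δ₁ δ₂ := by
    rw [div_lt_iff₀ hn0]
    rw [div_lt_iff₀ hδ] at hn
    nlinarith
  have hpart : ∀ i < n + 1, p i ≤ p i ∧ p i ≤ p (i + 1) ∧ p (i + 1) - p i < min δ₁ δ₂ :=
    fun i _ => ⟨le_rfl, by linarith [hstep i], by rw [hstep]; exact hmesh⟩
  have hp0 : p 0 = a := by simp [hp]
  have hpn : p (n + 1) = b := by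
    simp only [hp]
    push_cast
    field_simp
    ring
  have h3 := h1 (n + 1) p p hp0 hpn fun i hi =>
    ⟨(hpart i hi).1, (hpart i hi).2.1, (hpart i hi).2.2.trans_le (min_le_left _ _)⟩
  have h4 := h2 (n + 1) p p hp0 hpn fun i hi =>
    ⟨(hpart i hi).1, (hpart i hi).2.1, (hpart i hi).2.2.trans_le (min_le_right _ _)⟩
  set s := ∑ i ∈ Finset.range (n + 1), f (p i) * (g (p (i + 1)) - g (p i))
  have h5 : |I - J| ≤ |s - I| + |s - J| := by
    have := abs_sub (s - J) (s - I)
    rw [show s - J - (s - I) = I - J by ring] at this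
    linarith
  linarith

theorem HasRSIntegral.rsIntegral_eq {f g : ℝ → ℝ} {a b I : ℝ} (hab : a ≤ b)
    (hI : HasRSIntegral f g a b I) : rsIntegral f g a b = I := by
  have h : ∃ I, HasRSIntegral f g a b I := ⟨I, hI⟩
  rw [rsIntegral, dif_pos h]
  exact h.choose_spec.unique hab hI

theorem HasRSIntegral.add {f g h : ℝ → ℝ} {a b I J : ℝ} (hI : HasRSIntegral f g a b I)
    (hJ : HasRSIntegral f h a b J) : HasRSIntegral f (fun r => g r + h r) a b (I + J) := by
  intro ε hε
  obtain ⟨δ₁, hδ₁, h1⟩ := hI _ (half_pos hε)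
  obtain ⟨δ₂, hδ₂, h2⟩ := hJ _ (half_pos hε)
  refine ⟨min δ₁ δ₂, lt_min hδ₁ hδ₂, fun n p ξ hp0 hpn hp => ?_⟩
  have h3 := h1 n p ξ hp0 hpn fun i hi =>
    ⟨(hp i hi).1, (hp i hi).2.1, (hp i hi).2.2.trans_le (min_le_left _ _)⟩
  have h4 := h2 n p ξ hp0 hpn fun i hi =>
    ⟨(hp i hi).1, (hp i hi).2.1, (hp i hi).2.2.trans_le (min_le_right _ _)⟩
  have h5 : ∑ i ∈ Finset.range n, f (ξ i) * (g (p (i + 1)) + h (p (i + 1)) - (g (p i) + h (p i))) =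
      ∑ i ∈ Finset.range n, f (ξ i) * (g (p (i + 1)) - g (p i)) +
      ∑ i ∈ Finset.range n, f (ξ i) * (h (p (i + 1)) - h (p i)) := by
    rw [← Finset.sum_add_distrib]
    exact Finset.sum_congr rfl fun i _ => by ring
  rw [h5, add_sub_add_comm]
  exact (abs_add_le _ _).trans_lt (by linarith)

theorem hasRSIntegral_const (f : ℝ → ℝ) (c a b : ℝ) : HasRSIntegral f (fun _ => c) a b 0 :=
  fun ε hε => ⟨1, one_pos, fun n p ξ _ _ _ => by simpa using hε⟩

theorem HasRSIntegral.const_mul {f g : ℝ → ℝ} {a b I : ℝ} (c : ℝ) (hI : HasRSIntegral f g a b I) :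
    HasRSIntegral f (fun r => c * g r) a b (c * I) := by
  intro ε hε
  obtain ⟨δ, hδ, h1⟩ := hI (ε / (|c| + 1)) (by positivity)
  refine ⟨δ, hδ, fun n p ξ hp0 hpn hp => ?_⟩
  have h2 := h1 n p ξ hp0 hpn hp
  have h3 : ∑ i ∈ Finset.range n, f (ξ i) * (c * g (p (i + 1)) - c * g (p i)) =
      c * ∑ i ∈ Finset.range n, f (ξ i) * (g (p (i + 1)) - g (p i)) := by
    rw [Finset.mul_sum]
    exact Finset.sum_congr rfl fun i _ => by ring
  rw [h3, ← mul_sub, abs_mul]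
  rw [lt_div_iff₀ (by positivity)] at h2
  nlinarith [abs_nonneg (∑ i ∈ Finset.range n, f (ξ i) * (g (p (i + 1)) - g (p i)) - I)]

theorem hasRSIntegral_sum {f : ℝ → ℝ} {g : ℕ → ℝ → ℝ} {a b : ℝ} {I : ℕ → ℝ} {m : ℕ}
    (h : ∀ j < m, HasRSIntegral f (g j) a b (I j)) :
    HasRSIntegral f (fun r => ∑ j ∈ Finset.range m, g j r) a b (∑ j ∈ Finset.range m, I j) := by
  induction m with
  | zero => simpa using hasRSIntegral_const f 0 a b
  | succ m ih =>
    simp only [Finset.sum_range_succ]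
    exact (ih fun j hj => h j (hj.trans m.lt_succ_self)).add (h m m.lt_succ_self)

theorem partition_mem_Icc {n : ℕ} {p : ℕ → ℝ} (hp : ∀ i < n, p i ≤ p (i + 1)) :
    ∀ i ≤ n, p i ∈ Icc (p 0) (p n) := by
  have hmono : ∀ i j, i ≤ j → j ≤ n → p i ≤ p j := by
    intro i j hij
    induction j, hij using Nat.le_induction with
    | base => exact fun _ => le_rfl
    | succ j _ ih => exact fun hj => (ih (Nat.le_of_succ_le hj)).trans (hp j hj)
  exact fun i hi => ⟨hmono 0 i i.zero_le hi, hmono i n hi le_rfl⟩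

theorem HasRSIntegral.congr {f g h : ℝ → ℝ} {a b I : ℝ} (hI : HasRSIntegral f g a b I)
    (hgh : ∀ r ∈ Icc a b, h r = g r) : HasRSIntegral f h a b I := by
  intro ε hε
  obtain ⟨δ, hδ, h1⟩ := hI ε hε
  refine ⟨δ, hδ, fun n p ξ hp0 hpn hp => ?_⟩
  have hmem := partition_mem_Icc fun i hi => (hp i hi).1.trans (hp i hi).2.1
  rw [hp0, hpn] at hmem
  have h2 : ∑ i ∈ Finset.range n, f (ξ i) * (h (p (i + 1)) - h (p i)) =
      ∑ i ∈ Finset.range n, f (ξ i) * (g (p (i + 1)) - g (p i)) :=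
    Finset.sum_congr rfl fun i hi => by
      have hi' := Finset.mem_range.1 hi
      rw [hgh _ (hmem i hi'.le), hgh _ (hmem (i + 1) hi')]
  rw [h2]
  exact h1 n p ξ hp0 hpn hp

/-- Only the partition interval in which q is passed contributes, and there the tag is within the
mesh of q. The case q = s is excluded because the integrands in question may be singular at the
endpoint s. -/
theorem hasRSIntegral_jump {f : ℝ → ℝ} {q s : ℝ} (hq : 0 < q) (hqs : q ≠ s)
    (hf : q < s → ContinuousAt f q) :
    HasRSIntegral f (fun r => if q ≤ r then 1 else 0) 0 s (if q < s then f q else 0) := by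
  intro ε hε
  rcases lt_or_ge q s with h | h
  · rw [if_pos h]
    obtain ⟨δ, hδ, h1⟩ := Metric.continuousAt_iff.1 (hf h) (ε / 2) (half_pos hε)
    refine ⟨δ, hδ, fun n p ξ hp0 hpn hp => ?_⟩
    have key : ∀ m ≤ n, |∑ i ∈ Finset.range m, f (ξ i) * ((if q ≤ p (i + 1) then 1 else 0) -
        if q ≤ p i then 1 else 0) - f q * if q ≤ p m then 1 else 0| ≤ ε / 2 := by
      intro m
      induction m with
      | zero => simpa [hp0, hq.not_ge] using (half_pos hε).le
      | succ m ih =>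
        intro hm
        have h2 := ih (Nat.le_of_succ_le hm)
        obtain ⟨h3, h4, h5⟩ := hp m hm
        rw [Finset.sum_range_succ]
        by_cases h6 : q ≤ p m
        · have h7 : q ≤ p (m + 1) := h6.trans (h3.trans h4)
          simpa [h6, h7] using h2
        · by_cases h7 : q ≤ p (m + 1)
          · have h8 : ∑ i ∈ Finset.range m, f (ξ i) * ((if q ≤ p (i + 1) then 1 else 0) -
                if q ≤ p i then 1 else 0) = 0 := by
              refine Finset.sum_eq_zero fun i hi => ?_
              have hi' := Finset.mem_range.1 hi
              have hmem := partition_mem_Icc (n := m) (p := p) fun i hi =>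
                (hp i (hi.trans hm)).1.trans (hp i (hi.trans hm)).2.1
              have h9 : ¬ q ≤ p i := fun h => h6 (h.trans (hmem i hi'.le).2)
              have h10 : ¬ q ≤ p (i + 1) := fun h => h6 (h.trans (hmem (i + 1) hi').2)
              simp [h9, h10]
            have h11 := h1 (x := ξ m) (by
              rw [Real.dist_eq, abs_lt]
              constructor <;> linarith [not_le.1 h6])
            rw [Real.dist_eq] at h11
            rw [h8]
            simpa [h6, h7] using h11.le
          · simpa [h6, h7] using h2
    have h2 := key n le_rfl
    rw [hpn, if_pos h.le, mul_one] at h2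
    linarith
  · rw [if_neg h.not_gt]
    have hsq : s < q := lt_of_le_of_ne h hqs.symm
    refine ⟨1, one_pos, fun n p ξ hp0 hpn hp => ?_⟩
    have hmem := partition_mem_Icc fun i hi => (hp i hi).1.trans (hp i hi).2.1
    rw [Finset.sum_eq_zero fun i hi => ?_]
    · simpa using hε
    · have hi' := Finset.mem_range.1 hi
      have h9 : ¬ q ≤ p i := fun h => (h.trans ((hmem i hi'.le).2.trans hpn.le)).not_gt hsq
      have h10 : ¬ q ≤ p (i + 1) := fun h =>
        (h.trans ((hmem (i + 1) hi').2.trans hpn.le)).not_gt hsq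
      simp [h9, h10]

end Jumps
/-! ### The phase process of a path of bounded variation -/

section PhaseFormula

variable {M : Type*} [MeasurableSpace M] {μ : Measure M} {ω : M → ℝ}

theorem BddMul.integrable_mul_sq {m : M → ℝ} (h : BddMul m) (f : OneBoson μ) :
    Integrable (fun k => m k * ‖f k‖ ^ 2) μ := by
  obtain ⟨C, hC⟩ := h.2
  exact ((memLp_two_iff_integrable_sq_norm (Lp.memLp f).1).1 (Lp.memLp f)).bdd_mul
    h.1.aestronglyMeasurable (ae_of_all _ fun k => by simpa using hC k)

variable (ω) in
/-- The function `r ↦ ∫ e^{-rω} (1 + √ω)² |v₀|² dμ`. -/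
def phaseKernel (v₀ : OneBoson μ) (r : ℝ) : ℝ :=
  ∫ k, Real.exp (-r * ω k) * ((1 + Real.sqrt (ω k)) ^ 2 * ‖v₀ k‖ ^ 2) ∂μ

theorem phaseIntegrator_eq (hω_nonneg : ∀ k, 0 ≤ ω k) (hω_pos : ∀ᵐ k ∂μ, 0 < ω k) {v : M → ℂ}
    (hv : MemLp (fun k => v k / (rho ω k : ℂ)) 2 μ) (r : ℝ) :
    phaseIntegrator μ ω v r = -phaseKernel ω (toL2 μ fun k => v k / (rho ω k : ℂ)) r := by
  rw [phaseIntegrator, phaseKernel]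
  congr 1
  refine integral_congr_ae ?_
  filter_upwards [hω_pos, toL2_coe hv] with k hk hk2
  have h1 : 0 < rho ω k := by
    have := Real.sqrt_pos.2 hk
    unfold rho
    positivity
  have h2 := rho_sq hω_nonneg k
  rw [hk2, norm_div, Complex.norm_real, Real.norm_of_nonneg h1.le, div_pow, h2]
  field_simp

theorem bddMul_exp_mul_one_add_sqrt_sq (hω : Measurable ω) (hω_nonneg : ∀ k, 0 ≤ ω k) {r : ℝ}
    (hr : 0 < r) : (∀ k, |Real.exp (-r * ω k) * (1 + Real.sqrt (ω k)) ^ 2| ≤ 2 * (1 + r⁻¹)) ∧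
      BddMul fun k => Real.exp (-r * ω k) * (1 + Real.sqrt (ω k)) ^ 2 := by
  have h : ∀ k, |Real.exp (-r * ω k) * (1 + Real.sqrt (ω k)) ^ 2| ≤ 2 * (1 + r⁻¹) := fun k => by
    rw [abs_of_nonneg (by positivity), mul_comm]
    refine one_add_sqrt_sq_mul_le hω_nonneg (Real.exp_pos _).le
      (exp_neg_mul_le_one hr.le (hω_nonneg k)) ?_
    have h1 := Real.add_one_le_exp (r * ω k)
    have h2 : Real.exp (-r * ω k) * Real.exp (r * ω k) = 1 := by
      rw [← Real.exp_add]
      simp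
    rw [inv_eq_one_div, le_div_iff₀ hr]
    nlinarith [Real.exp_pos (-r * ω k)]
  exact ⟨h, by fun_prop, _, h⟩

theorem phaseKernel_eq (hω : Measurable ω) (hω_nonneg : ∀ k, 0 ≤ ω k) (v₀ : OneBoson μ) {r : ℝ}
    (hr : 0 < r) : (phaseKernel ω v₀ r : ℂ) =
      ⟪v₀, mulOp μ (fun k => Real.exp (-r * ω k) * (1 + Real.sqrt (ω k)) ^ 2) v₀⟫_ℂ := by
  rw [inner_mulOp_self (bddMul_exp_mul_one_add_sqrt_sq hω hω_nonneg hr).2, phaseKernel]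
  simp only [mul_assoc]

theorem continuousAt_phaseKernel (hω : Measurable ω) (hω_nonneg : ∀ k, 0 ≤ ω k) (v₀ : OneBoson μ)
    {r : ℝ} (hr : 0 < r) : ContinuousAt (phaseKernel ω v₀) r := by
  refine tendsto_of_seq_tendsto fun u hu => ?_
  have hev : ∀ᶠ n in atTop, r / 2 < u n := hu.eventually (lt_mem_nhds (half_lt_self hr))
  -- The multipliers e^{-rω}(1 + √ω)² are bounded only for r away from 0; truncating the sequence at
  -- r/2 gives a uniform bound and changes nothing eventually.
  have hmax : Tendsto (fun n => max (u n) (r / 2)) atTop (𝓝 r) := by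
    have := hu.max (tendsto_const_nhds (x := r / 2))
    rwa [max_eq_left (half_lt_self hr).le] at this
  have hpos : ∀ n, 0 < max (u n) (r / 2) := fun n => lt_max_of_lt_right (half_pos hr)
  have h1 := tendsto_mulOp (μ := μ) (l := atTop) (C := 2 * (1 + (r / 2)⁻¹))
    (fun n => (bddMul_exp_mul_one_add_sqrt_sq hω hω_nonneg (hpos n)).2)
    (bddMul_exp_mul_one_add_sqrt_sq hω hω_nonneg hr).2.1
    (Eventually.of_forall fun n k =>
      ((bddMul_exp_mul_one_add_sqrt_sq hω hω_nonneg (hpos n)).1 k).trans (by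
        gcongr
        exact le_max_right _ _))
    (fun k => ((bddMul_exp_mul_one_add_sqrt_sq hω hω_nonneg hr).1 k).trans (by
        gcongr
        linarith))
    (ae_of_all _ fun k => ((Real.continuous_exp.tendsto _).comp
      (hmax.neg.mul_const (ω k))).mul_const _) v₀
  have h2 := (Complex.continuous_re.tendsto _).comp ((innerSL ℂ v₀).continuous.tendsto _ |>.comp h1)
  simp only [Function.comp_def, innerSL_apply_apply, ← phaseKernel_eq hω hω_nonneg v₀ hr,
    ← phaseKernel_eq hω hω_nonneg v₀ (hpos _), Complex.ofReal_re] at h2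
  refine h2.congr' ?_
  filter_upwards [hev] with n hn
  rw [max_eq_left hn.le, Function.comp_apply]

/-- The function `s ↦ 1_{q < s} e^{-(s - q) l}`. -/
def jumpKernel (q s l : ℝ) : ℝ := if q < s then Real.exp (-(s - q) * l) else 0

theorem measurable_jumpKernel (q : ℝ) : Measurable fun z : ℝ × ℝ => jumpKernel q z.1 z.2 :=
  Measurable.ite (measurableSet_lt measurable_const measurable_fst) (by fun_prop) measurable_const

theorem jumpKernel_nonneg (q s l : ℝ) : 0 ≤ jumpKernel q s l := by
  unfold jumpKernel
  split_ifs <;> positivity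

theorem jumpKernel_le_one {l : ℝ} (hl : 0 ≤ l) (q s : ℝ) : jumpKernel q s l ≤ 1 := by
  unfold jumpKernel
  split_ifs with h
  · exact exp_neg_mul_le_one (sub_nonneg.2 h.le) hl
  · exact zero_le_one

theorem intervalIntegrable_jumpKernel {l : ℝ} (hl : 0 ≤ l) (q a b : ℝ) :
    IntervalIntegrable (fun s => jumpKernel q s l) volume a b :=
  (intervalIntegrable_const (c := (1 : ℝ))).mono_fun
    ((measurable_jumpKernel q).comp (measurable_id.prodMk measurable_const)).aestronglyMeasurable
    (ae_of_all _ fun s => by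
      dsimp only
      rw [Real.norm_of_nonneg (jumpKernel_nonneg q s l), norm_one]
      exact jumpKernel_le_one hl q s)

theorem integral_jumpKernel {l : ℝ} (hl : 0 ≤ l) {q t : ℝ} (hq : 0 ≤ q) (hqt : q ≤ t) :
    ∫ s in (0 : ℝ)..t, jumpKernel q s l = beta (t - q) l := by
  rw [← intervalIntegral.integral_add_adjacent_intervals (intervalIntegrable_jumpKernel hl q 0 q)
    (intervalIntegrable_jumpKernel hl q q t)]
  have h1 : ∫ s in (0 : ℝ)..q, jumpKernel q s l = 0 := by
    rw [intervalIntegral.integral_congr_ae (g := fun _ => (0 : ℝ)) (ae_of_all _ fun s hs => ?_)]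
    · simp
    · rw [uIoc_of_le hq] at hs
      exact if_neg hs.2.not_gt
  have h2 : ∫ s in q..t, jumpKernel q s l = ∫ s in q..t, Real.exp (-(s - q) * l) := by
    refine intervalIntegral.integral_congr_ae (ae_of_all _ fun s hs => ?_)
    rw [uIoc_of_le hqt] at hs
    exact if_pos hs.1
  rw [h1, h2, zero_add, intervalIntegral.integral_comp_sub_right (fun r => Real.exp (-r * l)) q,
    sub_self, beta]

variable [SigmaFinite μ]

/-- Fubini. The kernel may be singular at s = q, but integrating over s first replaces e^{-(s-q)ω}
by β_{t-q}(ω), and (1 + √ω)² β_{t-q}(ω) is bounded. -/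
theorem integral_mul_phaseKernel (hω : Measurable ω) (hω_nonneg : ∀ k, 0 ≤ ω k) (v₀ : OneBoson μ)
    {g : ℝ → ℝ} (hg : Measurable g) (hg1 : ∀ s, |g s| ≤ 1) {q t : ℝ} (hq : 0 ≤ q) (ht : 0 ≤ t) :
    IntervalIntegrable (fun s => g s * if q < s then phaseKernel ω v₀ (s - q) else 0)
      volume 0 t ∧
    Integrable (fun k => ((1 + Real.sqrt (ω k)) ^ 2 * ‖v₀ k‖ ^ 2) *
      (∫ s in (0 : ℝ)..t, g s * jumpKernel q s (ω k))) μ ∧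
    ∫ s in (0 : ℝ)..t, (g s * if q < s then phaseKernel ω v₀ (s - q) else 0) =
      ∫ k, ((1 + Real.sqrt (ω k)) ^ 2 * ‖v₀ k‖ ^ 2) *
        (∫ s in (0 : ℝ)..t, g s * jumpKernel q s (ω k)) ∂μ := by
  rcases lt_or_ge t q with htq | hqt
  · have h1 : ∀ s ∈ uIoc 0 t, ¬ q < s := fun s hs => by
      rw [uIoc_of_le ht] at hs
      exact not_lt.2 (hs.2.trans htq.le)
    have h2 : ∀ l, ∫ s in (0 : ℝ)..t, g s * jumpKernel q s l = 0 := fun l => by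
      rw [intervalIntegral.integral_congr_ae (g := fun _ => (0 : ℝ)) (ae_of_all _ fun s hs => ?_)]
      · simp
      · simp [jumpKernel, h1 s hs]
    refine ⟨?_, by simp [h2], ?_⟩
    · refine (intervalIntegrable_const (c := (0 : ℝ))).congr fun s hs => ?_
      simp [h1 s hs]
    · rw [intervalIntegral.integral_congr_ae (g := fun _ => (0 : ℝ)) (ae_of_all _ fun s hs => ?_)]
      · simp [h2]
      · simp [h1 s hs]
  set F : ℝ → M → ℝ := fun s k =>
    (g s * jumpKernel q s (ω k)) * ((1 + Real.sqrt (ω k)) ^ 2 * ‖v₀ k‖ ^ 2) with hF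
  have hFm : AEStronglyMeasurable (Function.uncurry F) ((volume.restrict (Ioc 0 t)).prod μ) := by
    refine AEStronglyMeasurable.mul ?_ ?_
    · exact ((hg.comp measurable_fst).mul ((measurable_jumpKernel q).comp
        (measurable_fst.prodMk (hω.comp measurable_snd)))).aestronglyMeasurable
    · exact ((by fun_prop : Measurable fun k => (1 + Real.sqrt (ω k)) ^ 2).aestronglyMeasurable.mul
        ((Lp.memLp v₀).1.norm.pow 2)).comp_snd
  have hint : ∀ l, 0 ≤ l → Integrable (fun s => g s * jumpKernel q s l)
      (volume.restrict (Ioc 0 t)) := fun l hl => by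
    have := intervalIntegrable_jumpKernel hl q 0 t
    rw [intervalIntegrable_iff_integrableOn_Ioc_of_le ht] at this
    exact this.bdd_mul hg.aestronglyMeasurable (ae_of_all _ hg1)
  have hFi : Integrable (Function.uncurry F) ((volume.restrict (Ioc 0 t)).prod μ) := by
    rw [integrable_prod_iff' hFm]
    refine ⟨ae_of_all _ fun k => (hint _ (hω_nonneg k)).mul_const
      ((1 + Real.sqrt (ω k)) ^ 2 * ‖v₀ k‖ ^ 2), ?_⟩
    refine ((bddMul_cMul hω hω_nonneg (sub_nonneg.2 hqt)).integrable_mul_sq v₀).mono'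
      hFm.norm.prod_swap.integral_prod_right' (ae_of_all _ fun k => ?_)
    have h1 := intervalIntegrable_jumpKernel (hω_nonneg k) q 0 t
    rw [intervalIntegrable_iff_integrableOn_Ioc_of_le ht] at h1
    rw [Real.norm_of_nonneg (integral_nonneg fun s => norm_nonneg _)]
    calc ∫ s in Ioc 0 t, ‖F s k‖ ≤ ∫ s in Ioc 0 t, jumpKernel q s (ω k) *
          ((1 + Real.sqrt (ω k)) ^ 2 * ‖v₀ k‖ ^ 2) := by
          refine integral_mono ((hint _ (hω_nonneg k)).mul_const _).norm (h1.mul_const _)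
            fun s => ?_
          simp only [hF]
          rw [norm_mul, norm_mul, Real.norm_of_nonneg (jumpKernel_nonneg q s _),
            Real.norm_of_nonneg (by positivity : 0 ≤ (1 + Real.sqrt (ω k)) ^ 2 * ‖v₀ k‖ ^ 2)]
          exact mul_le_mul_of_nonneg_right
            (mul_le_of_le_one_left (jumpKernel_nonneg q s _) (hg1 s)) (by positivity)
      _ = _ := by
          rw [integral_mul_const, ← intervalIntegral.integral_of_le ht,
            integral_jumpKernel (hω_nonneg k) hq hqt, cMul]
          ring
  have h1 : ∀ s, ∫ k, F s k ∂μ = g s * if q < s then phaseKernel ω v₀ (s - q) else 0 := fun s => by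
    simp only [hF, mul_assoc]
    rw [integral_const_mul]
    split_ifs with h
    · simp only [jumpKernel, if_pos h, phaseKernel]
    · simp [jumpKernel, if_neg h]
  have h2 : ∀ k, ∫ s in Ioc 0 t, F s k = ((1 + Real.sqrt (ω k)) ^ 2 * ‖v₀ k‖ ^ 2) *
      ∫ s in (0 : ℝ)..t, g s * jumpKernel q s (ω k) := fun k => by
    rw [integral_mul_const, mul_comm, intervalIntegral.integral_of_le ht]
  refine ⟨?_, ?_, ?_⟩
  · rw [intervalIntegrable_iff_integrableOn_Ioc_of_le ht]
    have h3 := hFi.integral_prod_left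
    simp only [Function.uncurry_apply_pair, h1] at h3
    exact h3
  · simpa only [Function.uncurry_apply_pair, h2] using hFi.integral_prod_right
  · rw [intervalIntegral.integral_of_le ht]
    simp only [← h1, ← h2]
    exact integral_integral_swap hFi

/-- Integration by parts for a single jump: 1 - l ∫_q^s e^{-(s-r)l} dr = e^{-(s-q)l}. It converts
the integral against dγ in the phase into an integral against γ itself. -/
theorem jump_sub_pathMinus {q s l : ℝ} (hq : 0 ≤ q) (hs : 0 ≤ s) (hqs : q ≠ s) :
    ((if q ≤ s then 1 else 0) - l * pathMinus (fun r => if q ≤ r then 1 else 0) s l) =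
      jumpKernel q s l := by
  set u : ℝ → ℝ := fun r => if q ≤ r then 1 else 0 with hu
  have hum : Measurable u := Measurable.ite measurableSet_Ici measurable_const measurable_const
  have hu1 : ∀ r, |u r| ≤ 1 := fun r => by
    simp only [hu]
    split_ifs <;> simp
  have h0 : ∀ a, 0 ≤ a → a ≤ q → pathMinus u a l = 0 := fun a ha haq => by
    rw [pathMinus_add_const hum hu1 ha (y := 0) fun r hr => if_neg (hr.2.trans_le haq).not_ge]
    simp [pathMinus]
  rcases lt_or_ge s q with h | h
  · rw [h0 s hs h.le, jumpKernel, if_neg h.not_ge, if_neg h.not_gt]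
    ring
  · rw [pathMinus_add_const hum hu1 h (y := 1) fun r hr => if_pos hr.1, h0 q hq le_rfl,
      jumpKernel, if_pos h, if_pos (lt_of_le_of_ne h hqs)]
    linear_combination -mul_beta (s - q) l

theorem sub_pathMinus_eq_sum {g : ℝ → ℝ} {t : ℝ} {n : ℕ} {q D : ℕ → ℝ} (hq : ∀ j < n, 0 ≤ q j)
    (hg : ∀ r ∈ Icc 0 t, g r = ∑ j ∈ Finset.range n, D j * if q j ≤ r then 1 else 0) {s : ℝ}
    (hs : s ∈ Icc 0 t) (hqs : ∀ j < n, q j ≠ s) (l : ℝ) :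
    g s - l * pathMinus g s l = ∑ j ∈ Finset.range n, D j * jumpKernel (q j) s l := by
  have h1 : pathMinus g s l = ∑ j ∈ Finset.range n,
      D j * pathMinus (fun r => if q j ≤ r then 1 else 0) s l := by
    have h2 : pathMinus g s l = ∫ r in (0 : ℝ)..s, ∑ j ∈ Finset.range n,
        D j * (Real.exp (-(s - r) * l) * if q j ≤ r then 1 else 0) := by
      refine intervalIntegral.integral_congr_ae (ae_of_all _ fun r hr => ?_)
      rw [uIoc_of_le hs.1] at hr
      rw [hg r ⟨hr.1.le, hr.2.trans hs.2⟩, Finset.mul_sum]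
      exact Finset.sum_congr rfl fun j _ => by ring
    rw [h2, intervalIntegral.integral_finsetSum fun j _ => ?_]
    · simp only [intervalIntegral.integral_const_mul, pathMinus]
    · refine (intervalIntegrable_mul_of_bounded (by fun_prop)
        (Measurable.ite measurableSet_Ici measurable_const measurable_const)
        (fun r => ?_) 0 s).const_mul _
      split_ifs <;> simp
  rw [hg s hs, h1, Finset.mul_sum, ← Finset.sum_sub_distrib]
  refine Finset.sum_congr rfl fun j hj => ?_
  have hj' := Finset.mem_range.1 hj
  rw [← jump_sub_pathMinus (hq j hj') hs.1 (hqs j hj')]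
  ring

/-- On a path of finite variation the Riemann-Stieltjes integral is a finite sum over the jumps of ν
evaluated at the elapsed times. Fubini in each term and integration by parts then identify the
integrand over M as `pathPhase`, which is stable under limits of discretizations. -/
theorem phase_eq (hω : Measurable ω) (hω_nonneg : ∀ k, 0 ≤ ω k) (hω_pos : ∀ᵐ k ∂μ, 0 < ω k)
    {v : M → ℂ} (hv : MemLp (fun k => v k / (rho ω k : ℂ)) 2 μ) {t : ℝ} (ht : 0 ≤ t)
    {γ : SpinPath} (hγ : eVariationOn γ.val (Icc 0 t) ≠ ∞) :
    phase μ ω v t γ = -∫ k, ((1 + Real.sqrt (ω k)) ^ 2 * pathPhase γ.val t (ω k)) *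
      ‖(toL2 μ fun k => v k / (rho ω k : ℂ)) k‖ ^ 2 ∂μ := by
  set v₀ := toL2 μ fun k => v k / (rho ω k : ℂ) with hv₀
  set g := γ.val with hgdef
  have hgm : Measurable g := γ.measurable_val
  have hg1 : ∀ s, |g s| ≤ 1 := fun s => abs_le_one_of_sq (γ.val_sq s)
  obtain ⟨K, hK⟩ := ENNReal.exists_nat_gt hγ
  obtain ⟨m, q, D, hq, hrep⟩ := exists_jumps γ.val_sq (fun s _ => γ.continuousWithinAt_val s) K 0
    le_rfl ht (hK.le.trans (le_mul_of_one_le_left' (by norm_num)))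
  -- The initial value γ₀ is treated as a jump of height γ₀ at time 0, so that the boundary term γ₀
  -- ν(s) becomes one more summand.
  set q' : ℕ → ℝ := fun j => Nat.casesOn j 0 q with hq'
  set D' : ℕ → ℝ := fun j => Nat.casesOn j (g 0) D with hD'
  have hq'0 : ∀ j < m + 1, 0 ≤ q' j := by
    rintro (_ | j) hj
    · exact le_rfl
    · exact (hq j (Nat.succ_lt_succ_iff.1 hj)).le
  have hrep' : ∀ r ∈ Icc 0 t, g r =
      ∑ j ∈ Finset.range (m + 1), D' j * if q' j ≤ r then 1 else 0 := fun r hr => by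
    rw [Finset.sum_range_succ', show g r = _ from hrep r hr, add_comm]
    change _ = _ + g 0 * if 0 ≤ r then 1 else 0
    rw [if_pos hr.1, mul_one]
  -- Times s that are themselves jump times form a null set; there the Riemann-Stieltjes integral
  -- might not exist.
  have hne : ∀ᵐ s : ℝ, ∀ j, q' j ≠ s := by
    rw [ae_all_iff]
    intro j
    simp [ae_iff]
  have hphase : phase μ ω v t γ = ∫ s in (0 : ℝ)..t, ∑ j ∈ Finset.range (m + 1),
      -D' j * (g s * if q' j < s then phaseKernel ω v₀ (s - q' j) else 0) := by
    refine intervalIntegral.integral_congr_ae ?_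
    filter_upwards [hne] with s hs hst
    rw [uIoc_of_le ht] at hst
    have h1 : HasRSIntegral (fun r => phaseIntegrator μ ω v (s - r)) g 0 s
        (0 + ∑ j ∈ Finset.range m,
          D j * if q j < s then phaseIntegrator μ ω v (s - q j) else 0) := by
      refine ((hasRSIntegral_const _ (g 0) 0 s).add (hasRSIntegral_sum fun j hj =>
        (hasRSIntegral_jump (hq j hj) (hs (j + 1)) fun hjs => ?_).const_mul (D j))).congr
        fun r hr => hrep r ⟨hr.1, hr.2.trans hst.2⟩
      simp only [phaseIntegrator_eq hω_nonneg hω_pos hv]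
      refine ContinuousAt.neg ?_
      exact (continuousAt_phaseKernel hω hω_nonneg v₀ (sub_pos.2 hjs)).comp
        (f := fun r => s - r) (by fun_prop)
    rw [h1.rsIntegral_eq hst.1.le, Finset.sum_range_succ']
    change _ = _ + -g 0 * (g s * if 0 < s then phaseKernel ω v₀ (s - 0) else 0)
    change _ = (∑ j ∈ Finset.range m, -D j * (g s * if q j < s then phaseKernel ω v₀ (s - q j)
      else 0)) + _
    rw [if_pos hst.1, sub_zero, add_mul, zero_add, Finset.sum_mul, add_comm]
    congr 1
    · refine Finset.sum_congr rfl fun j _ => ?_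
      rw [phaseIntegrator_eq hω_nonneg hω_pos hv]
      split_ifs <;> ring
    · rw [phaseIntegrator_eq hω_nonneg hω_pos hv]
      ring
  have key := fun j (hj : j ∈ Finset.range (m + 1)) => integral_mul_phaseKernel hω hω_nonneg v₀
    hgm hg1 (hq'0 j (Finset.mem_range.1 hj)) ht
  have hpath : ∀ k, pathPhase g t (ω k) = ∑ j ∈ Finset.range (m + 1),
      D' j * ∫ s in (0 : ℝ)..t, g s * jumpKernel (q' j) s (ω k) := fun k => by
    have h1 : pathPhase g t (ω k) = ∫ s in (0 : ℝ)..t, ∑ j ∈ Finset.range (m + 1),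
        D' j * (g s * jumpKernel (q' j) s (ω k)) := by
      refine intervalIntegral.integral_congr_ae ?_
      filter_upwards [hne] with s hs hst
      rw [uIoc_of_le ht] at hst
      rw [sub_pathMinus_eq_sum hq'0 hrep' ⟨hst.1.le, hst.2⟩ (fun j _ => hs j), Finset.mul_sum]
      exact Finset.sum_congr rfl fun j _ => by ring
    rw [h1, intervalIntegral.integral_finsetSum fun j _ => ?_]
    · simp only [intervalIntegral.integral_const_mul]
    · refine IntervalIntegrable.const_mul ?_ _
      have := intervalIntegrable_jumpKernel (hω_nonneg k) (q' j) 0 t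
      rw [intervalIntegrable_iff_integrableOn_Ioc_of_le ht] at this ⊢
      exact Integrable.bdd_mul this hgm.aestronglyMeasurable (ae_of_all _ hg1)
  rw [hphase, intervalIntegral.integral_finsetSum fun j hj => (key j hj).1.const_mul _]
  simp only [intervalIntegral.integral_const_mul]
  rw [Finset.sum_congr rfl fun j hj => congrArg (-D' j * ·) (key j hj).2.2]
  simp only [hpath, Finset.mul_sum, Finset.sum_mul]
  rw [integral_finsetSum _ fun j hj => ?_, ← Finset.sum_neg_distrib]
  · refine Finset.sum_congr rfl fun j hj => ?_
    rw [neg_mul, ← integral_const_mul]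
    congr 1
    refine integral_congr_ae (ae_of_all _ fun k => ?_)
    dsimp only
    ring
  · refine ((key j hj).2.1.const_mul (D' j)).congr (ae_of_all _ fun k => ?_)
    dsimp only
    ring

end PhaseFormula
/-! ### The Feynman-Kac operator of a path -/

section PathBounds

variable {g : ℝ → ℝ}

theorem measurable_pathMinus (hg : Measurable g) (t : ℝ) : Measurable (pathMinus g t) := by
  have h : ∀ a b : ℝ, Measurable fun l => ∫ r in Ioc a b, Real.exp (-(t - r) * l) * g r :=
    fun a b => (StronglyMeasurable.integral_prod_right' (ν := volume.restrict (Ioc a b))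
      (f := fun z : ℝ × ℝ => Real.exp (-(t - z.2) * z.1) * g z.2)
      (by fun_prop : Measurable _).stronglyMeasurable).measurable
  exact (h 0 t).sub (h t 0)

theorem measurable_pathPlus (hg : Measurable g) (t : ℝ) : Measurable (pathPlus g t) := by
  have h : ∀ a b : ℝ, Measurable fun l => ∫ r in Ioc a b, Real.exp (-r * l) * g r :=
    fun a b => (StronglyMeasurable.integral_prod_right' (ν := volume.restrict (Ioc a b))
      (f := fun z : ℝ × ℝ => Real.exp (-z.2 * z.1) * g z.2)
      (by fun_prop : Measurable _).stronglyMeasurable).measurable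
  exact (h 0 t).sub (h t 0)

theorem measurable_pathPhase (hg : Measurable g) (hg1 : ∀ s, |g s| ≤ 1) (t : ℝ) :
    Measurable (pathPhase g t) := by
  have h0 : Measurable (Function.uncurry fun s l => pathMinus g s l) :=
    measurable_uncurry_of_continuous_of_measurable (u := fun s l => pathMinus g s l)
      (fun l => continuous_pathMinus hg hg1 l) (measurable_pathMinus hg)
  have h1 : Measurable fun z : ℝ × ℝ => g z.2 * (g z.2 - z.1 * pathMinus g z.2 z.1) :=
    (hg.comp measurable_snd).mul ((hg.comp measurable_snd).sub
      (measurable_fst.mul (h0.comp (measurable_snd.prodMk measurable_fst))))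
  have h : ∀ a b : ℝ, Measurable fun l => ∫ s in Ioc a b, g s * (g s - l * pathMinus g s l) :=
    fun a b => (StronglyMeasurable.integral_prod_right' (ν := volume.restrict (Ioc a b))
      h1.stronglyMeasurable).measurable
  exact (h 0 t).sub (h t 0)

theorem abs_integral_mul_le {f : ℝ → ℝ} (hf : Continuous f) (hf0 : ∀ s, 0 ≤ f s)
    (hg1 : ∀ s, |g s| ≤ 1) {t : ℝ} (ht : 0 ≤ t) :
    |∫ r in (0 : ℝ)..t, f r * g r| ≤ ∫ r in (0 : ℝ)..t, f r := by
  rw [← Real.norm_eq_abs]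
  refine intervalIntegral.norm_integral_le_of_norm_le ht (ae_of_all _ fun r _ => ?_)
    (hf.intervalIntegrable 0 t)
  rw [norm_mul, Real.norm_of_nonneg (hf0 r)]
  exact mul_le_of_le_one_right (hf0 r) (hg1 r)

theorem abs_pathMinus_le (hg1 : ∀ s, |g s| ≤ 1) {t : ℝ} (ht : 0 ≤ t) (l : ℝ) :
    |pathMinus g t l| ≤ beta t l := by
  refine (abs_integral_mul_le (by fun_prop) (fun s => (Real.exp_pos _).le) hg1 ht).trans_eq ?_
  rw [intervalIntegral.integral_comp_sub_left (fun r => Real.exp (-r * l)) t, sub_self, sub_zero,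
    beta]

theorem abs_pathPlus_le (hg1 : ∀ s, |g s| ≤ 1) {t : ℝ} (ht : 0 ≤ t) (l : ℝ) :
    |pathPlus g t l| ≤ beta t l :=
  abs_integral_mul_le (by fun_prop) (fun s => (Real.exp_pos _).le) hg1 ht

/-- One plus the variation of `g` on `[0, t]`. -/
def varBound (g : ℝ → ℝ) (t : ℝ) : ℝ := 1 + (eVariationOn g (Icc 0 t)).toReal

theorem one_le_varBound (g : ℝ → ℝ) (t : ℝ) : 1 ≤ varBound g t :=
  le_add_of_nonneg_right ENNReal.toReal_nonneg

/-- The frozen values sit at the points `p n (i + 1)`; for `m < N n` the last one used is at most t,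
so the sum is a variation sum inside [0, t]. -/
theorem IsPartitionSeq.sum_le_varBound {t : ℝ} {p : ℕ → ℕ → ℝ} {N : ℕ → ℕ}
    (hp : IsPartitionSeq t p N) (hvar : eVariationOn g (Icc 0 t) ≠ ∞) (n : ℕ) :
    ∀ m < N n, 1 + ∑ i ∈ Finset.range m, |g (p n (i + 1 + 1)) - g (p n (i + 1))| ≤
      varBound g t := by
  intro m hm
  refine add_le_add_right ?_ 1
  have h1 := eVariationOn.sum_le_of_monotoneOn_Iic (f := g) (s := Icc 0 t) (n := m)
    (u := fun i => p n (i + 1)) (fun i _ j _ hij => hp.mono n (Nat.succ_le_succ hij))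
    fun i hi => ⟨(hp.zero n).ge.trans (hp.mono n (i + 1).zero_le),
      (hp.mono n (by omega)).trans (hp.last n).le⟩
  simp only [edist_dist, Real.dist_eq] at h1
  rw [← ENNReal.ofReal_sum_of_nonneg fun i _ => abs_nonneg _] at h1
  exact (ENNReal.ofReal_le_iff_le_toReal hvar).1 h1

/-- The partitions of `[0, t]` into `n + 1` intervals of equal length. -/
theorem isPartitionSeq_uniform {t : ℝ} (ht : 0 ≤ t) :
    IsPartitionSeq t (fun n i => i * (t / (n + 1))) fun n => n + 1 where
  mono n i j hij := by
    dsimp only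
    gcongr
  zero n := by simp
  last n := by
    push_cast
    field_simp
  mesh ε hε := by
    have h : Tendsto (fun n : ℕ => t / ((n : ℝ) + 1)) atTop (𝓝 0) :=
      (tendsto_const_nhds (x := t)).div_atTop
        (tendsto_atTop_add_const_right _ _ tendsto_natCast_atTop_atTop)
    filter_upwards [h.eventually (gt_mem_nhds hε)] with n hn i _
    push_cast
    linarith

/-- The discrete bounds depend on the partition only through the variation, so they survive the
limit along uniform partitions. They give both β-type bounds on the phase and hence a bounded
multiplier. -/
theorem pathPhase_bounds (hg2 : ∀ s, g s ^ 2 = 1)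
    (hgc : ∀ s, 0 ≤ s → ContinuousWithinAt g (Ici s) s) {t : ℝ} (ht : 0 ≤ t)
    (hvar : eVariationOn g (Icc 0 t) ≠ ∞) {l : ℝ} (hl : 0 ≤ l) :
    0 ≤ pathPhase g t l ∧ pathPhase g t l ≤ varBound g t * t ∧
      l * pathPhase g t l ≤ varBound g t := by
  have hp := isPartitionSeq_uniform ht
  have h := (tendsto_step ht hp hg2 hgc hl).2.2
  refine ⟨ge_of_tendsto' h fun n => stepPhase_nonneg (hp.mono n) (fun i => hg2 _) hl _,
    le_of_tendsto' h fun n => ?_, le_of_tendsto' (h.const_mul l) fun n => ?_⟩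
  · refine (stepPhase_le (hp.mono n) (hp.zero n) (fun i => hg2 _) hl
      (hp.sum_le_varBound hvar n)).trans_eq ?_
    rw [hp.last n]
  · exact mul_stepPhase_le (hp.mono n) (fun i => hg2 _) hl
      (zero_le_one.trans (one_le_varBound g t)) (hp.sum_le_varBound hvar n)

end PathBounds

/-! ### The operator of a path: multipliers, strong limits, Lipschitz bounds -/

section PathOperator

variable {M : Type*} [MeasurableSpace M] {μ : Measure M} {ω : M → ℝ}

variable (ω) in
/-- The multiplier of the phase of a path. -/
def phaseMul (g : ℝ → ℝ) (t : ℝ) (k : M) : ℝ := (1 + Real.sqrt (ω k)) ^ 2 * pathPhase g t (ω k)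

variable (ω) in
/-- The multiplier of the process `U⁻` of a path. -/
def minusMul (g : ℝ → ℝ) (t : ℝ) (k : M) : ℝ := rho ω k * pathMinus g t (ω k)

variable (ω) in
/-- The multiplier of the process `U⁺` of a path. -/
def plusMul (g : ℝ → ℝ) (t : ℝ) (k : M) : ℝ := rho ω k * pathPlus g t (ω k)

/-- The quotient of a multiplier and `√(1 - e^{-tω})`. -/
def quotMul (ω : M → ℝ) (t : ℝ) (m : M → ℝ) (k : M) : ℝ :=
  m k / Real.sqrt (1 - Real.exp (-(t / 2) * ω k) ^ 2)

/-- Brings U^± into the form √(1 - e^{-2sω}) h with s = t/2, as the bound for I_{t/2} requires. The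
bound |m| ≤ β_t and ω β_t = 1 - e^{-tω} reduce the quotient to √(1 - e^{-tω}) ρ/ω. -/
theorem quotMul_spec (hω : Measurable ω) (hω_nonneg : ∀ k, 0 ≤ ω k) {t : ℝ} (ht : 0 ≤ t)
    {m : ℝ → ℝ} (hm : Measurable m) (hb : ∀ l, 0 ≤ l → |m l| ≤ beta t l) :
    (∀ k, |quotMul ω t (fun k => rho ω k * m (ω k)) k| ≤ Real.sqrt t + 1) ∧
    BddMul (quotMul ω t fun k => rho ω k * m (ω k)) ∧
    ∀ v₀ : OneBoson μ, mulOp μ (fun k => rho ω k * m (ω k)) v₀ =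
      rOp μ ω (t / 2) (mulOp μ (quotMul ω t fun k => rho ω k * m (ω k)) v₀) := by
  have hexp : ∀ k, Real.exp (-(t / 2) * ω k) ^ 2 = Real.exp (-t * ω k) := fun k => by
    rw [← Real.exp_nat_mul]
    congr 1
    push_cast
    ring
  -- Where the root vanishes the quotient is 0 by the convention for division, so the numerator must
  -- vanish there as well.
  have hzero : ∀ k, Real.sqrt (1 - Real.exp (-(t / 2) * ω k) ^ 2) = 0 →
      rho ω k * m (ω k) = 0 := fun k h => by
    rw [Real.sqrt_eq_zero (one_sub_exp_sq_nonneg (by positivity) (hω_nonneg k)), hexp] at h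
    have h1 : ω k * beta t (ω k) = 0 := (mul_beta t (ω k)).trans h
    rcases mul_eq_zero.1 h1 with h2 | h2
    · simp [rho, h2]
    · have := hb _ (hω_nonneg k)
      rw [h2, abs_nonpos_iff] at this
      rw [this, mul_zero]
  have hbd : ∀ k, |quotMul ω t (fun k => rho ω k * m (ω k)) k| ≤ Real.sqrt t + 1 := fun k => by
    have h3 := sqrt_mul_rho_div_le hω_nonneg (t / 2) k
    rw [mul_div_cancel₀ t two_ne_zero] at h3
    refine le_trans ?_ h3
    rw [quotMul]
    set S := Real.sqrt (1 - Real.exp (-(t / 2) * ω k) ^ 2) with hS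
    have hS0 : 0 ≤ S := Real.sqrt_nonneg _
    have hρ := rho_nonneg hω_nonneg k
    rcases (hω_nonneg k).eq_or_lt with h0 | hpos
    · simp only [rho, ← h0]
      simp
    · rcases hS0.eq_or_lt with h1 | h1
      · rw [← h1]
        simp
      · rw [abs_div, abs_of_nonneg hS0, div_le_iff₀ h1, abs_mul, abs_of_nonneg hρ]
        have h4 : S ^ 2 = ω k * beta t (ω k) := by
          rw [hS, Real.sq_sqrt (one_sub_exp_sq_nonneg (by positivity) (hω_nonneg k)), hexp,
            mul_beta]
        calc rho ω k * |m (ω k)| ≤ rho ω k * beta t (ω k) :=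
              mul_le_mul_of_nonneg_left (hb _ hpos.le) hρ
          _ = rho ω k / ω k * S ^ 2 := by
              rw [h4]
              field_simp
          _ = _ := by ring
  have hmeas : Measurable (quotMul ω t fun k => rho ω k * m (ω k)) := by
    have h1 := measurable_rho hω
    have h2 := hm.comp hω
    exact (h1.mul h2).div (by fun_prop)
  refine ⟨hbd, ⟨hmeas, _, hbd⟩, fun v₀ => ?_⟩
  rw [rOp, mulOp_mul (bddMul_sqrt hω _) ⟨hmeas, _, hbd⟩]
  congr 1
  congr 1
  funext k
  rw [quotMul]
  by_cases h : Real.sqrt (1 - Real.exp (-(t / 2) * ω k) ^ 2) = 0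
  · rw [h, zero_mul, hzero k h]
  · rw [mul_div_cancel₀ _ h]

theorem BddMul.of_phase (hω : Measurable ω) (hω_nonneg : ∀ k, 0 ≤ ω k) {t : ℝ} (ht : 0 ≤ t)
    {γ : SpinPath} (hγ : eVariationOn γ.val (Icc 0 t) ≠ ∞) :
    (∀ k, |phaseMul ω γ.val t k| ≤ 2 * (varBound γ.val t * t + varBound γ.val t)) ∧
      BddMul (phaseMul ω γ.val t) := by
  have h : ∀ k, |phaseMul ω γ.val t k| ≤ 2 * (varBound γ.val t * t + varBound γ.val t) :=
    fun k => by
    obtain ⟨h0, h1, h2⟩ := pathPhase_bounds γ.val_sq (fun s _ => γ.continuousWithinAt_val s) ht hγ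
      (hω_nonneg k)
    rw [phaseMul, abs_of_nonneg (by positivity)]
    exact one_add_sqrt_sq_mul_le hω_nonneg h0 h1 h2
  refine ⟨h, ?_, _, h⟩
  have h3 := (measurable_pathPhase γ.measurable_val
    (fun s => abs_le_one_of_sq (γ.val_sq s)) t).comp hω
  exact (by fun_prop : Measurable fun k => (1 + Real.sqrt (ω k)) ^ 2).mul h3

variable [SigmaFinite μ]

variable (μ ω) in
/-- The operator `e^{u_t(v)} I_{t/2}(ω, U_t^+(v))* I_{t/2}(ω, U_t^-(v))`. -/
def fkOp (v : M → ℂ) (t : ℝ) (γ : SpinPath) : Fock μ →L[ℂ] Fock μ :=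
  (Real.exp (phase μ ω v t γ) : ℂ) •
    (ContinuousLinearMap.adjoint (opI (t / 2) ω (toL2 μ (UPlus ω v t γ))) *
      opI (t / 2) ω (toL2 μ (UMinus ω v t γ)))

theorem fkIntegrand_eq (v : M → ℂ) (t : ℝ≥0) (ψ : SpinFock μ) (γ : SpinPath) :
    fkIntegrand μ ω v t ψ γ = fkOp μ ω v t γ (ψ (γ.1 t)) := rfl

theorem ae_eq_rho_mul_toL2 (hω_pos : ∀ᵐ k ∂μ, 0 < ω k) {v : M → ℂ}
    (hv : MemLp (fun k => v k / (rho ω k : ℂ)) 2 μ) :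
    v =ᵐ[μ] fun k => (rho ω k : ℂ) * (toL2 μ fun k => v k / (rho ω k : ℂ)) k := by
  filter_upwards [hω_pos, toL2_coe hv] with k hk hk2
  have h1 : rho ω k ≠ 0 := by
    have := Real.sqrt_pos.2 hk
    unfold rho
    positivity
  rw [hk2, mul_div_cancel₀]
  exact_mod_cast h1

theorem UMinus_eq (v : M → ℂ) (t : ℝ) (γ : SpinPath) (k : M) :
    UMinus ω v t γ k = (pathMinus γ.val t (ω k) : ℂ) * v k := by
  rw [UMinus, intervalIntegral.integral_mul_const, intervalIntegral.integral_ofReal, pathMinus]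

theorem UPlus_eq (v : M → ℂ) (t : ℝ) (γ : SpinPath) (k : M) :
    UPlus ω v t γ k = (pathPlus γ.val t (ω k) : ℂ) * v k := by
  rw [UPlus, intervalIntegral.integral_mul_const, intervalIntegral.integral_ofReal, pathPlus]

theorem toL2_pathMul (hω : Measurable ω) (hω_nonneg : ∀ k, 0 ≤ ω k) (hω_pos : ∀ᵐ k ∂μ, 0 < ω k)
    {v : M → ℂ} (hv : MemLp (fun k => v k / (rho ω k : ℂ)) 2 μ) {t : ℝ} (ht : 0 ≤ t)
    {m : ℝ → ℝ} (hm : Measurable m) (hb : ∀ l, 0 ≤ l → |m l| ≤ beta t l) :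
    (toL2 μ fun k => (m (ω k) : ℂ) * v k) =
      mulOp μ (fun k => rho ω k * m (ω k)) (toL2 μ fun k => v k / (rho ω k : ℂ)) := by
  refine toL2_eq_mulOp (bddMul_rho_mul hω hω_nonneg ht hm hb) ?_
  filter_upwards [ae_eq_rho_mul_toL2 hω_pos hv] with k hk
  rw [hk]
  push_cast
  ring

theorem toL2_UMinus (hω : Measurable ω) (hω_nonneg : ∀ k, 0 ≤ ω k) (hω_pos : ∀ᵐ k ∂μ, 0 < ω k)
    {v : M → ℂ} (hv : MemLp (fun k => v k / (rho ω k : ℂ)) 2 μ) {t : ℝ} (ht : 0 ≤ t)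
    (γ : SpinPath) : toL2 μ (UMinus ω v t γ) =
      mulOp μ (minusMul ω γ.val t) (toL2 μ fun k => v k / (rho ω k : ℂ)) := by
  rw [show UMinus ω v t γ = fun k => (pathMinus γ.val t (ω k) : ℂ) * v k from
    funext (UMinus_eq v t γ)]
  exact toL2_pathMul hω hω_nonneg hω_pos hv ht (measurable_pathMinus γ.measurable_val t)
    fun l _ => abs_pathMinus_le (fun s => abs_le_one_of_sq (γ.val_sq s)) ht l

theorem toL2_UPlus (hω : Measurable ω) (hω_nonneg : ∀ k, 0 ≤ ω k) (hω_pos : ∀ᵐ k ∂μ, 0 < ω k)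
    {v : M → ℂ} (hv : MemLp (fun k => v k / (rho ω k : ℂ)) 2 μ) {t : ℝ} (ht : 0 ≤ t)
    (γ : SpinPath) : toL2 μ (UPlus ω v t γ) =
      mulOp μ (plusMul ω γ.val t) (toL2 μ fun k => v k / (rho ω k : ℂ)) := by
  rw [show UPlus ω v t γ = fun k => (pathPlus γ.val t (ω k) : ℂ) * v k from
    funext (UPlus_eq v t γ)]
  exact toL2_pathMul hω hω_nonneg hω_pos hv ht (measurable_pathPlus γ.measurable_val t)
    fun l _ => abs_pathPlus_le (fun s => abs_le_one_of_sq (γ.val_sq s)) ht l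

theorem quotMul_minus (hω : Measurable ω) (hω_nonneg : ∀ k, 0 ≤ ω k) {t : ℝ} (ht : 0 ≤ t)
    (γ : SpinPath) :
    (∀ k, |quotMul ω t (minusMul ω γ.val t) k| ≤ Real.sqrt t + 1) ∧
    BddMul (quotMul ω t (minusMul ω γ.val t)) ∧
    ∀ v₀ : OneBoson μ, mulOp μ (minusMul ω γ.val t) v₀ =
      rOp μ ω (t / 2) (mulOp μ (quotMul ω t (minusMul ω γ.val t)) v₀) :=
  quotMul_spec hω hω_nonneg ht (measurable_pathMinus γ.measurable_val t)
    fun l _ => abs_pathMinus_le (fun s => abs_le_one_of_sq (γ.val_sq s)) ht l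

theorem quotMul_plus (hω : Measurable ω) (hω_nonneg : ∀ k, 0 ≤ ω k) {t : ℝ} (ht : 0 ≤ t)
    (γ : SpinPath) :
    (∀ k, |quotMul ω t (plusMul ω γ.val t) k| ≤ Real.sqrt t + 1) ∧
    BddMul (quotMul ω t (plusMul ω γ.val t)) ∧
    ∀ v₀ : OneBoson μ, mulOp μ (plusMul ω γ.val t) v₀ =
      rOp μ ω (t / 2) (mulOp μ (quotMul ω t (plusMul ω γ.val t)) v₀) :=
  quotMul_spec hω hω_nonneg ht (measurable_pathPlus γ.measurable_val t)
    fun l _ => abs_pathPlus_le (fun s => abs_le_one_of_sq (γ.val_sq s)) ht l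

theorem phase_eq_inner (hω : Measurable ω) (hω_nonneg : ∀ k, 0 ≤ ω k)
    (hω_pos : ∀ᵐ k ∂μ, 0 < ω k) {v : M → ℂ} (hv : MemLp (fun k => v k / (rho ω k : ℂ)) 2 μ) {t : ℝ}
    (ht : 0 ≤ t) {γ : SpinPath} (hγ : eVariationOn γ.val (Icc 0 t) ≠ ∞) :
    (phase μ ω v t γ : ℂ) = -⟪toL2 μ fun k => v k / (rho ω k : ℂ),
      mulOp μ (phaseMul ω γ.val t) (toL2 μ fun k => v k / (rho ω k : ℂ))⟫_ℂ := by
  rw [phase_eq hω hω_nonneg hω_pos hv ht hγ, inner_mulOp_self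
    (BddMul.of_phase hω hω_nonneg ht hγ).2, Complex.ofReal_neg]
  rfl

/-- The two factors e^{-tω/2} combine to e^{-tω}, I_{t/2} contributes the scalar with U⁻ and the
adjoint the shift by U⁺. The result has the same affine shape as `prodS_expVec`, so only multipliers
have to be compared. -/
theorem fkOp_expVec (hω : Measurable ω) (hω_nonneg : ∀ k, 0 ≤ ω k)
    (hω_pos : ∀ᵐ k ∂μ, 0 < ω k) {v : M → ℂ} (hv : MemLp (fun k => v k / (rho ω k : ℂ)) 2 μ) {t : ℝ}
    (ht : 0 ≤ t) {γ : SpinPath} (hγ : eVariationOn γ.val (Icc 0 t) ≠ ∞) (g : OneBoson μ) :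
    fkOp μ ω v t γ (expVec g) = affineExp ω (toL2 μ fun k => v k / (rho ω k : ℂ)) t
      (phaseMul ω γ.val t) (minusMul ω γ.val t) (plusMul ω γ.val t) g := by
  have ht2 : 0 ≤ t / 2 := by positivity
  rw [fkOp, smul_apply, mul_apply_eq_comp,
    toL2_UMinus hω hω_nonneg hω_pos hv ht, toL2_UPlus hω hω_nonneg hω_pos hv ht,
    (quotMul_minus hω hω_nonneg ht γ).2.2, (quotMul_plus hω hω_nonneg ht γ).2.2,
    (opI_expVec_and_norm hω hω_nonneg ht2 _).1, map_smul,
    adjoint_opI_expVec hω hω_nonneg ht2, smul_smul, affineExp,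
    ← (quotMul_minus hω hω_nonneg ht γ).2.2, ← (quotMul_plus hω hω_nonneg ht γ).2.2,
    eOp_add hω hω_nonneg ht2 ht2, add_halves, Complex.ofReal_exp, ← Complex.exp_add,
    phase_eq_inner hω hω_nonneg hω_pos hv ht hγ, sub_eq_add_neg (-_)]

theorem tendsto_affineExp {v₀ : OneBoson μ} {t : ℝ} {A a b : ℕ → M → ℝ} {A₀ a₀ b₀ : M → ℝ}
    {C : ℝ} (hA : ∀ n, Measurable (A n)) (ha : ∀ n, Measurable (a n)) (hb : ∀ n, Measurable (b n))
    (hA₀ : Measurable A₀) (ha₀ : Measurable a₀) (hb₀ : Measurable b₀)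
    (hAC : ∀ n k, |A n k| ≤ C) (haC : ∀ n k, |a n k| ≤ C) (hbC : ∀ n k, |b n k| ≤ C)
    (hAl : ∀ k, Tendsto (fun n => A n k) atTop (𝓝 (A₀ k)))
    (hal : ∀ k, Tendsto (fun n => a n k) atTop (𝓝 (a₀ k)))
    (hbl : ∀ k, Tendsto (fun n => b n k) atTop (𝓝 (b₀ k))) (g : OneBoson μ) :
    Tendsto (fun n => affineExp ω v₀ t (A n) (a n) (b n) g) atTop
      (𝓝 (affineExp ω v₀ t A₀ a₀ b₀ g)) := by
  have key : ∀ {m : ℕ → M → ℝ} {m₀ : M → ℝ}, (∀ n, Measurable (m n)) → Measurable m₀ →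
      (∀ n k, |m n k| ≤ C) → (∀ k, Tendsto (fun n => m n k) atTop (𝓝 (m₀ k))) →
      Tendsto (fun n => mulOp μ (m n) v₀) atTop (𝓝 (mulOp μ m₀ v₀)) :=
    fun h1 h2 h3 h4 => tendsto_mulOp (fun n => ⟨h1 n, _, h3 n⟩) h2 (Eventually.of_forall h3)
      (fun k => le_of_tendsto' (h4 k).abs fun n => h3 n k) (ae_of_all _ h4) v₀
  exact ((Complex.continuous_exp.tendsto _).comp
    (((tendsto_const_nhds.inner (key hA hA₀ hAC hAl)).neg).sub
      ((key ha ha₀ haC hal).inner tendsto_const_nhds))).smul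
    ((continuous_expVec.tendsto _).comp (tendsto_const_nhds.sub (key hb hb₀ hbC hbl)))

/-- Contractivity is uniform in n, so convergence on a total set extends to all vectors. It also
transfers to the limit, which is how e^{u} I* I is seen to be a contraction although its factors are
not bounded by 1 separately. -/
theorem tendsto_of_tendsto_expVec {T : ℕ → Fock μ →L[ℂ] Fock μ} {T₀ : Fock μ →L[ℂ] Fock μ}
    (hT : ∀ n, ‖T n‖ ≤ 1)
    (h : ∀ g, Tendsto (fun n => T n (expVec g)) atTop (𝓝 (T₀ (expVec g)))) :
    ‖T₀‖ ≤ 1 ∧ ∀ ψ, Tendsto (fun n => T n ψ) atTop (𝓝 (T₀ ψ)) := by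
  have hn : ∀ n φ, ‖T n φ‖ ≤ ‖φ‖ := fun n φ => ((T n).le_of_opNorm_le (hT n) φ).trans_eq (one_mul _)
  have hspan : ∀ φ ∈ Submodule.span ℂ (range (expVec : OneBoson μ → Fock μ)),
      Tendsto (fun n => T n φ) atTop (𝓝 (T₀ φ)) := by
    intro φ hφ
    induction hφ using Submodule.span_induction with
    | mem x hx =>
      obtain ⟨g, rfl⟩ := hx
      exact h g
    | zero => simp
    | add x y _ _ hx hy => simpa using hx.add hy
    | smul c x _ hx => simpa using hx.const_smul c
  have hle : ∀ φ, ‖T₀ φ‖ ≤ ‖φ‖ := by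
    have hcl : IsClosed {φ | ‖T₀ φ‖ ≤ ‖φ‖} := isClosed_le T₀.continuous.norm continuous_norm
    intro φ
    refine hcl.closure_subset_iff.2 (fun x hx => ?_) (dense_span_expVec φ)
    exact le_of_tendsto' (hspan x hx).norm fun n => hn n x
  refine ⟨T₀.opNorm_le_bound zero_le_one fun φ => (hle φ).trans_eq (one_mul _).symm, fun ψ => ?_⟩
  rw [Metric.tendsto_nhds]
  intro ε hε
  obtain ⟨φ, hφ, hd⟩ := Metric.dense_iff.1 dense_span_expVec ψ (ε / 3) (by positivity)
  rw [Metric.mem_ball, dist_eq_norm] at hφ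
  filter_upwards [Metric.tendsto_nhds.1 (hspan φ hd) (ε / 3) (by positivity)] with n h1
  rw [dist_eq_norm] at h1 ⊢
  have h2 : T n ψ - T₀ ψ = (T n φ - T₀ φ) - T n (φ - ψ) + T₀ (φ - ψ) := by
    rw [map_sub, map_sub]
    abel
  have h3 := hn n (φ - ψ)
  have h4 := hle (φ - ψ)
  calc ‖T n ψ - T₀ ψ‖ ≤ ‖T n φ - T₀ φ‖ + ‖T n (φ - ψ)‖ + ‖T₀ (φ - ψ)‖ := by
        rw [h2]
        exact (norm_add_le _ _).trans (add_le_add (norm_sub_le _ _) le_rfl)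
    _ < ε := by linarith

/-- The Feynman-Kac operator of a path is the strong limit of ordered products. -/
theorem tendsto_prodS (hω : Measurable ω) (hω_nonneg : ∀ k, 0 ≤ ω k)
    (hω_pos : ∀ᵐ k ∂μ, 0 < ω k) {v : M → ℂ} (hv : MemLp (fun k => v k / (rho ω k : ℂ)) 2 μ) {t : ℝ}
    (ht : 0 ≤ t) {γ : SpinPath} (hγ : eVariationOn γ.val (Icc 0 t) ≠ ∞) {p : ℕ → ℕ → ℝ}
    {N : ℕ → ℕ} (hp : IsPartitionSeq t p N) :
    ‖fkOp μ ω v t γ‖ ≤ 1 ∧ ∀ ψ, Tendsto (fun n => prodS ω (toL2 μ fun k => v k / (rho ω k : ℂ))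
      (p n) (fun i => γ.1 (p n (i + 1)).toNNReal) (N n) ψ) atTop (𝓝 (fkOp μ ω v t γ ψ)) := by
  set v₀ := toL2 μ fun k => v k / (rho ω k : ℂ)
  refine tendsto_of_tendsto_expVec
    (fun n => norm_prodS_le hω hω_nonneg v₀ (hp.mono n) _ (N n)) fun g => ?_
  have hsq : ∀ n i, γ.val (p n i) ^ 2 = 1 := fun n i => γ.val_sq _
  have h1 : ∀ n i, |γ.val (p n i)| ≤ 1 := fun n i => abs_le_one_of_sq (hsq n i)
  have hlim := fun k => tendsto_step ht hp γ.val_sq (fun s _ => γ.continuousWithinAt_val s)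
    (hω_nonneg k)
  have hm1 : ∀ s, |γ.val s| ≤ 1 := fun s => abs_le_one_of_sq (γ.val_sq s)
  have e1 : ∀ n, prodS ω v₀ (p n) (fun i => γ.1 (p n (i + 1)).toNNReal) (N n) (expVec g) =
      affineExp ω v₀ t
        (fun k => (1 + Real.sqrt (ω k)) ^ 2 * stepPhase (p n) (fun i => γ.val (p n (i + 1)))
          (ω k) (N n))
        (fun k => rho ω k * stepMinus (p n) (fun i => γ.val (p n (i + 1))) (ω k) (N n))
        (fun k => rho ω k * stepPlus (p n) (fun i => γ.val (p n (i + 1))) (ω k) (N n)) g :=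
    fun n => by
      rw [prodS_expVec hω hω_nonneg v₀ (hp.mono n) (hp.zero n), hp.last n]
      rfl
  simp only [e1]
  rw [fkOp_expVec hω hω_nonneg hω_pos hv ht hγ]
  set K := varBound γ.val t with hK
  have hK1 : 1 ≤ K := one_le_varBound _ _
  have hρ := measurable_rho hω
  refine tendsto_affineExp (C := max (2 * (K * t + K)) (Real.sqrt t + 1)) (fun n => ?_)
    (fun n => ?_) (fun n => ?_) (BddMul.of_phase hω hω_nonneg ht hγ).2.1
    (hρ.mul ((measurable_pathMinus γ.measurable_val t).comp hω))
    (hρ.mul ((measurable_pathPlus γ.measurable_val t).comp hω)) (fun n k => ?_) (fun n k => ?_)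
    (fun n k => ?_) (fun k => (hlim k).2.2.const_mul _) (fun k => (hlim k).1.const_mul _)
    (fun k => (hlim k).2.1.const_mul _) g
  · exact (by fun_prop : Measurable fun k => (1 + Real.sqrt (ω k)) ^ 2).mul
      ((measurable_stepPhase _ _ _).comp hω)
  · exact hρ.mul ((measurable_stepMinus _ _ _).comp hω)
  · exact hρ.mul ((measurable_stepPlus _ _ _).comp hω)
  · refine le_max_of_le_left ?_
    have h0 := stepPhase_nonneg (hp.mono n) (fun i => hsq n (i + 1)) (hω_nonneg k) (N n)
    have h2 := stepPhase_le (hp.mono n) (hp.zero n) (fun i => hsq n (i + 1)) (hω_nonneg k)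
      (hp.sum_le_varBound hγ n)
    have h3 := mul_stepPhase_le (hp.mono n) (fun i => hsq n (i + 1)) (hω_nonneg k)
      (zero_le_one.trans hK1) (hp.sum_le_varBound hγ n)
    rw [hp.last n] at h2
    rw [abs_of_nonneg (mul_nonneg (by positivity) h0)]
    exact one_add_sqrt_sq_mul_le hω_nonneg h0 h2 h3
  · refine le_max_of_le_right (rho_mul_abs_le_of_beta hω_nonneg ht ?_)
    have := abs_stepMinus_le (hp.mono n) (hp.zero n) (fun i => h1 n (i + 1)) (ω k) (N n)
    rwa [hp.last n] at this
  · refine le_max_of_le_right (rho_mul_abs_le_of_beta hω_nonneg ht ?_)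
    have := abs_stepPlus_le (hp.mono n) (hp.zero n) (fun i => h1 n (i + 1)) (ω k) (N n)
    rwa [hp.last n] at this

/-- The constant in the Lipschitz bound for the Feynman-Kac operators of form factors of norm at
most `r`. -/
def fkConst (t r : ℝ) : ℝ :=
  Real.exp (((Real.sqrt t + 1) * r) ^ 2 / 2) ^ 2 * (4 * (t + 1) * r) +
    2 * (Real.exp (((Real.sqrt t + 1) * r) ^ 2 / 2) *
      (Real.exp ((3 * ((Real.sqrt t + 1) * r) + 1) ^ 2 / 2) * (Real.sqrt t + 1)))

theorem fkConst_nonneg {t r : ℝ} (ht : 0 ≤ t) (hr : 0 ≤ r) : 0 ≤ fkConst t r := by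
  unfold fkConst
  positivity

theorem phase_eq_neg_re (hω : Measurable ω) (hω_nonneg : ∀ k, 0 ≤ ω k)
    (hω_pos : ∀ᵐ k ∂μ, 0 < ω k) {v : M → ℂ} (hv : MemLp (fun k => v k / (rho ω k : ℂ)) 2 μ) {t : ℝ}
    (ht : 0 ≤ t) {γ : SpinPath} (hγ : eVariationOn γ.val (Icc 0 t) ≠ ∞) :
    phase μ ω v t γ = -(⟪toL2 μ fun k => v k / (rho ω k : ℂ),
      mulOp μ (phaseMul ω γ.val t) (toL2 μ fun k => v k / (rho ω k : ℂ))⟫_ℂ).re := by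
  have := congrArg Complex.re (phase_eq_inner hω hω_nonneg hω_pos hv ht hγ)
  rwa [Complex.ofReal_re, Complex.neg_re] at this

theorem phase_nonpos (hω : Measurable ω) (hω_nonneg : ∀ k, 0 ≤ ω k)
    (hω_pos : ∀ᵐ k ∂μ, 0 < ω k) {v : M → ℂ} (hv : MemLp (fun k => v k / (rho ω k : ℂ)) 2 μ) {t : ℝ}
    (ht : 0 ≤ t) {γ : SpinPath} (hγ : eVariationOn γ.val (Icc 0 t) ≠ ∞) :
    phase μ ω v t γ ≤ 0 := by
  rw [phase_eq_neg_re hω hω_nonneg hω_pos hv ht hγ, neg_nonpos]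
  refine re_inner_mulOp_nonneg (BddMul.of_phase hω hω_nonneg ht hγ).2 (fun k => ?_) _
  exact mul_nonneg (by positivity) (pathPhase_bounds γ.val_sq
    (fun s _ => γ.continuousWithinAt_val s) ht hγ (hω_nonneg k)).1

/-- The phase is minus a bounded quadratic form in v₀. Polarizing the difference gives two terms,
each bounded by the multiplier bound 2(Kt + K) times r. -/
theorem abs_phase_sub_le (hω : Measurable ω) (hω_nonneg : ∀ k, 0 ≤ ω k)
    (hω_pos : ∀ᵐ k ∂μ, 0 < ω k) {v w : M → ℂ} (hv : MemLp (fun k => v k / (rho ω k : ℂ)) 2 μ)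
    (hw : MemLp (fun k => w k / (rho ω k : ℂ)) 2 μ) {t r : ℝ} (ht : 0 ≤ t)
    (hvr : ‖toL2 μ fun k => v k / (rho ω k : ℂ)‖ ≤ r)
    (hwr : ‖toL2 μ fun k => w k / (rho ω k : ℂ)‖ ≤ r) {γ : SpinPath}
    (hγ : eVariationOn γ.val (Icc 0 t) ≠ ∞) :
    |phase μ ω w t γ - phase μ ω v t γ| ≤ 4 * (t + 1) * r * varBound γ.val t *
      ‖(toL2 μ fun k => w k / (rho ω k : ℂ)) - toL2 μ fun k => v k / (rho ω k : ℂ)‖ := by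
  rw [phase_eq_neg_re hω hω_nonneg hω_pos hv ht hγ, phase_eq_neg_re hω hω_nonneg hω_pos hw ht hγ]
  obtain ⟨hb, hm⟩ := BddMul.of_phase hω hω_nonneg ht hγ
  set v₀ := toL2 μ fun k => v k / (rho ω k : ℂ)
  set w₀ := toL2 μ fun k => w k / (rho ω k : ℂ)
  set A := mulOp μ (phaseMul ω γ.val t)
  set K := varBound γ.val t
  have hK : 0 ≤ K := zero_le_one.trans (one_le_varBound _ _)
  have hA : ∀ f, ‖A f‖ ≤ 2 * (K * t + K) * ‖f‖ := norm_mulOp_le hm.1 hb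
  have h1 : -(⟪w₀, A w₀⟫_ℂ).re - -(⟪v₀, A v₀⟫_ℂ).re =
      -(⟪w₀ - v₀, A w₀⟫_ℂ + ⟪v₀, A (w₀ - v₀)⟫_ℂ).re := by
    rw [inner_sub_left, map_sub, inner_sub_right]
    simp only [Complex.add_re, Complex.sub_re]
    ring
  have hr : 0 ≤ r := (norm_nonneg _).trans hvr
  rw [h1, abs_neg]
  calc |(⟪w₀ - v₀, A w₀⟫_ℂ + ⟪v₀, A (w₀ - v₀)⟫_ℂ).re|
      ≤ ‖⟪w₀ - v₀, A w₀⟫_ℂ + ⟪v₀, A (w₀ - v₀)⟫_ℂ‖ := Complex.abs_re_le_norm _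
    _ ≤ ‖w₀ - v₀‖ * ‖A w₀‖ + ‖v₀‖ * ‖A (w₀ - v₀)‖ :=
        (norm_add_le _ _).trans (add_le_add (norm_inner_le_norm _ _) (norm_inner_le_norm _ _))
    _ ≤ ‖w₀ - v₀‖ * (2 * (K * t + K) * r) + r * (2 * (K * t + K) * ‖w₀ - v₀‖) := by
        gcongr
        · exact (hA w₀).trans (by gcongr)
        · exact hA _
    _ = _ := by ring

theorem abs_exp_sub_exp_le {x y : ℝ} (hx : x ≤ 0) (hy : y ≤ 0) :
    |Real.exp x - Real.exp y| ≤ |x - y| := by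
  wlog h : y ≤ x generalizing x y
  · rw [abs_sub_comm, abs_sub_comm x]
    exact this hy hx (le_of_not_ge h)
  rw [abs_of_nonneg (sub_nonneg.2 (Real.exp_le_exp.2 h)), abs_of_nonneg (sub_nonneg.2 h)]
  have h1 := Real.add_one_le_exp (y - x)
  have h2 : Real.exp y = Real.exp x * Real.exp (y - x) := by
    rw [← Real.exp_add]
    congr 1
    ring
  have h3 : Real.exp x ≤ 1 := Real.exp_le_one_iff.2 hx
  nlinarith [Real.exp_pos x]

theorem norm_smul_mul_sub_le {R : Type*} [NormedRing R] [NormedAlgebra ℂ R] {P P' Q Q' : R}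
    {c c' a b E : ℝ} (hc0 : 0 ≤ c') (hc1 : c' ≤ 1) (hc : |c - c'| ≤ a) (hP : ‖P‖ ≤ E)
    (hP' : ‖P'‖ ≤ E) (hQ : ‖Q‖ ≤ E) (hPP : ‖P - P'‖ ≤ b) (hQQ : ‖Q - Q'‖ ≤ b) :
    ‖(c : ℂ) • (P * Q) - (c' : ℂ) • (P' * Q')‖ ≤ a * (E * E) + 2 * (E * b) := by
  have hsplit : (c : ℂ) • (P * Q) - (c' : ℂ) • (P' * Q') = ((c - c' : ℝ) : ℂ) • (P * Q) +
      (c' : ℂ) • ((P - P') * Q) + (c' : ℂ) • (P' * (Q - Q')) := by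
    push_cast
    rw [sub_mul, mul_sub, sub_smul, smul_sub, smul_sub]
    abel
  have hE0 : 0 ≤ E := (norm_nonneg _).trans hP
  have ha0 : 0 ≤ a := (abs_nonneg _).trans hc
  have hb0 : 0 ≤ b := (norm_nonneg _).trans hPP
  rw [hsplit]
  calc _ ≤ |c - c'| * (‖P‖ * ‖Q‖) + c' * (‖P - P'‖ * ‖Q‖) + c' * (‖P'‖ * ‖Q - Q'‖) := by
        refine norm_add₃_le.trans ?_
        simp only [norm_smul, Complex.norm_real, Real.norm_eq_abs, abs_of_nonneg hc0]
        gcongr <;> exact norm_mul_le _ _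
    _ ≤ a * (E * E) + 1 * (b * E) + 1 * (E * b) := by gcongr
    _ = _ := by ring

theorem norm_opI_mulOp_le (hω : Measurable ω) (hω_nonneg : ∀ k, 0 ≤ ω k) {t S r : ℝ} (ht : 0 ≤ t)
    {m : M → ℝ} (hm : BddMul m) (hS : 0 ≤ S) (hb : ∀ k, |m k| ≤ S) {f : OneBoson μ}
    (hf : ‖f‖ ≤ r) :
    ‖opI t ω (rOp μ ω t (mulOp μ m f))‖ ≤ Real.exp ((S * r) ^ 2 / 2) := by
  refine ((opI_expVec_and_norm hω hω_nonneg ht _).2).trans (Real.exp_le_exp.2 ?_)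
  have := (norm_mulOp_le hm.1 hb f).trans (mul_le_mul_of_nonneg_left hf hS)
  gcongr

theorem norm_opI_mulOp_sub_le (hω : Measurable ω) (hω_nonneg : ∀ k, 0 ≤ ω k) {t S r : ℝ}
    (ht : 0 ≤ t) {m : M → ℝ} (hm : BddMul m) (hS : 0 ≤ S) (hb : ∀ k, |m k| ≤ S)
    {f f' : OneBoson μ} (hf : ‖f‖ ≤ r) (hf' : ‖f'‖ ≤ r) :
    ‖opI t ω (rOp μ ω t (mulOp μ m f)) - opI t ω (rOp μ ω t (mulOp μ m f'))‖ ≤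
      Real.exp ((3 * (S * r) + 1) ^ 2 / 2) * S * ‖f - f'‖ := by
  have hd : ‖f - f'‖ ≤ 2 * r := (norm_sub_le _ _).trans (by linarith)
  have h1 : ‖mulOp μ m f - mulOp μ m f'‖ ≤ S * ‖f - f'‖ := by
    rw [← map_sub]
    exact norm_mulOp_le hm.1 hb _
  have h2 := (norm_mulOp_le hm.1 hb f').trans (mul_le_mul_of_nonneg_left hf' hS)
  have h3 : ‖mulOp μ m f - mulOp μ m f'‖ ≤ 2 * (S * r) := by nlinarith
  refine (norm_opI_sub_le hω hω_nonneg ht _ _).trans ?_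
  rw [mul_assoc]
  refine mul_le_mul (Real.exp_le_exp.2 ?_) h1 (norm_nonneg _) (Real.exp_pos _).le
  have : ‖mulOp μ m f'‖ + ‖mulOp μ m f - mulOp μ m f'‖ + 1 ≤ 3 * (S * r) + 1 := by linarith
  gcongr

/-- Lipschitz continuity of the Feynman-Kac operator of a path in the form factor. -/
theorem norm_fkOp_sub_le (hω : Measurable ω) (hω_nonneg : ∀ k, 0 ≤ ω k)
    (hω_pos : ∀ᵐ k ∂μ, 0 < ω k) {v w : M → ℂ} (hv : MemLp (fun k => v k / (rho ω k : ℂ)) 2 μ)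
    (hw : MemLp (fun k => w k / (rho ω k : ℂ)) 2 μ) {t r : ℝ} (ht : 0 ≤ t)
    (hvr : ‖toL2 μ fun k => v k / (rho ω k : ℂ)‖ ≤ r)
    (hwr : ‖toL2 μ fun k => w k / (rho ω k : ℂ)‖ ≤ r) {γ : SpinPath}
    (hγ : eVariationOn γ.val (Icc 0 t) ≠ ∞) :
    ‖fkOp μ ω w t γ - fkOp μ ω v t γ‖ ≤ fkConst t r * varBound γ.val t *
      ‖(toL2 μ fun k => w k / (rho ω k : ℂ)) - toL2 μ fun k => v k / (rho ω k : ℂ)‖ := by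
  have hu := abs_phase_sub_le hω hω_nonneg hω_pos hv hw ht hvr hwr hγ
  have hv0 := phase_nonpos hω hω_nonneg hω_pos hv ht hγ
  have hw0 := phase_nonpos hω hω_nonneg hω_pos hw ht hγ
  have ht2 : 0 ≤ t / 2 := by positivity
  obtain ⟨hmb, hm, hmeq⟩ := quotMul_minus (μ := μ) hω hω_nonneg ht γ
  obtain ⟨hpb, hp, hpeq⟩ := quotMul_plus (μ := μ) hω hω_nonneg ht γ
  have hS : 0 ≤ Real.sqrt t + 1 := by positivity
  have hPw := norm_opI_mulOp_le hω hω_nonneg ht2 hp hS hpb hwr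
  have hPv := norm_opI_mulOp_le hω hω_nonneg ht2 hp hS hpb hvr
  have hQw := norm_opI_mulOp_le hω hω_nonneg ht2 hm hS hmb hwr
  have hP := norm_opI_mulOp_sub_le hω hω_nonneg ht2 hp hS hpb hwr hvr
  have hQ := norm_opI_mulOp_sub_le hω hω_nonneg ht2 hm hS hmb hwr hvr
  rw [← hmeq] at hQw
  rw [← hpeq] at hPw hPv
  rw [← hmeq, ← hmeq] at hQ
  rw [← hpeq, ← hpeq] at hP
  rw [← toL2_UMinus hω hω_nonneg hω_pos hw ht] at hQw hQ
  rw [← toL2_UMinus hω hω_nonneg hω_pos hv ht] at hQ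
  rw [← toL2_UPlus hω hω_nonneg hω_pos hw ht] at hPw hP
  rw [← toL2_UPlus hω hω_nonneg hω_pos hv ht] at hPv hP
  rw [← ContinuousLinearMap.adjoint.norm_map] at hPw hPv hP
  rw [map_sub] at hP
  refine (norm_smul_mul_sub_le (Real.exp_pos _).le (Real.exp_le_one_iff.2 hv0)
    ((abs_exp_sub_exp_le hw0 hv0).trans hu) hPw hPv hQw hP hQ).trans ?_
  have hK : 1 ≤ varBound γ.val t := one_le_varBound _ _
  have hr : 0 ≤ r := (norm_nonneg _).trans hvr
  rw [fkConst]
  set E := Real.exp (((Real.sqrt t + 1) * r) ^ 2 / 2)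
  set D := Real.exp ((3 * ((Real.sqrt t + 1) * r) + 1) ^ 2 / 2)
  set d := ‖(toL2 μ fun k => w k / (rho ω k : ℂ)) - toL2 μ fun k => v k / (rho ω k : ℂ)‖
  -- The terms from I and I* do not involve the variation; they are absorbed into the common
  -- constant because `varBound` is at least 1.
  have h : 2 * (E * (D * (Real.sqrt t + 1) * d)) ≤
      varBound γ.val t * (2 * (E * (D * (Real.sqrt t + 1) * d))) :=
    le_mul_of_one_le_left (by positivity) hK
  linarith

end PathOperator
/-! ### Bounded perturbations of contraction semigroups by operator products -/

section Trotter

variable {E : Type*} [NormedAddCommGroup E] [NormedSpace ℂ E]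

/-- The approximation `(1 - b(h) B) S_h` of the perturbed semigroup. -/
def stepOp (S : ℝ≥0 → E →L[ℂ] E) (B : E →L[ℂ] E) (b : ℝ) (h : ℝ≥0) : E →L[ℂ] E :=
  (1 - (b : ℂ) • B) * S h

variable {S : ℝ≥0 → E →L[ℂ] E} {B : E →L[ℂ] E} {b : ℝ} {h : ℝ≥0}

theorem norm_stepOp_le (hS : IsContractionSemigroup S) (hB : ‖1 - (b : ℂ) • B‖ ≤ 1) :
    ‖stepOp S B b h‖ ≤ 1 :=
  (norm_mul_le _ _).trans (mul_le_one₀ hB (norm_nonneg _) (hS.norm_le h))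

theorem norm_pow_apply_le {A : E →L[ℂ] E} (hA : ‖A‖ ≤ 1) (n : ℕ) (φ : E) : ‖(A ^ n) φ‖ ≤ ‖φ‖ := by
  induction n generalizing φ with
  | zero => simp
  | succ n ih =>
    rw [pow_succ, mul_apply_eq_comp]
    exact (ih _).trans ((A.le_of_opNorm_le hA φ).trans_eq (one_mul _))

theorem stepOp_pow_succ_apply (n : ℕ) (φ : E) : (stepOp S B b h ^ (n + 1)) φ =
    (stepOp S B b h ^ n) (S h φ) - (b : ℂ) • (stepOp S B b h ^ n) (B (S h φ)) := by
  rw [pow_succ, mul_apply_eq_comp, stepOp, mul_apply_eq_comp, sub_apply, smul_apply, map_sub,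
    map_smul]
  rfl

/-- Zeroth order comparison: each factor 1 - b B costs at most b ‖B‖ ‖φ‖, and all other factors are
contractions. -/
theorem norm_stepOp_pow_sub_le (hS : IsContractionSemigroup S) (hb : 0 ≤ b)
    (hB : ‖1 - (b : ℂ) • B‖ ≤ 1) (n : ℕ) (φ : E) :
    ‖(stepOp S B b h ^ n) φ - S (n * h) φ‖ ≤ n * b * (‖B‖ * ‖φ‖) := by
  induction n generalizing φ with
  | zero => simp [hS.zero]
  | succ n ih =>
    have h1 : S ((n + 1 : ℕ) * h) φ = S (n * h) (S h φ) := by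
      rw [Nat.cast_succ, add_mul, one_mul, hS.add, mul_apply_eq_comp]
    rw [stepOp_pow_succ_apply, h1, sub_right_comm]
    have h2 := hS.norm_apply_le h φ
    have h3 : ‖(stepOp S B b h ^ n) (B (S h φ))‖ ≤ ‖B‖ * ‖φ‖ :=
      (norm_pow_apply_le (norm_stepOp_le hS hB) n _).trans
        ((B.le_opNorm _).trans (mul_le_mul_of_nonneg_left h2 (norm_nonneg _)))
    have h4 := ih (S h φ)
    calc _ ≤ ‖(stepOp S B b h ^ n) (S h φ) - S (n * h) (S h φ)‖ +
          b * ‖(stepOp S B b h ^ n) (B (S h φ))‖ := by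
          refine (norm_sub_le _ _).trans_eq ?_
          rw [norm_smul, Complex.norm_real, Real.norm_of_nonneg hb]
      _ ≤ n * b * (‖B‖ * ‖φ‖) + b * (‖B‖ * ‖φ‖) := by
          refine add_le_add (h4.trans ?_) (mul_le_mul_of_nonneg_left h3 hb)
          gcongr
      _ = _ := by
          push_cast
          ring

/-- First order comparison, with error o(t) after division by t. Expanding one factor at a time
moves an S_h onto ψ, which is why the induction runs over vectors S_τ ψ with τ varying. -/
theorem norm_stepOp_pow_sub_add_le (hS : IsContractionSemigroup S) (hb : 0 ≤ b)
    (hB : ‖1 - (b : ℂ) • B‖ ≤ 1) (hbh : b ≤ h) {ψ : E} {t : ℝ≥0} {ε : ℝ}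
    (h1 : ∀ τ ≤ t, ‖ψ - S τ ψ‖ ≤ ε) (h2 : ∀ τ ≤ t, ‖B ψ - S τ (B ψ)‖ ≤ ε)
    (h3 : t * (‖B‖ * ‖B ψ‖) ≤ ε) (n : ℕ) (τ : ℝ≥0) (hτ : τ + n * h ≤ t) :
    ‖(stepOp S B b h ^ n) (S τ ψ) - S (n * h + τ) ψ + ((n * b : ℝ) : ℂ) • B ψ‖ ≤
      n * b * (ε * (2 + ‖B‖)) := by
  induction n generalizing τ with
  | zero => simp
  | succ n ih =>
    have hτ' : τ + h + n * h ≤ t := by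
      refine le_trans (le_of_eq ?_) hτ
      push_cast
      ring
    have hnt : (n * h : ℝ≥0) ≤ t := le_trans (le_add_of_nonneg_left zero_le) hτ'
    have hτt : τ + h ≤ t := le_trans (le_add_of_nonneg_right zero_le) hτ'
    have e1 : S h (S τ ψ) = S (τ + h) ψ := by rw [add_comm, hS.add, mul_apply_eq_comp]
    have e2 : ((n + 1 : ℕ) * h + τ : ℝ≥0) = n * h + (τ + h) := by
      push_cast
      ring
    -- Three errors: S displaces Bψ (at most ε), the product deviates from S on Bψ (at most t ‖B‖
    -- ‖Bψ‖ ≤ ε), and B acts on ψ - S_{τ+h} ψ (at most ‖B‖ ε).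
    have key : ‖B ψ - (stepOp S B b h ^ n) (B (S (τ + h) ψ))‖ ≤ ε * (2 + ‖B‖) := by
      have k1 : ‖B ψ - S (n * h) (B ψ)‖ ≤ ε := h2 _ hnt
      have k2 : ‖(stepOp S B b h ^ n) (B ψ) - S (n * h) (B ψ)‖ ≤ ε := by
        refine (norm_stepOp_pow_sub_le hS hb hB n (B ψ)).trans (le_trans ?_ h3)
        have : (n * b : ℝ) ≤ t := le_trans (mul_le_mul_of_nonneg_left hbh n.cast_nonneg)
          (by exact_mod_cast hnt)
        exact mul_le_mul_of_nonneg_right this (by positivity)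
      have k3 : ‖(stepOp S B b h ^ n) (B (ψ - S (τ + h) ψ))‖ ≤ ‖B‖ * ε :=
        (norm_pow_apply_le (norm_stepOp_le hS hB) n _).trans
          ((B.le_opNorm _).trans (mul_le_mul_of_nonneg_left (h1 _ hτt) (norm_nonneg _)))
      have k4 : B ψ - (stepOp S B b h ^ n) (B (S (τ + h) ψ)) = (B ψ - S (n * h) (B ψ)) -
          ((stepOp S B b h ^ n) (B ψ) - S (n * h) (B ψ)) +
          (stepOp S B b h ^ n) (B (ψ - S (τ + h) ψ)) := by
        rw [map_sub, map_sub]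
        abel
      rw [k4]
      refine (norm_add_le _ _).trans ((add_le_add_left (norm_sub_le _ _) _).trans ?_)
      linarith
    rw [stepOp_pow_succ_apply, e1, e2]
    have e3 : (stepOp S B b h ^ n) (S (τ + h) ψ) -
        (b : ℂ) • (stepOp S B b h ^ n) (B (S (τ + h) ψ)) - S (n * h + (τ + h)) ψ +
        (((n + 1 : ℕ) * b : ℝ) : ℂ) • B ψ =
        ((stepOp S B b h ^ n) (S (τ + h) ψ) - S (n * h + (τ + h)) ψ + ((n * b : ℝ) : ℂ) • B ψ) +
        (b : ℂ) • (B ψ - (stepOp S B b h ^ n) (B (S (τ + h) ψ))) := by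
      push_cast
      rw [add_mul, add_smul, one_mul, smul_sub]
      abel
    rw [e3]
    refine (norm_add_le _ _).trans ((add_le_add (ih (τ + h) hτ') (le_of_eq (norm_smul _ _))).trans ?_)
    rw [Complex.norm_real, Real.norm_of_nonneg hb]
    rw [Nat.cast_succ]
    linarith [mul_le_mul_of_nonneg_left key hb]

variable {T : ℝ≥0 → E →L[ℂ] E} {β : ℝ → ℝ}

theorem norm_sub_add_smul_le (hS : IsContractionSemigroup S) (hβ : ∀ h, 0 ≤ h → 0 ≤ β h)
    (hβ' : ∀ h, 0 ≤ h → β h ≤ h) (hB : ∀ h, 0 ≤ h → ‖1 - (β h : ℂ) • B‖ ≤ 1)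
    (hlim : ∀ t : ℝ≥0, Tendsto (fun n : ℕ => ((n + 1 : ℕ) : ℝ) * β (t / (n + 1))) atTop (𝓝 t))
    (hT : ∀ (t : ℝ≥0) ψ, Tendsto (fun n : ℕ =>
      (stepOp S B (β (t / (n + 1))) (t / (n + 1)) ^ (n + 1)) ψ) atTop (𝓝 (T t ψ)))
    {ψ : E} {t : ℝ≥0} {ε : ℝ} (h1 : ∀ τ ≤ t, ‖ψ - S τ ψ‖ ≤ ε)
    (h2 : ∀ τ ≤ t, ‖B ψ - S τ (B ψ)‖ ≤ ε) (h3 : t * (‖B‖ * ‖B ψ‖) ≤ ε) :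
    ‖T t ψ - S t ψ + (t : ℂ) • B ψ‖ ≤ t * (ε * (2 + ‖B‖)) := by
  have hmul : ∀ n : ℕ, ((n + 1 : ℕ) : ℝ≥0) * (t / (n + 1)) = t := fun n => by
    push_cast
    rw [mul_div_cancel₀]
    positivity
  have hc : Tendsto (fun n : ℕ => ((((n + 1 : ℕ) : ℝ) * β (t / (n + 1)) : ℝ) : ℂ)) atTop
      (𝓝 (t : ℂ)) := (Complex.continuous_ofReal.tendsto _).comp (hlim t)
  have hl := (((hT t ψ).sub_const (S t ψ)).add (hc.smul_const (B ψ))).norm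
  refine le_of_tendsto_of_tendsto' hl ((hlim t).mul_const (ε * (2 + ‖B‖))) fun n => ?_
  have h0 : (0 : ℝ) ≤ t / (n + 1) := by positivity
  have h4 := norm_stepOp_pow_sub_add_le hS (h := t / (n + 1)) (hβ _ h0) (hB _ h0)
    ((hβ' _ h0).trans_eq (by push_cast; rfl)) h1 h2 h3 (n + 1) 0
    (by rw [zero_add, hmul])
  rw [hmul, add_zero, hS.zero] at h4
  exact h4

/-- The limit of the operator products is a contraction semigroup if it has the semigroup
property, and it is a perturbation of `S` with generator shifted by `B`. -/
theorem isContractionSemigroup_and_tendsto (hS : IsContractionSemigroup S)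
    (hβ : ∀ h, 0 ≤ h → 0 ≤ β h) (hβ' : ∀ h, 0 ≤ h → β h ≤ h)
    (hB : ∀ h, 0 ≤ h → ‖1 - (β h : ℂ) • B‖ ≤ 1)
    (hlim : ∀ t : ℝ≥0, Tendsto (fun n : ℕ => ((n + 1 : ℕ) : ℝ) * β (t / (n + 1))) atTop (𝓝 t))
    (hT : ∀ (t : ℝ≥0) ψ, Tendsto (fun n : ℕ =>
      (stepOp S B (β (t / (n + 1))) (t / (n + 1)) ^ (n + 1)) ψ) atTop (𝓝 (T t ψ)))
    (hadd : ∀ s t, T (s + t) = T s * T t) :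
    IsContractionSemigroup T ∧ ∀ ψ, Tendsto
      (fun t : ℝ≥0 => ((t : ℝ)⁻¹ : ℂ) • (S t ψ - T t ψ)) (𝓝[>] 0) (𝓝 (B ψ)) := by
  have hev : ∀ (φ : E) {ε : ℝ}, 0 < ε → ∃ δ > (0 : ℝ≥0), ∀ τ < δ, ‖φ - S τ φ‖ ≤ ε := by
    intro φ ε hε
    have h1 := (hS.continuous φ).tendsto 0
    rw [hS.zero] at h1
    obtain ⟨δ, hδ, h2⟩ := Metric.tendsto_nhds_nhds.1 h1 ε hε
    refine ⟨⟨δ, hδ.le⟩, hδ, fun τ hτ => ?_⟩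
    have h3 := h2 (x := τ) (by
      rw [NNReal.dist_eq, NNReal.coe_zero, sub_zero, NNReal.abs_eq]
      exact hτ)
    rw [dist_comm, dist_eq_norm] at h3
    exact h3.le
  -- For t small the three smallness conditions hold with the same ε. This one estimate yields
  -- strong continuity of T at 0 and the limit of the difference quotient.
  have hbd : ∀ (ψ : E) {ε : ℝ}, 0 < ε → ∃ δ > (0 : ℝ≥0), ∀ t < δ,
      ‖ψ - S t ψ‖ ≤ ε ∧ ‖T t ψ - S t ψ + (t : ℂ) • B ψ‖ ≤ t * (ε * (2 + ‖B‖)) := by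
    intro ψ ε hε
    obtain ⟨δ₁, hδ₁, h1⟩ := hev ψ hε
    obtain ⟨δ₂, hδ₂, h2⟩ := hev (B ψ) hε
    have hc : 0 < ε / (‖B‖ * ‖B ψ‖ + 1) := by positivity
    refine ⟨min (min δ₁ δ₂) ⟨_, hc.le⟩, lt_min (lt_min hδ₁ hδ₂) hc, fun t ht => ?_⟩
    have ht1 := ht.trans_le ((min_le_left _ _).trans (min_le_left _ _))
    have ht2 := ht.trans_le ((min_le_left _ _).trans (min_le_right _ _))
    have ht3 : (t : ℝ) < ε / (‖B‖ * ‖B ψ‖ + 1) := ht.trans_le (min_le_right _ _)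
    refine ⟨h1 t ht1, norm_sub_add_smul_le hS hβ hβ' hB hlim hT
      (fun τ hτ => h1 τ (hτ.trans_lt ht1)) (fun τ hτ => h2 τ (hτ.trans_lt ht2)) ?_⟩
    rw [lt_div_iff₀ (by positivity)] at ht3
    nlinarith [t.2]
  refine ⟨isContractionSemigroup_of_tendsto ?_ hadd (fun t => ?_) (D := univ) (by simp)
    fun ψ _ => ?_, fun ψ => ?_⟩
  · ext ψ
    have h1 : β 0 = 0 := le_antisymm (hβ' 0 le_rfl) (hβ 0 le_rfl)
    refine tendsto_nhds_unique (hT 0 ψ) ?_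
    simp [stepOp, h1, hS.zero]
  · refine ContinuousLinearMap.opNorm_le_bound _ zero_le_one fun ψ => ?_
    rw [one_mul]
    refine le_of_tendsto' (hT t ψ).norm fun n => norm_pow_apply_le (norm_stepOp_le hS ?_) _ _
    exact hB _ (by positivity)
  · rw [Metric.tendsto_nhds]
    intro ε hε
    have hc : 0 < ε / (2 * (3 + ‖B‖)) := by positivity
    obtain ⟨δ, hδ, h1⟩ := hbd ψ hc
    have hc2 : 0 < ε / (2 * (‖B ψ‖ + 1)) := by positivity
    have hmin : 0 < min (min δ 1) ⟨_, hc2.le⟩ := lt_min (lt_min hδ one_pos) hc2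
    filter_upwards [gt_mem_nhds hmin] with t ht
    have ht1 := ht.trans_le ((min_le_left _ _).trans (min_le_left _ _))
    have ht2 : (t : ℝ) < 1 := ht.trans_le ((min_le_left _ _).trans (min_le_right _ _))
    have ht3 : (t : ℝ) < ε / (2 * (‖B ψ‖ + 1)) := ht.trans_le (min_le_right _ _)
    obtain ⟨h2, h3⟩ := h1 t ht1
    rw [lt_div_iff₀ (by positivity)] at ht3
    have e : T t ψ - ψ = (T t ψ - S t ψ + (t : ℂ) • B ψ) - (ψ - S t ψ) - (t : ℂ) • B ψ := by abel
    rw [dist_eq_norm, e]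
    have h4 : ‖(t : ℂ) • B ψ‖ = t * ‖B ψ‖ := by
      rw [norm_smul]
      simp
    have h5 : ε / (2 * (3 + ‖B‖)) * (2 + ‖B‖) + ε / (2 * (3 + ‖B‖)) = ε / 2 := by
      field_simp
      ring
    have h6 : (t : ℝ) * (ε / (2 * (3 + ‖B‖)) * (2 + ‖B‖)) ≤ ε / (2 * (3 + ‖B‖)) * (2 + ‖B‖) :=
      mul_le_of_le_one_left (by positivity) ht2.le
    calc _ ≤ _ := (norm_sub_le _ _).trans (add_le_add_left (norm_sub_le _ _) _)
      _ ≤ ε / (2 * (3 + ‖B‖)) * (2 + ‖B‖) + ε / (2 * (3 + ‖B‖)) + t * ‖B ψ‖ := by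
          rw [h4]
          linarith
      _ < ε := by
          rw [h5]
          nlinarith [t.2]
  · rw [Metric.tendsto_nhds]
    intro ε hε
    obtain ⟨δ, hδ, h1⟩ := hbd ψ (ε := ε / (3 + ‖B‖)) (by positivity)
    filter_upwards [self_mem_nhdsWithin, mem_nhdsWithin_of_mem_nhds (gt_mem_nhds hδ)] with t ht0 ht
    have ht0' : (0 : ℝ) < t := ht0
    have h2 := (h1 t ht).2
    have e : ((t : ℝ)⁻¹ : ℂ) • (S t ψ - T t ψ) - B ψ =
        -((t : ℝ)⁻¹ : ℂ) • (T t ψ - S t ψ + (t : ℂ) • B ψ) := by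
      have h3 : ((t : ℝ) : ℂ)⁻¹ * ((t : ℝ) : ℂ) = 1 :=
        inv_mul_cancel₀ (by exact_mod_cast ht0'.ne')
      rw [smul_add, smul_smul, neg_mul, h3, neg_smul, neg_smul, one_smul, ← smul_neg, neg_sub]
      abel
    rw [dist_eq_norm, e, norm_smul, norm_neg, norm_inv, Complex.norm_real,
      Real.norm_of_nonneg ht0'.le, inv_mul_lt_iff₀ ht0']
    refine h2.trans_lt (mul_lt_mul_of_pos_left ?_ ht0')
    rw [div_mul_eq_mul_div, div_lt_iff₀ (by positivity)]
    nlinarith [norm_nonneg B]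

end Trotter
/-! ### Expectations under the law of the spin process -/

section SpinLaw

instance : DiscreteMeasurableSpace ℤˣ where
  forall_measurableSet s :=
    ⟨(fun u : ℤˣ => (u : ℤ)) '' s, MeasurableSet.of_discrete,
      preimage_image_eq s Units.val_injective⟩

theorem SpinPath.measurable_eval (t : ℝ≥0) : Measurable fun γ : SpinPath => γ.1 t :=
  fun s _ => le_iSup (fun t : ℝ≥0 => MeasurableSpace.comap (fun γ : SpinPath => γ.1 t) ⊤) t _
    ⟨s, trivial, rfl⟩

theorem sum_units {F : Type*} [AddCommMonoid F] (f : ℤˣ → F) (y : ℤˣ) :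
    ∑ a, f a = f y + f (-y) := by
  have h : (Finset.univ : Finset ℤˣ) = {1, -1} := rfl
  rw [h, Finset.sum_pair (by decide)]
  rcases Int.units_eq_one_or y with rfl | rfl
  · rfl
  · rw [neg_neg, add_comm]

/-- The probability `(1 - e^{-2t})/2` of a spin flip within time `t`. -/
def flipProb (t : ℝ) : ℝ := (1 - Real.exp (-2 * t)) / 2

theorem flipProb_nonneg {t : ℝ} (ht : 0 ≤ t) : 0 ≤ flipProb t := by
  have : Real.exp (-2 * t) ≤ 1 := Real.exp_le_one_iff.2 (by linarith)
  unfold flipProb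
  linarith

theorem flipProb_le (t : ℝ) : flipProb t ≤ t := by
  have := Real.add_one_le_exp (-2 * t)
  unfold flipProb
  linarith

theorem flipProb_le_one (t : ℝ) : flipProb t ≤ 1 := by
  have := Real.exp_pos (-2 * t)
  unfold flipProb
  linarith

theorem units_ne_neg (x : ℤˣ) : x ≠ -x := by
  rcases Int.units_eq_one_or x with rfl | rfl <;> decide

theorem transition_self (t : ℝ) (x : ℤˣ) : transition t x x = 1 - flipProb t := by
  rw [transition, if_pos rfl, if_neg (units_ne_neg x), flipProb]
  ring

theorem transition_neg (t : ℝ) (x : ℤˣ) : transition t x (-x) = flipProb t := by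
  rw [transition, if_neg (units_ne_neg x), if_pos (neg_neg x).symm, flipProb]
  ring

theorem transition_nonneg {t : ℝ} (ht : 0 ≤ t) (x y : ℤˣ) : 0 ≤ transition t x y := by
  rcases Int.units_eq_one_or (x * y) with h | h
  · rw [show y = x by rw [← Int.units_inv_eq_self x]; exact eq_inv_of_mul_eq_one_right h,
      transition_self]
    linarith [flipProb_le_one t]
  · have : y = -x := by
      rw [← one_mul y, ← Int.units_mul_self x, mul_assoc, h, mul_neg, mul_one]
    rw [this, transition_neg]
    exact flipProb_nonneg ht

variable {x : ℤˣ} {P : Measure SpinPath}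

theorem IsSpinLaw.isProbabilityMeasure (hP : IsSpinLaw x P) : IsProbabilityMeasure P :=
  ⟨by simpa using hP 0 (fun _ => 0) (fun _ => x) monotone_const rfl rfl⟩

theorem IsSpinLaw.ae_zero (hP : IsSpinLaw x P) : ∀ᵐ γ ∂P, γ.1 0 = x := by
  have := hP.isProbabilityMeasure
  have h := hP 1 (fun _ => 0) (fun _ => x) monotone_const rfl rfl
  have h0 : flipProb 0 = 0 := by simp [flipProb]
  simp only [Nat.lt_one_iff, forall_eq, Finset.prod_range_one, sub_self, transition_self, h0,
    sub_zero, ENNReal.ofReal_one] at h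
  exact (mem_ae_iff_prob_eq_one ((SpinPath.measurable_eval 0) (measurableSet_singleton x))).2 h

variable {t : ℕ → ℝ≥0}

/-- Both events are cylinder sets and their product formulas differ by one factor. The law
prescribes only times with index at least 1, so the value at index 0 is supplied by X₀ = x almost
surely; if `y 0 ≠ x` both sides vanish. -/
theorem IsSpinLaw.measure_markov (hP : IsSpinLaw x P) (ht : Monotone t) (ht0 : t 0 = 0) (n : ℕ)
    (y : ℕ → ℤˣ) (a : ℤˣ) :
    P {γ | (∀ i ≤ n, γ.1 (t i) = y i) ∧ γ.1 (t (n + 1)) = a} =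
      P {γ | ∀ i ≤ n, γ.1 (t i) = y i} *
        ENNReal.ofReal (transition (t (n + 1) - t n) (y n) a) := by
  have h0 : ∀ᵐ γ ∂P, γ.1 (t 0) = x := by
    rw [ht0]
    exact hP.ae_zero
  by_cases hy : y 0 = x
  · set y' : ℕ → ℤˣ := fun i => if i ≤ n then y i else a with hy'
    have hy'n : ∀ i ≤ n, y' i = y i := fun i hi => if_pos hi
    have hy's : y' (n + 1) = a := if_neg (by omega)
    have e1 : P {γ | (∀ i ≤ n, γ.1 (t i) = y i) ∧ γ.1 (t (n + 1)) = a} =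
        P {γ | ∀ i < n + 1, γ.1 (t (i + 1)) = y' (i + 1)} := by
      refine measure_congr ?_
      filter_upwards [h0] with γ hγ
      refine propext ⟨fun ⟨h1, h2⟩ i hi => ?_, fun h => ⟨fun i hi => ?_, ?_⟩⟩
      · rcases Nat.lt_succ_iff_lt_or_eq.1 hi with h3 | rfl
        · rw [hy'n _ h3]
          exact h1 _ h3
        · rw [hy's]
          exact h2
      · rcases i with _ | i
        · rw [hy, hγ]
        · rw [← hy'n _ hi]
          exact h i (by omega)
      · rw [← hy's]
        exact h n n.lt_succ_self
    have e2 : P {γ | ∀ i ≤ n, γ.1 (t i) = y i} =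
        P {γ | ∀ i < n, γ.1 (t (i + 1)) = y (i + 1)} := by
      refine measure_congr ?_
      filter_upwards [h0] with γ hγ
      refine propext ⟨fun h1 i hi => h1 _ hi, fun h i hi => ?_⟩
      rcases i with _ | i
      · rw [hy, hγ]
      · exact h i hi
    have hnn : ∀ i u w, 0 ≤ transition (t (i + 1) - t i) u w := fun i u w =>
      transition_nonneg (sub_nonneg.2 (by exact_mod_cast ht i.le_succ)) u w
    rw [e1, e2, hP (n + 1) t y' ht ht0 (by rw [hy'n 0 n.zero_le, hy]), hP n t y ht ht0 hy,
      Finset.prod_range_succ, ENNReal.ofReal_mul (Finset.prod_nonneg fun i _ => hnn i _ _), hy's,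
      hy'n n le_rfl]
    congr 2
    refine Finset.prod_congr rfl fun i hi => ?_
    rw [hy'n i (Finset.mem_range.1 hi).le, hy'n _ (Finset.mem_range.1 hi)]
  · have e : P {γ | ∀ i ≤ n, γ.1 (t i) = y i} = 0 := by
      have h1 : P {γ | ¬ γ.1 (t 0) = x} = 0 := h0
      have h2 : {γ : SpinPath | ∀ i ≤ n, γ.1 (t i) = y i} ⊆ {γ | ¬ γ.1 (t 0) = x} :=
        fun γ hγ h => hy ((hγ 0 n.zero_le).symm.trans h)
      exact measure_mono_null h2 h1
    rw [e, zero_mul]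
    exact measure_mono_null (fun γ hγ => hγ.1) e

variable {F : Type*} [NormedAddCommGroup F] [NormedSpace ℝ F] [CompleteSpace F]

/-- Conditioning on the first n + 1 sampled values. They range over a finite set, so both integrals
are finite sums weighted by the probabilities of cylinder sets. -/
theorem IsSpinLaw.integral_markov (hP : IsSpinLaw x P) (ht : Monotone t) (ht0 : t 0 = 0) (n : ℕ)
    (f : (Fin (n + 1) → ℤˣ) → ℤˣ → F) :
    ∫ γ, f (fun i => γ.1 (t i)) (γ.1 (t (n + 1))) ∂P =
      ∫ γ, ∑ a, transition (t (n + 1) - t n) (γ.1 (t n)) a • f (fun i => γ.1 (t i)) a ∂P := by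
  have := hP.isProbabilityMeasure
  set Y : SpinPath → Fin (n + 1) → ℤˣ := fun γ i => γ.1 (t i) with hY
  have hYm : Measurable Y := measurable_pi_lambda _ fun _ => SpinPath.measurable_eval _
  set Z : SpinPath → (Fin (n + 1) → ℤˣ) × ℤˣ := fun γ => (Y γ, γ.1 (t (n + 1))) with hZ
  have hZm : Measurable Z := hYm.prodMk (SpinPath.measurable_eval _)
  have : IsProbabilityMeasure (P.map Y) := Measure.isProbabilityMeasure_map hYm.aemeasurable
  have : IsProbabilityMeasure (P.map Z) := Measure.isProbabilityMeasure_map hZm.aemeasurable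
  have hst : ∀ z a, (P.map Z).real {(z, a)} =
      (P.map Y).real {z} * transition (t (n + 1) - t n) (z (Fin.last n)) a := fun z a => by
    rw [measureReal_def, measureReal_def, Measure.map_apply hZm (measurableSet_singleton _),
      Measure.map_apply hYm (measurableSet_singleton _)]
    have h := hP.measure_markov ht ht0 n (fun i => z (Fin.ofNat (n + 1) i)) a
    have hiff : ∀ γ : SpinPath, (∀ i ≤ n, γ.1 (t i) = z (Fin.ofNat (n + 1) i)) ↔ Y γ = z :=
      fun γ => by
        rw [funext_iff]
        refine ⟨fun h i => ?_, fun h i hi => ?_⟩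
        · have := h i (Nat.lt_succ_iff.1 i.2)
          rwa [show Fin.ofNat (n + 1) (i : ℕ) = i from Fin.ext (Nat.mod_eq_of_lt i.2)] at this
        · have := h (Fin.ofNat (n + 1) i)
          change γ.1 (t (i % (n + 1))) = _ at this
          rwa [Nat.mod_eq_of_lt (Nat.lt_succ_of_le hi)] at this
    simp only [hiff] at h
    have hl : Fin.ofNat (n + 1) n = Fin.last n := Fin.ext (Nat.mod_eq_of_lt n.lt_succ_self)
    rw [hl] at h
    have e1 : Z ⁻¹' {(z, a)} = {γ | Y γ = z ∧ γ.1 (t (n + 1)) = a} := by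
      ext γ
      simp [hZ]
    have e2 : Y ⁻¹' {z} = {γ | Y γ = z} := rfl
    rw [e1, e2, h, ENNReal.toReal_mul, ENNReal.toReal_ofReal
      (transition_nonneg (sub_nonneg.2 (by exact_mod_cast ht n.le_succ)) _ _)]
  have h1 : ∫ γ, f (fun i => γ.1 (t i)) (γ.1 (t (n + 1))) ∂P = ∫ p, f p.1 p.2 ∂(P.map Z) :=
    (integral_map hZm.aemeasurable (f := fun p : (Fin (n + 1) → ℤˣ) × ℤˣ => f p.1 p.2)
      StronglyMeasurable.of_discrete.aestronglyMeasurable).symm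
  have h2 : ∫ γ, ∑ a, transition (t (n + 1) - t n) (γ.1 (t n)) a • f (fun i => γ.1 (t i)) a ∂P =
      ∫ z, ∑ a, transition (t (n + 1) - t n) (z (Fin.last n)) a • f z a ∂(P.map Y) :=
    (integral_map hYm.aemeasurable
      (f := fun z => ∑ a, transition (t (n + 1) - t n) (z (Fin.last n)) a • f z a)
      StronglyMeasurable.of_discrete.aestronglyMeasurable).symm
  rw [h1, h2, integral_fintype Integrable.of_finite, integral_fintype Integrable.of_finite,
    Fintype.sum_prod_type]
  refine Finset.sum_congr rfl fun z _ => ?_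
  rw [Finset.smul_sum]
  refine Finset.sum_congr rfl fun a _ => ?_
  rw [hst, mul_smul]

theorem aestronglyMeasurable_of_eval {G : Type*} [TopologicalSpace G] (t : ℕ → ℝ≥0) (n : ℕ)
    (f : (Fin (n + 1) → ℤˣ) → G) : AEStronglyMeasurable (fun γ : SpinPath => f fun i => γ.1 (t i)) P :=
  (StronglyMeasurable.of_discrete.comp_measurable
    (measurable_pi_lambda _ fun _ => SpinPath.measurable_eval _)).aestronglyMeasurable

end SpinLaw

/-! ### Expected variation of the spin process -/

section Variation

variable {x : ℤˣ} {P : Measure SpinPath}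

theorem SpinPath.measurable_val_apply (s : ℝ) : Measurable fun γ : SpinPath => γ.val s :=
  (measurable_of_countable spinVal).comp (SpinPath.measurable_eval s.toNNReal)

/-- An increment has size 2 with the flip probability (1 - e^{-2δ})/2 ≤ δ and is 0 otherwise. -/
theorem IsSpinLaw.lintegral_edist_val (hP : IsSpinLaw x P) {p : ℕ → ℝ} (hp : Monotone p)
    (hp0 : p 0 = 0) (n : ℕ) : ∫⁻ γ, edist (γ.val (p n)) (γ.val (p (n + 1))) ∂P ≤
      ENNReal.ofReal (2 * (p (n + 1) - p n)) := by
  have := hP.isProbabilityMeasure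
  have hpn : ∀ i, 0 ≤ p i := fun i => hp0.ge.trans (hp i.zero_le)
  have hd : ∀ a y : ℤˣ, |spinVal y - spinVal a| ≤ 2 := fun a y =>
    (abs_sub _ _).trans (by 
      have h1 := abs_le_one_of_sq (spinVal_sq a)
      have h2 := abs_le_one_of_sq (spinVal_sq y)
      linarith)
  have h1 := hP.integral_markov (t := fun i => (p i).toNNReal)
    (fun i j hij => Real.toNNReal_le_toNNReal (hp hij)) (by simp [hp0]) n
    fun z a => |spinVal (z (Fin.last n)) - spinVal a|
  have h2 : ∀ y : ℤˣ, ∑ a, transition ((p (n + 1)).toNNReal - (p n).toNNReal) y a •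
      |spinVal y - spinVal a| = 2 * flipProb (p (n + 1) - p n) := fun y => by
    rw [sum_units _ y, sub_self, abs_zero, smul_zero, zero_add, transition_neg,
      Real.coe_toNNReal _ (hpn _), Real.coe_toNNReal _ (hpn _), smul_eq_mul, mul_comm]
    congr 1
    rcases Int.units_eq_one_or y with rfl | rfl <;> norm_num [spinVal]
  simp only [Fin.val_last, h2, integral_const, probReal_univ, one_smul] at h1
  have h3 : Integrable (fun γ : SpinPath => |γ.val (p n) - γ.val (p (n + 1))|) P := by
    refine Integrable.of_bound (C := 2) ?_ (ae_of_all _ fun γ => ?_)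
    · exact (((SpinPath.measurable_val_apply _).sub
        (SpinPath.measurable_val_apply _)).abs).aestronglyMeasurable
    · rw [Real.norm_eq_abs, abs_abs]
      exact hd _ _
  simp only [edist_dist, Real.dist_eq]
  rw [← ofReal_integral_eq_lintegral_ofReal h3 (ae_of_all _ fun γ => abs_nonneg _)]
  refine ENNReal.ofReal_le_ofReal ?_
  refine (le_of_eq h1).trans ?_
  have := flipProb_le (p (n + 1) - p n)
  linarith

/-- The variation of a path along the partition of `[0, t]` into `n + 1` equal intervals. -/
def gridVar (t : ℝ) (n : ℕ) (γ : SpinPath) : ℝ≥0∞ :=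
  ∑ i ∈ Finset.range (n + 1),
    edist (γ.val (i * (t / (n + 1)))) (γ.val ((i + 1 : ℕ) * (t / (n + 1))))

/-- A measurable bound of the variation of a path on `[0, t]`. -/
def limVar (t : ℝ) (γ : SpinPath) : ℝ≥0∞ := liminf (fun n => gridVar t n γ) atTop

theorem measurable_gridVar (t : ℝ) (n : ℕ) : Measurable (gridVar t n) :=
  Finset.measurable_fun_sum _ fun _ _ =>
    (SpinPath.measurable_val_apply _).edist (SpinPath.measurable_val_apply _)

theorem measurable_limVar (t : ℝ) : Measurable (limVar t) :=
  Measurable.liminf fun n => measurable_gridVar t n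

/-- Fatou's lemma: on every grid the expected increments add up to at most 2t. -/
theorem IsSpinLaw.lintegral_limVar_le (hP : IsSpinLaw x P) {t : ℝ} (ht : 0 ≤ t) :
    ∫⁻ γ, limVar t γ ∂P ≤ ENNReal.ofReal (2 * t) := by
  refine (lintegral_liminf_le fun n => measurable_gridVar t n).trans ?_
  have h : ∀ n, ∫⁻ γ, gridVar t n γ ∂P ≤ ENNReal.ofReal (2 * t) := fun n => by
    have hp := isPartitionSeq_uniform ht
    unfold gridVar
    rw [lintegral_finsetSum _ fun i _ =>
      (SpinPath.measurable_val_apply _).edist (SpinPath.measurable_val_apply _)]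
    refine (Finset.sum_le_sum fun i _ =>
      hP.lintegral_edist_val (hp.mono n) (hp.zero n) i).trans ?_
    have h1 : ∀ i : ℕ, ENNReal.ofReal (2 * (((i + 1 : ℕ) : ℝ) * (t / (n + 1)) -
        (i : ℝ) * (t / (n + 1)))) = ENNReal.ofReal (2 * (t / (n + 1))) := fun i => by
      congr 1
      push_cast
      ring
    simp only [h1]
    rw [Finset.sum_const, Finset.card_range, nsmul_eq_mul, ← ENNReal.ofReal_natCast,
      ← ENNReal.ofReal_mul (Nat.cast_nonneg _)]
    refine ENNReal.ofReal_le_ofReal (le_of_eq ?_)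
    push_cast
    field_simp
  exact (liminf_le_liminf (Eventually.of_forall h)).trans_eq (liminf_const _)

/-- Sampling γ at the next grid point gives paths whose variation is at most the grid variation and
which converge pointwise by right-continuity; the variation is lower semicontinuous under pointwise
convergence. The liminf serves as a measurable majorant, so measurability of the variation itself
never arises. -/
theorem eVariationOn_le_limVar {t : ℝ} (ht : 0 ≤ t) (γ : SpinPath) :
    eVariationOn γ.val (Icc 0 t) ≤ limVar t γ := by
  have hp := isPartitionSeq_uniform ht
  set φ : ℕ → ℝ → ℝ := fun n u => (⌈u / (t / (n + 1))⌉₊ : ℝ) * (t / (n + 1)) with hφ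
  have h0 : ∀ n : ℕ, 0 ≤ t / ((n : ℝ) + 1) := fun n => by positivity
  have hφu : ∀ n, ∀ u ∈ Icc 0 t, u ≤ φ n u ∧ φ n u ≤ u + t / (n + 1) := fun n u hu => by
    rcases (h0 n).eq_or_lt with h | h
    · have ht0 : t = 0 := by
        rcases div_eq_zero_iff.1 h.symm with h1 | h1
        · exact h1
        · exact absurd h1 (by positivity)
      rw [ht0, Icc_self, mem_singleton_iff] at hu
      simp [hφ, hu, ht0]
    · have h1 := Nat.le_ceil (u / (t / ((n : ℝ) + 1)))
      have h2 := (Nat.ceil_lt_add_one (div_nonneg hu.1 h.le)).le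
      rw [div_le_iff₀ h] at h1
      refine ⟨h1, ?_⟩
      calc φ n u ≤ (u / (t / (n + 1)) + 1) * (t / (n + 1)) := mul_le_mul_of_nonneg_right h2 h.le
        _ = _ := by rw [add_mul, div_mul_cancel₀ _ h.ne', one_mul]
  have hlim : ∀ u ∈ Icc 0 t, Tendsto (fun n => (γ.val ∘ φ n) u) atTop (𝓝 (γ.val u)) := by
    intro u hu
    refine (γ.continuousWithinAt_val u).tendsto.comp (tendsto_nhdsWithin_iff.2
      ⟨?_, Eventually.of_forall fun n => (hφu n u hu).1⟩)
    refine tendsto_of_tendsto_of_tendsto_of_le_of_le (tendsto_const_nhds (x := u))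
      (h := fun n : ℕ => u + t / ((n : ℝ) + 1)) ?_ (fun n => (hφu n u hu).1)
      (fun n => (hφu n u hu).2)
    have h : Tendsto (fun n : ℕ => t / ((n : ℝ) + 1)) atTop (𝓝 0) :=
      (tendsto_const_nhds (x := t)).div_atTop
        (tendsto_atTop_add_const_right _ _ tendsto_natCast_atTop_atTop)
    simpa using h.const_add u
  have hle : ∀ n, eVariationOn (γ.val ∘ φ n) (Icc 0 t) ≤ gridVar t n γ := fun n => by
    have h1 := eVariationOn.image_range_of_monotone γ.val (hp.mono n) (n + 1)
    refine le_trans ?_ (le_of_eq h1)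
    refine eVariationOn.comp_le_of_monotoneOn _ _ (fun u _ w _ huw => ?_) fun u hu => ?_
    · have := h0 n
      simp only [hφ]
      gcongr
    · refine ⟨⌈u / (t / ((n : ℝ) + 1))⌉₊, ?_, rfl⟩
      rw [mem_Iic, Nat.ceil_le]
      refine div_le_of_le_mul₀ (h0 n) (by positivity) (hu.2.trans (le_of_eq ?_))
      push_cast
      field_simp
  refine le_of_forall_lt fun c hc => ?_
  obtain ⟨d, hcd, hd⟩ := exists_between hc
  refine hcd.trans_le (le_liminf_of_le (by isBoundedDefault) ?_)
  filter_upwards [eVariationOn.lowerSemicontinuous_aux hlim hd] with n hn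
  exact hn.le.trans (hle n)

theorem IsSpinLaw.ae_limVar_lt_top (hP : IsSpinLaw x P) {t : ℝ} (ht : 0 ≤ t) :
    ∀ᵐ γ ∂P, limVar t γ < ∞ :=
  ae_lt_top (measurable_limVar t) ((hP.lintegral_limVar_le ht).trans_lt ENNReal.ofReal_lt_top).ne

theorem IsSpinLaw.ae_eVariationOn_ne_top (hP : IsSpinLaw x P) {t : ℝ} (ht : 0 ≤ t) :
    ∀ᵐ γ ∂P, eVariationOn γ.val (Icc 0 t) ≠ ∞ := by
  filter_upwards [hP.ae_limVar_lt_top ht] with γ hγ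
  exact ((eVariationOn_le_limVar ht γ).trans_lt hγ).ne

theorem IsSpinLaw.integrable_and_integral_limVar (hP : IsSpinLaw x P) {t : ℝ} (ht : 0 ≤ t) :
    Integrable (fun γ => 1 + (limVar t γ).toReal) P ∧
      ∫ γ, (1 + (limVar t γ).toReal) ∂P ≤ 1 + 2 * t := by
  have := hP.isProbabilityMeasure
  have h1 := hP.lintegral_limVar_le ht
  have h2 := integrable_toReal_of_lintegral_ne_top (measurable_limVar t).aemeasurable
    (h1.trans_lt ENNReal.ofReal_lt_top).ne
  refine ⟨(integrable_const 1).add h2, ?_⟩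
  rw [integral_add (integrable_const 1) h2, integral_const, probReal_univ, one_smul,
    integral_toReal (measurable_limVar t).aemeasurable (hP.ae_limVar_lt_top ht)]
  exact add_le_add_right (ENNReal.toReal_le_of_le_ofReal (by positivity) h1) 1

end Variation
/-! ### The Feynman-Kac semigroup -/

section FeynmanKacSemigroup

variable {M : Type*} [MeasurableSpace M] {μ : Measure M} [SigmaFinite μ] {ω : M → ℝ}

theorem prodS_congr {v₀ : OneBoson μ} {p : ℕ → ℝ} {y y' : ℕ → ℤˣ} {n : ℕ}
    (h : ∀ i < n, y i = y' i) : prodS ω v₀ p y n = prodS ω v₀ p y' n := by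
  induction n with
  | zero => rfl
  | succ n ih => rw [prodS, prodS, ih fun i hi => h i (hi.trans n.lt_succ_self), h n n.lt_succ_self]

variable (ω) in
/-- The ordered product of the operators `(1 - β(δᵢ) B) S_{δᵢ}` with `δᵢ = pᵢ₊₁ - pᵢ`. -/
def stepProd (v₀ : OneBoson μ) (p : ℕ → ℝ) : ℕ → SpinFock μ →L[ℂ] SpinFock μ
  | 0 => 1
  | n + 1 => stepProd v₀ p n * stepOp (fun t : ℝ≥0 => spinS ω v₀ t) (spinB (Fock μ))
      (flipProb (p (n + 1) - p n)) (p (n + 1) - p n).toNNReal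

theorem stepProd_add {v₀ : OneBoson μ} {p : ℕ → ℝ} {k m : ℕ} {h : ℝ≥0}
    (hp : ∀ i < m, p (k + i + 1) - p (k + i) = h) : stepProd ω v₀ p (k + m) =
      stepProd ω v₀ p k *
        stepOp (fun t : ℝ≥0 => spinS ω v₀ t) (spinB (Fock μ)) (flipProb h) h ^ m := by
  induction m with
  | zero => rw [pow_zero, mul_one, add_zero]
  | succ m ih =>
    rw [← add_assoc, stepProd, ih fun i hi => hp i (hi.trans m.lt_succ_self),
      hp m m.lt_succ_self, Real.toNNReal_coe, pow_succ, mul_assoc]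

theorem real_smul_fock (r : ℝ) (φ : Fock μ) : r • φ = (r : ℂ) • φ := rfl

/-- The transition matrix for time t is 1 - p B with p the flip probability, which is exact and not
only to first order. -/
theorem sum_transition_smul (t : ℝ) (y : ℤˣ) (φ : SpinFock μ) :
    ∑ a, transition t y a • φ a = ((1 - (flipProb t : ℂ) • spinB (Fock μ)) φ) y := by
  rw [sum_units _ y, transition_self, transition_neg]
  change _ = φ y - (flipProb t : ℂ) • (φ y - φ (-y))
  rw [real_smul_fock, real_smul_fock, Complex.ofReal_sub, Complex.ofReal_one, sub_smul, one_smul,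
    smul_sub]
  abel

theorem ofNat_eval_eq {n : ℕ} (γ : SpinPath) (t : ℕ → ℝ≥0) {i : ℕ} (hi : i ≤ n) :
    (fun j : Fin (n + 1) => γ.1 (t j)) (Fin.ofNat (n + 1) i) = γ.1 (t i) := by
  change γ.1 (t (i % (n + 1))) = _
  rw [Nat.mod_eq_of_lt (Nat.lt_succ_of_le hi)]

/-- Displays the product as a function of finitely many evaluations. `Fin.ofNat` reduces modulo n +
1, which is harmless as only indices up to n occur. -/
theorem prodS_eval_eq {v₀ : OneBoson μ} {p : ℕ → ℝ} (n : ℕ) (γ : SpinPath) :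
    prodS ω v₀ p (fun i => γ.1 (p (i + 1)).toNNReal) n = prodS ω v₀ p
      (fun i => (fun j : Fin (n + 1) => γ.1 (p j).toNNReal) (Fin.ofNat (n + 1) (i + 1))) n :=
  prodS_congr fun _ hi => (ofNat_eval_eq γ (fun i => (p i).toNNReal) (Nat.succ_le_of_lt hi)).symm

variable {x : ℤˣ} {P : Measure SpinPath}

/-- The rightmost factor depends on the last spin only. Conditioning on the previous ones averages
it over one transition, which produces the factor (1 - p B) S_δ acting on ψ, and the rest is the
induction hypothesis. -/
theorem IsSpinLaw.integral_prodS (hP : IsSpinLaw x P) (v₀ : OneBoson μ) {p : ℕ → ℝ}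
    (hp : Monotone p) (hp0 : p 0 = 0) (n : ℕ) (ψ : SpinFock μ) :
    ∫ γ, prodS ω v₀ p (fun i => γ.1 (p (i + 1)).toNNReal) n (ψ (γ.1 (p n).toNNReal)) ∂P =
      stepProd ω v₀ p n ψ x := by
  have := hP.isProbabilityMeasure
  have hpn : ∀ i, 0 ≤ p i := fun i => hp0.ge.trans (hp i.zero_le)
  induction n generalizing ψ with
  | zero =>
    have h1 : ∀ᵐ γ ∂P, prodS ω v₀ p (fun i => γ.1 (p (i + 1)).toNNReal) 0
        (ψ (γ.1 (p 0).toNNReal)) = ψ x := by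
      filter_upwards [hP.ae_zero] with γ hγ
      rw [hp0, Real.toNNReal_zero, hγ]
      rfl
    rw [integral_congr_ae h1, integral_const, probReal_univ, one_smul]
    rfl
  | succ n ih =>
    set δ := p (n + 1) - p n with hδ
    have hδ0 : 0 ≤ δ := sub_nonneg.2 (hp n.le_succ)
    have h1 := hP.integral_markov (t := fun i => (p i).toNNReal)
      (fun i j hij => Real.toNNReal_le_toNNReal (hp hij)) (by simp [hp0]) n
      fun z a => prodS ω v₀ p (fun i => z (Fin.ofNat (n + 1) (i + 1))) n
        (spinS ω v₀ δ ψ a)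
    rw [Real.coe_toNNReal _ (hpn _), Real.coe_toNNReal _ (hpn _)] at h1
    have h2 : ∀ (A : Fock μ →L[ℂ] Fock μ) (φ : SpinFock μ) (y : ℤˣ),
        ∑ a, transition δ y a • A (φ a) = A (((1 - (flipProb δ : ℂ) • spinB (Fock μ)) φ) y) :=
      fun A φ y => by
        rw [← sum_transition_smul, map_sum]
        refine Finset.sum_congr rfl fun a _ => ?_
        rw [real_smul_fock, real_smul_fock, map_smul]
    simp only [← hδ, h2] at h1
    have h3 := ih ((1 - (flipProb δ : ℂ) • spinB (Fock μ)) (spinS ω v₀ δ ψ))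
    have h4 : stepProd ω v₀ p (n + 1) ψ =
        stepProd ω v₀ p n ((1 - (flipProb δ : ℂ) • spinB (Fock μ)) (spinS ω v₀ δ ψ)) := by
      rw [stepProd, mul_apply_eq_comp, stepOp, mul_apply_eq_comp, ← hδ, Real.coe_toNNReal _ hδ0]
    rw [h4, ← h3]
    have e1 : ∀ γ : SpinPath, prodS ω v₀ p (fun i => γ.1 (p (i + 1)).toNNReal) (n + 1)
        (ψ (γ.1 (p (n + 1)).toNNReal)) = prodS ω v₀ p
          (fun i => (fun j : Fin (n + 1) => γ.1 (p j).toNNReal) (Fin.ofNat (n + 1) (i + 1))) n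
          (spinS ω v₀ δ ψ (γ.1 (p (n + 1)).toNNReal)) := fun γ => by
      rw [← prodS_eval_eq]
      rfl
    simp only [e1, prodS_eval_eq n]
    exact h1

theorem aestronglyMeasurable_prodS (v₀ : OneBoson μ) (p : ℕ → ℝ) (n : ℕ) (ψ : SpinFock μ) :
    AEStronglyMeasurable (fun γ : SpinPath => prodS ω v₀ p (fun i => γ.1 (p (i + 1)).toNNReal) n
      (ψ (γ.1 (p n).toNNReal))) P := by
  have h := aestronglyMeasurable_of_eval (P := P) (fun i => (p i).toNNReal) n
    fun z => prodS ω v₀ p (fun i => z (Fin.ofNat (n + 1) (i + 1))) n (ψ (z (Fin.last n)))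
  refine h.congr (ae_of_all _ fun γ => ?_)
  dsimp only
  rw [prodS_eval_eq, Fin.val_last]

/-- Almost every path has finite variation, so the integrand is an almost sure limit of functions of
finitely many evaluations. This gives measurability; contractivity bounds everything by ‖ψ‖, whence
integrability and dominated convergence. -/
theorem IsSpinLaw.integrable_and_tendsto (hP : IsSpinLaw x P) (hω : Measurable ω)
    (hω_nonneg : ∀ k, 0 ≤ ω k) (hω_pos : ∀ᵐ k ∂μ, 0 < ω k) {v : M → ℂ}
    (hv : MemLp (fun k => v k / (rho ω k : ℂ)) 2 μ) (t : ℝ≥0) (ψ : SpinFock μ) {p : ℕ → ℕ → ℝ}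
    {N : ℕ → ℕ} (hp : IsPartitionSeq t p N) :
    Integrable (fkIntegrand μ ω v t ψ) P ∧
    Tendsto (fun n => stepProd ω (toL2 μ fun k => v k / (rho ω k : ℂ)) (p n) (N n) ψ x) atTop
      (𝓝 (∫ γ, fkIntegrand μ ω v t ψ γ ∂P)) := by
  have := hP.isProbabilityMeasure
  set v₀ := toL2 μ fun k => v k / (rho ω k : ℂ) with hv₀
  have hvar := hP.ae_eVariationOn_ne_top t.coe_nonneg
  have hψ : ∀ a, ‖ψ a‖ ≤ ‖ψ‖ := fun a => PiLp.norm_apply_le ψ a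
  have hlim : ∀ᵐ γ ∂P, Tendsto (fun n => prodS ω v₀ (p n)
      (fun i => γ.1 (p n (i + 1)).toNNReal) (N n) (ψ (γ.1 (p n (N n)).toNNReal))) atTop
      (𝓝 (fkIntegrand μ ω v t ψ γ)) := by
    filter_upwards [hvar] with γ hγ
    have h := (tendsto_prodS hω hω_nonneg hω_pos hv t.coe_nonneg hγ hp).2 (ψ (γ.1 t))
    simp only [hp.last]
    rw [Real.toNNReal_coe, fkIntegrand_eq]
    exact h
  have hm : AEStronglyMeasurable (fkIntegrand μ ω v t ψ) P :=
    aestronglyMeasurable_of_tendsto_ae atTop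
      (fun n => aestronglyMeasurable_prodS v₀ (p n) (N n) ψ) hlim
  have hb : ∀ᵐ γ ∂P, ‖fkIntegrand μ ω v t ψ γ‖ ≤ ‖ψ‖ := by
    filter_upwards [hvar] with γ hγ
    rw [fkIntegrand_eq]
    have h := (tendsto_prodS hω hω_nonneg hω_pos hv t.coe_nonneg hγ hp).1
    exact (ContinuousLinearMap.le_of_opNorm_le _ h _).trans ((one_mul _).trans_le (hψ _))
  refine ⟨Integrable.of_bound hm _ hb, ?_⟩
  simp only [← hP.integral_prodS v₀ (hp.mono _) (hp.zero _)]
  refine tendsto_integral_of_dominated_convergence (fun _ => ‖ψ‖)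
    (fun n => aestronglyMeasurable_prodS v₀ (p n) (N n) ψ) (integrable_const _)
    (fun n => ae_of_all _ fun γ => ?_) hlim
  exact (ContinuousLinearMap.le_of_opNorm_le _
    (norm_prodS_le hω hω_nonneg v₀ (hp.mono n) _ _) _).trans ((one_mul _).trans_le (hψ _))

variable {P : ℤˣ → Measure SpinPath}

variable (μ ω) in
open Classical in
/-- The operators `T_t(v)` given by the Feynman-Kac formula. -/
def feynmanKac (P : ℤˣ → Measure SpinPath) (v : M → ℂ) (t : ℝ≥0) : SpinFock μ →L[ℂ] SpinFock μ :=
  if h : ∃ T : SpinFock μ →L[ℂ] SpinFock μ, ∀ ψ x, T ψ x = ∫ γ, fkIntegrand μ ω v t ψ γ ∂(P x)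
    then h.choose else 0

theorem feynmanKac_apply (hω : Measurable ω) (hω_nonneg : ∀ k, 0 ≤ ω k)
    (hω_pos : ∀ᵐ k ∂μ, 0 < ω k) (hP : ∀ x, IsSpinLaw x (P x)) {v : M → ℂ}
    (hv : MemLp (fun k => v k / (rho ω k : ℂ)) 2 μ) (t : ℝ≥0) (ψ : SpinFock μ) (x : ℤˣ) :
    feynmanKac μ ω P v t ψ x = ∫ γ, fkIntegrand μ ω v t ψ γ ∂(P x) := by
  have h : ∃ T : SpinFock μ →L[ℂ] SpinFock μ, ∀ ψ x,
      T ψ x = ∫ γ, fkIntegrand μ ω v t ψ γ ∂(P x) := by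
    -- Linearity and boundedness of the expectation come from the Banach-Steinhaus theorem, as a
    -- pointwise limit of bounded operator products.
    refine ⟨continuousLinearMapOfTendsto (l := atTop)
      (fun n : ℕ => stepProd ω (toL2 μ fun k => v k / (rho ω k : ℂ))
        (fun i : ℕ => (i : ℝ) * ((t : ℝ) / ((n : ℝ) + 1))) (n + 1))
      (f := fun ψ => WithLp.toLp 2 fun x => ∫ γ, fkIntegrand μ ω v t ψ γ ∂(P x))
      (tendsto_pi_nhds.2 fun ψ => tendsto_spin_iff.2 fun x =>
        ((hP x).integrable_and_tendsto hω hω_nonneg hω_pos hv t ψ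
          (isPartitionSeq_uniform t.coe_nonneg)).2), fun ψ x => rfl⟩
  rw [feynmanKac, dif_pos h]
  exact h.choose_spec ψ x

theorem tendsto_stepProd (hω : Measurable ω) (hω_nonneg : ∀ k, 0 ≤ ω k)
    (hω_pos : ∀ᵐ k ∂μ, 0 < ω k) (hP : ∀ x, IsSpinLaw x (P x)) {v : M → ℂ}
    (hv : MemLp (fun k => v k / (rho ω k : ℂ)) 2 μ) (t : ℝ≥0) (ψ : SpinFock μ) {p : ℕ → ℕ → ℝ}
    {N : ℕ → ℕ} (hp : IsPartitionSeq t p N) :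
    Tendsto (fun n => stepProd ω (toL2 μ fun k => v k / (rho ω k : ℂ)) (p n) (N n) ψ) atTop
      (𝓝 (feynmanKac μ ω P v t ψ)) := by
  rw [tendsto_spin_iff]
  intro x
  rw [feynmanKac_apply hω hω_nonneg hω_pos hP hv]
  exact ((hP x).integrable_and_tendsto hω hω_nonneg hω_pos hv t ψ hp).2

theorem tendsto_stepOp_pow (hω : Measurable ω) (hω_nonneg : ∀ k, 0 ≤ ω k)
    (hω_pos : ∀ᵐ k ∂μ, 0 < ω k) (hP : ∀ x, IsSpinLaw x (P x)) {v : M → ℂ}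
    (hv : MemLp (fun k => v k / (rho ω k : ℂ)) 2 μ) (t : ℝ≥0) (ψ : SpinFock μ) :
    Tendsto (fun n : ℕ => (stepOp
      (fun t : ℝ≥0 => spinS ω (toL2 μ fun k => v k / (rho ω k : ℂ)) t) (spinB (Fock μ))
      (flipProb (t / (n + 1))) (t / (n + 1)) ^ (n + 1)) ψ) atTop
      (𝓝 (feynmanKac μ ω P v t ψ)) := by
  refine (tendsto_stepProd hω hω_nonneg hω_pos hP hv t ψ (isPartitionSeq_uniform t.coe_nonneg)).congr
    fun n => ?_
  have h := stepProd_add (ω := ω) (v₀ := toL2 μ fun k => v k / (rho ω k : ℂ))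
    (p := fun i => i * ((t : ℝ) / (n + 1))) (k := 0) (m := n + 1) (h := t / (n + 1))
    fun i _ => by
      push_cast
      ring
  rw [zero_add, stepProd, one_mul] at h
  rw [h]
  push_cast
  rfl

/-- The partitions of `[0, s + t]` into `n + 1` equal intervals of `[0, s]` and `n + 1` equal
intervals of `[s, s + t]`. -/
def doublePartition (s t : ℝ) (n i : ℕ) : ℝ :=
  (min i (n + 1) : ℕ) * (s / (n + 1)) + (i - (n + 1) : ℕ) * (t / (n + 1))

theorem doublePartition_sub_of_lt {s t : ℝ} {n i : ℕ} (hi : i < n + 1) :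
    doublePartition s t n (i + 1) - doublePartition s t n i = s / (n + 1) := by
  unfold doublePartition
  rw [min_eq_left hi.le, min_eq_left (Nat.succ_le_of_lt hi), Nat.sub_eq_zero_of_le hi.le,
    Nat.sub_eq_zero_of_le (Nat.succ_le_of_lt hi)]
  push_cast
  ring

theorem doublePartition_sub_of_le {s t : ℝ} {n i : ℕ} (hi : n + 1 ≤ i) :
    doublePartition s t n (i + 1) - doublePartition s t n i = t / (n + 1) := by
  unfold doublePartition
  rw [min_eq_right hi, min_eq_right (hi.trans i.le_succ), Nat.succ_sub hi]
  push_cast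
  ring

theorem isPartitionSeq_double {s t : ℝ} (hs : 0 ≤ s) (ht : 0 ≤ t) :
    IsPartitionSeq (s + t) (doublePartition s t) fun n => (n + 1) + (n + 1) where
  mono n := by
    refine monotone_nat_of_le_succ fun i => sub_nonneg.1 ?_
    rcases lt_or_ge i (n + 1) with hi | hi
    · rw [doublePartition_sub_of_lt hi]
      positivity
    · rw [doublePartition_sub_of_le hi]
      positivity
  zero n := by simp [doublePartition]
  last n := by
    unfold doublePartition
    rw [min_eq_right (by omega), Nat.add_sub_cancel]
    push_cast
    field_simp
  mesh ε hε := by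
    have h : ∀ r : ℝ, ∀ᶠ n : ℕ in atTop, r / ((n : ℝ) + 1) < ε := fun r =>
      ((tendsto_const_nhds (x := r)).div_atTop
        (tendsto_atTop_add_const_right _ _ tendsto_natCast_atTop_atTop)).eventually
        (gt_mem_nhds hε)
    filter_upwards [h s, h t] with n h1 h2 i _
    rcases lt_or_ge i (n + 1) with hi | hi
    · rwa [doublePartition_sub_of_lt hi]
    · rwa [doublePartition_sub_of_le hi]

/-- 1 - p B is the convex combination (1 - p) + p · flip of two isometries. -/
theorem norm_one_sub_flipProb_smul_le {t : ℝ} (ht : 0 ≤ t) :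
    ‖1 - (flipProb t : ℂ) • spinB (Fock μ)‖ ≤ 1 := by
  refine ContinuousLinearMap.opNorm_le_bound _ zero_le_one fun ψ => ?_
  have h1 : (1 - (flipProb t : ℂ) • spinB (Fock μ)) ψ =
      ((1 - flipProb t : ℝ) : ℂ) • ψ + (flipProb t : ℂ) • spinFlip (Fock μ) ψ := by
    change ψ - (flipProb t : ℂ) • (ψ - spinFlip (Fock μ) ψ) = _
    push_cast
    rw [sub_smul, smul_sub, one_smul]
    abel
  have h2 := flipProb_nonneg ht
  have h3 := flipProb_le_one t
  rw [h1]
  refine (norm_add_le _ _).trans_eq ?_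
  rw [norm_smul, norm_smul, norm_spinFlip_apply, Complex.norm_real, Complex.norm_real,
    Real.norm_of_nonneg h2, Real.norm_of_nonneg (sub_nonneg.2 h3)]
  ring

theorem tendsto_mul_flipProb (t : ℝ≥0) :
    Tendsto (fun n : ℕ => ((n + 1 : ℕ) : ℝ) * flipProb (t / (n + 1))) atTop (𝓝 t) := by
  have h0 : Tendsto (fun n : ℕ => (t : ℝ) / ((n : ℝ) + 1)) atTop (𝓝 0) :=
    (tendsto_const_nhds (x := (t : ℝ))).div_atTop
      (tendsto_atTop_add_const_right _ _ tendsto_natCast_atTop_atTop)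
  have h1 : Tendsto (fun n : ℕ => (t : ℝ) / (1 + 2 * (t / ((n : ℝ) + 1)))) atTop (𝓝 t) := by
    have := (tendsto_const_nhds (x := (t : ℝ)) (f := atTop (α := ℕ))).div
      ((h0.const_mul 2).const_add 1) (by norm_num)
    rwa [mul_zero, add_zero, div_one] at this
  refine tendsto_of_tendsto_of_tendsto_of_le_of_le h1 tendsto_const_nhds (fun n => ?_) fun n => ?_
  · have hh : (0 : ℝ) ≤ t / (n + 1) := by positivity
    set h := (t : ℝ) / ((n : ℝ) + 1) with hdef
    have ht : (t : ℝ) = (n + 1) * h := by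
      rw [hdef]
      field_simp
    -- This is 1 - e^{-2h} ≥ 2h/(1 + 2h), from e^{2h} ≥ 1 + 2h.
    have h2 : h / (1 + 2 * h) ≤ flipProb h := by
      have h3 := Real.add_one_le_exp (2 * h)
      have h4 : Real.exp (-2 * h) * Real.exp (2 * h) = 1 := by
        rw [← Real.exp_add]
        simp
      rw [div_le_iff₀ (by positivity), flipProb]
      nlinarith [Real.exp_pos (-2 * h)]
    dsimp only
    push_cast
    calc (t : ℝ) / (1 + 2 * h) = (n + 1) * (h / (1 + 2 * h)) := by
          rw [ht]
          ring
      _ ≤ _ := by gcongr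
  · push_cast
    calc ((n : ℝ) + 1) * flipProb (t / (n + 1)) ≤ (n + 1) * (t / (n + 1)) := by
          gcongr
          exact flipProb_le _
      _ = t := by field_simp

/-- Along a partition of [0, s + t] through s the approximating product factors into approximants
for s and for t. Since these are uniformly contractive, strong limits may be taken in the two
factors jointly, and the left side does not depend on the partitions used. -/
theorem feynmanKac_add (hω : Measurable ω) (hω_nonneg : ∀ k, 0 ≤ ω k)
    (hω_pos : ∀ᵐ k ∂μ, 0 < ω k) (hP : ∀ x, IsSpinLaw x (P x)) {v : M → ℂ}
    (hv : MemLp (fun k => v k / (rho ω k : ℂ)) 2 μ) (s t : ℝ≥0) :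
    feynmanKac μ ω P v (s + t) = feynmanKac μ ω P v s * feynmanKac μ ω P v t := by
  ext1 ψ
  set v₀ := toL2 μ fun k => v k / (rho ω k : ℂ) with hv₀
  have hS := isContractionSemigroup_spinS hω hω_nonneg v₀
  have h1 := tendsto_stepProd hω hω_nonneg hω_pos hP hv (s + t) ψ (N := fun n => (n + 1) + (n + 1))
    (p := doublePartition s t) (by
      rw [NNReal.coe_add]
      exact isPartitionSeq_double s.coe_nonneg t.coe_nonneg)
  rw [← hv₀] at h1
  set A : ℝ≥0 → ℕ → SpinFock μ →L[ℂ] SpinFock μ := fun r n =>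
    stepOp (fun t : ℝ≥0 => spinS ω v₀ t) (spinB (Fock μ))
      (flipProb ((r / (n + 1) : ℝ≥0) : ℝ)) (r / (n + 1)) ^ (n + 1) with hA
  have hA1 : ∀ r n φ, ‖A r n φ‖ ≤ ‖φ‖ := fun r n φ =>
    norm_pow_apply_le (norm_stepOp_le hS (norm_one_sub_flipProb_smul_le (NNReal.coe_nonneg _))) _ _
  have h2 : ∀ r φ, Tendsto (fun n => A r n φ) atTop (𝓝 (feynmanKac μ ω P v r φ)) := fun r φ => by
    have := tendsto_stepOp_pow hω hω_nonneg hω_pos hP hv r φ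
    simpa only [hA, NNReal.coe_div, NNReal.coe_add, NNReal.coe_natCast, NNReal.coe_one] using this
  have h3 : ∀ n, stepProd ω v₀ (doublePartition s t n) ((n + 1) + (n + 1)) ψ =
      A s n (A t n ψ) := fun n => by
    have e1 := stepProd_add (ω := ω) (v₀ := v₀) (p := doublePartition s t n) (k := n + 1)
      (m := n + 1) (h := t / (n + 1)) fun i _ => by
        rw [doublePartition_sub_of_le (by omega)]
        push_cast
        rfl
    have e2 := stepProd_add (ω := ω) (v₀ := v₀) (p := doublePartition s t n) (k := 0)
      (m := n + 1) (h := s / (n + 1)) fun i hi => by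
        rw [zero_add, doublePartition_sub_of_lt hi]
        push_cast
        rfl
    rw [zero_add, stepProd, one_mul] at e2
    rw [e1, e2, mul_apply_eq_comp]
  simp only [h3] at h1
  refine tendsto_nhds_unique h1 ?_
  rw [mul_apply_eq_comp]
  have h4 : Tendsto (fun n => A s n (A t n ψ - feynmanKac μ ω P v t ψ)) atTop (𝓝 0) := by
    have h5 := ((h2 t ψ).sub_const (feynmanKac μ ω P v t ψ)).norm
    rw [sub_self, norm_zero] at h5
    exact squeeze_zero_norm (fun n => hA1 s n _) h5
  have h6 := h4.add (h2 s (feynmanKac μ ω P v t ψ))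
  rw [zero_add] at h6
  refine h6.congr fun n => ?_
  rw [map_sub, sub_add_cancel]

theorem feynmanKac_semigroup (hω : Measurable ω) (hω_nonneg : ∀ k, 0 ≤ ω k)
    (hω_pos : ∀ᵐ k ∂μ, 0 < ω k) (hP : ∀ x, IsSpinLaw x (P x)) {v : M → ℂ}
    (hv : MemLp (fun k => v k / (rho ω k : ℂ)) 2 μ) :
    IsContractionSemigroup (feynmanKac μ ω P v) ∧ ∀ ψ, Tendsto (fun t : ℝ≥0 => ((t : ℝ)⁻¹ : ℂ) •
      (spinS ω (toL2 μ fun k => v k / (rho ω k : ℂ)) t ψ - feynmanKac μ ω P v t ψ)) (𝓝[>] 0)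
      (𝓝 (spinB (Fock μ) ψ)) :=
  isContractionSemigroup_and_tendsto (isContractionSemigroup_spinS hω hω_nonneg _)
    (fun _ => flipProb_nonneg) (fun h _ => flipProb_le h)
    (fun _ => norm_one_sub_flipProb_smul_le) tendsto_mul_flipProb
    (tendsto_stepOp_pow hω hω_nonneg hω_pos hP hv) (feynmanKac_add hω hω_nonneg hω_pos hP hv)

theorem isGenerator_feynmanKac (hω : Measurable ω) (hω_nonneg : ∀ k, 0 ≤ ω k)
    (hω_pos : ∀ᵐ k ∂μ, 0 < ω k) (hP : ∀ x, IsSpinLaw x (P x)) {v vreg vuv : M → ℂ}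
    (hv : MemLp (fun k => v k / (rho ω k : ℂ)) 2 μ) (hreg : vreg ∈ VReg μ ω)
    (huv : vuv ∈ VUV μ ω) (hsum : v =ᵐ[μ] vreg + vuv) :
    IsGenerator (feynmanKac μ ω P v) (hRen μ ω vreg vuv) := fun ψ η =>
  (mem_graph_hRen_iff_genRel hω hω_nonneg hω_pos hreg huv hsum ψ η).trans
    (genRel_of_tendsto_sub (feynmanKac_semigroup hω hω_nonneg hω_pos hP hv).2 ψ η)

theorem norm_le_of_forall_apply_le {ψ : SpinFock μ} {c : ℝ} (hc : 0 ≤ c) (h : ∀ x, ‖ψ x‖ ≤ c) :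
    ‖ψ‖ ≤ 2 * c := by
  have h1 := PiLp.norm_sq_eq_of_L2 (fun _ : ℤˣ => Fock μ) ψ
  rw [sum_units _ 1] at h1
  have h2 := pow_le_pow_left₀ (norm_nonneg _) (h 1) 2
  have h3 := pow_le_pow_left₀ (norm_nonneg _) (h (-1)) 2
  refine abs_le_of_sq_le_sq' ?_ (by positivity) |>.2
  nlinarith [sq_nonneg c]

/-- The Lipschitz bound for a single path is integrated over paths; its constant is affine in the
variation, so only the first moment of the variation is needed. -/
theorem norm_feynmanKac_sub_le (hω : Measurable ω) (hω_nonneg : ∀ k, 0 ≤ ω k)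
    (hω_pos : ∀ᵐ k ∂μ, 0 < ω k) (hP : ∀ x, IsSpinLaw x (P x)) {v w : M → ℂ}
    (hv : MemLp (fun k => v k / (rho ω k : ℂ)) 2 μ)
    (hw : MemLp (fun k => w k / (rho ω k : ℂ)) 2 μ) {r : ℝ} (t : ℝ≥0)
    (hvr : ‖toL2 μ fun k => v k / (rho ω k : ℂ)‖ ≤ r)
    (hwr : ‖toL2 μ fun k => w k / (rho ω k : ℂ)‖ ≤ r) :
    ‖feynmanKac μ ω P w t - feynmanKac μ ω P v t‖ ≤ 2 * (fkConst t r * (1 + 2 * t)) *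
      ‖(toL2 μ fun k => w k / (rho ω k : ℂ)) - toL2 μ fun k => v k / (rho ω k : ℂ)‖ := by
  set d := ‖(toL2 μ fun k => w k / (rho ω k : ℂ)) - toL2 μ fun k => v k / (rho ω k : ℂ)‖
  have hd : 0 ≤ d := norm_nonneg _
  have hC := fkConst_nonneg t.coe_nonneg ((norm_nonneg _).trans hvr)
  refine ContinuousLinearMap.opNorm_le_bound _ (by positivity) fun ψ => ?_
  have key : ∀ x, ‖((feynmanKac μ ω P w t - feynmanKac μ ω P v t) ψ) x‖ ≤
      fkConst t r * (1 + 2 * t) * d * ‖ψ‖ := fun x => by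
    have hp := isPartitionSeq_uniform t.coe_nonneg
    have h1 := ((hP x).integrable_and_tendsto hω hω_nonneg hω_pos hw t ψ hp).1
    have h2 := ((hP x).integrable_and_tendsto hω hω_nonneg hω_pos hv t ψ hp).1
    change ‖feynmanKac μ ω P w t ψ x - feynmanKac μ ω P v t ψ x‖ ≤ _
    rw [feynmanKac_apply hω hω_nonneg hω_pos hP hv, feynmanKac_apply hω hω_nonneg hω_pos hP hw,
      ← integral_sub h1 h2]
    obtain ⟨h3, h4⟩ := (hP x).integrable_and_integral_limVar t.coe_nonneg
    have h5 : ∀ᵐ γ ∂(P x), ‖fkIntegrand μ ω w t ψ γ - fkIntegrand μ ω v t ψ γ‖ ≤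
        fkConst t r * d * ‖ψ‖ * (1 + (limVar t γ).toReal) := by
      filter_upwards [(hP x).ae_limVar_lt_top t.coe_nonneg] with γ hγ
      have h6 := eVariationOn_le_limVar t.coe_nonneg γ
      have h7 := norm_fkOp_sub_le hω hω_nonneg hω_pos hv hw t.coe_nonneg hvr hwr (h6.trans_lt hγ).ne
      have h8 : varBound γ.val t ≤ 1 + (limVar t γ).toReal :=
        add_le_add_right (ENNReal.toReal_mono hγ.ne h6) 1
      rw [fkIntegrand_eq, fkIntegrand_eq, ← sub_apply]
      calc _ ≤ ‖fkOp μ ω w t γ - fkOp μ ω v t γ‖ * ‖ψ (γ.1 t)‖ :=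
            ContinuousLinearMap.le_opNorm _ _
        _ ≤ (fkConst t r * (1 + (limVar t γ).toReal) * d) * ‖ψ‖ := by
            refine mul_le_mul (h7.trans ?_) (PiLp.norm_apply_le ψ _) (norm_nonneg _) (by positivity)
            gcongr
        _ = _ := by ring
    refine (norm_integral_le_of_norm_le (h3.const_mul _) h5).trans ?_
    rw [integral_const_mul]
    calc _ ≤ fkConst t r * d * ‖ψ‖ * (1 + 2 * t) := by gcongr
      _ = _ := by ring
  refine (norm_le_of_forall_apply_le (by positivity) key).trans_eq ?_
  ring

theorem memLp_div_rho (hω : Measurable ω) (hω_pos : ∀ᵐ k ∂μ, 0 < ω k) {v : M → ℂ}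
    (hv : v ∈ VReg μ ω + VUV μ ω) : MemLp (fun k => v k / (rho ω k : ℂ)) 2 μ := by
  obtain ⟨a, ha, b, hb, rfl⟩ := hv
  refine ((memLp_div_rho_of_reg hω hω_pos ha).add (memLp_div_rho_of_uv hω hω_pos hb)).ae_eq
    (ae_of_all _ fun k => ?_)
  simp [add_div]

theorem norm_toL2_sub_lt {v w : M → ℂ} (hv : MemLp (fun k => v k / (rho ω k : ℂ)) 2 μ)
    (hw : MemLp (fun k => w k / (rho ω k : ℂ)) 2 μ) {δ : ℝ}
    (h : formNorm μ ω (w - v) < ENNReal.ofReal δ) :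
    ‖(toL2 μ fun k => w k / (rho ω k : ℂ)) - toL2 μ fun k => v k / (rho ω k : ℂ)‖ < δ := by
  rw [Lp.norm_def]
  refine (ENNReal.toReal_lt_of_lt_ofReal (lt_of_eq_of_lt ?_ h))
  refine eLpNorm_congr_ae ?_
  filter_upwards [Lp.coeFn_sub (toL2 μ fun k => w k / (rho ω k : ℂ))
    (toL2 μ fun k => v k / (rho ω k : ℂ)), toL2_coe hv, toL2_coe hw] with k h1 h2 h3
  rw [h1, Pi.sub_apply, h2, h3, Pi.sub_apply, sub_div]
  rfl

theorem continuous_feynmanKac (hω : Measurable ω) (hω_nonneg : ∀ k, 0 ≤ ω k)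
    (hω_pos : ∀ᵐ k ∂μ, 0 < ω k) (hP : ∀ x, IsSpinLaw x (P x)) (t : ℝ≥0) {v : M → ℂ}
    (hv : v ∈ VReg μ ω + VUV μ ω) {ε : ℝ} (hε : 0 < ε) :
    ∃ δ > (0 : ℝ), ∀ w ∈ VReg μ ω + VUV μ ω, formNorm μ ω (w - v) < ENNReal.ofReal δ →
      ‖feynmanKac μ ω P w t - feynmanKac μ ω P v t‖ < ε := by
  have hv' := memLp_div_rho hω hω_pos hv
  set r := ‖toL2 μ fun k => v k / (rho ω k : ℂ)‖ + 1 with hr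
  have hr0 : 0 ≤ r := by positivity
  have hC := fkConst_nonneg t.coe_nonneg hr0
  set C := 2 * (fkConst t r * (1 + 2 * t)) with hCdef
  have hC0 : 0 ≤ C := by positivity
  have hδ : 0 < min 1 (ε / (C + 1)) := lt_min one_pos (by positivity)
  refine ⟨_, hδ, fun w hw hwv => ?_⟩
  have hw' := memLp_div_rho hω hω_pos hw
  have h1 := norm_toL2_sub_lt hv' hw' hwv
  have h2 : ‖toL2 μ fun k => w k / (rho ω k : ℂ)‖ ≤ r := by
    have := norm_le_norm_add_norm_sub' (toL2 μ fun k => w k / (rho ω k : ℂ))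
      (toL2 μ fun k => v k / (rho ω k : ℂ))
    linarith [h1.trans_le (min_le_left _ _)]
  refine (norm_feynmanKac_sub_le hω hω_nonneg hω_pos hP hv' hw' t
    (le_add_of_nonneg_right zero_le_one) h2).trans_lt ?_
  have h3 := h1.trans_le (min_le_right _ _)
  rw [lt_div_iff₀ (by positivity)] at h3
  rw [← hCdef]
  nlinarith [norm_nonneg ((toL2 μ fun k => w k / (rho ω k : ℂ)) -
    toL2 μ fun k => v k / (rho ω k : ℂ))]

end FeynmanKacSemigroup
end SpinBoson

end

theorem theorem3p4 {M : Type*} [MeasurableSpace M] (μ : MeasureTheory.Measure M)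
    [MeasureTheory.SigmaFinite μ] (ω : M → ℝ) (hω : Measurable ω) (hω_nonneg : ∀ k, 0 ≤ ω k)
    (hω_pos : ∀ᵐ k ∂μ, 0 < ω k)
    (P : ℤˣ → MeasureTheory.Measure SpinBoson.SpinPath)
    (hP : ∀ x, SpinBoson.IsSpinLaw x (P x)) :
    ∃ T : (M → ℂ) → ℝ≥0 → (SpinBoson.SpinFock μ →L[ℂ] SpinBoson.SpinFock μ),
      (∀ v ∈ SpinBoson.VReg μ ω + SpinBoson.VUV μ ω,
        (∀ (t : ℝ≥0) (ψ : SpinBoson.SpinFock μ) (x : ℤˣ),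
          MeasureTheory.Integrable (SpinBoson.fkIntegrand μ ω v t ψ) (P x) ∧
          T v t ψ x = ∫ γ, SpinBoson.fkIntegrand μ ω v t ψ γ ∂(P x)) ∧
        SpinBoson.IsStronglyContinuousSemigroup (T v) ∧
        (∀ vreg ∈ SpinBoson.VReg μ ω, ∀ vuv ∈ SpinBoson.VUV μ ω,
          v =ᵐ[μ] vreg + vuv →
          ∫ k, starRingEnd ℂ (vreg k) * (vuv k / (ω k : ℂ)) ∂μ = 0 →
            IsSelfAdjoint (SpinBoson.hRen μ ω vreg vuv) ∧
            SpinBoson.IsGenerator (T v) (SpinBoson.hRen μ ω vreg vuv))) ∧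
      (∀ t : ℝ≥0, ∀ v ∈ SpinBoson.VReg μ ω + SpinBoson.VUV μ ω, ∀ ε > (0 : ℝ), ∃ δ > (0 : ℝ),
        ∀ w ∈ SpinBoson.VReg μ ω + SpinBoson.VUV μ ω,
          SpinBoson.formNorm μ ω (w - v) < ENNReal.ofReal δ → ‖T w t - T v t‖ < ε) := by
  refine ⟨SpinBoson.feynmanKac μ ω P, fun v hv => ?_, fun t v hv ε hε =>
    SpinBoson.continuous_feynmanKac hω hω_nonneg hω_pos hP t hv hε⟩
  have hv' := SpinBoson.memLp_div_rho hω hω_pos hv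
  refine ⟨fun t ψ x => ⟨?_, SpinBoson.feynmanKac_apply hω hω_nonneg hω_pos hP hv' t ψ x⟩, ?_, ?_⟩
  · exact ((hP x).integrable_and_tendsto hω hω_nonneg hω_pos hv' t ψ
      (SpinBoson.isPartitionSeq_uniform t.coe_nonneg)).1
  · exact (SpinBoson.feynmanKac_semigroup hω hω_nonneg hω_pos hP hv').1.toIsStronglyContinuousSemigroup
  · exact fun vreg hreg vuv huv hsum _ =>
      ⟨SpinBoson.isSelfAdjoint_hRen hω hω_nonneg hω_pos hreg huv hsum,
        SpinBoson.isGenerator_feynmanKac hω hω_nonneg hω_pos hP hv' hreg huv hsum⟩
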